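/- **Setting.** Let $(W^{2n},\omega)$ be a symplectic manifold with $c_1(TW)|_{\pi_2(W)}=0$, and let $M\subset W$ be a closed (compact, without boundary) coisotropic submanifold of codimension $k$. Put $\omega_M=\omega|_M$, and let $\mathcal F$ be the characteristic foliation of $M$, $T\mathcal F=\ker\omega_M$. Assume that $M$ is *stable*: there are one-forms $\alpha_1,\dots,\alpha_k$ on $M$ with $\ker d\alpha_i\supset\ker\omega_M$ for all $i$ and $\alpha_1\wedge\dots\wedge\alpha_k\wedge\omega_M^{n-k}\neq0$ everywhere on $M$. Fix such forms, and a neighbourhood of $M$ in $W$ identified symplectically with $$U=\{(q,p)\in M\times\mathbb R^k : |p|<r\},\qquad \omega=\omega_M+\sum_{j=1}^k d(p_j\alpha_j),$$ so that $M=M\times\{0\}$. Let $\pi\colon U\to M$ be the projection, $\rho=|p|^2/2$ on $U$, and let $\varphi^t$ be the Hamiltonian flow of $\rho$, with the convention $i_{X_\rho}\omega=-d\rho$. **Mean index.** The mean index $\Delta(\Phi)\in\mathbb R$ of a path $\Phi$ in $\mathrm{Sp}(2n)$ starting at the identity is normalized to be positive for the flow of a negative definite quadratic Hamiltonian (for $e^{2\pi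 it}$, $0\le t\le 1$, generated by a negative definite Hamiltonian on $\mathbb R^2$, it is $2$). For a $T$-periodic orbit $x$ of $\varphi^t$ contractible in $W$, $\Delta_\rho(x)$ is the mean index of the linearized flow $d\varphi^t$ along $x$, $0\le t\le T$, read in a symplectic trivialization of $x^*TW$ that arises from a capping disc of $x$ in $W$. **Coisotropic Maslov index.** Let $\gamma$ be a loop in $M$ tangent to $\mathcal F$ and contractible in $W$. Choose along $\gamma$ a symplectic splitting $TW|_M=(T\mathcal F\oplus N)\oplus E$, where $N\cong T^*\mathcal F$ realizes the normal bundle of $M$, $T\mathcal F$ and $N$ are Lagrangian in $T\mathcal F\oplus N$, and $E\cong TM/T\mathcal F$ is a complement of $T\mathcal F$ in $TM$. If $T\mathcal F$ is orientable along $\gamma$, a trivialization $\xi$ of $\gamma^*T\mathcal F$ and its dual $\xi^*$ give symplectic maps $\Xi(t)\colon T_{\gamma(0)}\mathcal F\oplus N_{\gamma(0)}\to T_{\gamma(t)}\mathcal F\oplus N_{\gamma(t)}$. Let $\Gamma(t)\colon E_{\gamma(0)}\to E_{\gamma(t)}$ be the holonomy of $\mathcal F$ along $\gamma$. Then $\mu(\gamma)=-\Delta(\Phi)$,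 where $\Phi$ is $\Xi(t)\oplus\Gamma(t)$ read in a symplectic trivialization of $\gamma^*TW$ that arises from a capping disc of $\gamma$ in $W$. If $T\mathcal F$ is not orientable along $\gamma$, then $\mu(\gamma)$ is half the index of the double cover of $\gamma$. **Proposition.** Let $x$ be a non-trivial (non-constant) closed orbit of $\varphi^t$ that is contractible in $W$, and let $\gamma=\pi(x)$. Then $\gamma$ is a loop tangent to $\mathcal F$ and contractible in $W$, the numbers $\Delta_\rho(x)$ and $\mu(\gamma)$ exist and do not depend on the choices in their definitions (cappings, trivializations, splitting), and $$\mu(\gamma)=-\Delta_\rho(x).$$ -/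

import Mathlib

open scoped Manifold ContDiff Topology

noncomputable section

namespace CoisotropicIndex

/-! ## The mean index of a path of symplectic matrices

`ℝ^{2n}` has coordinates `(q, p)` and the symplectic form `∑ dp_i ∧ dq_i`, whose Gram matrix is
`Matrix.J (Fin n) ℝ`.  It is identified with `ℂ^n` by `z = q + i p`. -/

/-- The `ℂ`-linear part of a real `2n × 2n` matrix acting on `ℂ^n`, `z = q + i p`.
For a symplectic matrix with polar decomposition `A = U S` (`U` unitary, `S` symmetric positive
definite) it equals `U` times a positive definite Hermitian matrix, so that the argument of its
determinant is the argument of `det_ℂ U`. -/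
def complexPart {n : ℕ} (A : Matrix (Fin n ⊕ Fin n) (Fin n ⊕ Fin n) ℝ) :
    Matrix (Fin n) (Fin n) ℂ :=
  Matrix.of fun i j =>
    (((A (.inl i) (.inl j) + A (.inr i) (.inr j) : ℝ) : ℂ)
      + Complex.I * ((A (.inr i) (.inl j) - A (.inl i) (.inr j) : ℝ) : ℂ)) / 2

/-- `δ` is the total change of the argument of the nowhere zero function `c` on `[0, T]`,
measured by a continuous branch `θ` of the argument. -/
def HasRotation (T : ℝ) (c : ℝ → ℂ) (δ : ℝ) : Prop :=
  ∃ θ : ℝ → ℝ, ContinuousOn θ (Set.Icc 0 T) ∧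
    (∀ t ∈ Set.Icc 0 T, c t ≠ 0 ∧ c t = (‖c t‖ : ℂ) * Complex.exp ((θ t : ℂ) * Complex.I)) ∧
    δ = θ T - θ 0

/-- `A` restricts to a continuous path `[0, T] → Sp(2n)` and `d` is its mean index: the total
rotation of `det_ℂ` of the unitary part along the iterated path `t ↦ A(t)^k`, in half-turns, divided
by `k`, tends to `d`.  The sign is such that the rotation `z ↦ e^{ict} z`, `c > 0`, generated
by a negative definite Hamiltonian, has the positive mean index `n c T / π`. -/
def HasMeanIndex {n : ℕ} (T : ℝ) (A : ℝ → Matrix (Fin n ⊕ Fin n) (Fin n ⊕ Fin n) ℝ)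
    (d : ℝ) : Prop :=
  ContinuousOn A (Set.Icc 0 T) ∧
  (∀ t ∈ Set.Icc 0 T, A t ∈ Matrix.symplecticGroup (Fin n) ℝ) ∧
  ∃ δ : ℕ → ℝ, (∀ k, HasRotation T (fun t => (complexPart (A t ^ k)).det) (δ k)) ∧
    Filter.Tendsto (fun k : ℕ => δ k / (Real.pi * k)) Filter.atTop (𝓝 d)

section Manifolds

variable {E : Type*} [NormedAddCommGroup E] [NormedSpace ℝ E]
  {H : Type*} [TopologicalSpace H] {I : ModelWithCorners ℝ E H}
  {M : Type*} [TopologicalSpace M] [ChartedSpace H M]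
  {F : Type*} [NormedAddCommGroup F] [NormedSpace ℝ F]
  {G : Type*} [TopologicalSpace G] {J : ModelWithCorners ℝ F G}
  {W : Type*} [TopologicalSpace W] [ChartedSpace G W]

/-! ## Differential forms on a manifold -/

/-- A field of covectors on `M`. -/
abbrev OneForm (I : ModelWithCorners ℝ E H) (M : Type*) [TopologicalSpace M] [ChartedSpace H M] :=
  ∀ x : M, TangentSpace I x →L[ℝ] ℝ

/-- A field of bilinear forms on the tangent spaces of `M`. -/
abbrev TwoForm (I : ModelWithCorners ℝ E H) (M : Type*) [TopologicalSpace M] [ChartedSpace H M] :=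
  ∀ x : M, TangentSpace I x →L[ℝ] TangentSpace I x →L[ℝ] ℝ

/-- The expression of a one-form in the chart at `x₀` (its pull-back by the inverse chart). -/
def OneForm.inChart (α : OneForm I M) (x₀ : M) (y : E) : E →L[ℝ] ℝ :=
  (α ((extChartAt I x₀).symm y)).comp (mfderiv 𝓘(ℝ, E) I (extChartAt I x₀).symm y)

/-- The expression of a two-form in the chart at `x₀` (its pull-back by the inverse chart). -/
def TwoForm.inChart (Ω : TwoForm I M) (x₀ : M) (y : E) : E →L[ℝ] E →L[ℝ] ℝ :=
  ContinuousLinearMap.bilinearComp (show E →L[ℝ] E →L[ℝ] ℝ from Ω ((extChartAt I x₀).symm y))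
    (show E →L[ℝ] E from mfderiv 𝓘(ℝ, E) I (extChartAt I x₀).symm y)
    (show E →L[ℝ] E from mfderiv 𝓘(ℝ, E) I (extChartAt I x₀).symm y)

/-- Smoothness of a one-form: smooth coefficients in all charts. -/
def OneForm.IsSmooth (α : OneForm I M) : Prop :=
  ∀ x₀ : M, ContDiffOn ℝ ∞ (α.inChart x₀) (extChartAt I x₀).target

/-- Smoothness of a two-form: smooth coefficients in all charts. -/
def TwoForm.IsSmooth (Ω : TwoForm I M) : Prop :=
  ∀ x₀ : M, ContDiffOn ℝ ∞ (Ω.inChart x₀) (extChartAt I x₀).target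

/-- The exterior derivative `dα(v, w) = (D_v α)(w) - (D_w α)(v)`, computed at `x` in the chart at
`x`. -/
def OneForm.d (α : OneForm I M) (x : M) (v w : TangentSpace I x) : ℝ :=
  fderiv ℝ (α.inChart x) (extChartAt I x x)
      (mfderiv I 𝓘(ℝ, E) (extChartAt I x) x v) (mfderiv I 𝓘(ℝ, E) (extChartAt I x) x w)
    - fderiv ℝ (α.inChart x) (extChartAt I x x)
      (mfderiv I 𝓘(ℝ, E) (extChartAt I x) x w) (mfderiv I 𝓘(ℝ, E) (extChartAt I x) x v)

/-- `dΩ = 0`, where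
`dΩ(a, b, c) = (D_a Ω)(b, c) - (D_b Ω)(a, c) + (D_c Ω)(a, b)` in the chart at each point. -/
def TwoForm.IsClosed (Ω : TwoForm I M) : Prop :=
  ∀ (x : M) (a b c : E),
    fderiv ℝ (Ω.inChart x) (extChartAt I x x) a b c
      - fderiv ℝ (Ω.inChart x) (extChartAt I x x) b a c
      + fderiv ℝ (Ω.inChart x) (extChartAt I x x) c a b = 0

/-- Pull-back of a two-form. -/
def TwoForm.pullback (I : ModelWithCorners ℝ E H) (Ω : TwoForm J W) (ι : M → W) : TwoForm I M :=
  fun q => show E →L[ℝ] E →L[ℝ] ℝ from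
    ContinuousLinearMap.bilinearComp (show F →L[ℝ] F →L[ℝ] ℝ from Ω (ι q))
      (show E →L[ℝ] F from mfderiv I J ι q) (show E →L[ℝ] F from mfderiv I J ι q)

/-- A symplectic form: a smooth closed nondegenerate alternating two-form. -/
structure IsSymplecticForm (Ω : TwoForm J W) : Prop where
  smooth : Ω.IsSmooth
  alternating : ∀ (x : W) (v : TangentSpace J x), Ω x v v = 0
  nondegenerate : ∀ (x : W) (v : TangentSpace J x), (∀ w, Ω x v w = 0) → v = 0
  closed : Ω.IsClosed

/-- The velocity of a curve, as a point of the tangent bundle. -/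
def velocity (I : ModelWithCorners ℝ E H) (c : ℝ → M) (t : ℝ) : TangentBundle I M :=
  ⟨c t, mfderiv 𝓘(ℝ, ℝ) I c t (1 : ℝ)⟩

/-! ## Stable coisotropic submanifolds -/

/-- `ι : M → W` is a smooth embedding onto a coisotropic submanifold of `(W, Ω)`:
the `Ω`-orthogonal of `T M` lies in `T M`. -/
structure IsCoisotropicEmbedding (I : ModelWithCorners ℝ E H) (Ω : TwoForm J W) (ι : M → W) :
    Prop where
  embedding : Manifold.IsSmoothEmbedding I J ∞ ι
  coisotropic : ∀ (q : M) (v : TangentSpace J (ι q)),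
    (∀ w : TangentSpace I q, Ω (ι q) v (mfderiv I J ι q w) = 0) →
      ∃ w : TangentSpace I q, mfderiv I J ι q w = v

/-- The characteristic distribution `T𝓕 = ker Ω_M`. -/
def charDist (ΩM : TwoForm I M) (q : M) : Submodule ℝ (TangentSpace I q) :=
  LinearMap.ker (ΩM q).toLinearMap

/-- The value of `a_1 ∧ ⋯ ∧ a_k ∧ b^m` (up to sign and the factor `2^m`) on the `k + 2m` vectors
`v`, for linear forms `a_i` and an alternating bilinear form `b`. -/
def wedgeTop {V : Type*} [AddCommGroup V] {k m : ℕ} (a : Fin k → V → ℝ) (b : V → V → ℝ)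
    (v : Fin k ⊕ (Fin m ⊕ Fin m) → V) : ℝ :=
  ∑ σ : Equiv.Perm (Fin k ⊕ (Fin m ⊕ Fin m)), ((Equiv.Perm.sign σ : ℤ) : ℝ) *
    ((∏ i, a i (v (σ (.inl i)))) *
      ∏ j, b (v (σ (.inr (.inl j)))) (v (σ (.inr (.inr j)))))

/-- The one-forms `α_1, …, α_k` make `M` (of dimension `k + 2m`) stable: `ker dα_i ⊇ ker Ω_M` and
`α_1 ∧ ⋯ ∧ α_k ∧ Ω_M^m` vanishes nowhere. -/
structure IsStabilizing {k : ℕ} (m : ℕ) (ΩM : TwoForm I M) (α : Fin k → OneForm I M) : Prop where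
  smooth : ∀ i, (α i).IsSmooth
  ker_le : ∀ (i : Fin k) (q : M), ∀ v ∈ charDist ΩM q, ∀ w, (α i).d q v w = 0
  wedge_ne_zero : ∀ q : M, ∃ v : Fin k ⊕ (Fin m ⊕ Fin m) → TangentSpace I q,
    wedgeTop (fun i v => α i q v) (fun v w => ΩM q v w) v ≠ 0

/-! ## The normal form neighbourhood and the Hamiltonian flow -/

/-- `U_r = {(q, p) ∈ M × ℝ^k : |p| < r}`. -/
def tube (M : Type*) (k : ℕ) (r : ℝ) : Set (M × EuclideanSpace ℝ (Fin k)) := {z | ‖z.2‖ < r}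

/-- The `T M`-component of a tangent vector of `M × ℝ^k`. -/
def horizontal {k : ℕ} {z : M × EuclideanSpace ℝ (Fin k)}
    (X : TangentSpace (I.prod (𝓡 k)) z) : TangentSpace I z.1 :=
  (show E × EuclideanSpace ℝ (Fin k) from X).1

/-- The `ℝ^k`-component of a tangent vector of `M × ℝ^k`. -/
def vertical {k : ℕ} {z : M × EuclideanSpace ℝ (Fin k)}
    (X : TangentSpace (I.prod (𝓡 k)) z) : EuclideanSpace ℝ (Fin k) :=
  (show E × EuclideanSpace ℝ (Fin k) from X).2

/-- The form `Ω_M + ∑ d(p_j α_j)` on `M × ℝ^k`, where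
`d(p_j α_j) = p_j dα_j + dp_j ∧ α_j`. -/
def normalForm {k : ℕ} (ΩM : TwoForm I M) (α : Fin k → OneForm I M)
    (z : M × EuclideanSpace ℝ (Fin k)) (X Y : TangentSpace (I.prod (𝓡 k)) z) : ℝ :=
  ΩM z.1 (horizontal X) (horizontal Y) +
    ∑ j, (z.2 j * (α j).d z.1 (horizontal X) (horizontal Y) +
      (vertical X j * α j z.1 (horizontal Y) - vertical Y j * α j z.1 (horizontal X)))

/-- `ψ` identifies `U_r`, with the form `Ω_M + ∑ d(p_j α_j)`, symplectically with a neighbourhood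
of `M` in `(W, Ω)`, and `M × {0}` with `M`. -/
structure IsNormalFormNbhd {k : ℕ} (Ω : TwoForm J W) (ι : M → W) (α : Fin k → OneForm I M)
    (r : ℝ) (ψ : M × EuclideanSpace ℝ (Fin k) → W) : Prop where
  pos : 0 < r
  zero_section : ∀ q, ψ (q, 0) = ι q
  injOn : Set.InjOn ψ (tube M k r)
  localDiffeo : IsLocalDiffeomorphOn (I.prod (𝓡 k)) J ∞ ψ (tube M k r)
  pullback : ∀ z ∈ tube M k r, ∀ X Y : TangentSpace (I.prod (𝓡 k)) z,
    Ω (ψ z) (mfderiv (I.prod (𝓡 k)) J ψ z X) (mfderiv (I.prod (𝓡 k)) J ψ z Y)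
      = normalForm (Ω.pullback I ι) α z X Y

/-- The Hamiltonian `ρ = |p|² / 2`. -/
def rho (M : Type*) (k : ℕ) (z : M × EuclideanSpace ℝ (Fin k)) : ℝ := ‖z.2‖ ^ 2 / 2

/-- `φ` is the (complete, smooth) Hamiltonian flow of `h` on `U_r` with the form
`Ω_M + ∑ d(p_j α_j)`, the Hamiltonian vector field being defined by `i_X Ω = -dh`. -/
structure IsHamiltonianFlow {k : ℕ} (ΩM : TwoForm I M) (α : Fin k → OneForm I M) (r : ℝ)
    (h : M × EuclideanSpace ℝ (Fin k) → ℝ)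
    (φ : ℝ → M × EuclideanSpace ℝ (Fin k) → M × EuclideanSpace ℝ (Fin k)) : Prop where
  smooth : ContMDiffOn (𝓘(ℝ, ℝ).prod (I.prod (𝓡 k))) (I.prod (𝓡 k)) ∞
    (fun a : ℝ × (M × EuclideanSpace ℝ (Fin k)) => φ a.1 a.2) (Set.univ ×ˢ tube M k r)
  mapsTo : ∀ t, Set.MapsTo (φ t) (tube M k r) (tube M k r)
  zero : ∀ z ∈ tube M k r, φ 0 z = z
  hamilton : ∀ z ∈ tube M k r, ∀ t : ℝ, ∀ Y : TangentSpace (I.prod (𝓡 k)) (φ t z),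
    normalForm ΩM α (φ t z)
        (mfderiv 𝓘(ℝ, ℝ) (I.prod (𝓡 k)) (fun s => φ s z) t (1 : ℝ)) Y
      = -(mfderiv (I.prod (𝓡 k)) 𝓘(ℝ, ℝ) h (φ t z) Y)

variable [IsManifold J 1 W]

/-! ## Cappings, trivializations and the mean index of a transport along a loop -/

/-- The boundary point `e^{2πit/T}` of the unit disc. -/
def bd (T t : ℝ) : ℂ := Complex.exp ((2 * Real.pi * (t / T) : ℝ) * Complex.I)

/-- `u` restricts to a continuous map of the closed unit disc into `W` with boundary the `T`-periodic
loop `y`. -/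
def IsCapping (y : ℝ → W) (T : ℝ) (u : ℂ → W) : Prop :=
  ContinuousOn u (Metric.closedBall 0 1) ∧ ∀ t, u (bd T t) = y t

/-- `f` is a continuous symplectic trivialization of `u^* TW` over the closed unit disc, given by
a frame with the Gram matrix of the standard form of `ℝ^{2n}`. -/
structure IsSymplecticFrameOver {n : ℕ} (Ω : TwoForm J W) (u : ℂ → W)
    (f : ∀ z, Fin n ⊕ Fin n → TangentSpace J (u z)) : Prop where
  continuousOn : ∀ a, ContinuousOn (fun z => (⟨u z, f z a⟩ : TangentBundle J W))
    (Metric.closedBall 0 1)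
  gram : ∀ z ∈ Metric.closedBall (0 : ℂ) 1, ∀ a b,
    Ω (u z) (f z a) (f z b) = Matrix.J (Fin n) ℝ a b

/-- `e` is a symplectic trivialization of `y^* TW` arising from the capping `u` of the loop `y`. -/
def IsCappingFrame {n : ℕ} (Ω : TwoForm J W) (y : ℝ → W) (T : ℝ) (u : ℂ → W)
    (e : ∀ t, Fin n ⊕ Fin n → TangentSpace J (y t)) : Prop :=
  ∃ f : ∀ z, Fin n ⊕ Fin n → TangentSpace J (u z), IsSymplecticFrameOver Ω u f ∧
    ∀ t a, (⟨y t, e t a⟩ : TangentBundle J W) = ⟨u (bd T t), f (bd T t) a⟩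

/-- `d` is the mean index of the family of linear maps `Ψ(t) : T_{y(0)} W → T_{y(t)} W`,
`0 ≤ t ≤ T`, read as a path of `2n × 2n` matrices in a symplectic trivialization arising from the
capping `u`. -/
def IsTransportMeanIndex (n : ℕ) (Ω : TwoForm J W) (y : ℝ → W) (T : ℝ) (u : ℂ → W)
    (Ψ : ∀ t, TangentSpace J (y 0) →L[ℝ] TangentSpace J (y t)) (d : ℝ) : Prop :=
  ∃ (e : ∀ t, Fin n ⊕ Fin n → TangentSpace J (y t))
    (A : ℝ → Matrix (Fin n ⊕ Fin n) (Fin n ⊕ Fin n) ℝ),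
    IsCappingFrame Ω y T u e ∧
    (∀ t ∈ Set.Icc 0 T, ∀ b, Ψ t (e 0 b) = ∑ a, A t a b • e t a) ∧
    HasMeanIndex T A d

/-- `c` is the value of the first Chern class of the symplectic bundle `(TW, Ω)` on the sphere
formed by the discs `u₀`, `u₁` with common boundary, computed as the degree of the transition
loop between symplectic trivializations over the two discs (up to the sign given by the orientation
of the sphere). -/
def IsChernNumber (n : ℕ) (Ω : TwoForm J W) (u₀ u₁ : ℂ → W) (c : ℝ) : Prop :=
  ∃ (f₀ : ∀ z, Fin n ⊕ Fin n → TangentSpace J (u₀ z))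
    (f₁ : ∀ z, Fin n ⊕ Fin n → TangentSpace J (u₁ z))
    (A : ℝ → Matrix (Fin n ⊕ Fin n) (Fin n ⊕ Fin n) ℝ),
    IsSymplecticFrameOver Ω u₀ f₀ ∧ IsSymplecticFrameOver Ω u₁ f₁ ∧
    (∀ t ∈ Set.Icc (0 : ℝ) 1, ∀ b, (⟨u₁ (bd 1 t), f₁ (bd 1 t) b⟩ : TangentBundle J W) =
      ⟨u₀ (bd 1 t), ∑ a, A t a b • f₀ (bd 1 t) a⟩) ∧
    HasRotation 1 (fun t => (complexPart (A t)).det) (2 * Real.pi * c)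

/-- `c_1(TW)` vanishes on `π_2(W)`. -/
def ChernVanishesOnSpheres (n : ℕ) (Ω : TwoForm J W) : Prop :=
  ∀ u₀ u₁ : ℂ → W, ContinuousOn u₀ (Metric.closedBall 0 1) →
    ContinuousOn u₁ (Metric.closedBall 0 1) → (∀ t, u₀ (bd 1 t) = u₁ (bd 1 t)) →
    ∀ c, IsChernNumber n Ω u₀ u₁ c → c = 0

/-! ## The coisotropic Maslov index -/

/-- A smooth `T`-periodic loop tangent to the characteristic foliation. -/
structure IsCharLoop (ΩM : TwoForm I M) (γ : ℝ → M) (T : ℝ) : Prop where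
  smooth : ContMDiff 𝓘(ℝ, ℝ) I ∞ γ
  periodic : ∀ t, γ (t + T) = γ t
  tangent : ∀ t, mfderiv 𝓘(ℝ, ℝ) I γ t (1 : ℝ) ∈ charDist ΩM (γ t)

/-- `[w] = Γ(t)[v]` for the holonomy `Γ(t) : T_{γ(0)}M / T𝓕 → T_{γ(t)}M / T𝓕` of the
characteristic foliation along `γ`: there is a smooth variation `σ(t, s)` of `γ` through curves
lying in leaves, with `[∂_s σ(0, 0)] = [v]` and `[∂_s σ(t, 0)] = [w]`. -/
def IsHolonomyRelated (ΩM : TwoForm I M) (γ : ℝ → M) (t : ℝ)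
    (v : TangentSpace I (γ 0)) (w : TangentSpace I (γ t)) : Prop :=
  ∃ (ε : ℝ) (σ : ℝ × ℝ → M) (v' : TangentSpace I (γ 0)) (w' : TangentSpace I (γ t)), 0 < ε ∧
    ContMDiffOn 𝓘(ℝ, ℝ × ℝ) I ∞ σ (Set.univ ×ˢ Set.Ioo (-ε) ε) ∧
    (∀ τ, σ (τ, 0) = γ τ) ∧
    (∀ τ, ∀ s ∈ Set.Ioo (-ε) ε,
      mfderiv 𝓘(ℝ, ℝ) I (fun τ' => σ (τ', s)) τ (1 : ℝ) ∈ charDist ΩM (σ (τ, s))) ∧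
    velocity I (fun s => σ (0, s)) 0 = ⟨γ 0, v'⟩ ∧
    velocity I (fun s => σ (t, s)) 0 = ⟨γ t, w'⟩ ∧
    v' - v ∈ charDist ΩM (γ 0) ∧ w' - w ∈ charDist ΩM (γ t)

/-- `ξ` is a continuous trivialization of `γ^* T𝓕` (seen in `TW`) over the circle `ℝ / Tℤ`. -/
structure IsLeafFrame {k : ℕ} (I : ModelWithCorners ℝ E H) (Ω : TwoForm J W) (ι : M → W)
    (γ : ℝ → M) (T : ℝ) (ξ : ∀ t, Fin k → TangentSpace J (ι (γ t))) : Prop where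
  continuous : ∀ i, Continuous (fun t => (⟨ι (γ t), ξ t i⟩ : TangentBundle J W))
  periodic : ∀ t i,
    (⟨ι (γ (t + T)), ξ (t + T) i⟩ : TangentBundle J W) = ⟨ι (γ t), ξ t i⟩
  linearIndependent : ∀ t, LinearIndependent ℝ (ξ t)
  span : ∀ t, Submodule.span ℝ (Set.range (ξ t)) =
    (charDist (Ω.pullback I ι) (γ t)).map (mfderiv I J ι (γ t)).toLinearMap

/-- `ν` is a continuous loop of frames dual to the leaf frame `ξ`.  Its span `N(t)` realizes
`T^⊥M ≅ T^*𝓕` in `TW`, and it determines the symplectic splitting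
`TW = (T𝓕 ⊕ N) ⊕ E` along `γ`, where `E`, the `Ω`-orthogonal of `T𝓕 ⊕ N`, is a
complement of `T𝓕` in `TM`; every such splitting arises in this way. -/
structure IsDualFrame {k : ℕ} (Ω : TwoForm J W) (ι : M → W) (γ : ℝ → M) (T : ℝ)
    (ξ ν : ∀ t, Fin k → TangentSpace J (ι (γ t))) : Prop where
  continuous : ∀ i, Continuous (fun t => (⟨ι (γ t), ν t i⟩ : TangentBundle J W))
  periodic : ∀ t i,
    (⟨ι (γ (t + T)), ν (t + T) i⟩ : TangentBundle J W) = ⟨ι (γ t), ν t i⟩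
  dual : ∀ t i j, Ω (ι (γ t)) (ν t i) (ξ t j) = if i = j then 1 else 0
  isotropic : ∀ t i j, Ω (ι (γ t)) (ν t i) (ν t j) = 0

/-- `Ψ(t) = Ξ(t) ⊕ Γ(t)` for `0 ≤ t ≤ T`, with respect to some splitting of `TW` along `γ` and
some trivialization of `γ^* T𝓕`. -/
def IsAdaptedTransport (k : ℕ) (I : ModelWithCorners ℝ E H) (Ω : TwoForm J W) (ι : M → W)
    (γ : ℝ → M) (T : ℝ)
    (Ψ : ∀ t, TangentSpace J (ι (γ 0)) →L[ℝ] TangentSpace J (ι (γ t))) : Prop :=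
  ∃ ξ ν : ∀ t, Fin k → TangentSpace J (ι (γ t)),
    IsLeafFrame I Ω ι γ T ξ ∧ IsDualFrame Ω ι γ T ξ ν ∧
    ∀ t ∈ Set.Icc 0 T,
      (∀ i, Ψ t (ξ 0 i) = ξ t i) ∧ (∀ i, Ψ t (ν 0 i) = ν t i) ∧
      ∀ v : TangentSpace I (γ 0), (∀ i, Ω (ι (γ 0)) (ν 0 i) (mfderiv I J ι (γ 0) v) = 0) →
        ∃ w : TangentSpace I (γ t), (∀ i, Ω (ι (γ t)) (ν t i) (mfderiv I J ι (γ t) w) = 0) ∧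
          IsHolonomyRelated (Ω.pullback I ι) γ t v w ∧
          Ψ t (mfderiv I J ι (γ 0) v) = mfderiv I J ι (γ t) w

/-- `μ = -Δ(Ξ ⊕ Γ)`, for loops `γ` along which `T𝓕` is orientable. -/
def IsOrientedMaslovIndex (n k : ℕ) (I : ModelWithCorners ℝ E H) (Ω : TwoForm J W) (ι : M → W)
    (γ : ℝ → M) (T : ℝ) (u : ℂ → W) (μ : ℝ) : Prop :=
  ∃ Ψ : ∀ t, TangentSpace J (ι (γ 0)) →L[ℝ] TangentSpace J (ι (γ t)),
    IsAdaptedTransport k I Ω ι γ T Ψ ∧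
    IsTransportMeanIndex n Ω (fun t => ι (γ t)) T u Ψ (-μ)

/-- `μ` is the coisotropic Maslov index `μ(γ, u)` of the `T`-periodic loop `γ` tangent to the
characteristic foliation, with capping `u`.  If `T𝓕` is not orientable along `γ`, the index is half
that of the double cover. -/
def IsMaslovIndex (n k : ℕ) (I : ModelWithCorners ℝ E H) (Ω : TwoForm J W) (ι : M → W)
    (γ : ℝ → M) (T : ℝ) (u : ℂ → W) (μ : ℝ) : Prop :=
  ((∃ ξ : ∀ t, Fin k → TangentSpace J (ι (γ t)), IsLeafFrame I Ω ι γ T ξ) ∧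
    IsOrientedMaslovIndex n k I Ω ι γ T u μ) ∨
  ((¬ ∃ ξ : ∀ t, Fin k → TangentSpace J (ι (γ t)), IsLeafFrame I Ω ι γ T ξ) ∧
    IsOrientedMaslovIndex n k I Ω ι γ (2 * T) (fun z => u (z ^ 2)) (2 * μ))

/-! ## The mean index of a closed orbit -/

/-- `d` is the mean index, with respect to the capping `u`, of the `T`-periodic orbit
`x(t) = φ^t(z₀)` (seen in `W` through `ψ`): that of the linearized flow `dφ^t` along `x`,
`0 ≤ t ≤ T`. -/
def IsOrbitMeanIndex {k : ℕ} (n : ℕ) (I : ModelWithCorners ℝ E H) (Ω : TwoForm J W)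
    (ψ : M × EuclideanSpace ℝ (Fin k) → W)
    (φ : ℝ → M × EuclideanSpace ℝ (Fin k) → M × EuclideanSpace ℝ (Fin k))
    (z₀ : M × EuclideanSpace ℝ (Fin k)) (T : ℝ) (u : ℂ → W) (d : ℝ) : Prop :=
  ∃ Ψ : ∀ t, TangentSpace J (ψ (φ 0 z₀)) →L[ℝ] TangentSpace J (ψ (φ t z₀)),
    (∀ t ∈ Set.Icc 0 T, ∀ (X : TangentSpace (I.prod (𝓡 k)) z₀)
      (v : TangentSpace J (ψ (φ 0 z₀))),
      tangentMap (I.prod (𝓡 k)) J ψ ⟨z₀, X⟩ = ⟨ψ (φ 0 z₀), v⟩ →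
      tangentMap (I.prod (𝓡 k)) J ψ
          (tangentMap (I.prod (𝓡 k)) (I.prod (𝓡 k)) (φ t) ⟨z₀, X⟩)
        = ⟨ψ (φ t z₀), Ψ t v⟩) ∧
    IsTransportMeanIndex n Ω (fun t => ψ (φ t z₀)) T u Ψ d

end Manifolds

end CoisotropicIndex

end

open CoisotropicIndex

namespace CoisotropicIndex

/-! ### Rotation of nowhere zero complex paths. -/

section Rotation

/-! Write a point of the tube as `(q, p)`. Since every `dα_i` vanishes on `T𝓕 = ker ω_M`, the
Hamiltonian vector field of `ρ` at `(q, p)` is the horizontal vector `∑ p_i R_i`, where the `R_i`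
span `T𝓕` and are dual to the `α_i`. Hence `p` is conserved, and the orbit is `(φ^t q, p)`, where
`φ^t` now denotes the flow on `M` at the fixed momentum `p`. Its projection `γ` is tangent to `𝓕`.
Let `F_t` be the derivative of `φ^t` on `M`. It preserves `ω_M`, the `α_i` and the `dα_i`, and
therefore sends Reeb vectors to Reeb vectors (`flow_oneForm`, `flow_twoForm`, `flowDeriv_d`). The
linearized Hamiltonian flow sends `(v, w)` to `(F_t v + t ∑ w_i R_i, w)`, so it is `(F_t × id)(1 + t
N)` with a shear `N` satisfying `N² = 0` (`mfderiv_flow`).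

Consider the loops `(φ^t q, s p)` for `0 ≤ s ≤ 1`: the momentum that drives the flow stays `p`, and
only the base point is moved to the zero section. They join `γ` to `x`, so a capping of `x` with a
collar caps `γ`. Along each of them `F_t × id` is a symplectic transport whose closing map `D = F_T
× id` does not depend on `s`. At `s = 1`, with the shear inserted, it is the linearized flow along
`x`. At `s = 0`, without the shear, it carries the `R_i` to the `R_i`, the vectors `∂/∂p_i` to
themselves, and acts on `TM / T𝓕` by holonomy; this is exactly an adapted transport `Ξ ⊕ Γ`. In
particular the Reeb vectors trivialize `T𝓕` along `γ`, so the non-orientable case does not arise. It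
remains to see that the mean index ignores the homotopy, the shear and all the choices.

The analysis of the mean index rests on the decomposition `A z = P z + Q z̄` of a symplectic matrix.
The complexified matrix preserves `|a|² - |b|²`, so `P a + τ Q b` cannot vanish for `|b| ≤ |a|`, `a
≠ 0` and `0 ≤ τ ≤ 1`. This gives nonvanishing determinants along straight homotopies; along a
homotopy affine in the parameter the determinant is a polynomial of bounded degree, and its rotation
is bounded (`HasRotation.bound_affine`). Thus the rotation number is a quasimorphism, exact on
loops, and the mean index exists and is unchanged by loops of rotation zero (`exists_hasMeanIndex`,
`HasMeanIndex.loop_change`).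

Three comparisons follow. Moving frames in `s` conjugates the powers of one fixed closing matrix,
which costs a rotation bounded independently of the power (`rotation_conj_bound`). As `N` commutes
with `D`, the powers of `D (1 + x N)` are affine in `x`, so the shear also costs a bounded amount;
together these give `HasMeanIndex.of_frame_homotopy`. Two adapted transports differ by a loop of
symplectic maps preserving `T𝓕` and trivial on `TM / T𝓕`; on a suitable nonnegative Lagrangian graph
its determinant is real, so its rotation is zero (`HasMeanIndex.change_splitting`). Finally, two
cappings differ by a transition loop whose rotation is `2π` times a value of `c_1` on a sphere,
hence zero (`transport_index_unique`). -/

theorem exists_continuous_argument (f : ℝ × ℝ → ℂ) (hf : Continuous f) (h0 : ∀ p, f p ≠ 0) :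
    ∃ θ : ℝ × ℝ → ℝ, Continuous θ ∧
      ∀ p, f p = (‖f p‖ : ℂ) * Complex.exp ((θ p : ℂ) * Complex.I) := by
  obtain ⟨g, ⟨-, hg⟩, -⟩ := Complex.isCoveringMapOn_exp.existsUnique_continuousMap_lifts
    (⟨f, hf⟩ : C(ℝ × ℝ, ℂ)) (a₀ := 0) (Complex.exp_log (h0 0)) h0
  refine ⟨fun p => (g p).im, Complex.continuous_im.comp g.continuous, fun p => ?_⟩
  have h1 : Complex.exp (g p) = f p := congrFun hg p
  rw [← h1, Complex.norm_exp, Complex.ofReal_exp, ← Complex.exp_add, Complex.re_add_im]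

theorem exists_argument_on_rectangle {S T : ℝ} (hS : 0 ≤ S) (hT : 0 ≤ T) (c : ℝ → ℝ → ℂ)
    (hc : ContinuousOn (fun p : ℝ × ℝ => c p.1 p.2) (Set.Icc 0 S ×ˢ Set.Icc 0 T))
    (h0 : ∀ s ∈ Set.Icc 0 S, ∀ t ∈ Set.Icc 0 T, c s t ≠ 0) :
    ∃ θ : ℝ × ℝ → ℝ, Continuous θ ∧ ∀ s ∈ Set.Icc 0 S, ∀ t ∈ Set.Icc 0 T,
      c s t = (‖c s t‖ : ℂ) * Complex.exp ((θ (s, t) : ℂ) * Complex.I) := by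
  let P : ℝ × ℝ → ℝ × ℝ := fun p => (Set.projIcc 0 S hS p.1, Set.projIcc 0 T hT p.2)
  have hP : Continuous P := by
    refine Continuous.prodMk ?_ ?_
    · exact continuous_subtype_val.comp (continuous_projIcc.comp continuous_fst)
    · exact continuous_subtype_val.comp (continuous_projIcc.comp continuous_snd)
  have hPm : ∀ p, P p ∈ Set.Icc 0 S ×ˢ Set.Icc 0 T := fun p =>
    ⟨(Set.projIcc 0 S hS p.1).2, (Set.projIcc 0 T hT p.2).2⟩
  obtain ⟨θ, hθ, h⟩ := exists_continuous_argument (fun p => c (P p).1 (P p).2)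
    (hc.comp_continuous hP hPm) (fun p => h0 _ (hPm p).1 _ (hPm p).2)
  refine ⟨θ, hθ, fun s hs t ht => ?_⟩
  have := h (s, t)
  simpa [P, Set.projIcc_of_mem hS hs, Set.projIcc_of_mem hT ht] using this

theorem HasRotation.congr {T : ℝ} {c d : ℝ → ℂ} {δ : ℝ} (h : HasRotation T c δ)
    (hcd : ∀ t ∈ Set.Icc 0 T, c t = d t) : HasRotation T d δ := by
  obtain ⟨θ, h1, h2, h3⟩ := h
  exact ⟨θ, h1, fun t ht => by rw [← hcd t ht]; exact h2 t ht, h3⟩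

/-- Two branches of the argument differ by `2π` times a continuous integer-valued function, and such
a function is constant on an interval. -/
theorem HasRotation.unique {T : ℝ} (hT : 0 ≤ T) {c : ℝ → ℂ} {δ δ' : ℝ}
    (h : HasRotation T c δ) (h' : HasRotation T c δ') : δ = δ' := by
  obtain ⟨θ, h1, h2, rfl⟩ := h
  obtain ⟨η, k1, k2, rfl⟩ := h'
  have key : ∀ t ∈ Set.Icc 0 T, ∃ n : ℤ, (θ t - η t) / (2 * Real.pi) = n := by
    intro t ht
    obtain ⟨a, b⟩ := h2 t ht
    obtain ⟨_, b'⟩ := k2 t ht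
    have hn : (‖c t‖ : ℂ) ≠ 0 := by simpa using a
    have : Complex.exp ((θ t : ℂ) * Complex.I) = Complex.exp ((η t : ℂ) * Complex.I) :=
      mul_left_cancel₀ hn (b.symm.trans b')
    obtain ⟨n, hn⟩ := Complex.exp_eq_exp_iff_exists_int.1 this
    refine ⟨n, ?_⟩
    have h3 : (θ t : ℂ) = η t + n * (2 * Real.pi) :=
      mul_right_cancel₀ Complex.I_ne_zero (by rw [hn]; ring)
    have h4 : θ t = η t + n * (2 * Real.pi) := by exact_mod_cast h3
    rw [h4]; field_simp [Real.pi_ne_zero]; ring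
  have hcont : ContinuousOn (fun t => (θ t - η t) / (2 * Real.pi)) (Set.Icc 0 T) :=
    (h1.sub k1).div_const _
  have hconst := isPreconnected_Icc.constant_of_mapsTo (S := Set.Icc (0:ℝ) T)
    (T := Set.range ((↑) : ℤ → ℝ)) (f := fun t => (θ t - η t) / (2 * Real.pi)) ?_ hcont ?_
    (Set.left_mem_Icc.2 hT) (Set.right_mem_Icc.2 hT)
  · have hpi := Real.pi_pos
    field_simp at hconst
    linarith
  · exact ⟨Int.isClosedEmbedding_coe_real.isEmbedding.toHomeomorph.symm.isEmbedding.discreteTopology⟩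
  · intro t ht
    obtain ⟨n, hn⟩ := key t ht
    exact ⟨n, hn.symm⟩

theorem hasRotation_of_argument {T : ℝ} (c : ℝ → ℂ) (θ : ℝ → ℝ) (hθ : ContinuousOn θ (Set.Icc 0 T))
    (h0 : ∀ t ∈ Set.Icc 0 T, c t ≠ 0)
    (h : ∀ t ∈ Set.Icc 0 T, c t = (‖c t‖ : ℂ) * Complex.exp ((θ t : ℂ) * Complex.I)) :
    HasRotation T c (θ T - θ 0) := ⟨θ, hθ, fun t ht => ⟨h0 t ht, h t ht⟩, rfl⟩

theorem exists_hasRotation {T : ℝ} (hT : 0 ≤ T) (c : ℝ → ℂ) (hc : ContinuousOn c (Set.Icc 0 T))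
    (h0 : ∀ t ∈ Set.Icc 0 T, c t ≠ 0) : ∃ δ, HasRotation T c δ := by
  obtain ⟨θ, hθ, h⟩ := exists_argument_on_rectangle (S := 0) le_rfl hT (fun _ t => c t)
    (hc.comp continuousOn_snd fun p hp => hp.2) (fun _ _ => h0)
  exact ⟨_, hasRotation_of_argument c (fun t => θ (0, t)) (by fun_prop) h0
    (h 0 (Set.left_mem_Icc.2 le_rfl))⟩

/-- The rotations along the four sides of a rectangle add up to zero. -/
theorem HasRotation.square {S T : ℝ} (hS : 0 ≤ S) (hT : 0 ≤ T) {c : ℝ → ℝ → ℂ}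
    (hc : ContinuousOn (fun p : ℝ × ℝ => c p.1 p.2) (Set.Icc 0 S ×ˢ Set.Icc 0 T))
    (h0 : ∀ s ∈ Set.Icc 0 S, ∀ t ∈ Set.Icc 0 T, c s t ≠ 0) {a₀ a₁ b₀ b₁ : ℝ}
    (ha₀ : HasRotation T (fun t => c 0 t) a₀) (ha₁ : HasRotation T (fun t => c S t) a₁)
    (hb₀ : HasRotation S (fun s => c s 0) b₀) (hb₁ : HasRotation S (fun s => c s T) b₁) :
    a₁ - a₀ = b₁ - b₀ := by
  obtain ⟨θ, hθ, h⟩ := exists_argument_on_rectangle hS hT c hc h0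
  have l0 : (0 : ℝ) ∈ Set.Icc 0 S := Set.left_mem_Icc.2 hS
  have l1 : S ∈ Set.Icc 0 S := Set.right_mem_Icc.2 hS
  have m0 : (0 : ℝ) ∈ Set.Icc 0 T := Set.left_mem_Icc.2 hT
  have m1 : T ∈ Set.Icc 0 T := Set.right_mem_Icc.2 hT
  have e1 := ha₀.unique hT (hasRotation_of_argument _ (fun t => θ (0, t)) (by fun_prop) (h0 0 l0)
    (h 0 l0))
  have e2 := ha₁.unique hT (hasRotation_of_argument _ (fun t => θ (S, t)) (by fun_prop) (h0 S l1)
    (h S l1))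
  have e3 := hb₀.unique hS (hasRotation_of_argument _ (fun s => θ (s, 0)) (by fun_prop)
    (fun s hs => h0 s hs 0 m0) (fun s hs => h s hs 0 m0))
  have e4 := hb₁.unique hS (hasRotation_of_argument _ (fun s => θ (s, T)) (by fun_prop)
    (fun s hs => h0 s hs T m1) (fun s hs => h s hs T m1))
  rw [e1, e2, e3, e4]; ring

/-- The diagonal of the square is homotopic with fixed ends to the side `t = 0` followed by the side
`s = T`. This decouples a product of two paths that run simultaneously. -/
theorem HasRotation.diagonal {T : ℝ} (hT : 0 ≤ T) {c : ℝ → ℝ → ℂ}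
    (hc : ContinuousOn (fun p : ℝ × ℝ => c p.1 p.2) (Set.Icc 0 T ×ˢ Set.Icc 0 T))
    (h0 : ∀ s ∈ Set.Icc 0 T, ∀ t ∈ Set.Icc 0 T, c s t ≠ 0) {a b δ : ℝ}
    (ha : HasRotation T (fun s => c s 0) a) (hb : HasRotation T (fun t => c T t) b)
    (hδ : HasRotation T (fun t => c t t) δ) : δ = a + b := by
  obtain ⟨θ, hθ, h⟩ := exists_argument_on_rectangle hT hT c hc h0
  have m0 : (0 : ℝ) ∈ Set.Icc 0 T := Set.left_mem_Icc.2 hT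
  have m1 : T ∈ Set.Icc 0 T := Set.right_mem_Icc.2 hT
  have e1 := ha.unique hT (hasRotation_of_argument _ (fun s => θ (s, 0)) (by fun_prop)
    (fun s hs => h0 s hs 0 m0) (fun s hs => h s hs 0 m0))
  have e2 := hb.unique hT (hasRotation_of_argument _ (fun t => θ (T, t)) (by fun_prop) (h0 T m1)
    (h T m1))
  have e3 := hδ.unique hT (hasRotation_of_argument _ (fun t => θ (t, t)) (by fun_prop)
    (fun s hs => h0 s hs s hs) (fun s hs => h s hs s hs))
  rw [e1, e2, e3]; ring

theorem HasRotation.mul {T : ℝ} {c d : ℝ → ℂ} {a b : ℝ} (hc : HasRotation T c a)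
    (hd : HasRotation T d b) : HasRotation T (fun t => c t * d t) (a + b) := by
  obtain ⟨θ, h1, h2, rfl⟩ := hc
  obtain ⟨η, k1, k2, rfl⟩ := hd
  refine ⟨fun t => θ t + η t, h1.add k1, fun t ht => ?_, by ring⟩
  obtain ⟨x, y⟩ := h2 t ht
  obtain ⟨x', y'⟩ := k2 t ht
  refine ⟨mul_ne_zero x x', ?_⟩
  beta_reduce
  conv_lhs => rw [y, y']
  rw [norm_mul, Complex.ofReal_add, add_mul, Complex.exp_add, Complex.ofReal_mul]; ring

theorem HasRotation.const_mul {T : ℝ} {c : ℝ → ℂ} {a : ℝ} {z : ℂ} (hz : z ≠ 0)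
    (hc : HasRotation T c a) : HasRotation T (fun t => z * c t) a := by
  have h : HasRotation T (fun _ => z) 0 := ⟨fun _ => z.arg, continuousOn_const,
    fun t _ => ⟨hz, (Complex.norm_mul_exp_arg_mul_I z).symm⟩, by ring⟩
  simpa using h.mul hc

theorem HasRotation.conj {T : ℝ} {c : ℝ → ℂ} {a : ℝ} (hc : HasRotation T c a) :
    HasRotation T (fun t => (starRingEnd ℂ) (c t)) (-a) := by
  obtain ⟨θ, h1, h2, rfl⟩ := hc
  refine ⟨fun t => -θ t, h1.neg, fun t ht => ?_, by ring⟩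
  obtain ⟨x, y⟩ := h2 t ht
  refine ⟨by simpa using x, ?_⟩
  beta_reduce
  conv_lhs => rw [y]
  rw [map_mul, ← Complex.exp_conj]
  simp

/-- Conjugation reverses the rotation and fixes a real path. -/
theorem HasRotation.eq_zero_of_real {T : ℝ} (hT : 0 ≤ T) {c : ℝ → ℂ} {a : ℝ}
    (hr : ∀ t ∈ Set.Icc 0 T, (c t).im = 0) (hc : HasRotation T c a) : a = 0 := by
  have h := hc.conj.congr (d := c) fun t ht => Complex.conj_eq_iff_im.2 (hr t ht)
  have := hc.unique hT h
  linarith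

theorem HasRotation.bound_of_slitPlane {S : ℝ} (hS : 0 ≤ S) {c : ℝ → ℂ} {a : ℝ}
    (hc : ContinuousOn c (Set.Icc 0 S)) (h : ∀ t ∈ Set.Icc 0 S, c t ∈ Complex.slitPlane)
    (ha : HasRotation S c a) : |a| ≤ 2 * Real.pi := by
  have := ha.unique hS (hasRotation_of_argument c (fun t => (c t).arg)
    (fun t ht => (Complex.continuousAt_arg (h t ht)).comp_continuousWithinAt (hc t ht))
    (fun t ht => Complex.slitPlane_ne_zero (h t ht))
    (fun t _ => (Complex.norm_mul_exp_arg_mul_I (c t)).symm))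
  rw [this]
  calc |(c S).arg - (c 0).arg| ≤ |(c S).arg| + |(c 0).arg| := abs_sub _ _
    _ ≤ 2 * Real.pi := by linarith [Complex.abs_arg_le_pi (c S), Complex.abs_arg_le_pi (c 0)]

/-- Either `w` is real and the path is real, or `t - w` has constant nonzero imaginary part and
stays in the slit plane, where the principal argument is a branch. The bound does not depend on `w`
or `S`. -/
theorem HasRotation.bound_linear {S : ℝ} (hS : 0 ≤ S) {w : ℂ} {a : ℝ}
    (ha : HasRotation S (fun t => (t : ℂ) - w) a) : |a| ≤ 2 * Real.pi := by
  by_cases hw : w.im = 0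
  · rw [ha.eq_zero_of_real hS (fun t _ => by simp [hw])]
    simp [Real.pi_pos.le]
  · refine ha.bound_of_slitPlane hS (by fun_prop) fun t _ => ?_
    right; simpa using hw

/-- The rotation of a polynomial without zeros on `[0, S]` is bounded in terms of its degree. -/
theorem HasRotation.bound_polynomial {S : ℝ} (hS : 0 ≤ S) (p : Polynomial ℂ) {a : ℝ}
    (h0 : ∀ t ∈ Set.Icc 0 S, p.eval (t : ℂ) ≠ 0)
    (ha : HasRotation S (fun t => p.eval (t : ℂ)) a) : |a| ≤ p.natDegree * (2 * Real.pi) := by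
  -- Rotation is additive over the linear factors, each of which contributes at most `2π`.
  have key : ∀ s : Multiset ℂ, (∀ w ∈ s, ∀ t ∈ Set.Icc 0 S, (t : ℂ) - w ≠ 0) →
      ∃ b, HasRotation S (fun t : ℝ => (s.map fun w => (t : ℂ) - w).prod) b ∧
        |b| ≤ Multiset.card s * (2 * Real.pi) := by
    intro s
    induction s using Multiset.induction with
    | empty =>
      intro _
      exact ⟨0, ⟨fun _ => 0, continuousOn_const, by simp, by ring⟩, by simp⟩
    | cons w s ih =>
      intro hs
      obtain ⟨b, hb, hb'⟩ := ih fun w hw => hs w (Multiset.mem_cons_of_mem hw)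
      obtain ⟨e, he⟩ := exists_hasRotation hS (fun t => (t : ℂ) - w) (by fun_prop)
        (hs w (Multiset.mem_cons_self w s))
      refine ⟨e + b, by simpa using he.mul hb, ?_⟩
      have := he.bound_linear hS
      calc |e + b| ≤ |e| + |b| := abs_add_le _ _
        _ ≤ _ := by simp; linarith
  have hp : p ≠ 0 := by
    rintro rfl
    exact h0 0 (Set.left_mem_Icc.2 hS) (by simp)
  have hsplit := IsAlgClosed.splits p
  have hev : ∀ t : ℝ, p.eval (t : ℂ) = p.leadingCoeff * (p.roots.map fun w => (t : ℂ) - w).prod := by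
    intro t
    conv_lhs => rw [hsplit.eq_prod_roots]
    rw [Polynomial.eval_mul, Polynomial.eval_C, Polynomial.eval_multiset_prod, Multiset.map_map]
    simp
  obtain ⟨b, hb, hb'⟩ := key p.roots fun w hw t ht h => h0 t ht (by
    rw [sub_eq_zero] at h
    rw [h]; exact (Polynomial.mem_roots hp).1 hw)
  have := ha.unique hS ((hb.const_mul (Polynomial.leadingCoeff_ne_zero.2 hp)).congr
    fun t _ => (hev t).symm)
  rw [this]
  refine hb'.trans ?_
  gcongr
  exact p.card_roots'

end Rotation

end CoisotropicIndex

namespace CoisotropicIndex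

/-! ### Linear and antilinear parts of symplectic matrices. -/

section SymplecticMatrices

open Matrix

variable {n : ℕ}

/-- The `ℂ`-antilinear part of a real matrix acting on `ℂ^n`, `z = q + i p`. -/
noncomputable def antiPart (A : Matrix (Fin n ⊕ Fin n) (Fin n ⊕ Fin n) ℝ) :
    Matrix (Fin n) (Fin n) ℂ :=
  Matrix.of fun i j =>
    (((A (.inl i) (.inl j) - A (.inr i) (.inr j) : ℝ) : ℂ)
      + Complex.I * ((A (.inr i) (.inl j) + A (.inl i) (.inr j) : ℝ) : ℂ)) / 2

/-- Entrywise complex conjugation. -/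
noncomputable def cbar {m : Type*} (A : Matrix m (Fin n) ℂ) : Matrix m (Fin n) ℂ :=
  A.map (starRingEnd ℂ)

/-- Compose `z ↦ P z + Q z̄` with another map of this kind. The second summand is the defect that
prevents `complexPart` from being multiplicative; multiplying it by `τ ∈ [0, 1]` is the homotopy
behind the quasimorphism property. -/
theorem complexPart_mul (A B : Matrix (Fin n ⊕ Fin n) (Fin n ⊕ Fin n) ℝ) :
    complexPart (A * B) = complexPart A * complexPart B + antiPart A * cbar (antiPart B) := by
  ext i j
  simp only [complexPart, antiPart, cbar, Matrix.of_apply, Matrix.mul_apply, Matrix.add_apply,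
    Matrix.map_apply, Fintype.sum_sum_type, map_div₀, map_add, map_mul, Complex.conj_I,
    Complex.conj_ofReal, map_ofNat, ← Finset.sum_add_distrib, ← Finset.sum_sub_distrib,
    Complex.ofReal_sum, Finset.mul_sum, Finset.sum_div]
  refine Finset.sum_congr rfl fun x _ => ?_
  push_cast
  linear_combination (-1/4 : ℂ) * (
    ((A (.inr i) (.inl x) : ℂ) - A (.inl i) (.inr x)) * (B (.inr x) (.inl j) - B (.inl x) (.inr j))
    - ((A (.inr i) (.inl x) : ℂ) + A (.inl i) (.inr x)) *
      (B (.inr x) (.inl j) + B (.inl x) (.inr j))) * Complex.I_mul_I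

theorem antiPart_mul (A B : Matrix (Fin n ⊕ Fin n) (Fin n ⊕ Fin n) ℝ) :
    antiPart (A * B) = complexPart A * antiPart B + antiPart A * cbar (complexPart B) := by
  ext i j
  simp only [complexPart, antiPart, cbar, Matrix.of_apply, Matrix.mul_apply, Matrix.add_apply,
    Matrix.map_apply, Fintype.sum_sum_type, map_div₀, map_add, map_mul, Complex.conj_I,
    Complex.conj_ofReal, map_ofNat, ← Finset.sum_add_distrib, ← Finset.sum_sub_distrib,
    Complex.ofReal_sum, Finset.mul_sum, Finset.sum_div]
  refine Finset.sum_congr rfl fun x _ => ?_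
  push_cast
  linear_combination (-1/4 : ℂ) * (
    ((A (.inr i) (.inl x) : ℂ) - A (.inl i) (.inr x)) * (B (.inr x) (.inl j) + B (.inl x) (.inr j))
    - ((A (.inr i) (.inl x) : ℂ) + A (.inl i) (.inr x)) *
      (B (.inr x) (.inl j) - B (.inl x) (.inr j))) * Complex.I_mul_I

theorem complexPart_transpose (A : Matrix (Fin n ⊕ Fin n) (Fin n ⊕ Fin n) ℝ) :
    complexPart Aᵀ = (complexPart A)ᴴ := by
  ext i j
  simp [complexPart, Matrix.conjTranspose_apply]
  ring

theorem antiPart_transpose (A : Matrix (Fin n ⊕ Fin n) (Fin n ⊕ Fin n) ℝ) :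
    antiPart Aᵀ = (antiPart A)ᵀ := by
  ext i j
  simp [antiPart]
  ring

theorem complexPart_one : complexPart (1 : Matrix (Fin n ⊕ Fin n) (Fin n ⊕ Fin n) ℝ) = 1 := by
  ext i j
  by_cases h : i = j <;> simp [complexPart, Matrix.one_apply, h]

theorem antiPart_one : antiPart (1 : Matrix (Fin n ⊕ Fin n) (Fin n ⊕ Fin n) ℝ) = 0 := by
  ext i j
  by_cases h : i = j <;> simp [antiPart, Matrix.one_apply, h]

theorem complexPart_J : complexPart (Matrix.J (Fin n) ℝ) = Complex.I • 1 := by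
  ext i j
  by_cases h : i = j
  · simp [complexPart, Matrix.J, h]; ring
  · simp [complexPart, Matrix.J, Matrix.one_apply, h]

theorem antiPart_J : antiPart (Matrix.J (Fin n) ℝ) = 0 := by
  ext i j
  by_cases h : i = j <;> simp [antiPart, Matrix.J, Matrix.one_apply, h]

theorem complexPart_add (A B : Matrix (Fin n ⊕ Fin n) (Fin n ⊕ Fin n) ℝ) :
    complexPart (A + B) = complexPart A + complexPart B := by
  ext i j; simp [complexPart]; ring

theorem complexPart_smul (c : ℝ) (A : Matrix (Fin n ⊕ Fin n) (Fin n ⊕ Fin n) ℝ) :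
    complexPart (c • A) = (c : ℂ) • complexPart A := by
  ext i j; simp [complexPart]; ring

theorem cbar_smul_I (A : Matrix (Fin n) (Fin n) ℂ) :
    cbar (Complex.I • A) = -(Complex.I • cbar A) := by
  ext i j; simp [cbar]

@[fun_prop]
theorem continuous_complexPart :
    Continuous (complexPart : Matrix (Fin n ⊕ Fin n) (Fin n ⊕ Fin n) ℝ → _) := by
  refine continuous_matrix fun i j => ?_
  simp only [complexPart, Matrix.of_apply]
  fun_prop

@[fun_prop]
theorem continuous_antiPart :
    Continuous (antiPart : Matrix (Fin n ⊕ Fin n) (Fin n ⊕ Fin n) ℝ → _) := by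
  refine continuous_matrix fun i j => ?_
  simp only [antiPart, Matrix.of_apply]
  fun_prop

@[fun_prop]
theorem continuous_cbar {m : Type*} : Continuous (cbar : Matrix m (Fin n) ℂ → _) := by
  refine continuous_matrix fun i j => ?_
  simp only [cbar, Matrix.map_apply]
  exact Complex.continuous_conj.comp (continuous_apply_apply i j)

/-- This is the linear part of `AᵀJA = J`, with the factor `i` that represents `J` cancelled. -/
theorem symplectic_complex_relation {A : Matrix (Fin n ⊕ Fin n) (Fin n ⊕ Fin n) ℝ}
    (hA : A ∈ symplecticGroup (Fin n) ℝ) :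
    (complexPart A)ᴴ * complexPart A - (antiPart A)ᵀ * cbar (antiPart A) = 1 := by
  have h := congrArg complexPart (SymplecticGroup.mem_iff'.1 hA)
  rw [mul_assoc, complexPart_mul, complexPart_mul, antiPart_mul, complexPart_J, antiPart_J,
    complexPart_transpose, antiPart_transpose] at h
  simp only [Matrix.zero_mul, add_zero, Matrix.smul_mul, Matrix.one_mul, cbar_smul_I,
    Matrix.mul_smul, Matrix.mul_neg, ← sub_eq_add_neg, ← smul_sub] at h
  exact smul_right_injective _ Complex.I_ne_zero h

theorem symplectic_anti_relation {A : Matrix (Fin n ⊕ Fin n) (Fin n ⊕ Fin n) ℝ}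
    (hA : A ∈ symplecticGroup (Fin n) ℝ) :
    (complexPart A)ᴴ * antiPart A - (antiPart A)ᵀ * cbar (complexPart A) = 0 := by
  have h := congrArg antiPart (SymplecticGroup.mem_iff'.1 hA)
  rw [mul_assoc, antiPart_mul, complexPart_mul, antiPart_mul, complexPart_J, antiPart_J,
    complexPart_transpose, antiPart_transpose] at h
  simp only [Matrix.zero_mul, add_zero, Matrix.smul_mul, Matrix.one_mul, cbar_smul_I,
    Matrix.mul_smul, Matrix.mul_neg, ← sub_eq_add_neg, ← smul_sub] at h
  exact (smul_eq_zero.1 h).resolve_left Complex.I_ne_zero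

/-- The squared Hermitian norm. -/
noncomputable def normSqVec (v : Fin n → ℂ) : ℝ := ∑ i, ‖v i‖ ^ 2

theorem normSqVec_nonneg (v : Fin n → ℂ) : 0 ≤ normSqVec v :=
  Finset.sum_nonneg fun _ _ => by positivity

theorem eq_zero_of_normSqVec_le {v : Fin n → ℂ} (h : normSqVec v ≤ 0) : v = 0 := by
  have h1 := (Finset.sum_eq_zero_iff_of_nonneg (s := Finset.univ) (f := fun i => ‖v i‖ ^ 2)
    (fun _ _ => by positivity)).1 (le_antisymm h (normSqVec_nonneg v))
  ext i
  simpa using h1 i (Finset.mem_univ i)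

theorem normSqVec_eq (v : Fin n → ℂ) : (normSqVec v : ℂ) = star v ⬝ᵥ v := by
  simp [normSqVec, dotProduct, Complex.conj_mul']

theorem normSqVec_smul (c : ℂ) (v : Fin n → ℂ) : normSqVec (c • v) = ‖c‖ ^ 2 * normSqVec v := by
  simp [normSqVec, Finset.mul_sum, mul_pow]

/-- A symplectic matrix preserves the indefinite Hermitian form `|a|² - |b|²` on the
complexification of `ℂ^n`. -/
theorem symplectic_preserves_form {A : Matrix (Fin n ⊕ Fin n) (Fin n ⊕ Fin n) ℝ}
    (hA : A ∈ symplecticGroup (Fin n) ℝ) (a b : Fin n → ℂ) :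
    normSqVec (complexPart A *ᵥ a + antiPart A *ᵥ b)
      - normSqVec (cbar (antiPart A) *ᵥ a + cbar (complexPart A) *ᵥ b)
      = normSqVec a - normSqVec b := by
  set P := complexPart A
  set Q := antiPart A
  have h1 : Pᴴ * P - Qᵀ * cbar Q = 1 := symplectic_complex_relation hA
  have h2 : Pᴴ * Q - Qᵀ * cbar P = 0 := symplectic_anti_relation hA
  have cH : ∀ X : Matrix (Fin n) (Fin n) ℂ, (cbar X)ᴴ = Xᵀ := fun X => by
    ext i j; simp [cbar, Matrix.conjTranspose_apply]
  have cT : ∀ X : Matrix (Fin n) (Fin n) ℂ, (Xᵀ)ᴴ = cbar X := fun X => by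
    ext i j; simp [cbar, Matrix.conjTranspose_apply]
  -- The form `|a|² - |b|²` on the complexification has four blocks; the two remaining relations are
  -- the conjugate transpose and the conjugate of the two known ones.
  have h3 : Qᴴ * P - Pᵀ * cbar Q = 0 := by
    have := congrArg conjTranspose h2
    simpa [conjTranspose_sub, conjTranspose_mul, cH, cT] using this
  have cm : ∀ X Y : Matrix (Fin n) (Fin n) ℂ, cbar (X * Y) = cbar X * cbar Y := fun X Y => by
    simp [cbar, Matrix.map_mul]
  have h4 : Pᵀ * cbar P - Qᴴ * Q = 1 := by
    have := congrArg cbar h1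
    have c1 : ∀ X : Matrix (Fin n) (Fin n) ℂ, cbar (Xᴴ) = Xᵀ := fun X => by
      ext i j; simp [cbar, Matrix.conjTranspose_apply]
    have c2 : ∀ X : Matrix (Fin n) (Fin n) ℂ, cbar (Xᵀ) = Xᴴ := fun X => by
      ext i j; simp [cbar, Matrix.conjTranspose_apply]
    have c3 : ∀ X : Matrix (Fin n) (Fin n) ℂ, cbar (cbar X) = X := fun X => by
      ext i j; simp [cbar]
    have c4 : ∀ X Y : Matrix (Fin n) (Fin n) ℂ, cbar (X - Y) = cbar X - cbar Y := fun X Y => by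
      ext i j; simp [cbar]
    have c5 : cbar (1 : Matrix (Fin n) (Fin n) ℂ) = 1 := by
      simp [cbar]
    rwa [c4, cm, cm, c1, c2, c3, c5] at this
  have expand : ∀ (X Y : Matrix (Fin n) (Fin n) ℂ) (u v : Fin n → ℂ),
      star (X *ᵥ u) ⬝ᵥ (Y *ᵥ v) = star u ⬝ᵥ ((Xᴴ * Y) *ᵥ v) := fun X Y u v => by
    rw [star_mulVec, ← dotProduct_mulVec, mulVec_mulVec]
  have main : ((normSqVec (P *ᵥ a + Q *ᵥ b) : ℝ) : ℂ)
      - (normSqVec (cbar Q *ᵥ a + cbar P *ᵥ b) : ℝ) = (normSqVec a : ℝ) - (normSqVec b : ℝ) := by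
    simp only [normSqVec_eq, star_add, add_dotProduct, dotProduct_add, expand, cH]
    have e1 := congrArg (fun X => star a ⬝ᵥ (X *ᵥ a)) h1
    have e2 := congrArg (fun X => star a ⬝ᵥ (X *ᵥ b)) h2
    have e3 := congrArg (fun X => star b ⬝ᵥ (X *ᵥ a)) h3
    have e4 := congrArg (fun X => star b ⬝ᵥ (X *ᵥ b)) h4
    simp only [sub_mulVec, dotProduct_sub, one_mulVec, zero_mulVec, dotProduct_zero] at e1 e2 e3 e4
    linear_combination e1 + e2 + e3 - e4
  exact_mod_cast main

/-- Put `b' = τ b`, so that `|b'| ≤ |a|`. If the first component of the image of `(a, b')` vanishes,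
invariance of `|a|² - |b|²` forces the second one to vanish as well; the complexified symplectic
matrix being injective, `a = 0`. -/
theorem symplectic_nonneg_injective {A : Matrix (Fin n ⊕ Fin n) (Fin n ⊕ Fin n) ℝ}
    (hA : A ∈ symplecticGroup (Fin n) ℝ) {a b : Fin n → ℂ} (hab : normSqVec b ≤ normSqVec a)
    {τ : ℝ} (hτ : τ ∈ Set.Icc (0 : ℝ) 1)
    (h : complexPart A *ᵥ a + (τ : ℂ) • antiPart A *ᵥ b = 0) : a = 0 := by
  have h1 : complexPart A *ᵥ a + antiPart A *ᵥ ((τ : ℂ) • b) = 0 := by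
    rwa [mulVec_smul]
  have hf := symplectic_preserves_form hA a ((τ : ℂ) • b)
  rw [h1, normSqVec_smul] at hf
  have h0 : normSqVec (0 : Fin n → ℂ) = 0 := by simp [normSqVec]
  have hτ2 : ‖(τ : ℂ)‖ ^ 2 * normSqVec b ≤ normSqVec a := by
    have : ‖(τ : ℂ)‖ ^ 2 ≤ 1 := by
      rw [Complex.norm_real, Real.norm_eq_abs, sq_abs]
      exact pow_le_one₀ hτ.1 hτ.2
    calc _ ≤ 1 * normSqVec b := by gcongr; exact normSqVec_nonneg b
      _ ≤ _ := by linarith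
  have h2 := eq_zero_of_normSqVec_le (v := cbar (antiPart A) *ᵥ a
    + cbar (complexPart A) *ᵥ ((τ : ℂ) • b)) (by linarith)
  have e1 := congrArg ((complexPart A)ᴴ *ᵥ ·) h1
  have e2 := congrArg ((antiPart A)ᵀ *ᵥ ·) h2
  simp only [mulVec_add, mulVec_mulVec, mulVec_zero] at e1 e2
  have e3 : ((complexPart A)ᴴ * complexPart A - (antiPart A)ᵀ * cbar (antiPart A)) *ᵥ a
      + ((complexPart A)ᴴ * antiPart A - (antiPart A)ᵀ * cbar (complexPart A)) *ᵥ ((τ : ℂ) • b)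
      = 0 := by
    rw [sub_mulVec, sub_mulVec]
    calc _ = ((complexPart A)ᴴ * complexPart A) *ᵥ a + ((complexPart A)ᴴ * antiPart A) *ᵥ ((τ : ℂ) • b)
        - (((antiPart A)ᵀ * cbar (antiPart A)) *ᵥ a
          + ((antiPart A)ᵀ * cbar (complexPart A)) *ᵥ ((τ : ℂ) • b)) := by abel
      _ = 0 := by rw [e1, e2, sub_zero]
  rwa [symplectic_complex_relation hA, symplectic_anti_relation hA, one_mulVec, zero_mulVec,
    add_zero] at e3

theorem det_ne_zero_of_injective {K : Matrix (Fin n) (Fin n) ℂ} (h : ∀ v, K *ᵥ v = 0 → v = 0) :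
    K.det ≠ 0 := fun h0 => by
  obtain ⟨v, hv, hv'⟩ := exists_mulVec_eq_zero_iff.2 h0
  exact hv (h v hv')

/-- The graph of a contraction `β` consists of vectors `(v, βv)` on which `|a|² - |b|²` is
nonnegative, so `symplectic_nonneg_injective` applies. -/
theorem det_graph_ne_zero {A : Matrix (Fin n ⊕ Fin n) (Fin n ⊕ Fin n) ℝ}
    (hA : A ∈ symplecticGroup (Fin n) ℝ) {β : Matrix (Fin n) (Fin n) ℂ}
    (hβ : ∀ v, normSqVec (β *ᵥ v) ≤ normSqVec v) {τ : ℝ} (hτ : τ ∈ Set.Icc (0 : ℝ) 1) :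
    (complexPart A + (τ : ℂ) • (antiPart A * β)).det ≠ 0 :=
  det_ne_zero_of_injective fun v hv => symplectic_nonneg_injective hA (hβ v) hτ (by
    rw [← hv, add_mulVec, smul_mulVec, mulVec_mulVec])

/-- The matrix `B` sends `(v, 0)` to `(P_B v, cbar Q_B v)`, again a vector on which the indefinite
form is nonnegative; then `symplectic_nonneg_injective` is applied to `A`. -/
theorem det_quasi_ne_zero {A B : Matrix (Fin n ⊕ Fin n) (Fin n ⊕ Fin n) ℝ}
    (hA : A ∈ symplecticGroup (Fin n) ℝ) (hB : B ∈ symplecticGroup (Fin n) ℝ)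
    {τ : ℝ} (hτ : τ ∈ Set.Icc (0 : ℝ) 1) :
    (complexPart A * complexPart B + (τ : ℂ) • (antiPart A * cbar (antiPart B))).det ≠ 0 := by
  refine det_ne_zero_of_injective fun v hv => ?_
  have hf := symplectic_preserves_form hB v 0
  simp only [mulVec_zero, add_zero] at hf
  have h0 : normSqVec (0 : Fin n → ℂ) = 0 := by simp [normSqVec]
  have := normSqVec_nonneg v
  have h1 := symplectic_nonneg_injective hA (a := complexPart B *ᵥ v)
    (b := cbar (antiPart B) *ᵥ v) (by linarith) hτ (by
      rw [← hv, add_mulVec, smul_mulVec, mulVec_mulVec, mulVec_mulVec])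
  rw [h1, h0] at hf
  have := normSqVec_nonneg (cbar (antiPart B) *ᵥ v)
  exact eq_zero_of_normSqVec_le (by linarith)

theorem det_complexPart_ne_zero {A : Matrix (Fin n ⊕ Fin n) (Fin n ⊕ Fin n) ℝ}
    (hA : A ∈ symplecticGroup (Fin n) ℝ) : (complexPart A).det ≠ 0 := by
  simpa using det_graph_ne_zero hA (β := 1) (fun v => by simp) (τ := 0) (by simp)

/-! ### Rotation along segments of matrices -/

/-- The determinant is a polynomial in `t` of degree at most the size of the matrices. The bound is
uniform in `M₀` and `M₁`, which is what makes estimates on all powers of a path possible. -/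
theorem HasRotation.bound_affine {ι : Type*} [Fintype ι] [DecidableEq ι] {S : ℝ} (hS : 0 ≤ S)
    (M₀ M₁ : Matrix ι ι ℂ) {a : ℝ}
    (h0 : ∀ t ∈ Set.Icc 0 S, (M₀ + (t : ℂ) • M₁).det ≠ 0)
    (ha : HasRotation S (fun t => (M₀ + (t : ℂ) • M₁).det) a) :
    |a| ≤ Fintype.card ι * (2 * Real.pi) := by
  let p : Polynomial ℂ :=
    ((Polynomial.X : Polynomial ℂ) • M₁.map Polynomial.C + M₀.map Polynomial.C).det
  have hp : ∀ t : ℂ, p.eval t = (M₀ + t • M₁).det := by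
    intro t
    have := RingHom.map_det (Polynomial.evalRingHom t)
      ((Polynomial.X : Polynomial ℂ) • M₁.map Polynomial.C + M₀.map Polynomial.C)
    rw [Polynomial.coe_evalRingHom] at this
    rw [this]
    congr 1
    ext i j
    simp only [RingHom.mapMatrix_apply, Matrix.map_apply, Matrix.add_apply, Matrix.smul_apply,
      smul_eq_mul, Polynomial.coe_evalRingHom, Polynomial.eval_add, Polynomial.eval_mul,
      Polynomial.eval_X, Polynomial.eval_C]
    ring
  have := HasRotation.bound_polynomial hS p (fun t ht => by rw [hp]; exact h0 t ht)
    (ha.congr fun t _ => (hp t).symm)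
  refine this.trans ?_
  gcongr
  exact Polynomial.natDegree_det_X_add_C_le M₁ M₀

end SymplecticMatrices

end CoisotropicIndex

namespace CoisotropicIndex

/-! ### The mean index: quasimorphism, existence and change by loops. -/

section MeanIndex

open Matrix

variable {n : ℕ} {T : ℝ}

local notation "Mat" => Matrix (Fin n ⊕ Fin n) (Fin n ⊕ Fin n) ℝ
local notation "Sp" => symplecticGroup (Fin n) ℝ

theorem continuousOn_det_complexPart {X : Type*} [TopologicalSpace X] {s : Set X} {A : X → Mat}
    (hA : ContinuousOn A s) : ContinuousOn (fun t => (complexPart (A t)).det) s :=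
  (continuous_complexPart.matrix_det).comp_continuousOn hA

theorem exists_rotation_path (hT : 0 ≤ T) {A : ℝ → Mat} (hA : ContinuousOn A (Set.Icc 0 T))
    (hS : ∀ t ∈ Set.Icc 0 T, A t ∈ Sp) : ∃ δ, HasRotation T (fun t => (complexPart (A t)).det) δ :=
  exists_hasRotation hT _ (continuousOn_det_complexPart hA)
    fun t ht => det_complexPart_ne_zero (hS t ht)

/-- The homotopy behind the quasimorphism property. -/
theorem rotation_mul_aux (hT : 0 ≤ T) {A B : ℝ → Mat} (hA : ContinuousOn A (Set.Icc 0 T))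
    (hB : ContinuousOn B (Set.Icc 0 T)) (hAS : ∀ t ∈ Set.Icc 0 T, A t ∈ Sp)
    (hBS : ∀ t ∈ Set.Icc 0 T, B t ∈ Sp) {a b δ : ℝ}
    (ha : HasRotation T (fun t => (complexPart (A t)).det) a)
    (hb : HasRotation T (fun t => (complexPart (B t)).det) b)
    (hδ : HasRotation T (fun t => (complexPart (A t * B t)).det) δ) {x₀ x₁ : ℝ}
    (h₀ : HasRotation 1 (fun τ : ℝ => (complexPart (A 0) * complexPart (B 0)
      + (τ : ℂ) • (antiPart (A 0) * cbar (antiPart (B 0)))).det) x₀)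
    (h₁ : HasRotation 1 (fun τ : ℝ => (complexPart (A T) * complexPart (B T)
      + (τ : ℂ) • (antiPart (A T) * cbar (antiPart (B T)))).det) x₁) :
    δ - (a + b) = x₁ - x₀ := by
  refine HasRotation.square (c := fun τ t => (complexPart (A t) * complexPart (B t)
      + (τ : ℂ) • (antiPart (A t) * cbar (antiPart (B t)))).det) zero_le_one hT ?_ ?_
      ?_ ?_ h₀ h₁
  · have h1 : ContinuousOn (fun p : ℝ × ℝ => A p.2) (Set.Icc 0 1 ×ˢ Set.Icc 0 T) :=
      hA.comp continuousOn_snd fun p hp => hp.2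
    have h2 : ContinuousOn (fun p : ℝ × ℝ => B p.2) (Set.Icc 0 1 ×ˢ Set.Icc 0 T) :=
      hB.comp continuousOn_snd fun p hp => hp.2
    have hr : ContinuousOn (fun p : ℝ × ℝ => (p.1 : ℂ)) (Set.Icc 0 1 ×ˢ Set.Icc 0 T) :=
      (Complex.continuous_ofReal.comp continuous_fst).continuousOn
    exact (continuous_id.matrix_det).comp_continuousOn
      (((continuous_complexPart.comp_continuousOn h1).mul
        (continuous_complexPart.comp_continuousOn h2)).add
      (hr.smul ((continuous_antiPart.comp_continuousOn h1).mul
        (continuous_cbar.comp_continuousOn (continuous_antiPart.comp_continuousOn h2)))))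
  · exact fun τ hτ t ht => det_quasi_ne_zero (hAS t ht) (hBS t ht) hτ
  · exact (ha.mul hb).congr fun t _ => by simp
  · exact hδ.congr fun t _ => by simp [complexPart_mul]

/-- The defect of additivity is carried by the two vertical sides of the homotopy, at `t = 0` and `t
= T`. There the matrix is affine in `τ`, and each side rotates by at most `n · 2π`. -/
theorem rotation_mul_bound (hT : 0 ≤ T) {A B : ℝ → Mat} (hA : ContinuousOn A (Set.Icc 0 T))
    (hB : ContinuousOn B (Set.Icc 0 T)) (hAS : ∀ t ∈ Set.Icc 0 T, A t ∈ Sp)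
    (hBS : ∀ t ∈ Set.Icc 0 T, B t ∈ Sp) {a b δ : ℝ}
    (ha : HasRotation T (fun t => (complexPart (A t)).det) a)
    (hb : HasRotation T (fun t => (complexPart (B t)).det) b)
    (hδ : HasRotation T (fun t => (complexPart (A t * B t)).det) δ) :
    |δ - (a + b)| ≤ 2 * (n * (2 * Real.pi)) := by
  have key : ∀ t ∈ Set.Icc 0 T, ∃ x, HasRotation 1 (fun τ : ℝ =>
      (complexPart (A t) * complexPart (B t)
      + (τ : ℂ) • (antiPart (A t) * cbar (antiPart (B t)))).det) x ∧ |x| ≤ n * (2 * Real.pi) := by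
    intro t ht
    obtain ⟨x, hx⟩ := exists_hasRotation zero_le_one (fun τ : ℝ =>
      (complexPart (A t) * complexPart (B t)
      + (τ : ℂ) • (antiPart (A t) * cbar (antiPart (B t)))).det)
      (by
        have hr : Continuous fun q : ℝ => (q : ℂ) := Complex.continuous_ofReal
        refine Continuous.continuousOn (Continuous.matrix_det ?_)
        fun_prop)
      (fun τ hτ => det_quasi_ne_zero (hAS t ht) (hBS t ht) hτ)
    refine ⟨x, hx, ?_⟩
    simpa using HasRotation.bound_affine zero_le_one _ _
      (fun τ hτ => det_quasi_ne_zero (hAS t ht) (hBS t ht) hτ) hx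
  obtain ⟨x₀, h₀, b₀⟩ := key 0 (Set.left_mem_Icc.2 hT)
  obtain ⟨x₁, h₁, b₁⟩ := key T (Set.right_mem_Icc.2 hT)
  rw [rotation_mul_aux hT hA hB hAS hBS ha hb hδ h₀ h₁]
  calc |x₁ - x₀| ≤ |x₁| + |x₀| := abs_sub _ _
    _ ≤ _ := by linarith

theorem rotation_mul_loop (hT : 0 ≤ T) {A B : ℝ → Mat} (hA : ContinuousOn A (Set.Icc 0 T))
    (hB : ContinuousOn B (Set.Icc 0 T)) (hAS : ∀ t ∈ Set.Icc 0 T, A t ∈ Sp)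
    (hBS : ∀ t ∈ Set.Icc 0 T, B t ∈ Sp) (hAl : A T = A 0) (hBl : B T = B 0) {a b : ℝ}
    (ha : HasRotation T (fun t => (complexPart (A t)).det) a)
    (hb : HasRotation T (fun t => (complexPart (B t)).det) b) :
    HasRotation T (fun t => (complexPart (A t * B t)).det) (a + b) := by
  obtain ⟨δ, hδ⟩ := exists_rotation_path hT (hA.mul hB)
    fun t ht => Submonoid.mul_mem _ (hAS t ht) (hBS t ht)
  have m0 := Set.left_mem_Icc.2 hT
  obtain ⟨x, hx⟩ := exists_hasRotation zero_le_one (fun τ : ℝ =>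
      (complexPart (A 0) * complexPart (B 0)
      + (τ : ℂ) • (antiPart (A 0) * cbar (antiPart (B 0)))).det)
      (by
        have hr : Continuous fun q : ℝ => (q : ℂ) := Complex.continuous_ofReal
        refine Continuous.continuousOn (Continuous.matrix_det ?_)
        fun_prop)
      (fun τ hτ => det_quasi_ne_zero (hAS 0 m0) (hBS 0 m0) hτ)
  have := rotation_mul_aux hT hA hB hAS hBS ha hb hδ hx (by rw [hAl, hBl]; exact hx)
  rwa [show a + b = δ by linarith]

theorem rotation_pow_loop (hT : 0 ≤ T) {A : ℝ → Mat} (hA : ContinuousOn A (Set.Icc 0 T))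
    (hAS : ∀ t ∈ Set.Icc 0 T, A t ∈ Sp) (hAl : A T = A 0) {a : ℝ}
    (ha : HasRotation T (fun t => (complexPart (A t)).det) a) (k : ℕ) :
    HasRotation T (fun t => (complexPart (A t ^ k)).det) (k * a) := by
  induction k with
  | zero =>
    refine ⟨fun _ => 0, continuousOn_const, fun t _ => ?_, by simp⟩
    simp [complexPart_one]
  | succ k ih =>
    have := rotation_mul_loop hT (hA.pow k) hA (fun t ht => Submonoid.pow_mem _ (hAS t ht) k) hAS
      (by simp [hAl]) hAl ih ha
    simpa [pow_succ, add_mul] using this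

theorem symplectic_mul_inv_cancel {A : Mat} (hA : A ∈ Sp) : A * A⁻¹ = 1 :=
  mul_nonsing_inv _ (SymplecticGroup.symplectic_det hA)

theorem symplectic_inv_mul_cancel {A : Mat} (hA : A ∈ Sp) : A⁻¹ * A = 1 :=
  nonsing_inv_mul _ (SymplecticGroup.symplectic_det hA)

theorem symplectic_inv_mem {A : Mat} (hA : A ∈ Sp) : A⁻¹ ∈ Sp := by
  have := (⟨A, hA⟩ : symplecticGroup (Fin n) ℝ)⁻¹.2
  rwa [SymplecticGroup.coe_inv'] at this

/-- Powers of a path of symplectic matrices have rotations which are almost additive. -/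
theorem exists_rotations_pow (hT : 0 ≤ T) {A : ℝ → Mat} (hA : ContinuousOn A (Set.Icc 0 T))
    (hS : ∀ t ∈ Set.Icc 0 T, A t ∈ Sp) :
    ∃ δ : ℕ → ℝ, ∀ k, HasRotation T (fun t => (complexPart (A t ^ k)).det) (δ k) := by
  choose δ hδ using fun k : ℕ => exists_rotation_path hT (hA.pow k)
    fun t ht => Submonoid.pow_mem _ (hS t ht) k
  exact ⟨δ, hδ⟩

/-- The rotations `δ k` of the powers are additive up to a constant `C`, so `δ k + C` is subadditive
and Fekete's lemma gives the limit of `(δ k + C) / k`. -/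
theorem exists_hasMeanIndex (hT : 0 ≤ T) {A : ℝ → Mat} (hA : ContinuousOn A (Set.Icc 0 T))
    (hS : ∀ t ∈ Set.Icc 0 T, A t ∈ Sp) : ∃ d, HasMeanIndex T A d := by
  obtain ⟨δ, hδ⟩ := exists_rotations_pow hT hA hS
  set C : ℝ := 2 * (n * (2 * Real.pi)) with hC
  have hC0 : 0 ≤ C := by positivity
  have hq : ∀ k l, |δ (k + l) - (δ k + δ l)| ≤ C := fun k l =>
    rotation_mul_bound hT (hA.pow k) (hA.pow l) (fun t ht => Submonoid.pow_mem _ (hS t ht) k)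
      (fun t ht => Submonoid.pow_mem _ (hS t ht) l) (hδ k) (hδ l)
      ((hδ (k + l)).congr fun t _ => by rw [pow_add]; rfl)
  have hsub : Subadditive fun k => δ k + C := fun k l => by
    have := (abs_le.1 (hq k l)).2
    linarith
  -- Fekete's lemma needs a lower bound of the quotients; the other half of almost additivity bounds
  -- `δ k` below linearly in `k`.
  have hlow : ∀ k : ℕ, -(k * (|δ 1| + C)) ≤ δ k + C := by
    intro k
    induction k with
    | zero =>
      have := (abs_le.1 (hq 0 0)).2
      have h0 := (abs_le.1 (hq 0 0)).1
      simp at this h0 ⊢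
      linarith
    | succ k ih =>
      have := (abs_le.1 (hq k 1)).1
      have h2 := neg_abs_le (δ 1)
      push_cast
      nlinarith
  have hbdd : BddBelow (Set.range fun k : ℕ => (δ k + C) / k) := by
    refine ⟨-(|δ 1| + C), ?_⟩
    rintro _ ⟨k, rfl⟩
    have habs := abs_nonneg (δ 1)
    -- At `k = 0` the quotient is `0` by the convention for division by zero.
    rcases Nat.eq_zero_or_pos k with rfl | hk
    · simp; linarith
    · have hk' : (0 : ℝ) < k := by exact_mod_cast hk
      simp only
      rw [le_div_iff₀ hk']
      have := hlow k
      linarith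
  have ht := hsub.tendsto_lim hbdd
  have h0 : Filter.Tendsto (fun k : ℕ => C / (k : ℝ)) Filter.atTop (𝓝 0) :=
    tendsto_const_div_atTop_nhds_zero_nat C
  refine ⟨(hsub.lim - 0) / Real.pi, hA, hS, δ, hδ, ?_⟩
  have h3 := (ht.sub h0).div_const Real.pi
  refine h3.congr fun k => ?_
  rw [← sub_div, add_sub_cancel_right, div_div, mul_comm]

theorem HasMeanIndex.congr {A B : ℝ → Mat} {d : ℝ} (h : HasMeanIndex T A d)
    (hAB : ∀ t ∈ Set.Icc 0 T, A t = B t) : HasMeanIndex T B d := by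
  obtain ⟨h1, h2, δ, h3, h4⟩ := h
  exact ⟨h1.congr fun t ht => (hAB t ht).symm, fun t ht => hAB t ht ▸ h2 t ht, δ,
    fun k => (h3 k).congr fun t ht => by rw [hAB t ht], h4⟩

/-- Two paths whose powers have rotations at bounded distance have the same mean index. -/
theorem HasMeanIndex.of_bounded {A B : ℝ → Mat} {d : ℝ} (h : HasMeanIndex T A d) (hT : 0 ≤ T)
    (hB : ContinuousOn B (Set.Icc 0 T)) (hS : ∀ t ∈ Set.Icc 0 T, B t ∈ Sp) (K : ℝ)
    (hK : ∀ (k : ℕ) (a b : ℝ), HasRotation T (fun t => (complexPart (A t ^ k)).det) a →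
      HasRotation T (fun t => (complexPart (B t ^ k)).det) b → |b - a| ≤ K) :
    HasMeanIndex T B d := by
  obtain ⟨hA, hAS, δ, hδ, hlim⟩ := h
  obtain ⟨ε, hε⟩ := exists_rotations_pow hT hB hS
  refine ⟨hB, hS, ε, hε, ?_⟩
  have h0 : Filter.Tendsto (fun k : ℕ => (ε k - δ k) / (Real.pi * k)) Filter.atTop (𝓝 0) := by
    refine squeeze_zero_norm (a := fun k : ℕ => (K / Real.pi) / (k : ℝ)) (fun k => ?_)
      (tendsto_const_div_atTop_nhds_zero_nat _)
    rw [Real.norm_eq_abs, abs_div, div_div, abs_of_nonneg (a := Real.pi * k) (by positivity)]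
    exact div_le_div_of_nonneg_right (hK k _ _ (hδ k) (hε k)) (by positivity)
  have := hlim.add h0
  rw [add_zero] at this
  refine this.congr fun k => ?_
  rw [← add_div, add_sub_cancel]

theorem HasMeanIndex.unique {A : ℝ → Mat} {d d' : ℝ} (h : HasMeanIndex T A d) (hT : 0 ≤ T)
    (h' : HasMeanIndex T A d') : d = d' := by
  obtain ⟨_, _, δ, hδ, hlim⟩ := h
  obtain ⟨_, _, δ', hδ', hlim'⟩ := h'
  have : δ = δ' := funext fun k => (hδ k).unique hT (hδ' k)
  subst this
  exact tendsto_nhds_unique hlim hlim'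

/-- Changing a path of symplectic matrices by a loop of rotation `0` does not change the mean
index. -/
theorem HasMeanIndex.loop_change (hT : 0 ≤ T) {A S : ℝ → Mat} {d : ℝ} (h : HasMeanIndex T A d)
    (hA0 : A 0 = 1) (hS : ContinuousOn S (Set.Icc 0 T)) (hSS : ∀ t ∈ Set.Icc 0 T, S t ∈ Sp)
    (hSl : S T = S 0) (hrot : HasRotation T (fun t => (complexPart (S t)).det) 0) :
    HasMeanIndex T (fun t => S t * A t * (S 0)⁻¹) d := by
  have hA := h.1
  have hAS := h.2.1
  have m0 := Set.left_mem_Icc.2 hT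
  have m1 := Set.right_mem_Icc.2 hT
  have hS0 := hSS 0 m0
  have hi := symplectic_inv_mem hS0
  have hconst : ContinuousOn (fun _ : ℝ => (S 0)⁻¹) (Set.Icc 0 T) := continuousOn_const
  have hconst' : ContinuousOn (fun _ : ℝ => S 0) (Set.Icc 0 T) := continuousOn_const
  have rotc : ∀ C : Mat, C ∈ Sp → HasRotation T (fun _ => (complexPart C).det) 0 := fun C hC =>
    ⟨fun _ => ((complexPart C).det).arg, continuousOn_const, fun t _ =>
      ⟨det_complexPart_ne_zero hC, (Complex.norm_mul_exp_arg_mul_I _).symm⟩, by ring⟩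
  have hconj : ∀ k t, (S 0 * A t * (S 0)⁻¹) ^ k = S 0 * A t ^ k * (S 0)⁻¹ := by
    intro k t
    induction k with
    | zero => simp [symplectic_mul_inv_cancel hS0]
    | succ k ih =>
      rw [pow_succ, ih, pow_succ]
      simp only [mul_assoc]
      rw [← mul_assoc (S 0)⁻¹ (S 0), symplectic_inv_mul_cancel hS0, one_mul]
  refine h.of_bounded hT ((hS.mul hA).mul hconst)
    (fun t ht => Submonoid.mul_mem _ (Submonoid.mul_mem _ (hSS t ht) (hAS t ht)) hi)
    (2 * (2 * (n * (2 * Real.pi)))) fun k a b ha hb => ?_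
  -- the loop part
  have hL := rotation_pow_loop hT (hS.mul hconst)
    (fun t ht => Submonoid.mul_mem _ (hSS t ht) hi) (by simp [hSl])
    (rotation_mul_loop hT hS hconst hSS (fun _ _ => hi) hSl rfl hrot (rotc _ hi)) k
  -- the conjugated part
  obtain ⟨x, hx⟩ := exists_rotation_path hT (hconst'.mul (hA.pow k))
    fun t ht => Submonoid.mul_mem _ hS0 (Submonoid.pow_mem _ (hAS t ht) k)
  obtain ⟨y, hy⟩ := exists_rotation_path hT ((hconst'.mul (hA.pow k)).mul hconst)
    fun t ht => Submonoid.mul_mem _ (Submonoid.mul_mem _ hS0 (Submonoid.pow_mem _ (hAS t ht) k)) hi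
  have b1 := rotation_mul_bound hT hconst' (hA.pow k) (fun _ _ => hS0)
    (fun t ht => Submonoid.pow_mem _ (hAS t ht) k) (rotc _ hS0) ha hx
  have b2 := rotation_mul_bound hT (hconst'.mul (hA.pow k)) hconst
    (fun t ht => Submonoid.mul_mem _ hS0 (Submonoid.pow_mem _ (hAS t ht) k)) (fun _ _ => hi)
    hx (rotc _ hi) hy
  -- Separate the times of `S` and `A`. On the side `t = 0`, where `A 0 = 1`, one has the `k`-th
  -- power of the loop `S (S 0)⁻¹`, of rotation zero. On the side `s = T` one has the conjugate of
  -- `A t ^ k` by `S 0`, whose rotation is at bounded distance from that of `A t ^ k`.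
  have hdiag : b = k * (0 + 0) + y := by
    refine HasRotation.diagonal hT (c := fun s t => (complexPart ((S s * A t * (S 0)⁻¹) ^ k)).det)
      ?_ ?_ (hL.congr fun t _ => by simp [hA0]) (hy.congr fun t _ => by simp [hSl, hconj]) hb
    · refine continuousOn_det_complexPart ?_
      have e1 : ContinuousOn (fun p : ℝ × ℝ => S p.1) (Set.Icc 0 T ×ˢ Set.Icc 0 T) :=
        hS.comp continuousOn_fst fun p hp => hp.1
      have e2 : ContinuousOn (fun p : ℝ × ℝ => A p.2) (Set.Icc 0 T ×ˢ Set.Icc 0 T) :=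
        hA.comp continuousOn_snd fun p hp => hp.2
      exact ((e1.mul e2).mul continuousOn_const).pow k
    · exact fun s hs t ht => det_complexPart_ne_zero (Submonoid.pow_mem _ (Submonoid.mul_mem _
        (Submonoid.mul_mem _ (hSS s hs) (hAS t ht)) hi) k)
  rw [hdiag]
  rw [abs_le] at b1 b2 ⊢
  constructor <;> linarith [b1.1, b1.2, b2.1, b2.2]

end MeanIndex

end CoisotropicIndex

namespace CoisotropicIndex

/-! ### Moving frames: conjugation by matrices that need not be symplectic. -/

section Conjugation

open Matrix

variable {n : ℕ}

local notation "Mat" => Matrix (Fin n ⊕ Fin n) (Fin n ⊕ Fin n) ℝ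
local notation "Sp" => symplecticGroup (Fin n) ℝ

attribute [local instance] Matrix.linftyOpNormedRing Matrix.linftyOpNormedAlgebra

/-- The complex structure of `ℂ^n` is tamed by the pull-back of the standard form under `g`. -/
def IsTame (g : Mat) : Prop := ∀ x, x ≠ 0 → (g *ᵥ x) ⬝ᵥ (J (Fin n) ℝ *ᵥ (g *ᵥ (J (Fin n) ℝ *ᵥ x))) < 0

theorem IsTame.isUnit_det {g : Mat} (hg : IsTame g) : IsUnit g.det := by
  rw [isUnit_iff_ne_zero]
  intro h
  obtain ⟨v, hv, hv'⟩ := exists_mulVec_eq_zero_iff.2 h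
  have := hg v hv
  rw [hv'] at this
  simp at this

/-- At `g = 1` the expression is `-|x|²`, and strict negativity of a quadratic form is an open
condition. The entries of `N g`, the deviation from that value, are required to have total size
below `1`. -/
theorem eventually_isTame : ∃ ε > 0, ∀ g ∈ Metric.ball (1 : Mat) ε, IsTame g := by
  let N : Mat → Mat := fun g => gᵀ * (J (Fin n) ℝ * (g * J (Fin n) ℝ)) + 1
  have hN : Continuous fun g : Mat => ∑ i, ∑ j, |N g i j| := by
    have hN' : Continuous N := by fun_prop
    refine continuous_finsetSum _ fun i _ => continuous_finsetSum _ fun j _ => ?_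
    exact (hN'.matrix_elem i j).abs
  have h1 : ∑ i, ∑ j, |N 1 i j| = 0 := by
    have : N 1 = 0 := by simp [N, Matrix.J_squared]
    simp [this]
  have hev : ∀ᶠ g in 𝓝 (1 : Mat), ∑ i, ∑ j, |N g i j| < 1 :=
    hN.continuousAt.eventually_lt continuousAt_const (by rw [h1]; exact one_pos)
  obtain ⟨ε, hε, hb⟩ := Metric.eventually_nhds_iff_ball.1 hev
  refine ⟨ε, hε, fun g hg x hx => ?_⟩
  have hs := hb g hg
  have hxx : 0 < x ⬝ᵥ x := by
    have h2 := dotProduct_self_eq_zero (v := x)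
    have h3 : 0 ≤ x ⬝ᵥ x := Finset.sum_nonneg fun i _ => mul_self_nonneg _
    exact lt_of_le_of_ne h3 fun h => hx (h2.1 h.symm)
  have e1 : (g *ᵥ x) ⬝ᵥ (J (Fin n) ℝ *ᵥ (g *ᵥ (J (Fin n) ℝ *ᵥ x))) = x ⬝ᵥ (N g *ᵥ x) - x ⬝ᵥ x := by
    simp only [N, add_mulVec, one_mulVec, dotProduct_add, add_sub_cancel_right]
    rw [← mulVec_mulVec, dotProduct_mulVec x, vecMul_transpose]
    simp only [mulVec_mulVec]
  have e2 : x ⬝ᵥ (N g *ᵥ x) ≤ (∑ i, ∑ j, |N g i j|) * (x ⬝ᵥ x) := by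
    have hle : ∀ i, x i * x i ≤ x ⬝ᵥ x := fun i =>
      Finset.single_le_sum (f := fun i => x i * x i) (fun i _ => mul_self_nonneg _)
        (Finset.mem_univ i)
    have hexp : x ⬝ᵥ (N g *ᵥ x) = ∑ i, ∑ j, x i * (N g i j * x j) := by
      simp only [dotProduct, mulVec, Finset.mul_sum]
    rw [hexp, Finset.sum_mul]
    refine Finset.sum_le_sum fun i _ => ?_
    rw [Finset.sum_mul]
    refine Finset.sum_le_sum fun k _ => ?_
    calc x i * (N g i k * x k) ≤ |x i * (N g i k * x k)| := le_abs_self _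
      _ = |N g i k| * (|x i| * |x k|) := by rw [abs_mul, abs_mul]; ring
      _ ≤ |N g i k| * (x ⬝ᵥ x) := by
        refine mul_le_mul_of_nonneg_left ?_ (abs_nonneg _)
        have h1 := hle i
        have h2 := hle k
        rw [← abs_mul_abs_self] at h1 h2
        nlinarith [sq_nonneg (|x i| - |x k|)]
  rw [e1]
  nlinarith

/-- The conjugate `Y` preserves the form `ω_g` pulled back by `g`. A vector `w` killed by the linear
part of `Y` satisfies `Y w = j u` with `u = Y j w`. Then `ω_g(j u, u) = ω_g(w, j w) < 0`, while
tameness at `u` gives `ω_g(j u, u) > 0`. -/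
theorem IsTame.det_ne_zero {g X : Mat} (hg : IsTame g) (hX : X ∈ Sp) :
    (complexPart (g⁻¹ * X * g)).det ≠ 0 := by
  refine det_ne_zero_of_injective fun v hv => ?_
  set Y := g⁻¹ * X * g with hY
  let w : Fin n ⊕ Fin n → ℝ := Sum.elim (fun i => (v i).re) (fun i => (v i).im)
  set j := J (Fin n) ℝ with hj
  by_contra hv0
  have hw : w ≠ 0 := fun h => hv0 (by
    ext i
    have h1 := congrFun h (.inl i)
    have h2 := congrFun h (.inr i)
    simp only [w, Sum.elim_inl, Sum.elim_inr, Pi.zero_apply] at h1 h2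
    exact Complex.ext h1 h2)
  -- As a real map the linear part of `Y` is `(Y - j Y j) / 2`; the real and imaginary parts of `hv`
  -- are the two halves of this identity.
  have hYw : Y *ᵥ w = j *ᵥ (Y *ᵥ (j *ᵥ w)) := by
    have hv1 : ∀ i, ∑ x, complexPart Y i x * v x = 0 := fun i => congrFun hv i
    have hre : ∀ i, ∑ x, ((Y (.inl i) (.inl x) + Y (.inr i) (.inr x)) * (v x).re
        - (Y (.inr i) (.inl x) - Y (.inl i) (.inr x)) * (v x).im) = 0 := fun i => by
      have := congrArg Complex.re (hv1 i)
      simp only [Complex.re_sum, complexPart, of_apply, Complex.zero_re] at this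
      rw [← mul_zero 2, ← this, Finset.mul_sum]
      refine Finset.sum_congr rfl fun x _ => ?_
      simp
      ring
    have him : ∀ i, ∑ x, ((Y (.inl i) (.inl x) + Y (.inr i) (.inr x)) * (v x).im
        + (Y (.inr i) (.inl x) - Y (.inl i) (.inr x)) * (v x).re) = 0 := fun i => by
      have := congrArg Complex.im (hv1 i)
      simp only [Complex.im_sum, complexPart, of_apply, Complex.zero_im] at this
      rw [← mul_zero 2, ← this, Finset.mul_sum]
      refine Finset.sum_congr rfl fun x _ => ?_
      simp
      ring
    have hjm : ∀ u : Fin n ⊕ Fin n → ℝ, j *ᵥ u = Sum.elim (fun i => -u (.inr i)) (fun i => u (.inl i)) := by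
      intro u
      ext i
      rcases i with i | i <;>
        simp [hj, J, mulVec, dotProduct, Fintype.sum_sum_type, one_apply]
    rw [hjm, hjm]
    ext i
    rcases i with i | i
    · have := hre i
      simp only [mulVec, dotProduct, Fintype.sum_sum_type, w, Sum.elim_inl, Sum.elim_inr,
        ← Finset.sum_add_distrib]
      rw [← sub_eq_zero, sub_neg_eq_add, ← Finset.sum_add_distrib, ← this]
      refine Finset.sum_congr rfl fun x _ => ?_
      ring
    · have := him i
      simp only [mulVec, dotProduct, Fintype.sum_sum_type, w, Sum.elim_inl, Sum.elim_inr,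
        ← Finset.sum_add_distrib]
      rw [← sub_eq_zero, ← Finset.sum_sub_distrib, ← this]
      refine Finset.sum_congr rfl fun x _ => ?_
      ring
  have hgu := hg.isUnit_det
  -- the pulled back form is preserved by `Y`
  let form : (Fin n ⊕ Fin n → ℝ) → (Fin n ⊕ Fin n → ℝ) → ℝ := fun a b => (g *ᵥ a) ⬝ᵥ (j *ᵥ (g *ᵥ b))
  have hgY : ∀ a, g *ᵥ (Y *ᵥ a) = X *ᵥ (g *ᵥ a) := fun a => by
    rw [mulVec_mulVec, mulVec_mulVec, hY, ← mul_assoc, ← mul_assoc, mul_nonsing_inv _ hgu, one_mul]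
  have hpres : ∀ a b, form (Y *ᵥ a) (Y *ᵥ b) = form a b := fun a b => by
    simp only [form, hgY]
    have h1 := SymplecticGroup.mem_iff'.1 hX
    rw [← vecMul_transpose X (g *ᵥ a), ← dotProduct_mulVec, mulVec_mulVec, mulVec_mulVec, mul_assoc, ← mul_assoc Xᵀ,
      h1]
  have hskew : ∀ a b, form a b = - form b a := fun a b => by
    simp only [form]
    rw [dotProduct_comm, ← vecMul_transpose j, ← dotProduct_mulVec, J_transpose, neg_mulVec, dotProduct_neg]
  have t1 : form (Y *ᵥ w) (Y *ᵥ (j *ᵥ w)) < 0 := by rw [hpres]; exact hg w hw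
  have t2 : Y *ᵥ (j *ᵥ w) ≠ 0 := fun h => by
    rw [h] at t1
    simp [form] at t1
  have t3 := hg _ t2
  have t4 : form (Y *ᵥ (j *ᵥ w)) (j *ᵥ (Y *ᵥ (j *ᵥ w))) < 0 := t3
  rw [hYw, hskew] at t1
  linarith


theorem continuousOn_matrix_inv {X : Type*} [TopologicalSpace X] {s : Set X} {m : Type*} [Fintype m]
    [DecidableEq m] {A : X → Matrix m m ℝ}
    (hA : ContinuousOn A s) (hu : ∀ x ∈ s, IsUnit (A x).det) : ContinuousOn (fun x => (A x)⁻¹) s := by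
  simp only [Matrix.inv_def, Ring.inverse_eq_inv']
  have h1 : ContinuousOn (fun x => (A x).det) s := (continuous_id.matrix_det).comp_continuousOn hA
  have h2 : ContinuousOn (fun x => (A x).adjugate) s :=
    (continuous_id.matrix_adjugate).comp_continuousOn hA
  exact (h1.inv₀ fun x hx => (hu x hx).ne_zero).smul h2

/-- The `ℂ`-linear part is a compression of the complexified matrix. -/
theorem exists_compression : ∃ (K₁ : Matrix (Fin n) (Fin n ⊕ Fin n) ℂ)
    (K₂ : Matrix (Fin n ⊕ Fin n) (Fin n) ℂ),
    ∀ A : Mat, complexPart A = K₁ * A.map Complex.ofReal * K₂ := by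
  refine ⟨Matrix.of fun i => Sum.elim (fun j => if i = j then 1 else 0)
    (fun j => if i = j then Complex.I else 0),
    Matrix.of (Sum.elim (fun i j => if i = j then 1 / 2 else 0)
    (fun i j => if i = j then -Complex.I / 2 else 0)), fun A => ?_⟩
  ext i j
  simp [complexPart, Matrix.mul_apply, Fintype.sum_sum_type]
  linear_combination (1 / 2 : ℂ) * (A (.inr i) (.inr j) : ℂ) * Complex.I_mul_I

/-- The inverse of `1 + τ H` is avoided by a Schur complement. The linear part is a compression `K₁
· K₂`, so up to the real factor `det (1 + τ H)`, which does not rotate, its determinant is that of a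
block matrix of size `3n` that is affine in `τ`. The bound therefore depends neither on `X` nor on
`H`. -/
theorem rotation_conj_segment {X H : Mat} (hX : X ∈ Sp)
    (hH : ∀ τ ∈ Set.Icc (0 : ℝ) 1, IsTame (1 + τ • H)) {a : ℝ}
    (ha : HasRotation 1 (fun τ : ℝ => (complexPart ((1 + τ • H)⁻¹ * X * (1 + τ • H))).det) a) :
    |a| ≤ Fintype.card ((Fin n ⊕ Fin n) ⊕ Fin n) * (2 * Real.pi) := by
  obtain ⟨K₁, K₂, hK⟩ := exists_compression (n := n)
  set c : Mat → Matrix (Fin n ⊕ Fin n) (Fin n ⊕ Fin n) ℂ := fun A => A.map Complex.ofReal with hc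
  have cmul : ∀ A B : Mat, c (A * B) = c A * c B := fun A B =>
    Matrix.map_mul (f := Complex.ofRealHom)
  have cone : c 1 = 1 := Matrix.map_one _ (by simp) (by simp)
  let M₀ := fromBlocks (1 : Matrix (Fin n ⊕ Fin n) (Fin n ⊕ Fin n) ℂ) (c X * K₂) (-K₁) 0
  let M₁ := fromBlocks (c H) (c X * c H * K₂) (0 : Matrix (Fin n) (Fin n ⊕ Fin n) ℂ) 0
  have key : ∀ τ ∈ Set.Icc (0 : ℝ) 1, (M₀ + (τ : ℂ) • M₁).det
      = (((1 + τ • H).det : ℝ) : ℂ) * (complexPart ((1 + τ • H)⁻¹ * X * (1 + τ • H))).det := by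
    intro τ hτ
    set l := 1 + τ • H with hl
    have hu := (hH τ hτ).isUnit_det
    have cl : c l = 1 + (τ : ℂ) • c H := by
      ext i j
      by_cases h : i = j <;> simp [hc, hl, one_apply, h]
    have h1 : M₀ + (τ : ℂ) • M₁ = fromBlocks (c l) (c X * c l * K₂) (-K₁) 0 := by
      simp only [M₀, M₁, fromBlocks_smul, fromBlocks_add, cl]
      congr 1
      · rw [mul_add, mul_one, Matrix.add_mul, Matrix.mul_smul, Matrix.smul_mul]
      · simp
      · simp
    have hinv : c l⁻¹ * c l = 1 := by rw [← cmul, nonsing_inv_mul _ hu, cone]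
    let _ : Invertible (c l) := invertibleOfLeftInverse _ _ hinv
    have hinv' : ⅟(c l) = c l⁻¹ := invOf_eq_left_inv hinv
    have hdet : (c l).det = ((l.det : ℝ) : ℂ) := by
      exact (RingHom.map_det Complex.ofRealHom l).symm
    rw [h1, det_fromBlocks₁₁, hdet, hinv', hK]
    congr 2
    change _ = K₁ * c (l⁻¹ * X * l) * K₂
    rw [cmul, cmul]
    simp [Matrix.mul_assoc]
  have hne : ∀ τ ∈ Set.Icc (0 : ℝ) 1, (M₀ + (τ : ℂ) • M₁).det ≠ 0 := fun τ hτ => by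
    rw [key τ hτ]
    refine mul_ne_zero ?_ ((hH τ hτ).det_ne_zero hX)
    exact_mod_cast (hH τ hτ).isUnit_det.ne_zero
  have hdc : Continuous fun τ : ℝ => (((1 + τ • H).det : ℝ) : ℂ) := by
    refine Complex.continuous_ofReal.comp (Continuous.matrix_det ?_)
    fun_prop
  obtain ⟨b, hb⟩ := exists_hasRotation zero_le_one _ hdc.continuousOn (fun τ hτ => by
    exact_mod_cast (hH τ hτ).isUnit_det.ne_zero)
  have hb0 := hb.eq_zero_of_real zero_le_one (fun τ _ => Complex.ofReal_im _)
  subst hb0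
  have := (hb.mul ha).congr fun τ hτ => (key τ hτ).symm
  rw [zero_add] at this
  exact HasRotation.bound_affine zero_le_one M₀ M₁ hne this

/-- Conjugating by a fixed path of matrices, the rotation of the conjugates of `D` is bounded
uniformly over all `D` all of whose conjugates are symplectic. -/
theorem rotation_conj_bound {e : ℝ → Mat} (he : ContinuousOn e (Set.Icc 0 1))
    (hu : ∀ s ∈ Set.Icc (0 : ℝ) 1, IsUnit (e s).det) :
    ∃ K : ℝ, ∀ D : Mat, (∀ s ∈ Set.Icc (0 : ℝ) 1, (e s)⁻¹ * D * e s ∈ Sp) →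
      ∀ a, HasRotation 1 (fun s => (complexPart ((e s)⁻¹ * D * e s)).det) a → |a| ≤ K := by
  -- The path is cut into pieces, independent of `D`, on which `(e s)⁻¹ * e s'` stays in a ball of
  -- tame matrices about `1`.
  obtain ⟨ε, hε, htame⟩ := eventually_isTame (n := n)
  have hinv := continuousOn_matrix_inv he hu
  have hcont2 : ContinuousOn (fun p : ℝ × ℝ => (e p.1)⁻¹ * e p.2)
      (Set.Icc 0 1 ×ˢ Set.Icc 0 1) :=
    (hinv.comp continuousOn_fst fun p hp => hp.1).mul
      (he.comp continuousOn_snd fun p hp => hp.2)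
  have hunif := (isCompact_Icc.prod isCompact_Icc).uniformContinuousOn_of_continuous hcont2
  obtain ⟨δ, hδ, hclose⟩ := Metric.uniformContinuousOn_iff.1 hunif ε hε
  have hclose' : ∀ s ∈ Set.Icc (0 : ℝ) 1, ∀ s' ∈ Set.Icc (0 : ℝ) 1, |s' - s| < δ →
      (e s)⁻¹ * e s' ∈ Metric.ball (1 : Mat) ε := by
    intro s hs s' hs' hd
    have := hclose (s, s') ⟨hs, hs'⟩ (s, s) ⟨hs, hs⟩ (by
      rw [Prod.dist_eq, dist_self, Real.dist_eq]; exact max_lt hδ hd)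
    rwa [nonsing_inv_mul _ (hu s hs)] at this
  set C : ℝ := Fintype.card ((Fin n ⊕ Fin n) ⊕ Fin n) * (2 * Real.pi) with hC
  obtain ⟨N, hN⟩ := exists_nat_gt (1 / δ)
  have hN0 : (0 : ℝ) < N := lt_trans (by positivity) hN
  have hNδ : (1 : ℝ) / N < δ := by
    rw [div_lt_iff₀ hN0]
    rw [div_lt_iff₀ hδ] at hN
    linarith
  -- There are `N` pieces of length `1 / N < δ`, and each rotates by at most the constant `C` of
  -- `rotation_conj_segment`.
  refine ⟨N * C, fun D hD a ha => ?_⟩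
  have hconj : ContinuousOn (fun s => (e s)⁻¹ * D * e s) (Set.Icc 0 1) :=
    (hinv.mul continuousOn_const).mul he
  obtain ⟨θ, hθ, hθ2, rfl⟩ := ha
  have step : ∀ s ∈ Set.Icc (0 : ℝ) 1, ∀ s' ∈ Set.Icc (0 : ℝ) 1, s ≤ s' → s' - s < δ →
      |θ s' - θ s| ≤ C := by
    intro s hs s' hs' hss hd
    have hsub : ∀ x ∈ Set.Icc 0 (s' - s), s + x ∈ Set.Icc (0 : ℝ) 1 := fun x hx =>
      ⟨by linarith [hs.1, hx.1], by linarith [hs'.2, hx.2]⟩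
    let g : ℝ → Mat := fun x => (e s)⁻¹ * e (s + x)
    have hg : ∀ x ∈ Set.Icc 0 (s' - s), g x ∈ Metric.ball (1 : Mat) ε := fun x hx =>
      hclose' s hs _ (hsub x hx) (by
        rw [add_sub_cancel_left, abs_of_nonneg hx.1]; linarith [hx.2])
    have hgc : ContinuousOn g (Set.Icc 0 (s' - s)) :=
      continuousOn_const.mul (he.comp (by fun_prop) hsub)
    set X := (e s)⁻¹ * D * e s with hX
    have hXS : X ∈ Sp := hD s hs
    have htm : ∀ τ ∈ Set.Icc (0 : ℝ) 1, ∀ x ∈ Set.Icc 0 (s' - s),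
        IsTame (1 + τ • (g x - 1)) := fun τ hτ x hx => htame _ (by
      have := (convex_ball (1 : Mat) ε).add_smul_sub_mem (Metric.mem_ball_self hε) (hg x hx) hτ
      exact this)
    have hgX : ∀ x ∈ Set.Icc 0 (s' - s), (g x)⁻¹ * X * g x
        = (e (s + x))⁻¹ * D * e (s + x) := fun x hx => by
      have h1 : e s * g x = e (s + x) := by
        simp only [g]
        rw [← mul_assoc, mul_nonsing_inv _ (hu s hs), one_mul]
      have h2 : (g x)⁻¹ * (e s)⁻¹ = (e (s + x))⁻¹ := by
        rw [← Matrix.mul_inv_rev, h1]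
      calc (g x)⁻¹ * X * g x = ((g x)⁻¹ * (e s)⁻¹) * D * (e s * g x) := by
            rw [hX]; simp only [mul_assoc]
        _ = _ := by rw [h2, h1]
    have hrot : HasRotation (s' - s) (fun x => (complexPart ((g x)⁻¹ * X * g x)).det)
        (θ s' - θ s) := by
      refine ⟨fun x => θ (s + x), hθ.comp (by fun_prop) hsub, fun x hx => ?_, by simp⟩
      simp only [hgX x hx]
      exact hθ2 _ (hsub x hx)
    have hl0 : (0 : ℝ) ≤ s' - s := by linarith
    have hle := Set.right_mem_Icc.2 hl0
    have hcc : ContinuousOn (fun p : ℝ × ℝ => (complexPart ((1 + p.1 • (g p.2 - 1))⁻¹ * X *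
        (1 + p.1 • (g p.2 - 1)))).det) (Set.Icc 0 1 ×ˢ Set.Icc 0 (s' - s)) := by
      have h1 : ContinuousOn (fun p : ℝ × ℝ => 1 + p.1 • (g p.2 - 1))
          (Set.Icc 0 1 ×ˢ Set.Icc 0 (s' - s)) :=
        continuousOn_const.add (continuousOn_fst.smul
          ((hgc.comp continuousOn_snd fun p hp => hp.2).sub continuousOn_const))
      exact continuousOn_det_complexPart (((continuousOn_matrix_inv h1 fun p hp =>
        (htm _ hp.1 _ hp.2).isUnit_det).mul continuousOn_const).mul h1)
    have hne : ∀ τ ∈ Set.Icc (0 : ℝ) 1, ∀ x ∈ Set.Icc 0 (s' - s),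
        (complexPart ((1 + τ • (g x - 1))⁻¹ * X * (1 + τ • (g x - 1)))).det ≠ 0 :=
      fun τ hτ x hx => (htm τ hτ x hx).det_ne_zero hXS
    obtain ⟨b₁, hb₁⟩ := exists_hasRotation zero_le_one (fun τ : ℝ =>
      (complexPart ((1 + τ • (g (s' - s) - 1))⁻¹ * X * (1 + τ • (g (s' - s) - 1)))).det)
      (hcc.comp (f := fun τ : ℝ => (τ, s' - s)) (by fun_prop) fun τ hτ => ⟨hτ, hle⟩)
      (fun τ hτ => hne τ hτ _ hle)
    have hX0 := det_complexPart_ne_zero hXS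
    have hconst : ∀ S, HasRotation S (fun _ => (complexPart X).det) 0 := fun S =>
      ⟨fun _ => ((complexPart X).det).arg, continuousOn_const, fun t _ =>
        ⟨hX0, (Complex.norm_mul_exp_arg_mul_I _).symm⟩, by ring⟩
    have hg0 : g 0 = 1 := by simp [g, nonsing_inv_mul _ (hu s hs)]
    -- Contract the piece of path to its initial point along the segments `1 + τ (g x - 1)`, which
    -- lie in the tame ball. Two sides of this square are constant, so the rotation along the path
    -- equals that along the segment at its endpoint.
    have hsq := HasRotation.square zero_le_one hl0 hcc hne
      ((hconst _).congr fun x _ => by simp) (hrot.congr fun x _ => by simp)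
      ((hconst _).congr fun x _ => by simp [hg0]) hb₁
    rw [sub_zero, sub_zero] at hsq
    rw [hsq]
    exact rotation_conj_segment hXS (fun τ hτ => htm τ hτ _ hle) hb₁
  have hmem : ∀ j : ℕ, j ≤ N → (j : ℝ) / N ∈ Set.Icc (0 : ℝ) 1 := fun j hj =>
    ⟨by positivity, (div_le_one hN0).2 (by exact_mod_cast hj)⟩
  have ind : ∀ j : ℕ, j ≤ N → |θ ((j : ℝ) / N) - θ 0| ≤ j * C := by
    intro j
    induction j with
    | zero => intro _; simp
    | succ j ih =>
      intro hj
      have h1 := ih (by omega)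
      have hdiff : ((j + 1 : ℕ) : ℝ) / N - (j : ℝ) / N = 1 / N := by push_cast; ring
      have h2 := step _ (hmem j (by omega)) _ (hmem (j + 1) hj)
        (by have : (0 : ℝ) < 1 / N := by positivity
            linarith) (by rw [hdiff]; exact hNδ)
      calc |θ (((j + 1 : ℕ) : ℝ) / N) - θ 0|
          ≤ |θ (((j + 1 : ℕ) : ℝ) / N) - θ ((j : ℝ) / N)| + |θ ((j : ℝ) / N) - θ 0| :=
            abs_sub_le _ _ _
        _ ≤ ((j + 1 : ℕ) : ℝ) * C := by
          rw [show ((j + 1 : ℕ) : ℝ) * C = j * C + C by push_cast; ring]; linarith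
  have := ind N le_rfl
  rwa [div_self hN0.ne'] at this

theorem isUnit_det_of_gram {g G : Mat} (h : gᵀ * G * g = J (Fin n) ℝ) : IsUnit g.det := by
  have h1 := congrArg det h
  rw [det_mul] at h1
  have h2 := isUnit_det_J (Fin n) ℝ
  rw [← h1] at h2
  exact isUnit_of_mul_isUnit_right h2

theorem gram_conj_mem {g h G Y : Mat} (hg : gᵀ * G * g = J (Fin n) ℝ)
    (hh : hᵀ * G * h = J (Fin n) ℝ) (hY : Yᵀ * G * Y = G) : g⁻¹ * Y * h ∈ Sp := by
  rw [SymplecticGroup.mem_iff']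
  have hu := isUnit_det_of_gram hg
  have h1 : g * (g⁻¹ * Y * h) = Y * h := by
    rw [← mul_assoc, ← mul_assoc, mul_nonsing_inv _ hu, one_mul]
  calc (g⁻¹ * Y * h)ᵀ * J (Fin n) ℝ * (g⁻¹ * Y * h)
      = (g * (g⁻¹ * Y * h))ᵀ * G * (g * (g⁻¹ * Y * h)) := by
        rw [← hg, transpose_mul g]; simp only [mul_assoc]
    _ = hᵀ * (Yᵀ * G * Y) * h := by rw [h1, transpose_mul]; simp only [mul_assoc]
    _ = _ := by rw [hY, hh]

theorem conj_pow_matrix {g Y : Mat} (hu : IsUnit g.det) (k : ℕ) :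
    (g⁻¹ * Y * g) ^ k = g⁻¹ * Y ^ k * g := by
  induction k with
  | zero => simp [nonsing_inv_mul _ hu]
  | succ k ih =>
    rw [pow_succ, ih, pow_succ]
    simp only [mul_assoc]
    rw [← mul_assoc g g⁻¹, mul_nonsing_inv _ hu, one_mul]

/-- Invariance of the mean index when the symplectic frames `g s t` move with `s` and a unipotent
factor `1 + t N` is removed; the transport itself is constant in the underlying coordinates. -/
theorem HasMeanIndex.of_frame_homotopy {T : ℝ} (hT : 0 ≤ T) {G : ℝ → Mat} {g : ℝ → ℝ → Mat}
    (hg : ContinuousOn (fun p : ℝ × ℝ => g p.1 p.2) (Set.Icc 0 1 ×ˢ Set.Icc 0 T))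
    (hgram : ∀ s ∈ Set.Icc (0 : ℝ) 1, ∀ t ∈ Set.Icc 0 T, (g s t)ᵀ * G s * g s t = J (Fin n) ℝ)
    {N D : Mat} (hN : ∀ s ∈ Set.Icc (0 : ℝ) 1, ∀ x : ℝ, (1 + x • N)ᵀ * G s * (1 + x • N) = G s)
    (hND : N * D = D * N) (hN2 : N * N = 0)
    (hper : ∀ s ∈ Set.Icc (0 : ℝ) 1, g s 0 = D * g s T) {d : ℝ}
    (h : HasMeanIndex T (fun t => (g 1 t)⁻¹ * (1 + t • N) * g 1 0) d) :
    HasMeanIndex T (fun t => (g 0 t)⁻¹ * g 0 0) d := by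
  have s0 : (0 : ℝ) ∈ Set.Icc (0 : ℝ) 1 := by simp
  have s1 : (1 : ℝ) ∈ Set.Icc (0 : ℝ) 1 := by simp
  have m0 := Set.left_mem_Icc.2 hT
  have m1 := Set.right_mem_Icc.2 hT
  have hun : ∀ s ∈ Set.Icc (0 : ℝ) 1, ∀ t ∈ Set.Icc 0 T, IsUnit (g s t).det :=
    fun s hs t ht => isUnit_det_of_gram (hgram s hs t ht)
  have hgi : ContinuousOn (fun p : ℝ × ℝ => (g p.1 p.2)⁻¹) (Set.Icc 0 1 ×ˢ Set.Icc 0 T) :=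
    continuousOn_matrix_inv hg fun p hp => hun _ hp.1 _ hp.2
  have hend : ∀ s ∈ Set.Icc (0 : ℝ) 1, (g s T)⁻¹ = (g s 0)⁻¹ * D := fun s hs => by
    have hDu : IsUnit D.det := by
      have := hun s hs 0 m0
      rw [hper s hs, det_mul] at this
      exact isUnit_of_mul_isUnit_left this
    rw [hper s hs, Matrix.mul_inv_rev, mul_assoc, nonsing_inv_mul _ hDu, mul_one]
  have constrot : ∀ S : ℝ, HasRotation S (fun _ => (complexPart (1 : Mat)).det) 0 := fun S =>
    ⟨fun _ => 0, continuousOn_const, fun t _ => by simp [complexPart_one], by ring⟩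
  -- move the frames
  have st1 : HasMeanIndex T (fun t => (g 0 t)⁻¹ * (1 + t • N) * g 0 0) d := by
    have hce : ContinuousOn (fun s => g s 0) (Set.Icc 0 1) :=
      hg.comp (f := fun s : ℝ => (s, (0 : ℝ))) (by fun_prop) fun s hs => ⟨hs, m0⟩
    obtain ⟨K, hK⟩ := rotation_conj_bound hce fun s hs => hun s hs 0 m0
    have hc : ContinuousOn (fun p : ℝ × ℝ => (g p.1 p.2)⁻¹ * (1 + p.2 • N) * g p.1 0)
        (Set.Icc 0 1 ×ˢ Set.Icc 0 T) :=
      (hgi.mul (by fun_prop)).mul (hce.comp continuousOn_fst fun p hp => hp.1)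
    have hSp : ∀ s ∈ Set.Icc (0 : ℝ) 1, ∀ t ∈ Set.Icc 0 T,
        (g s t)⁻¹ * (1 + t • N) * g s 0 ∈ Sp := fun s hs t ht =>
      gram_conj_mem (hgram s hs t ht) (hgram s hs 0 m0) (hN s hs t)
    refine h.of_bounded hT (hc.comp (f := fun t : ℝ => ((0 : ℝ), t)) (by fun_prop)
      fun t ht => ⟨s0, ht⟩) (fun t ht => hSp 0 s0 t ht) K fun k a b ha hb => ?_
    -- By the closing relation the transport at `t = T` is the conjugate by `g s 0` of a matrix `D'`
    -- independent of `s`. Its powers are conjugates of `D' ^ k`, so the bound of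
    -- `rotation_conj_bound` holds for all `k` at once.
    set D' := D * (1 + T • N) with hD'
    have hT' : ∀ s ∈ Set.Icc (0 : ℝ) 1, ((g s T)⁻¹ * (1 + T • N) * g s 0) ^ k
        = (g s 0)⁻¹ * D' ^ k * g s 0 := fun s hs => by
      rw [hend s hs, mul_assoc (g s 0)⁻¹, ← hD', conj_pow_matrix (hun s hs 0 m0)]
    have hD'S : ∀ s ∈ Set.Icc (0 : ℝ) 1, (g s 0)⁻¹ * D' ^ k * g s 0 ∈ Sp := fun s hs => by
      rw [← hT' s hs]
      exact Submonoid.pow_mem _ (hSp s hs T m1) k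
    obtain ⟨x, hx⟩ := exists_rotation_path zero_le_one (A := fun s => (g s 0)⁻¹ * D' ^ k * g s 0)
      (((continuousOn_matrix_inv hce fun s hs => hun s hs 0 m0).mul continuousOn_const).mul hce)
      hD'S
    have := HasRotation.square zero_le_one hT (c := fun s t =>
      (complexPart (((g s t)⁻¹ * (1 + t • N) * g s 0) ^ k)).det)
      (continuousOn_det_complexPart (hc.pow k))
      (fun s hs t ht => det_complexPart_ne_zero (Submonoid.pow_mem _ (hSp s hs t ht) k))
      hb ha ((constrot 1).congr fun s hs => by simp [nonsing_inv_mul _ (hun s hs 0 m0)])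
      (hx.congr fun s hs => by rw [hT' s hs])
    rw [sub_zero] at this
    rw [abs_sub_comm, this]
    exact hK _ hD'S x hx
  -- remove the unipotent factor
  have hg0 : ContinuousOn (g 0) (Set.Icc 0 T) :=
    hg.comp (f := fun t : ℝ => ((0 : ℝ), t)) (by fun_prop) fun t ht => ⟨s0, ht⟩
  have hgi0 := continuousOn_matrix_inv hg0 fun t ht => hun 0 s0 t ht
  have hc : ContinuousOn (fun p : ℝ × ℝ => (g 0 p.2)⁻¹ * (1 + (p.1 * p.2) • N) * g 0 0)
      (Set.Icc 0 1 ×ˢ Set.Icc 0 T) :=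
    ((hgi0.comp continuousOn_snd fun p hp => hp.2).mul (by fun_prop)).mul continuousOn_const
  have hSp : ∀ t ∈ Set.Icc 0 T, ∀ x : ℝ, (g 0 t)⁻¹ * (1 + x • N) * g 0 0 ∈ Sp := fun t ht x =>
    gram_conj_mem (hgram 0 s0 t ht) (hgram 0 s0 0 m0) (hN 0 s0 x)
  have hSp0 : ∀ t ∈ Set.Icc 0 T, (g 0 t)⁻¹ * g 0 0 ∈ Sp := fun t ht => by
    simpa using hSp t ht 0
  refine st1.of_bounded hT (hgi0.mul continuousOn_const) hSp0 (n * (2 * Real.pi))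
    fun k a b ha hb => ?_
  -- Since `N` commutes with `D` and `N² = 0`, every power is affine in `x`. This keeps the
  -- determinant of degree at most `n`, whatever the exponent.
  have hpow : ∀ (j : ℕ) (x : ℝ), (D * (1 + x • N)) ^ j = D ^ j * (1 + (j * x) • N) := by
    intro j x
    induction j with
    | zero => simp
    | succ j ih =>
      have hcomm : (1 + (j * x) • N) * D = D * (1 + (j * x) • N) := by
        rw [add_mul, mul_add, one_mul, mul_one, Matrix.smul_mul, Matrix.mul_smul, hND]
      have hunip : (1 + (j * x) • N) * (1 + x • N) = 1 + ((j + 1 : ℕ) * x) • N := by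
        rw [mul_add, mul_one, add_mul, one_mul, Matrix.smul_mul, Matrix.mul_smul, hN2, smul_zero, smul_zero,
          add_zero, add_assoc, ← add_smul]
        congr 2; push_cast; ring
      rw [pow_succ, ih, pow_succ]
      calc D ^ j * (1 + (j * x) • N) * (D * (1 + x • N))
          = D ^ j * ((1 + (j * x) • N) * D) * (1 + x • N) := by simp only [mul_assoc]
        _ = D ^ j * D * ((1 + (j * x) • N) * (1 + x • N)) := by
            rw [hcomm]; simp only [mul_assoc]
        _ = _ := by rw [hunip]
  have hend' : ∀ x : ℝ, ((g 0 T)⁻¹ * (1 + (x * T) • N) * g 0 0) ^ k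
      = (g 0 0)⁻¹ * (D ^ k * (1 + (k * (x * T)) • N)) * g 0 0 := fun x => by
    rw [hend 0 s0, mul_assoc (g 0 0)⁻¹, conj_pow_matrix (hun 0 s0 0 m0), hpow]
  let M₀ := complexPart ((g 0 0)⁻¹ * D ^ k * g 0 0)
  let M₁ := complexPart ((g 0 0)⁻¹ * (D ^ k * ((k * T) • N)) * g 0 0)
  have haff : ∀ x : ℝ, complexPart (((g 0 T)⁻¹ * (1 + (x * T) • N) * g 0 0) ^ k)
      = M₀ + (x : ℂ) • M₁ := fun x => by
    rw [hend', ← complexPart_smul, ← complexPart_add]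
    congr 1
    rw [show (k * (x * T) : ℝ) = x * (k * T) by ring, mul_smul x (k * T : ℝ) N, mul_add, mul_one, mul_add, add_mul]
    simp only [Matrix.mul_smul, Matrix.smul_mul, smul_smul]
  have hne : ∀ x ∈ Set.Icc (0 : ℝ) 1, (M₀ + (x : ℂ) • M₁).det ≠ 0 := fun x hx => by
    rw [← haff]
    exact det_complexPart_ne_zero (Submonoid.pow_mem _ (hSp T m1 _) k)
  obtain ⟨y, hy⟩ := exists_hasRotation zero_le_one (fun x : ℝ => (M₀ + (x : ℂ) • M₁).det)
    (by
      have hr : Continuous fun q : ℝ => (q : ℂ) := Complex.continuous_ofReal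
      refine Continuous.continuousOn (Continuous.matrix_det ?_)
      fun_prop) hne
  have := HasRotation.square zero_le_one hT (c := fun x t =>
      (complexPart (((g 0 t)⁻¹ * (1 + (x * t) • N) * g 0 0) ^ k)).det)
      (continuousOn_det_complexPart (hc.pow k))
      (fun s _ t ht => det_complexPart_ne_zero (Submonoid.pow_mem _ (hSp t ht _) k))
      (hb.congr fun t _ => by simp) (ha.congr fun t _ => by simp)
      ((constrot 1).congr fun s _ => by simp [nonsing_inv_mul _ (hun 0 s0 0 m0)])
      (hy.congr fun x _ => by rw [haff])
  rw [sub_zero] at this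
  rw [abs_sub_comm, this]
  simpa using HasRotation.bound_affine zero_le_one M₀ M₁ hne hy

end Conjugation

end CoisotropicIndex

namespace CoisotropicIndex

/-! ### Independence of the splitting and of the leaf frame. -/

section Splitting

open Matrix

variable {n k : ℕ}

local notation "Mat" => Matrix (Fin n ⊕ Fin n) (Fin n ⊕ Fin n) ℝ
local notation "Sp" => symplecticGroup (Fin n) ℝ
local notation "Frm" => Matrix (Fin n ⊕ Fin n) (Fin k) ℝ

/-- Real columns in `ℝ^{2n}` seen in `ℂ^n`. -/
noncomputable def complexCols (X : Frm) : Matrix (Fin n) (Fin k) ℂ :=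
  Matrix.of fun i l => (X (.inl i) l : ℂ) + Complex.I * X (.inr i) l

/-- The linear part of real linear forms on `ℂ^n`. -/
noncomputable def rowLin (Y : Matrix (Fin k) (Fin n ⊕ Fin n) ℝ) : Matrix (Fin k) (Fin n) ℂ :=
  Matrix.of fun l j => ((Y l (.inl j) : ℂ) - Complex.I * Y l (.inr j)) / 2

/-- The antilinear part of real linear forms on `ℂ^n`. -/
noncomputable def rowAnti (Y : Matrix (Fin k) (Fin n ⊕ Fin n) ℝ) : Matrix (Fin k) (Fin n) ℂ :=
  Matrix.of fun l j => ((Y l (.inl j) : ℂ) + Complex.I * Y l (.inr j)) / 2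

theorem complexPart_mul_rows (X : Frm) (Y : Matrix (Fin k) (Fin n ⊕ Fin n) ℝ) :
    complexPart (X * Y) = complexCols X * rowLin Y := by
  ext i j
  simp only [complexPart, complexCols, rowLin, of_apply, mul_apply, ← Finset.sum_add_distrib,
    ← Finset.sum_sub_distrib, Complex.ofReal_sum, Finset.mul_sum, Finset.sum_div]
  refine Finset.sum_congr rfl fun x _ => ?_
  push_cast
  linear_combination (1 / 2 : ℂ) * X (.inr i) x * Y x (.inr j) * Complex.I_mul_I

theorem antiPart_mul_rows (X : Frm) (Y : Matrix (Fin k) (Fin n ⊕ Fin n) ℝ) :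
    antiPart (X * Y) = complexCols X * rowAnti Y := by
  ext i j
  simp only [antiPart, complexCols, rowAnti, of_apply, mul_apply, ← Finset.sum_add_distrib,
    ← Finset.sum_sub_distrib, Complex.ofReal_sum, Finset.mul_sum, Finset.sum_div]
  refine Finset.sum_congr rfl fun x _ => ?_
  push_cast
  linear_combination (-1 / 2 : ℂ) * X (.inr i) x * Y x (.inr j) * Complex.I_mul_I

theorem antiPart_add (A B : Mat) : antiPart (A + B) = antiPart A + antiPart B := by
  ext i j; simp [antiPart]; ring

theorem rowLin_transpose_J (X : Frm) :
    rowLin (Xᵀ * J (Fin n) ℝ) = (Complex.I / 2) • (complexCols X)ᴴ := by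
  ext l j
  simp [rowLin, complexCols, J, mul_apply, Fintype.sum_sum_type, one_apply, conjTranspose_apply]
  linear_combination (1 / 2 : ℂ) * X (.inr j) l * Complex.I_mul_I

theorem rowAnti_transpose_J (X : Frm) :
    rowAnti (Xᵀ * J (Fin n) ℝ) = (-(Complex.I / 2)) • (complexCols X)ᵀ := by
  ext l j
  simp [rowAnti, complexCols, J, mul_apply, Fintype.sum_sum_type, one_apply]
  linear_combination (1 / 2 : ℂ) * X (.inr j) l * Complex.I_mul_I

theorem rowLin_mul_cols (Y : Matrix (Fin k) (Fin n ⊕ Fin n) ℝ) (X : Frm) :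
    rowLin Y * complexCols X + rowAnti Y * (complexCols X).map (starRingEnd ℂ)
      = (Y * X).map Complex.ofReal := by
  ext l j
  simp only [rowLin, rowAnti, complexCols, of_apply, mul_apply, Matrix.add_apply, map_apply,
    Fintype.sum_sum_type, ← Finset.sum_add_distrib, Complex.ofReal_sum, map_add, map_mul,
    Complex.conj_I, Complex.conj_ofReal]
  push_cast
  refine Finset.sum_congr rfl fun x _ => ?_
  linear_combination (-1 : ℂ) * Y l (.inr x) * X (.inr x) j * Complex.I_mul_I

/-- The imaginary part of the Hermitian Gram matrix is the symplectic Gram matrix, which vanishes by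
isotropy. -/
theorem conjTranspose_mul_cols {X : Frm} (hX : Xᵀ * J (Fin n) ℝ * X = 0) :
    (complexCols X)ᴴ * complexCols X = (Xᵀ * X).map Complex.ofReal := by
  ext l j
  have h := congrFun (congrFun hX l) j
  simp only [J, mul_apply, Fintype.sum_sum_type, transpose_apply, fromBlocks_apply₁₁,
    fromBlocks_apply₁₂, fromBlocks_apply₂₁, fromBlocks_apply₂₂, Matrix.zero_apply, Matrix.neg_apply, one_apply,
    mul_zero, Finset.sum_const_zero, zero_add, add_zero, mul_ite, mul_one, mul_neg,
    Finset.sum_ite_eq', Finset.mem_univ, if_true, Finset.sum_neg_distrib,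
    neg_mul] at h
  have h' : (∑ x, (X (.inr x) l : ℂ) * X (.inl x) j) - ∑ x, (X (.inl x) l : ℂ) * X (.inr x) j = 0 := by
    rw [← sub_eq_add_neg] at h
    exact_mod_cast h
  simp only [complexCols, of_apply, mul_apply, map_apply, conjTranspose_apply, transpose_apply,
    Fintype.sum_sum_type, Complex.ofReal_add, Complex.ofReal_sum, Complex.ofReal_mul]
  rw [← Finset.sum_sub_distrib] at h'
  rw [← sub_eq_zero, ← Finset.sum_add_distrib, ← Finset.sum_sub_distrib]
  rw [← mul_zero (-Complex.I), ← h', Finset.mul_sum]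
  refine Finset.sum_congr rfl fun x _ => ?_
  simp
  linear_combination (-1 : ℂ) * X (.inr x) l * X (.inr x) j * Complex.I_mul_I

/-- The graph of this matrix over `ℂ^n` is a nonnegative Lagrangian subspace of the
complexification which contains the columns of the isotropic frame `X`. -/
noncomputable def isotropicGraph (X : Frm) : Matrix (Fin n) (Fin n) ℂ :=
  (complexCols X).map (starRingEnd ℂ) * ((Xᵀ * X)⁻¹).map Complex.ofReal * (complexCols X)ᴴ

theorem map_ofReal_inv_mul {X : Frm} (hu : IsUnit (Xᵀ * X).det) :
    ((Xᵀ * X)⁻¹).map Complex.ofReal * (Xᵀ * X).map Complex.ofReal = 1 := by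
  have h : ((Xᵀ * X)⁻¹ * (Xᵀ * X)).map Complex.ofReal
      = ((Xᵀ * X)⁻¹).map Complex.ofReal * (Xᵀ * X).map Complex.ofReal :=
    Matrix.map_mul (f := Complex.ofRealHom)
  rw [← h, nonsing_inv_mul _ hu]
  exact Matrix.map_one _ (by simp) (by simp)

/-- In the complexification the real vectors are the pairs `(z, z̄)`. Hence the graph contains the
complexified span of `X`, on which a map fixing that span acts by a real matrix. -/
theorem isotropicGraph_mul {X : Frm} (hX : Xᵀ * J (Fin n) ℝ * X = 0)
    (hu : IsUnit (Xᵀ * X).det) :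
    isotropicGraph X * complexCols X = (complexCols X).map (starRingEnd ℂ) := by
  rw [isotropicGraph, Matrix.mul_assoc, conjTranspose_mul_cols hX, Matrix.mul_assoc,
    map_ofReal_inv_mul hu, Matrix.mul_one]

theorem conj_gram {X : Frm} (hX : Xᵀ * J (Fin n) ℝ * X = 0) :
    (complexCols X)ᵀ * (complexCols X).map (starRingEnd ℂ) = (Xᵀ * X).map Complex.ofReal := by
  have := congrArg (fun M => M.map (starRingEnd ℂ)) (conjTranspose_mul_cols hX)
  simp only [Matrix.map_mul] at this
  convert this using 1
  · congr 1
    ext i j; simp [conjTranspose_apply]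
  · ext i j; simp

theorem transpose_mul_isotropicGraph {X : Frm} (hX : Xᵀ * J (Fin n) ℝ * X = 0)
    (hu : IsUnit (Xᵀ * X).det) :
    (complexCols X)ᵀ * isotropicGraph X = (complexCols X)ᴴ := by
  have hW : (Xᵀ * X).map Complex.ofReal * ((Xᵀ * X)⁻¹).map Complex.ofReal = 1 :=
    mul_eq_one_comm.1 (map_ofReal_inv_mul hu)
  rw [isotropicGraph, Matrix.mul_assoc, ← Matrix.mul_assoc, conj_gram hX, ← Matrix.mul_assoc, hW,
    Matrix.one_mul]

/-- If `β` is the graph map, `βᴴ β` is the orthogonal projection `Z W Zᴴ` onto the complex span of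
the columns, so `β` is a partial isometry. -/
theorem normSqVec_isotropicGraph_le {X : Frm} (hX : Xᵀ * J (Fin n) ℝ * X = 0)
    (hu : IsUnit (Xᵀ * X).det) (v : Fin n → ℂ) :
    normSqVec (isotropicGraph X *ᵥ v) ≤ normSqVec v := by
  set Z := complexCols X with hZ
  set W := ((Xᵀ * X)⁻¹).map Complex.ofReal with hW
  have hWH : Wᴴ = W := by
    have : ((Xᵀ * X)⁻¹)ᵀ = (Xᵀ * X)⁻¹ := by
      rw [transpose_nonsing_inv, transpose_mul, transpose_transpose]
    ext i j
    have h := congrFun (congrFun this i) j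
    simp only [transpose_apply] at h
    simp [hW, conjTranspose_apply, h]
  have hG := map_ofReal_inv_mul hu
  rw [← hW] at hG
  let Pr := Z * W * Zᴴ
  have hPrH : Prᴴ = Pr := by
    simp only [Pr, conjTranspose_mul, conjTranspose_conjTranspose, hWH, Matrix.mul_assoc]
  have hPr2 : Pr * Pr = Pr := by
    simp only [Pr]
    calc Z * W * Zᴴ * (Z * W * Zᴴ) = Z * (W * (Zᴴ * Z)) * W * Zᴴ := by
          simp only [Matrix.mul_assoc]
      _ = _ := by rw [hZ, conjTranspose_mul_cols hX, hG, Matrix.mul_one]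
  have hbb : (isotropicGraph X)ᴴ * isotropicGraph X = Pr := by
    have hc : (Z.map (starRingEnd ℂ))ᴴ = Zᵀ := by
      ext i j; simp [conjTranspose_apply]
    have h1 : (isotropicGraph X)ᴴ = Z * W * Zᵀ := by
      simp only [isotropicGraph, conjTranspose_mul, conjTranspose_conjTranspose]
      rw [← hW, hWH, ← hZ, hc, Matrix.mul_assoc]
    rw [h1, Matrix.mul_assoc, hZ, transpose_mul_isotropicGraph hX hu]
  have e1 : ∀ (M : Matrix (Fin n) (Fin n) ℂ), (normSqVec (M *ᵥ v) : ℂ) = star v ⬝ᵥ ((Mᴴ * M) *ᵥ v) :=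
    fun M => by rw [normSqVec_eq, star_mulVec, ← dotProduct_mulVec, mulVec_mulVec]
  have e2 : (normSqVec v : ℂ) - normSqVec (isotropicGraph X *ᵥ v) = normSqVec ((1 - Pr) *ᵥ v) := by
    rw [e1, e1, hbb, normSqVec_eq, conjTranspose_sub, conjTranspose_one, hPrH, sub_mul, mul_sub,
      mul_sub, hPr2, one_mul, mul_one, one_mul, sub_self, sub_zero, sub_mulVec, one_mulVec,
      dotProduct_sub]
  have e3 : normSqVec v - normSqVec (isotropicGraph X *ᵥ v) = normSqVec ((1 - Pr) *ᵥ v) := by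
    exact_mod_cast e2
  linarith [normSqVec_nonneg ((1 - Pr) *ᵥ v)]

/-- The graph annihilates the linear forms `XᵀJ`, so the summand with `N` disappears. What remains
is `1 + Z K`, with the same determinant as `1 + K Z`; and `K Z` is the real matrix `Y X` because the
graph sends `Z` to its conjugate. -/
theorem det_graph_real {X : Frm} (hX : Xᵀ * J (Fin n) ℝ * X = 0) (hu : IsUnit (Xᵀ * X).det)
    (Y : Matrix (Fin k) (Fin n ⊕ Fin n) ℝ) (N : Frm) {S : Mat}
    (hS : S = 1 + X * Y + N * (Xᵀ * J (Fin n) ℝ)) :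
    (complexPart S + antiPart S * isotropicGraph X).det.im = 0 := by
  set Z := complexCols X with hZ
  set β := isotropicGraph X with hβ
  have hK : complexPart S + antiPart S * β = 1 + Z * (rowLin Y + rowAnti Y * β) := by
    rw [hS, complexPart_add, complexPart_add, antiPart_add, antiPart_add, complexPart_one,
      antiPart_one, complexPart_mul_rows, complexPart_mul_rows, antiPart_mul_rows,
      antiPart_mul_rows, rowLin_transpose_J, rowAnti_transpose_J]
    have h1 := transpose_mul_isotropicGraph hX hu
    rw [← hZ, ← hβ] at h1
    simp only [Matrix.add_mul, Matrix.mul_add, Matrix.mul_assoc, Matrix.smul_mul, Matrix.mul_smul,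
      ← hZ, h1, zero_add]
    simp only [neg_smul]
    abel
  have h2 := isotropicGraph_mul hX hu
  rw [hK, det_one_add_mul_comm, Matrix.add_mul, Matrix.mul_assoc, hβ, hZ, h2, rowLin_mul_cols]
  have h3 : (1 : Matrix (Fin k) (Fin k) ℂ) + (Y * X).map Complex.ofReal
      = (1 + Y * X).map Complex.ofRealHom := by
    ext i j
    by_cases h : i = j <;> simp [one_apply, h]
  rw [h3, ← RingHom.mapMatrix_apply, ← RingHom.map_det]
  simp

/-- A dual frame makes the columns of `X` independent, so their Euclidean Gram matrix is definite.
-/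
theorem isUnit_gram_of_dual {X V : Frm} (h : Vᵀ * J (Fin n) ℝ * X = 1) : IsUnit (Xᵀ * X).det := by
  rw [isUnit_iff_ne_zero]
  intro h0
  obtain ⟨v, hv, hv'⟩ := exists_mulVec_eq_zero_iff.2 h0
  have h1 : (X *ᵥ v) ⬝ᵥ (X *ᵥ v) = 0 := by
    rw [dotProduct_mulVec, ← mulVec_transpose, dotProduct_comm, mulVec_mulVec, hv', dotProduct_zero]
  have h2 := dotProduct_self_eq_zero.1 h1
  apply hv
  rw [← one_mulVec v, ← h, ← mulVec_mulVec, h2, mulVec_zero]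

/-- The relations of a pair of dual isotropic frames. -/
structure IsDualPair (X V : Frm) : Prop where
  iso : Xᵀ * J (Fin n) ℝ * X = 0
  iso' : Vᵀ * J (Fin n) ℝ * V = 0
  dual : Vᵀ * J (Fin n) ℝ * X = 1

theorem IsDualPair.dual' {X V : Frm} (h : IsDualPair X V) : Xᵀ * J (Fin n) ℝ * V = -1 := by
  have := congrArg transpose h.dual
  rw [transpose_mul, transpose_mul, transpose_transpose, J_transpose, transpose_one,
    Matrix.neg_mul, Matrix.mul_neg, ← Matrix.mul_assoc] at this
  rw [← this, neg_neg]

/-- The projection onto the symplectic complement of a pair of dual isotropic frames. -/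
noncomputable def complProj (X V : Frm) : Mat :=
  1 - X * (Vᵀ * J (Fin n) ℝ) + V * (Xᵀ * J (Fin n) ℝ)

/-- The symplectic map which sends one pair of dual isotropic frames to another pair with the same
span of the first frame, and which is the identity on `X^ω / X`. -/
noncomputable def pairMap (X V X' V' : Frm) : Mat :=
  X' * (Vᵀ * J (Fin n) ℝ - V'ᵀ * J (Fin n) ℝ * complProj X V) - V' * (Xᵀ * J (Fin n) ℝ)
    + complProj X V

theorem complProj_left {X V : Frm} (h : IsDualPair X V) :
    Xᵀ * J (Fin n) ℝ * complProj X V = 0 := by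
  simp only [complProj, Matrix.mul_add, Matrix.mul_sub, ← Matrix.mul_assoc, h.iso, h.dual']
  simp

theorem complProj_left' {X V : Frm} (h : IsDualPair X V) :
    Vᵀ * J (Fin n) ℝ * complProj X V = 0 := by
  simp only [complProj, Matrix.mul_add, Matrix.mul_sub, ← Matrix.mul_assoc, h.iso', h.dual]
  simp

/-- The symplectic form in block coordinates. -/
theorem block_form {X V : Frm} (h : IsDualPair X V) (a b : Matrix (Fin k) (Fin n ⊕ Fin n) ℝ)
    (R : Mat) (hR : Xᵀ * J (Fin n) ℝ * R = 0) :
    (X * a + V * b + R)ᵀ * J (Fin n) ℝ * (X * a + V * b + R)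
      = bᵀ * a - aᵀ * b + bᵀ * (Vᵀ * J (Fin n) ℝ * R) - (Vᵀ * J (Fin n) ℝ * R)ᵀ * b
        + Rᵀ * J (Fin n) ℝ * R := by
  have hR' : Rᵀ * J (Fin n) ℝ * X = 0 := by
    have := congrArg transpose hR
    rw [transpose_mul, transpose_mul, transpose_transpose, J_transpose, transpose_zero,
      Matrix.neg_mul, Matrix.mul_neg, ← Matrix.mul_assoc, neg_eq_zero] at this
    exact this
  have hV' : (Vᵀ * J (Fin n) ℝ * R)ᵀ = -(Rᵀ * J (Fin n) ℝ * V) := by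
    rw [transpose_mul, transpose_mul, transpose_transpose, J_transpose, Matrix.neg_mul,
      Matrix.mul_neg, ← Matrix.mul_assoc]
  have r1 : ∀ M : Matrix (Fin k) (Fin n ⊕ Fin n) ℝ, Xᵀ * (J (Fin n) ℝ * (X * M)) = 0 := fun M => by
    rw [← Matrix.mul_assoc, ← Matrix.mul_assoc, h.iso, Matrix.zero_mul]
  have r2 : ∀ M : Matrix (Fin k) (Fin n ⊕ Fin n) ℝ, Vᵀ * (J (Fin n) ℝ * (V * M)) = 0 := fun M => by
    rw [← Matrix.mul_assoc, ← Matrix.mul_assoc, h.iso', Matrix.zero_mul]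
  have r3 : ∀ M : Matrix (Fin k) (Fin n ⊕ Fin n) ℝ, Vᵀ * (J (Fin n) ℝ * (X * M)) = M := fun M => by
    rw [← Matrix.mul_assoc, ← Matrix.mul_assoc, h.dual, Matrix.one_mul]
  have r4 : ∀ M : Matrix (Fin k) (Fin n ⊕ Fin n) ℝ, Xᵀ * (J (Fin n) ℝ * (V * M)) = -M := fun M => by
    rw [← Matrix.mul_assoc, ← Matrix.mul_assoc, h.dual', Matrix.neg_mul, Matrix.one_mul]
  have r5 : ∀ M : Matrix (Fin k) (Fin n ⊕ Fin n) ℝ, Rᵀ * (J (Fin n) ℝ * (X * M)) = 0 := fun M => by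
    rw [← Matrix.mul_assoc, ← Matrix.mul_assoc, hR', Matrix.zero_mul]
  have r6 : Xᵀ * (J (Fin n) ℝ * R) = 0 := by rw [← Matrix.mul_assoc, hR]
  rw [hV']
  simp only [transpose_add, transpose_mul, Matrix.add_mul, Matrix.mul_add, Matrix.mul_assoc, r1, r2,
    r3, r4, r5, r6, Matrix.mul_zero, Matrix.mul_neg, Matrix.neg_mul]
  abel

/-- Decompose a vector along `X`, `V` and their symplectic complement, and compare with its image
along `X'`, `V'`. The correction of the `X'`-coordinate cancels the pairing of `V'` with the old
complement, so `block_form` gives the same value for both. -/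
theorem pairMap_mem {X V X' V' : Frm} (h : IsDualPair X V) (h' : IsDualPair X' V')
    (M : Matrix (Fin k) (Fin k) ℝ) (hM : X' = X * M) : pairMap X V X' V' ∈ Sp := by
  rw [SymplecticGroup.mem_iff']
  have hR' : X'ᵀ * J (Fin n) ℝ * complProj X V = 0 := by
    rw [hM, transpose_mul, Matrix.mul_assoc, Matrix.mul_assoc, ← Matrix.mul_assoc Xᵀ,
      complProj_left h, Matrix.mul_zero]
  have e1 := block_form h' (Vᵀ * J (Fin n) ℝ - V'ᵀ * J (Fin n) ℝ * complProj X V)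
    (-(Xᵀ * J (Fin n) ℝ)) (complProj X V) hR'
  have e2 := block_form h (Vᵀ * J (Fin n) ℝ) (-(Xᵀ * J (Fin n) ℝ)) (complProj X V)
    (complProj_left h)
  have hone : X * (Vᵀ * J (Fin n) ℝ) + V * (-(Xᵀ * J (Fin n) ℝ)) + complProj X V = 1 := by
    simp only [complProj, Matrix.mul_neg]; abel
  have hpm : X' * (Vᵀ * J (Fin n) ℝ - V'ᵀ * J (Fin n) ℝ * complProj X V)
      + V' * (-(Xᵀ * J (Fin n) ℝ)) + complProj X V = pairMap X V X' V' := by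
    simp only [pairMap, Matrix.mul_neg]; abel
  rw [hone, complProj_left' h] at e2
  rw [hpm] at e1
  simp only [transpose_one, Matrix.one_mul, Matrix.mul_one, transpose_zero, Matrix.mul_zero,
    Matrix.zero_mul, add_zero, sub_zero] at e2
  refine e1.trans (Eq.trans ?_ e2.symm)
  simp only [transpose_sub, Matrix.mul_sub, Matrix.sub_mul, Matrix.mul_neg]
  abel

/-- The common span turns the map into a perturbation of the identity of the shape treated by
`det_graph_real`. -/
theorem pairMap_eq {X V X' V' : Frm} (M : Matrix (Fin k) (Fin k) ℝ) (hM : X' = X * M) :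
    pairMap X V X' V' = 1 + X * (M * (Vᵀ * J (Fin n) ℝ - V'ᵀ * J (Fin n) ℝ * complProj X V)
      - Vᵀ * J (Fin n) ℝ) + (V - V') * (Xᵀ * J (Fin n) ℝ) := by
  rw [pairMap, hM, Matrix.mul_sub X, ← Matrix.mul_assoc X M, Matrix.sub_mul V]
  generalize X * M * (Vᵀ * J (Fin n) ℝ - V'ᵀ * J (Fin n) ℝ * complProj X V) = Q
  rw [complProj]
  abel

/-- On the frames both sides agree by construction. On the symplectic complement the two transports
differ by a multiple `X₁' * C` of the leaf frame, and pairing with `V₁'` determines `C` as the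
difference of the two correction terms. -/
theorem pairMap_transport {X V X' V' X₁ V₁ X₁' V₁' : Frm} {A A' : Mat} (hA : A ∈ Sp)
    (hA' : A' ∈ Sp) (h : IsDualPair X V) (h₁' : IsDualPair X₁' V₁')
    (hX : A * X = X₁) (hV : A * V = V₁) (hX' : A' * X' = X₁') (hV' : A' * V' = V₁')
    (hE : ∀ v, (Xᵀ * J (Fin n) ℝ) *ᵥ v = 0 → ∃ c, A' *ᵥ v - A *ᵥ v = X₁' *ᵥ c) :
    A' * pairMap X V X' V' = pairMap X₁ V₁ X₁' V₁' * A := by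
  have hAJ := SymplecticGroup.mem_iff'.1 hA
  have hAJ' := SymplecticGroup.mem_iff'.1 hA'
  have hr : ∀ Y : Frm, (A * Y)ᵀ * J (Fin n) ℝ * A = Yᵀ * J (Fin n) ℝ := fun Y => by
    rw [transpose_mul, Matrix.mul_assoc, Matrix.mul_assoc, ← Matrix.mul_assoc Aᵀ, hAJ]
  have hr' : ∀ Y : Frm, (A' * Y)ᵀ * J (Fin n) ℝ * A' = Yᵀ * J (Fin n) ℝ := fun Y => by
    rw [transpose_mul, Matrix.mul_assoc, Matrix.mul_assoc, ← Matrix.mul_assoc A'ᵀ, hAJ']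
  have hR : complProj X₁ V₁ * A = A * complProj X V := by
    rw [complProj, complProj, Matrix.add_mul, Matrix.sub_mul, Matrix.mul_assoc X₁,
      Matrix.mul_assoc V₁, ← hX, ← hV, hr, hr, Matrix.mul_add, Matrix.mul_sub, Matrix.one_mul,
      Matrix.mul_one, Matrix.mul_assoc, Matrix.mul_assoc]
  obtain ⟨C, hC⟩ : ∃ C : Matrix (Fin k) (Fin n ⊕ Fin n) ℝ,
      A' * complProj X V - A * complProj X V = X₁' * C := by
    have : ∀ j, ∃ c, A' *ᵥ (fun i => complProj X V i j) - A *ᵥ (fun i => complProj X V i j)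
        = X₁' *ᵥ c := fun j => hE _ (by
      ext l
      exact congrFun (congrFun (complProj_left h) l) j)
    choose c hc using this
    refine ⟨Matrix.of fun l j => c j l, ?_⟩
    ext i j
    exact congrFun (hc j) i
  have hC2 : C = V'ᵀ * J (Fin n) ℝ * complProj X V - V₁'ᵀ * J (Fin n) ℝ * complProj X₁ V₁ * A := by
    have := congrArg (fun M => V₁'ᵀ * J (Fin n) ℝ * M) hC
    simp only [Matrix.mul_sub] at this
    rw [← Matrix.mul_assoc _ X₁', h₁'.dual, Matrix.one_mul, ← hR, ← Matrix.mul_assoc _ A',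
      ← Matrix.mul_assoc] at this
    rw [← this, ← hV', hr']
  have e1 : A' * complProj X V = A * complProj X V + X₁' * C := by rw [← hC]; abel
  rw [pairMap, pairMap, Matrix.mul_add, Matrix.mul_sub A', ← Matrix.mul_assoc A', hX',
    ← Matrix.mul_assoc A' V', hV', e1, hC2, Matrix.add_mul, Matrix.sub_mul, hR, Matrix.mul_assoc X₁',
    Matrix.sub_mul, Matrix.mul_assoc V₁' _ A, ← hX, hr X, ← hV, hr V, hX, hV, Matrix.mul_sub X₁', Matrix.mul_sub X₁',
    Matrix.mul_sub X₁']
  abel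

theorem continuousOn_isotropicGraph {Y : Type*} [TopologicalSpace Y] {s : Set Y} {X : Y → Frm}
    (hX : ContinuousOn X s) (hu : ∀ t ∈ s, IsUnit ((X t)ᵀ * X t).det) :
    ContinuousOn (fun t => isotropicGraph (X t)) s := by
  have hc : Continuous (complexCols : Frm → Matrix (Fin n) (Fin k) ℂ) := by
    refine continuous_matrix fun i l => ?_
    simp only [complexCols, of_apply]
    fun_prop
  have hZ : ContinuousOn (fun t => complexCols (X t)) s := hc.comp_continuousOn hX
  have hbar : Continuous fun M : Matrix (Fin n) (Fin k) ℂ => M.map (starRingEnd ℂ) :=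
    continuous_id.matrix_map Complex.continuous_conj
  have hre : Continuous fun M : Matrix (Fin k) (Fin k) ℝ => M.map Complex.ofReal :=
    continuous_id.matrix_map Complex.continuous_ofReal
  have hXT : ContinuousOn (fun t => (X t)ᵀ * X t) s :=
    (continuous_id.matrix_transpose.matrix_mul continuous_id).comp_continuousOn hX
  have hst : ContinuousOn (fun t => (complexCols (X t))ᴴ) s :=
    continuous_id.matrix_conjTranspose.comp_continuousOn hZ
  have h1 := (hbar.comp_continuousOn hZ).prodMk
    (hre.comp_continuousOn (continuousOn_matrix_inv hXT hu))
  have h2 : Continuous fun p : (Matrix (Fin n) (Fin k) ℂ × Matrix (Fin k) (Fin k) ℂ) ×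
      Matrix (Fin k) (Fin n) ℂ => p.1.1 * p.1.2 * p.2 :=
    (continuous_fst.fst.matrix_mul continuous_fst.snd).matrix_mul continuous_snd
  exact (h2.comp_continuousOn (h1.prodMk hst)).congr fun t _ => rfl

theorem continuous_pairMap {Y : Type*} [TopologicalSpace Y] {X V X' V' : Y → Frm}
    (hX : Continuous X) (hV : Continuous V) (hX' : Continuous X') (hV' : Continuous V') :
    Continuous fun t => pairMap (X t) (V t) (X' t) (V' t) := by
  have c1 := hX.matrix_transpose.matrix_mul (continuous_const (y := J (Fin n) ℝ))
  have c2 := hV.matrix_transpose.matrix_mul (continuous_const (y := J (Fin n) ℝ))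
  have c3 := hV'.matrix_transpose.matrix_mul (continuous_const (y := J (Fin n) ℝ))
  have c4 : Continuous fun t => complProj (X t) (V t) :=
    (continuous_const.sub (hX.matrix_mul c2)).add (hV.matrix_mul c1)
  exact ((hX'.matrix_mul (c2.sub (c3.matrix_mul c4))).sub (hV'.matrix_mul c1)).add c4

/-- Two adapted transports, given by loops of dual isotropic frames with the same span of the first
frame and with the same action on `X^ω / X`, have the same mean index. -/
theorem HasMeanIndex.change_splitting {T : ℝ} (hT : 0 ≤ T) {X V X' V' : ℝ → Frm}
    (hX : ContinuousOn X (Set.Icc 0 T)) (hV : ContinuousOn V (Set.Icc 0 T))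
    (hX' : ContinuousOn X' (Set.Icc 0 T)) (hV' : ContinuousOn V' (Set.Icc 0 T))
    (lX : X T = X 0) (lV : V T = V 0) (lX' : X' T = X' 0) (lV' : V' T = V' 0)
    (h : ∀ t ∈ Set.Icc 0 T, IsDualPair (X t) (V t))
    (h' : ∀ t ∈ Set.Icc 0 T, IsDualPair (X' t) (V' t))
    (hspan : ∀ t ∈ Set.Icc 0 T, ∃ M : Matrix (Fin k) (Fin k) ℝ, X' t = X t * M)
    {A A' : ℝ → Mat} {d : ℝ} (hA : HasMeanIndex T A d) (hA0 : A 0 = 1)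
    (hA' : ∀ t ∈ Set.Icc 0 T, A' t ∈ Sp)
    (tX : ∀ t ∈ Set.Icc 0 T, A t * X 0 = X t) (tV : ∀ t ∈ Set.Icc 0 T, A t * V 0 = V t)
    (tX' : ∀ t ∈ Set.Icc 0 T, A' t * X' 0 = X' t) (tV' : ∀ t ∈ Set.Icc 0 T, A' t * V' 0 = V' t)
    (hE : ∀ t ∈ Set.Icc 0 T, ∀ v, ((X 0)ᵀ * J (Fin n) ℝ) *ᵥ v = 0 →
      ∃ c, A' t *ᵥ v - A t *ᵥ v = X' t *ᵥ c) :
    HasMeanIndex T A' d := by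
  have m0 := Set.left_mem_Icc.2 hT
  have m1 := Set.right_mem_Icc.2 hT
  let S : ℝ → Mat := fun t => pairMap (X t) (V t) (X' t) (V' t)
  have hSc : ContinuousOn S (Set.Icc 0 T) := by
    rw [continuousOn_iff_continuous_domRestrict] at *
    exact continuous_pairMap hX hV hX' hV'
  have hSS : ∀ t ∈ Set.Icc 0 T, S t ∈ Sp := fun t ht => by
    obtain ⟨M, hM⟩ := hspan t ht
    exact pairMap_mem (h t ht) (h' t ht) M hM
  have hSl : S T = S 0 := by simp only [S, lX, lV, lX', lV']
  have hu : ∀ t ∈ Set.Icc 0 T, IsUnit ((X t)ᵀ * X t).det := fun t ht =>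
    isUnit_gram_of_dual (h t ht).dual
  have hβ := continuousOn_isotropicGraph hX hu
  -- Deform `complexPart S` to the determinant on the graph of `isotropicGraph X`, which is real.
  -- The graph is a loop as well, so the two vertical sides of the homotopy cancel.
  have hrot : HasRotation T (fun t => (complexPart (S t)).det) 0 := by
    obtain ⟨a, ha⟩ := exists_rotation_path hT hSc hSS
    have hcont : ContinuousOn (fun p : ℝ × ℝ => (complexPart (S p.2) + (p.1 : ℂ) •
        (antiPart (S p.2) * isotropicGraph (X p.2))).det) (Set.Icc 0 1 ×ˢ Set.Icc 0 T) := by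
      have h2 : ContinuousOn (fun p : ℝ × ℝ => S p.2) (Set.Icc 0 1 ×ˢ Set.Icc 0 T) :=
        hSc.comp continuousOn_snd fun p hp => hp.2
      have h3 : ContinuousOn (fun p : ℝ × ℝ => isotropicGraph (X p.2))
          (Set.Icc 0 1 ×ˢ Set.Icc 0 T) := hβ.comp continuousOn_snd fun p hp => hp.2
      have hr : ContinuousOn (fun p : ℝ × ℝ => (p.1 : ℂ)) (Set.Icc 0 1 ×ˢ Set.Icc 0 T) :=
        (Complex.continuous_ofReal.comp continuous_fst).continuousOn
      exact (continuous_id.matrix_det).comp_continuousOn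
        ((continuous_complexPart.comp_continuousOn h2).add
          (hr.smul ((continuous_antiPart.comp_continuousOn h2).mul h3)))
    have hne : ∀ τ ∈ Set.Icc (0 : ℝ) 1, ∀ t ∈ Set.Icc 0 T, (complexPart (S t) + (τ : ℂ) •
        (antiPart (S t) * isotropicGraph (X t))).det ≠ 0 := fun τ hτ t ht =>
      det_graph_ne_zero (hSS t ht) (normSqVec_isotropicGraph_le (h t ht).iso (hu t ht)) hτ
    have s1 : (1 : ℝ) ∈ Set.Icc (0 : ℝ) 1 := by simp
    obtain ⟨b, hb⟩ := exists_hasRotation hT (fun t => (complexPart (S t) + ((1 : ℝ) : ℂ) •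
        (antiPart (S t) * isotropicGraph (X t))).det)
      (hcont.comp (f := fun t : ℝ => ((1 : ℝ), t)) (by fun_prop) fun t ht => ⟨s1, ht⟩)
      (hne 1 s1)
    have hb0 : b = 0 := hb.eq_zero_of_real hT fun t ht => by
      obtain ⟨M, hM⟩ := hspan t ht
      have := det_graph_real (h t ht).iso (hu t ht) _ _ (pairMap_eq (V := V t) (V' := V' t) M hM)
      simpa [S] using this
    obtain ⟨x, hx⟩ := exists_hasRotation zero_le_one (fun τ : ℝ => (complexPart (S 0) + (τ : ℂ) •
        (antiPart (S 0) * isotropicGraph (X 0))).det)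
      (hcont.comp (f := fun τ : ℝ => (τ, (0 : ℝ))) (by fun_prop) fun t ht => ⟨ht, m0⟩)
      (fun τ hτ => hne τ hτ 0 m0)
    have := HasRotation.square zero_le_one hT hcont hne (ha.congr fun t _ => by simp) hb hx
      (by rw [hSl, lX]; exact hx)
    have ha0 : a = 0 := by linarith
    rwa [ha0] at ha
  have := hA.loop_change hT hA0 hSc hSS hSl hrot
  refine this.congr fun t ht => ?_
  -- Thus `A' t = S t * A t * (S 0)⁻¹`, which is the change covered by `HasMeanIndex.loop_change`.
  have htr := pairMap_transport (hA.2.1 t ht) (hA' t ht) (h 0 m0) (h' t ht) (tX t ht) (tV t ht)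
    (tX' t ht) (tV' t ht) (hE t ht)
  have : A' t * S 0 = S t * A t := htr
  rw [← this, mul_assoc, symplectic_mul_inv_cancel (hSS 0 m0), mul_one]

end Splitting

end CoisotropicIndex

namespace CoisotropicIndex

/-! ### Tangent vectors and forms read in charts. -/

section Tangent

variable {E : Type*} [NormedAddCommGroup E] [NormedSpace ℝ E]
  {H : Type*} [TopologicalSpace H] {I : ModelWithCorners ℝ E H}
  {M : Type*} [TopologicalSpace M] [ChartedSpace H M] [IsManifold I 1 M]
  {Y : Type*} [TopologicalSpace Y]

/-- The derivative at `x` of the chart at `x₀`. -/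
noncomputable def chartDeriv (I : ModelWithCorners ℝ E H) {M : Type*} [TopologicalSpace M]
    [ChartedSpace H M] (x₀ x : M) : TangentSpace I x →L[ℝ] E :=
  mfderiv I 𝓘(ℝ, E) (extChartAt I x₀) x

theorem chartDeriv_self (x : M) (v : TangentSpace I x) : chartDeriv I x x v = v :=
  congrArg (fun L : E →L[ℝ] E => L v) (mfderiv_extChartAt_self (I := I) (x := x))

theorem chartDeriv_eq {x₀ x : M} (hx : x ∈ (chartAt H x₀).source) (v : TangentSpace I x) :
    chartDeriv I x₀ x v = (trivializationAt E (TangentSpace I) x₀ ⟨x, v⟩).2 := by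
  rw [← Bundle.Trivialization.continuousLinearMapAt_apply_of_mem (R := ℝ) _ (by simpa using hx),
    TangentBundle.continuousLinearMapAt_trivializationAt hx]
  rfl

/-- Reduces continuity in the tangent bundle to continuity of a vector-valued map in one chart, of
which the point need not be the centre. -/
theorem continuousWithinAt_tangent_iff {u : Y → M} {v : ∀ y, TangentSpace I (u y)} {s : Set Y}
    {y₀ : Y} (hu : ContinuousWithinAt u s y₀) {x₀ : M} (h₀ : u y₀ ∈ (chartAt H x₀).source) :
    ContinuousWithinAt (fun y => (⟨u y, v y⟩ : TangentBundle I M)) s y₀ ↔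
      ContinuousWithinAt (fun y => chartDeriv I x₀ (u y) (v y)) s y₀ := by
  have h1 := (trivializationAt E (TangentSpace I) x₀).tendsto_nhds_iff
    (f := fun y => (⟨u y, v y⟩ : TangentBundle I M)) (l := 𝓝[s] y₀) (z := ⟨u y₀, v y₀⟩)
    (by simpa using h₀)
  have h2 : (fun y => chartDeriv I x₀ (u y) (v y)) =ᶠ[𝓝[s] y₀]
      fun y => (trivializationAt E (TangentSpace I) x₀ ⟨u y, v y⟩).2 := by
    filter_upwards [hu ((chartAt H x₀).open_source.mem_nhds h₀)] with y hy
    exact chartDeriv_eq hy _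
  unfold ContinuousWithinAt
  rw [h1, Filter.tendsto_congr' h2]
  dsimp only
  rw [chartDeriv_eq h₀]
  exact ⟨fun h => h.2, fun h => ⟨hu, h⟩⟩

theorem ContinuousWithinAt.of_tangent {u : Y → M} {v : ∀ y, TangentSpace I (u y)} {s : Set Y}
    {y₀ : Y} (h : ContinuousWithinAt (fun y => (⟨u y, v y⟩ : TangentBundle I M)) s y₀) :
    ContinuousWithinAt u s y₀ :=
  (FiberBundle.continuousWithinAt_totalSpace (F := E) (fun y => (⟨u y, v y⟩ : TangentBundle I M))).1
    h |>.1

theorem continuousWithinAt_tangent_sum {ι : Type*} [Fintype ι] {u : Y → M}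
    {v : ι → ∀ y, TangentSpace I (u y)} {a : ι → Y → ℝ} {s : Set Y} {y₀ : Y}
    (hu : ContinuousWithinAt u s y₀)
    (hv : ∀ i, ContinuousWithinAt (fun y => (⟨u y, v i y⟩ : TangentBundle I M)) s y₀)
    (ha : ∀ i, ContinuousWithinAt (a i) s y₀) :
    ContinuousWithinAt (fun y => (⟨u y, ∑ i, a i y • v i y⟩ : TangentBundle I M)) s y₀ := by
  have h₀ : u y₀ ∈ (chartAt H (u y₀)).source := mem_chart_source H _
  rw [continuousWithinAt_tangent_iff hu h₀]
  have : (fun y => chartDeriv I (u y₀) (u y) (∑ i, a i y • v i y))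
      = fun y => ∑ i, a i y • chartDeriv I (u y₀) (u y) (v i y) := by
    funext y
    exact (map_sum (chartDeriv I (u y₀) (u y)) _ _).trans
      (Finset.sum_congr rfl fun i _ => map_smul _ _ _)
  rw [this]
  exact tendsto_finsetSum _ fun i _ => (ha i).smul ((continuousWithinAt_tangent_iff hu h₀).1 (hv i))

variable [I.Boundaryless]

/-- The inverse of the derivative at `x` of the chart at `x₀`. -/
noncomputable def chartInv (I : ModelWithCorners ℝ E H) {M : Type*} [TopologicalSpace M]
    [ChartedSpace H M] [IsManifold I 1 M] (x₀ x : M) : E →L[ℝ] TangentSpace I x :=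
  (trivializationAt E (TangentSpace I) x₀).symmL ℝ x

omit [I.Boundaryless] in
theorem chartInv_chartDeriv {x₀ x : M} (hx : x ∈ (chartAt H x₀).source) (v : TangentSpace I x) :
    chartInv I x₀ x (chartDeriv I x₀ x v) = v := by
  have h := TangentBundle.continuousLinearMapAt_trivializationAt (I := I) (𝕜 := ℝ) hx
  have := (trivializationAt E (TangentSpace I) x₀).symmL_continuousLinearMapAt (R := ℝ)
    (b := x) (by simpa using hx) v
  rw [h] at this
  exact this

omit [I.Boundaryless] in
theorem chartDeriv_chartInv {x₀ x : M} (hx : x ∈ (chartAt H x₀).source) (v : E) :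
    chartDeriv I x₀ x (chartInv I x₀ x v) = v := by
  have h := TangentBundle.continuousLinearMapAt_trivializationAt (I := I) (𝕜 := ℝ) hx
  have := (trivializationAt E (TangentSpace I) x₀).continuousLinearMapAt_symmL (R := ℝ)
    (b := x) (by simpa using hx) v
  rw [h] at this
  exact this

/-- The derivative of the inverse chart at `x₀`. -/
noncomputable def symmDeriv (I : ModelWithCorners ℝ E H) {M : Type*} [TopologicalSpace M]
    [ChartedSpace H M] (x₀ : M) (y : E) : E →L[ℝ] E :=
  mfderiv 𝓘(ℝ, E) I (extChartAt I x₀).symm y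

theorem symmDeriv_eq {x₀ x : M} (hx : x ∈ (chartAt H x₀).source) (v : E) :
    symmDeriv I x₀ (extChartAt I x₀ x) v = chartInv I x₀ x v := by
  have := TangentBundle.symmL_trivializationAt (I := I) (𝕜 := ℝ) hx
  rw [I.range_eq_univ, mfderivWithin_univ] at this
  exact (congrArg (fun L : E →L[ℝ] E => L v) this).symm

theorem symmDeriv_chartDeriv {x₀ x : M} (hx : x ∈ (chartAt H x₀).source) (v : TangentSpace I x) :
    symmDeriv I x₀ (extChartAt I x₀ x) (chartDeriv I x₀ x v) = v :=
  (symmDeriv_eq hx _).trans (chartInv_chartDeriv (I := I) hx v)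

theorem TwoForm.inChart_apply (Ω : TwoForm I M) {x₀ x : M} (hx : x ∈ (chartAt H x₀).source)
    (v w : TangentSpace I x) :
    Ω.inChart x₀ (extChartAt I x₀ x) (chartDeriv I x₀ x v) (chartDeriv I x₀ x w) = Ω x v w := by
  have hx' : x ∈ (extChartAt I x₀).source := by rwa [extChartAt_source]
  -- The inverse chart returns `x` only up to a propositional equality. All fibres are the model
  -- space `E`, so the vectors are kept in `E` and only the base point of the form is rewritten.
  have key : ∀ x' : M, x' = x → (show E →L[ℝ] E →L[ℝ] ℝ from Ω x') v w = Ω x v w := by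
    rintro _ rfl; rfl
  have h := key _ ((extChartAt I x₀).left_inv hx')
  have e1 := symmDeriv_chartDeriv hx v
  have e2 := symmDeriv_chartDeriv hx w
  generalize (extChartAt I x₀) x = y at *
  refine Eq.trans ?_ h
  exact congrArg₂ (fun a b : E => (show E →L[ℝ] E →L[ℝ] ℝ from Ω ((extChartAt I x₀).symm y)) a b)
    e1 e2

theorem OneForm.inChart_apply (α : OneForm I M) {x₀ x : M} (hx : x ∈ (chartAt H x₀).source)
    (v : TangentSpace I x) :
    α.inChart x₀ (extChartAt I x₀ x) (chartDeriv I x₀ x v) = α x v := by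
  have hx' : x ∈ (extChartAt I x₀).source := by rwa [extChartAt_source]
  have key : ∀ x' : M, x' = x → (show E →L[ℝ] ℝ from α x') v = α x v := by
    rintro _ rfl; rfl
  have h := key _ ((extChartAt I x₀).left_inv hx')
  have e1 := symmDeriv_chartDeriv hx v
  generalize (extChartAt I x₀) x = y at *
  refine Eq.trans ?_ h
  exact congrArg (fun a : E => (show E →L[ℝ] ℝ from α ((extChartAt I x₀).symm y)) a) e1

theorem TwoForm.IsSmooth.continuousWithinAt {Ω : TwoForm I M} (hΩ : Ω.IsSmooth) {u : Y → M}
    {v w : ∀ y, TangentSpace I (u y)} {s : Set Y} {y₀ : Y} 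
    (hv : ContinuousWithinAt (fun y => (⟨u y, v y⟩ : TangentBundle I M)) s y₀)
    (hw : ContinuousWithinAt (fun y => (⟨u y, w y⟩ : TangentBundle I M)) s y₀) :
    ContinuousWithinAt (fun y => Ω (u y) (v y) (w y)) s y₀ := by
  have hu := ContinuousWithinAt.of_tangent hv
  obtain ⟨x₀, h₀⟩ : ∃ x₀, u y₀ ∈ (chartAt H x₀).source := ⟨_, mem_chart_source H (u y₀)⟩
  rw [continuousWithinAt_tangent_iff hu h₀] at hv hw
  have h2 : ContinuousAt (Ω.inChart x₀) (extChartAt I x₀ (u y₀)) :=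
    (hΩ x₀).continuousOn.continuousAt (extChartAt_target_mem_nhds' ((extChartAt I x₀).map_source
      (by rwa [extChartAt_source])))
  have h3 : ContinuousWithinAt (fun y => extChartAt I x₀ (u y)) s y₀ :=
    (continuousAt_extChartAt' (by rwa [extChartAt_source])).comp_continuousWithinAt hu
  have h1 : ContinuousWithinAt (fun y => Ω.inChart x₀ (extChartAt I x₀ (u y))) s y₀ :=
    ContinuousAt.comp_continuousWithinAt (g := Ω.inChart x₀)
      (f := fun y => extChartAt I x₀ (u y)) h2 h3
  have h4 : ContinuousWithinAt (fun y => Ω.inChart x₀ (extChartAt I x₀ (u y))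
      (chartDeriv I x₀ (u y) (v y)) (chartDeriv I x₀ (u y) (w y))) s y₀ :=
    (h1.clm_apply hv).clm_apply hw
  refine h4.congr_of_eventuallyEq ?_ (Ω.inChart_apply h₀ _ _).symm
  filter_upwards [hu ((chartAt H x₀).open_source.mem_nhds h₀)] with y hy
  exact (Ω.inChart_apply hy _ _).symm

end Tangent

end CoisotropicIndex

namespace CoisotropicIndex

/-! ### Symplectic bases and transition matrices. -/

section SymplecticLinear

open Matrix

variable {V : Type*} [AddCommGroup V] [Module ℝ V] [TopologicalSpace V] {n : ℕ}

theorem J_inl_inl (i j : Fin n) : J (Fin n) ℝ (.inl i) (.inl j) = 0 := rfl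

theorem J_inl_inr (i j : Fin n) : J (Fin n) ℝ (.inl i) (.inr j) = -if i = j then 1 else 0 := rfl

theorem J_inr_inl (i j : Fin n) : J (Fin n) ℝ (.inr i) (.inl j) = if i = j then 1 else 0 := rfl

theorem J_inr_inr (i j : Fin n) : J (Fin n) ℝ (.inr i) (.inr j) = 0 := rfl

/-- `f` has the Gram matrix of the standard symplectic basis. -/
def IsSymplecticBasis (B : V →L[ℝ] V →L[ℝ] ℝ) (f : Fin n ⊕ Fin n → V) : Prop :=
  ∀ a b, B (f a) (f b) = J (Fin n) ℝ a b

theorem form_sum_right {ι : Type*} [Fintype ι] (B : V →L[ℝ] V →L[ℝ] ℝ) (v : V) (c : ι → ℝ)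
    (f : ι → V) : B v (∑ a, c a • f a) = ∑ a, c a * B v (f a) := by
  simp [map_sum]

theorem form_sum_left {ι : Type*} [Fintype ι] (B : V →L[ℝ] V →L[ℝ] ℝ) (v : V) (c : ι → ℝ)
    (f : ι → V) : B (∑ a, c a • f a) v = ∑ a, c a * B (f a) v := by
  simp [map_sum]

theorem IsSymplecticBasis.form_sum {B : V →L[ℝ] V →L[ℝ] ℝ} {f : Fin n ⊕ Fin n → V}
    (hf : IsSymplecticBasis B f) (c : Fin n ⊕ Fin n → ℝ) (b) :
    B (f b) (∑ a, c a • f a) = (J (Fin n) ℝ *ᵥ c) b := by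
  rw [form_sum_right, mulVec, dotProduct]
  exact Finset.sum_congr rfl fun a _ => by rw [hf, mul_comm]

theorem neg_J_mulVec_J_mulVec (c : Fin n ⊕ Fin n → ℝ) :
    -(J (Fin n) ℝ) *ᵥ (J (Fin n) ℝ *ᵥ c) = c := by
  rw [mulVec_mulVec, Matrix.neg_mul, J_squared, neg_neg, one_mulVec]

theorem IsSymplecticBasis.linearIndependent {B : V →L[ℝ] V →L[ℝ] ℝ} {f : Fin n ⊕ Fin n → V}
    (hf : IsSymplecticBasis B f) : LinearIndependent ℝ f := by
  rw [Fintype.linearIndependent_iff]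
  intro c hc a
  have : J (Fin n) ℝ *ᵥ c = 0 := by
    ext b
    rw [← hf.form_sum, hc, map_zero]
    rfl
  rw [← neg_J_mulVec_J_mulVec c, this, mulVec_zero]
  rfl

/-- The coordinates of `v` in a symplectic basis. -/
noncomputable def sympCoord (B : V →L[ℝ] V →L[ℝ] ℝ) (f : Fin n ⊕ Fin n → V) (v : V) :
    Fin n ⊕ Fin n → ℝ :=
  -(J (Fin n) ℝ) *ᵥ fun a => B (f a) v

theorem IsSymplecticBasis.sympCoord_sum {B : V →L[ℝ] V →L[ℝ] ℝ} {f : Fin n ⊕ Fin n → V}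
    (hf : IsSymplecticBasis B f) (c : Fin n ⊕ Fin n → ℝ) :
    sympCoord B f (∑ a, c a • f a) = c := by
  rw [sympCoord]
  simp only [hf.form_sum]
  exact neg_J_mulVec_J_mulVec c

theorem IsSymplecticBasis.expand [FiniteDimensional ℝ V] {B : V →L[ℝ] V →L[ℝ] ℝ}
    {f : Fin n ⊕ Fin n → V} (hf : IsSymplecticBasis B f) (hn : Module.finrank ℝ V = 2 * n) (v : V) :
    ∑ a, sympCoord B f v a • f a = v := by
  have hs := hf.linearIndependent.span_eq_top_of_card_eq_finrank'
    (by rw [hn, Fintype.card_sum, Fintype.card_fin]; omega)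
  obtain ⟨c, rfl⟩ := (Submodule.mem_span_range_iff_exists_fun ℝ).1
    (hs ▸ Submodule.mem_top : v ∈ Submodule.span ℝ (Set.range f))
  rw [hf.sympCoord_sum]

/-- The matrix which expresses the vectors `g` in the symplectic basis `f`. -/
noncomputable def transMatrix {ι : Type*} (B : V →L[ℝ] V →L[ℝ] ℝ) (f : Fin n ⊕ Fin n → V)
    (g : ι → V) : Matrix (Fin n ⊕ Fin n) ι ℝ :=
  -(J (Fin n) ℝ) * Matrix.of fun a b => B (f a) (g b)

theorem transMatrix_apply {ι : Type*} (B : V →L[ℝ] V →L[ℝ] ℝ) (f : Fin n ⊕ Fin n → V)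
    (g : ι → V) (a b) : transMatrix B f g a b = sympCoord B f (g b) a := rfl

theorem IsSymplecticBasis.transMatrix_of_eq {ι : Type*} {B : V →L[ℝ] V →L[ℝ] ℝ}
    {f : Fin n ⊕ Fin n → V} (hf : IsSymplecticBasis B f) {g : ι → V}
    {A : Matrix (Fin n ⊕ Fin n) ι ℝ} (h : ∀ b, g b = ∑ a, A a b • f a) :
    transMatrix B f g = A := by
  ext a b
  rw [transMatrix_apply, h, hf.sympCoord_sum fun a => A a b]

theorem IsSymplecticBasis.expand_transMatrix {ι : Type*} [FiniteDimensional ℝ V]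
    {B : V →L[ℝ] V →L[ℝ] ℝ} {f : Fin n ⊕ Fin n → V} (hf : IsSymplecticBasis B f)
    (hn : Module.finrank ℝ V = 2 * n) (g : ι → V) (b) :
    g b = ∑ a, transMatrix B f g a b • f a :=
  (hf.expand hn (g b)).symm

theorem form_combination {ι κ : Type*} [Fintype κ] {B : V →L[ℝ] V →L[ℝ] ℝ} {f : κ → V} {g : ι → V}
    {A : Matrix κ ι ℝ} (h : ∀ b, g b = ∑ a, A a b • f a) :
    (Matrix.of fun a b => B (g a) (g b)) = Aᵀ * (Matrix.of fun a b => B (f a) (f b)) * A := by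
  ext a b
  rw [of_apply, h a, h b, form_sum_left, mul_apply]
  simp only [form_sum_right, mul_apply, transpose_apply, of_apply, Finset.sum_mul, Finset.mul_sum]
  rw [Finset.sum_comm]
  exact Finset.sum_congr rfl fun x _ => Finset.sum_congr rfl fun y _ => by ring

theorem IsSymplecticBasis.mem_symplecticGroup_of_eq {B : V →L[ℝ] V →L[ℝ] ℝ}
    {f g : Fin n ⊕ Fin n → V} (hf : IsSymplecticBasis B f) (hg : IsSymplecticBasis B g)
    {A : Matrix (Fin n ⊕ Fin n) (Fin n ⊕ Fin n) ℝ} (h : ∀ b, g b = ∑ a, A a b • f a) :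
    A ∈ symplecticGroup (Fin n) ℝ := by
  rw [SymplecticGroup.mem_iff']
  have h1 : (Matrix.of fun a b => B (f a) (f b)) = J (Fin n) ℝ := by ext a b; exact hf a b
  have h2 : (Matrix.of fun a b => B (g a) (g b)) = J (Fin n) ℝ := by ext a b; exact hg a b
  have := form_combination (B := B) h
  rw [h1, h2] at this
  exact this.symm

theorem IsSymplecticBasis.of_mem {B : V →L[ℝ] V →L[ℝ] ℝ}
    {f g : Fin n ⊕ Fin n → V} (hf : IsSymplecticBasis B f) 
    {A : Matrix (Fin n ⊕ Fin n) (Fin n ⊕ Fin n) ℝ} (h : ∀ b, g b = ∑ a, A a b • f a)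
    (hA : A ∈ symplecticGroup (Fin n) ℝ) : IsSymplecticBasis B g := by
  rw [SymplecticGroup.mem_iff'] at hA
  have h1 : (Matrix.of fun a b => B (f a) (f b)) = J (Fin n) ℝ := by ext a b; exact hf a b
  have := form_combination (B := B) h
  rw [h1, hA] at this
  intro a b
  exact congrFun (congrFun this a) b

end SymplecticLinear

/-! ### Symplectic Gram–Schmidt with parameters. -/

section LocalFrame

variable {E : Type*} [NormedAddCommGroup E] [NormedSpace ℝ E]

/-- Symplectic Gram–Schmidt process near a point, with `j` steps. -/
theorem exists_local_partial_frame [FiniteDimensional ℝ E] {n : ℕ} (hn : Module.finrank ℝ E = 2 * n)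
    {B : E → E →L[ℝ] E →L[ℝ] ℝ} {t : Set E} {y₀ : E} (ht : IsOpen t) (hy₀ : y₀ ∈ t)
    (hB : ContinuousOn B t) (halt : ∀ y ∈ t, ∀ v, B y v v = 0)
    (hnd : ∀ v, (∀ w, B y₀ v w = 0) → v = 0) (j : ℕ) (hj : j ≤ n) :
    ∃ (U : Set E) (e f : ℕ → E → E), IsOpen U ∧ y₀ ∈ U ∧ U ⊆ t ∧
      (∀ i < j, ContinuousOn (e i) U ∧ ContinuousOn (f i) U) ∧
      ∀ y ∈ U, ∀ i < j, ∀ l < j, B y (e i y) (e l y) = 0 ∧ B y (f i y) (f l y) = 0 ∧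
        B y (f i y) (e l y) = if i = l then 1 else 0 := by
  induction j with
  | zero => exact ⟨t, 0, 0, ht, hy₀, subset_rfl, by simp, by simp⟩
  | succ j ih =>
    obtain ⟨U, e, f, hU, hyU, hUt, hc, hr⟩ := ih (by omega)
    have hskew : ∀ y ∈ t, ∀ v w, B y v w = -B y w v := fun y hy v w => by
      have := halt y hy (v + w)
      simp only [map_add, add_apply, halt y hy, zero_add, add_zero] at this
      linarith
    -- The projection of `v` to the symplectic complement of the pairs already constructed,
    -- continuous in `y`.
    let P : E → E → E := fun v y =>
      v - ∑ i ∈ Finset.range j, (B y (f i y) v • e i y - B y (e i y) v • f i y)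
    have hPc : ∀ v, ContinuousOn (P v) U := fun v => by
      refine continuousOn_const.sub (continuousOn_finsetSum _ fun i hi => ?_)
      obtain ⟨h1, h2⟩ := hc i (Finset.mem_range.1 hi)
      have hBU := hB.mono hUt
      exact (((hBU.clm_apply h2).clm_apply continuousOn_const).smul h1).sub
        (((hBU.clm_apply h1).clm_apply continuousOn_const).smul h2)
    have hPf : ∀ v, ∀ y ∈ U, ∀ l < j, B y (f l y) (P v y) = 0 ∧ B y (e l y) (P v y) = 0 := by
      intro v y hy l hl
      have hy' := hUt hy
      constructor
      · simp only [P, map_sub, map_sum, map_smul, smul_eq_mul]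
        rw [Finset.sum_eq_single l]
        · rw [(hr y hy l hl l hl).2.2, (hr y hy l hl l hl).2.1]; simp
        · intro i hi hil
          rw [(hr y hy l hl i (Finset.mem_range.1 hi)).2.2, (hr y hy l hl i
            (Finset.mem_range.1 hi)).2.1, if_neg (Ne.symm hil)]; simp
        · intro h; exact absurd (Finset.mem_range.2 hl) h
      · simp only [P, map_sub, map_sum, map_smul, smul_eq_mul]
        rw [Finset.sum_eq_single l]
        · rw [(hr y hy l hl l hl).1, hskew y hy' (e l y) (f l y), (hr y hy l hl l hl).2.2]; simp
        · intro i hi hil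
          rw [(hr y hy l hl i (Finset.mem_range.1 hi)).1, hskew y hy' (e l y) (f i y), (hr y hy i
            (Finset.mem_range.1 hi) l hl).2.2, if_neg hil]; simp
        · intro h; exact absurd (Finset.mem_range.2 hl) h
    -- Otherwise the `2 j < 2 n` vectors found so far would span the space.
    obtain ⟨v, hv⟩ : ∃ v, P v y₀ ≠ 0 := by
      by_contra! h
      let b : Fin j ⊕ Fin j → E := Sum.elim (fun i => e i y₀) (fun i => f i y₀)
      have hspan : (⊤ : Submodule ℝ E) ≤ Submodule.span ℝ (Set.range b) := by
        intro v _
        have : v = ∑ i ∈ Finset.range j, (B y₀ (f i y₀) v • e i y₀ - B y₀ (e i y₀) v • f i y₀) :=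
          sub_eq_zero.1 (h v)
        rw [this]
        refine Submodule.sum_mem _ fun i hi => Submodule.sub_mem _ (Submodule.smul_mem _ _ ?_)
          (Submodule.smul_mem _ _ ?_)
        · exact Submodule.subset_span ⟨.inl ⟨i, Finset.mem_range.1 hi⟩, rfl⟩
        · exact Submodule.subset_span ⟨.inr ⟨i, Finset.mem_range.1 hi⟩, rfl⟩
      have h1 := finrank_range_le_card (R := ℝ) b
      rw [Set.finrank, top_le_iff.1 hspan, finrank_top, hn, Fintype.card_sum, Fintype.card_fin] at h1
      omega
    obtain ⟨w, hw⟩ : ∃ w, B y₀ (P v y₀) w ≠ 0 := by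
      by_contra! h
      exact hv (hnd _ h)
    -- As `P v` is orthogonal to the earlier pairs, pairing it with `P w` is the same as pairing it
    -- with `w`.
    have hw' : B y₀ (P w y₀) (P v y₀) ≠ 0 := by
      have : B y₀ (P v y₀) (P w y₀) = B y₀ (P v y₀) w := by
        conv_lhs => arg 2; simp only [P]
        rw [map_sub, map_sum, Finset.sum_eq_zero, sub_zero]
        intro i hi
        obtain ⟨h1, h2⟩ := hPf v y₀ hyU i (Finset.mem_range.1 hi)
        rw [map_sub, map_smul, map_smul, hskew y₀ hy₀ _ (e i y₀), hskew y₀ hy₀ _ (f i y₀), h1, h2]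
        simp
      rw [hskew y₀ hy₀, this]
      exact neg_ne_zero.2 hw
    -- The new pair is `P v` and `c⁻¹ P w`; the neighbourhood is shrunk to the open set where `c`
    -- does not vanish.
    let c : E → ℝ := fun y => B y (P w y) (P v y)
    have hcc : ContinuousOn c U := ((hB.mono hUt).clm_apply (hPc w)).clm_apply (hPc v)
    refine ⟨U ∩ c ⁻¹' {0}ᶜ, Function.update e j (P v),
      Function.update f j (fun y => (c y)⁻¹ • P w y),
      hcc.isOpen_inter_preimage hU isOpen_compl_singleton, ⟨hyU, hw'⟩, fun y hy => hUt hy.1, ?_, ?_⟩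
    · intro i hi
      rcases Nat.lt_succ_iff_lt_or_eq.1 hi with h | rfl
      · rw [Function.update_of_ne h.ne, Function.update_of_ne h.ne]
        exact ⟨(hc i h).1.mono Set.inter_subset_left, (hc i h).2.mono Set.inter_subset_left⟩
      · rw [Function.update_self, Function.update_self]
        exact ⟨(hPc v).mono Set.inter_subset_left,
          ((hcc.mono Set.inter_subset_left).inv₀ fun y hy => hy.2).smul
            ((hPc w).mono Set.inter_subset_left)⟩
    · intro y hy i hi l hl
      have hy' := hUt hy.1
      have hcy : c y ≠ 0 := hy.2
      rcases Nat.lt_succ_iff_lt_or_eq.1 hi with h | rfl <;>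
        rcases Nat.lt_succ_iff_lt_or_eq.1 hl with h' | rfl
      · rw [Function.update_of_ne h.ne, Function.update_of_ne h.ne, Function.update_of_ne h'.ne,
          Function.update_of_ne h'.ne]
        exact hr y hy.1 i h l h'
      · rw [Function.update_of_ne h.ne, Function.update_of_ne h.ne, Function.update_self,
          Function.update_self, if_neg h.ne, map_smul, (hPf v y hy.1 i h).1, (hPf v y hy.1 i h).2,
          (hPf w y hy.1 i h).1]
        simp
      · rw [Function.update_of_ne h'.ne, Function.update_of_ne h'.ne, Function.update_self,
          Function.update_self, if_neg h'.ne', hskew y hy' _ (e l y), hskew y hy' _ (f l y),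
          hskew y hy' _ (e l y), map_smul, map_smul, (hPf v y hy.1 l h').2, (hPf w y hy.1 l h').1,
          (hPf w y hy.1 l h').2]
        simp
      · rw [Function.update_self, Function.update_self, if_pos rfl, halt y hy', halt y hy']
        refine ⟨rfl, rfl, ?_⟩
        rw [map_smul, smul_apply, smul_eq_mul]
        exact inv_mul_cancel₀ hcy

end LocalFrame

end CoisotropicIndex

/-! ### Symplectic frames over rectangles and discs. -/

namespace CoisotropicIndex

/-- Gluing along an interval. -/
theorem interval_induction {Q : Set ℝ → Prop} (hmono : ∀ s t, s ⊆ t → Q t → Q s)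
    (hloc : ∀ x, ∃ U ∈ 𝓝 x, Q U)
    (hglue : ∀ a b c, a ≤ b → b ≤ c → Q (Set.Icc a b) → Q (Set.Icc b c) → Q (Set.Icc a c))
    {a b : ℝ} (hab : a ≤ b) : Q (Set.Icc a b) := by
  choose U hU hQ using hloc
  obtain ⟨δ, hδ, hL⟩ := lebesgue_number_lemma_of_metric (isCompact_Icc (a := a) (b := b))
    (fun x => isOpen_interior (s := U x)) fun x _ => Set.mem_iUnion.2 ⟨x, mem_interior_iff_mem_nhds.2 (hU x)⟩
  obtain ⟨N, hN⟩ := exists_nat_gt ((b - a) / δ)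
  have hN0 : (0 : ℝ) < N := (div_nonneg (sub_nonneg.2 hab) hδ.le).trans_lt hN
  have hstep : (b - a) / N < δ := by
    rw [div_lt_iff₀ hN0]
    rw [div_lt_iff₀ hδ] at hN
    linarith
  have h0 : 0 ≤ (b - a) / N := div_nonneg (sub_nonneg.2 hab) hN0.le
  have key : ∀ k : ℕ, k ≤ N → Q (Set.Icc a (a + k * ((b - a) / N))) := by
    intro k
    induction k with
    | zero =>
      intro _
      refine hmono _ _ ?_ (hQ a)
      intro x hx
      have : x = a := by simpa using hx
      rw [this]
      exact mem_of_mem_nhds (hU a)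
    | succ k ih =>
      intro hk
      have hkN : (k : ℝ) + 1 ≤ N := by exact_mod_cast hk
      refine hglue _ (a + k * ((b - a) / N)) _ (by have := mul_nonneg k.cast_nonneg h0; linarith)
        (by push_cast; nlinarith) (ih (by omega)) ?_
      obtain ⟨i, hi⟩ := hL (a + k * ((b - a) / N)) ⟨by have := mul_nonneg k.cast_nonneg h0; linarith, by
        have : (k : ℝ) * ((b - a) / N) ≤ N * ((b - a) / N) :=
          mul_le_mul_of_nonneg_right (by linarith) h0
        rw [mul_div_cancel₀ _ hN0.ne'] at this
        linarith⟩
      refine hmono _ _ (fun x hx => interior_subset (hi ?_)) (hQ i)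
      rw [Metric.mem_ball, Real.dist_eq, abs_lt]
      have h1 := hx.1
      have h2 := hx.2
      push_cast at h2
      constructor <;> linarith
  have := key N le_rfl
  rwa [mul_div_cancel₀ _ hN0.ne', add_sub_cancel] at this

section Frames

variable {F : Type*} [NormedAddCommGroup F] [NormedSpace ℝ F]
  {G : Type*} [TopologicalSpace G] {J : ModelWithCorners ℝ F G}
  {W : Type*} [TopologicalSpace W] [ChartedSpace G W] [IsManifold J 1 W]
  {Y : Type*} [TopologicalSpace Y] {n : ℕ}

instance [FiniteDimensional ℝ F] (x : W) : FiniteDimensional ℝ (TangentSpace J x) :=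
  inferInstanceAs (FiniteDimensional ℝ F)

/-- A continuous symplectic frame of `u^* TW` over a set. -/
structure IsFrameOn (Ω : TwoForm J W) (u : Y → W) (s : Set Y)
    (f : ∀ y, Fin n ⊕ Fin n → TangentSpace J (u y)) : Prop where
  continuousOn : ∀ a, ContinuousOn (fun y => (⟨u y, f y a⟩ : TangentBundle J W)) s
  basis : ∀ y ∈ s, IsSymplecticBasis (Ω (u y)) (f y)

theorem isSymplecticFrameOver_iff {Ω : TwoForm J W} {u : ℂ → W}
    {f : ∀ z, Fin n ⊕ Fin n → TangentSpace J (u z)} :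
    IsSymplecticFrameOver Ω u f ↔ IsFrameOn Ω u (Metric.closedBall 0 1) f :=
  ⟨fun h => ⟨h.1, fun z hz => h.2 z hz⟩, fun h => ⟨h.1, fun z hz => h.2 z hz⟩⟩

theorem IsFrameOn.comp {Ω : TwoForm J W} {u : Y → W} {s : Set Y}
    {f : ∀ y, Fin n ⊕ Fin n → TangentSpace J (u y)} (hf : IsFrameOn Ω u s f)
    {Z : Type*} [TopologicalSpace Z] {g : Z → Y} {s' : Set Z} (hg : ContinuousOn g s')
    (hm : Set.MapsTo g s' s) : IsFrameOn Ω (fun z => u (g z)) s' (fun z => f (g z)) :=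
  ⟨fun a => (hf.continuousOn a).comp hg hm, fun _ hz => hf.basis _ (hm hz)⟩

theorem IsFrameOn.mono {Ω : TwoForm J W} {u : Y → W} {s t : Set Y}
    {f : ∀ y, Fin n ⊕ Fin n → TangentSpace J (u y)} (hf : IsFrameOn Ω u s f) (h : t ⊆ s) :
    IsFrameOn Ω u t f :=
  ⟨fun a => (hf.continuousOn a).mono h, fun _ hz => hf.basis _ (h hz)⟩

variable [J.Boundaryless]

theorem IsSymplecticForm.continuousOn {Ω : TwoForm J W} (hΩ : IsSymplecticForm Ω) {u : Y → W}
    {v w : ∀ y, TangentSpace J (u y)} {s : Set Y}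
    (hv : ContinuousOn (fun y => (⟨u y, v y⟩ : TangentBundle J W)) s)
    (hw : ContinuousOn (fun y => (⟨u y, w y⟩ : TangentBundle J W)) s) :
    ContinuousOn (fun y => Ω (u y) (v y) (w y)) s :=
  fun y hy => hΩ.smooth.continuousWithinAt (hv y hy) (hw y hy)

theorem IsSymplecticForm.continuousOn_transMatrix {Ω : TwoForm J W} (hΩ : IsSymplecticForm Ω)
    {u : Y → W} {s : Set Y} {ι : Type*} {f : ∀ y, Fin n ⊕ Fin n → TangentSpace J (u y)}
    {g : ∀ y, ι → TangentSpace J (u y)}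
    (hf : ∀ a, ContinuousOn (fun y => (⟨u y, f y a⟩ : TangentBundle J W)) s)
    (hg : ∀ a, ContinuousOn (fun y => (⟨u y, g y a⟩ : TangentBundle J W)) s) :
    ContinuousOn (fun y => transMatrix (Ω (u y)) (f y) (g y)) s := by
  rw [continuousOn_iff_continuous_domRestrict]
  refine (continuous_const (y := -Matrix.J (Fin n) ℝ)).matrix_mul (continuous_matrix fun a b => ?_)
  exact continuousOn_iff_continuous_domRestrict.1 (hΩ.continuousOn (hf a) (hg b))

theorem IsSymplecticForm.exists_local_frame [FiniteDimensional ℝ F]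
    (hn : Module.finrank ℝ F = 2 * n) {Ω : TwoForm J W} (hΩ : IsSymplecticForm Ω) {u : Y → W}
    (hu : Continuous u) (y₀ : Y) :
    ∃ s ∈ 𝓝 y₀, ∃ f : ∀ y, Fin n ⊕ Fin n → TangentSpace J (u y), IsFrameOn Ω u s f := by
  set x₀ := u y₀ with hx₀
  have hsrc : ∀ x ∈ (chartAt G x₀).source, x ∈ (extChartAt J x₀).source := fun x hx => by
    rwa [extChartAt_source]
  have hval : ∀ x ∈ (chartAt G x₀).source, ∀ v w : F, Ω.inChart x₀ (extChartAt J x₀ x) v w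
      = Ω x (chartInv J x₀ x v) (chartInv J x₀ x w) := fun x hx v w => by
    have := Ω.inChart_apply hx (chartInv J x₀ x v) (chartInv J x₀ x w)
    rwa [chartDeriv_chartInv hx, chartDeriv_chartInv hx] at this
  have h₀ : x₀ ∈ (chartAt G x₀).source := mem_chart_source G x₀
  obtain ⟨U, e, f, hU, hyU, hUt, hc, hr⟩ := exists_local_partial_frame hn
    (B := Ω.inChart x₀) (t := (extChartAt J x₀).target) (y₀ := extChartAt J x₀ x₀)
    (isOpen_extChartAt_target x₀) (mem_extChartAt_target x₀) (hΩ.smooth x₀).continuousOn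
    (fun y hy v => by
      have hy' : (extChartAt J x₀).symm y ∈ (chartAt G x₀).source := by
        rw [← extChartAt_source J]
        exact (extChartAt J x₀).map_target hy
      rw [← (extChartAt J x₀).right_inv hy, hval _ hy']
      exact hΩ.alternating _ _)
    (fun v hv => by
      have h := hΩ.nondegenerate x₀ (chartInv J x₀ x₀ v) fun w => by
        rw [← chartInv_chartDeriv h₀ w, ← hval _ h₀]
        exact hv _
      rw [← chartDeriv_chartInv (I := J) h₀ v, h, map_zero]) n le_rfl
  have hxs : ∀ᶠ y in 𝓝 y₀, u y ∈ (chartAt G x₀).source ∧ extChartAt J x₀ (u y) ∈ U := by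
    have h1 : ContinuousAt (fun y => extChartAt J x₀ (u y)) y₀ :=
      (continuousAt_extChartAt x₀).comp (f := u) hu.continuousAt
    exact Filter.Eventually.and
      (hu.continuousAt.eventually_mem ((chartAt G x₀).open_source.mem_nhds h₀))
      (h1.eventually_mem (hU.mem_nhds hyU))
  refine ⟨_, hxs, fun y => Sum.elim (fun i => chartInv J x₀ (u y) (e i (extChartAt J x₀ (u y))))
    (fun i => chartInv J x₀ (u y) (f i (extChartAt J x₀ (u y)))), ⟨?_, ?_⟩⟩
  · have main : ∀ g : F → F, ContinuousOn g U → ContinuousOn (fun y =>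
        (⟨u y, chartInv J x₀ (u y) (g (extChartAt J x₀ (u y)))⟩ : TangentBundle J W))
        {y | u y ∈ (chartAt G x₀).source ∧ extChartAt J x₀ (u y) ∈ U} := by
      intro g hg y hy
      rw [continuousWithinAt_tangent_iff hu.continuousWithinAt hy.1]
      have h1 : ContinuousWithinAt (fun y => extChartAt J x₀ (u y))
          {y | u y ∈ (chartAt G x₀).source ∧ extChartAt J x₀ (u y) ∈ U} y :=
        (continuousAt_extChartAt' (hsrc _ hy.1)).comp_continuousWithinAt hu.continuousWithinAt
      have h2 : ContinuousWithinAt (fun y => g (extChartAt J x₀ (u y)))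
          {y | u y ∈ (chartAt G x₀).source ∧ extChartAt J x₀ (u y) ∈ U} y :=
        ContinuousWithinAt.comp (g := g) (f := fun y => extChartAt J x₀ (u y)) (hg _ hy.2) h1
          fun z hz => hz.2
      exact h2.congr (fun z hz => chartDeriv_chartInv hz.1 _) (chartDeriv_chartInv hy.1 _)
    rintro (i | i)
    · exact main _ (hc i i.2).1
    · exact main _ (hc i i.2).2
  · intro y hy a b
    have hy2 := hr _ hy.2
    have hsk : ∀ v w : F, Ω (u y) (chartInv J x₀ (u y) v) (chartInv J x₀ (u y) w)
        = -Ω (u y) (chartInv J x₀ (u y) w) (chartInv J x₀ (u y) v) := fun v w => by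
      have := hΩ.alternating (u y) (chartInv J x₀ (u y) v + chartInv J x₀ (u y) w)
      rw [map_add, map_add, add_apply, add_apply, hΩ.alternating, hΩ.alternating] at this
      linarith
    rcases a with i | i <;> rcases b with l | l <;>
      simp only [Sum.elim_inl, Sum.elim_inr, J_inl_inl, J_inl_inr, J_inr_inl, J_inr_inr]
    · rw [← hval _ hy.1]; exact (hy2 i i.2 l l.2).1
    · rw [hsk, ← hval _ hy.1, (hy2 l l.2 i i.2).2.2]
      simp [Fin.ext_iff, eq_comm]
    · rw [← hval _ hy.1, (hy2 i i.2 l l.2).2.2]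
      simp [Fin.ext_iff]
    · rw [← hval _ hy.1]; exact (hy2 i i.2 l l.2).2.1

/-- Multiply the second frame by the transition matrix found on the common slice at `b`, extended
independently of the last coordinate. The corrected frame agrees with the first one on that slice.
-/
theorem IsSymplecticForm.glue_frame [FiniteDimensional ℝ F]
    (hn : Module.finrank ℝ F = 2 * n) {Ω : TwoForm J W} (hΩ : IsSymplecticForm Ω)
    {u : Y × ℝ → W} {A : Set Y} {a b c : ℝ} (hab : a ≤ b) (hbc : b ≤ c)
    {f f' : ∀ y, Fin n ⊕ Fin n → TangentSpace J (u y)}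
    (hf : IsFrameOn Ω u (A ×ˢ Set.Icc a b) f) (hf' : IsFrameOn Ω u (A ×ˢ Set.Icc b c) f') :
    ∃ g : ∀ y, Fin n ⊕ Fin n → TangentSpace J (u y), IsFrameOn Ω u (A ×ˢ Set.Icc a c) g := by
  have hbm : b ∈ Set.Icc a b := ⟨hab, le_rfl⟩
  have hbm' : b ∈ Set.Icc b c := ⟨le_rfl, hbc⟩
  have gi : ContinuousOn (fun x : Y => (x, b)) A := by fun_prop
  have h1 := hf.comp gi fun x hx => ⟨hx, hbm⟩
  have h2 := hf'.comp gi fun x hx => ⟨hx, hbm'⟩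
  let S : Y → Matrix (Fin n ⊕ Fin n) (Fin n ⊕ Fin n) ℝ := fun x =>
    transMatrix (Ω (u (x, b))) (f' (x, b)) (f (x, b))
  have hS : ContinuousOn S A := hΩ.continuousOn_transMatrix h2.continuousOn h1.continuousOn
  have hfr : ∀ x : W, Module.finrank ℝ (TangentSpace J x) = 2 * n := fun x => hn
  have hSe : ∀ x ∈ A, ∀ d, f (x, b) d = ∑ i, S x i d • f' (x, b) i := fun x hx d =>
    (h2.basis x hx).expand_transMatrix (hfr _) _ d
  have hSm : ∀ x ∈ A, S x ∈ Matrix.symplecticGroup (Fin n) ℝ := fun x hx =>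
    (h2.basis x hx).mem_symplecticGroup_of_eq (h1.basis x hx) (hSe x hx)
  let g' : ∀ y, Fin n ⊕ Fin n → TangentSpace J (u y) := fun y d => ∑ i, S y.1 i d • f' y i
  have hg' : IsFrameOn Ω u (A ×ˢ Set.Icc b c) g' := by
    refine ⟨fun d y hy => ?_, fun y hy => ?_⟩
    · refine continuousWithinAt_tangent_sum (ContinuousWithinAt.of_tangent (hf'.continuousOn d y hy))
        (fun i => hf'.continuousOn i y hy) fun i => ?_
      have : ContinuousOn (fun y : Y × ℝ => S y.1) (A ×ˢ Set.Icc b c) :=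
        hS.comp continuousOn_fst fun y hy => hy.1
      exact ((continuous_id.matrix_elem i d).comp_continuousOn this) y hy
    · exact (hf'.basis y hy).of_mem (fun d => rfl) (hSm _ hy.1)
  classical
  let g : ∀ y, Fin n ⊕ Fin n → TangentSpace J (u y) := fun y => if y.2 ≤ b then f y else g' y
  have e1 : ∀ y ∈ A ×ˢ Set.Icc a b, g y = f y := fun y hy => if_pos hy.2.2
  have e2 : ∀ y ∈ A ×ˢ Set.Icc b c, g y = g' y := fun y hy => by
    by_cases h : y.2 ≤ b
    · obtain ⟨x, t⟩ := y
      obtain rfl : t = b := le_antisymm h hy.2.1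
      refine (if_pos h).trans ?_
      funext d
      exact hSe x hy.1 d
    · exact if_neg h
  have hsub : A ×ˢ Set.Icc a c = A ×ˢ Set.Icc a b ∪ A ×ˢ Set.Icc b c := by
    rw [← Set.prod_union, Set.Icc_union_Icc_eq_Icc hab hbc]
  have hcl : ∀ (p q : ℝ), ∀ y : Y × ℝ, y ∉ A ×ˢ Set.Icc p q → y.1 ∈ A →
      y ∉ closure (A ×ˢ Set.Icc p q) := by
    intro p q y hy hA hmem
    rw [closure_prod_eq] at hmem
    exact hy ⟨hA, by simpa using hmem.2⟩
  refine ⟨g, fun d y hy => ?_, fun y hy => ?_⟩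
  · rw [hsub]
    refine ContinuousWithinAt.union ?_ ?_
    · by_cases h : y ∈ A ×ˢ Set.Icc a b
      · exact (hf.continuousOn d y h).congr (fun z hz => by rw [e1 z hz]) (by rw [e1 y h])
      · exact continuousWithinAt_of_notMem_closure (hcl _ _ _ h hy.1)
    · by_cases h : y ∈ A ×ˢ Set.Icc b c
      · exact (hg'.continuousOn d y h).congr (fun z hz => by rw [e2 z hz]) (by rw [e2 y h])
      · exact continuousWithinAt_of_notMem_closure (hcl _ _ _ h hy.1)
  · rw [hsub] at hy
    rcases hy with h | h
    · rw [e1 y h]; exact hf.basis y h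
    · rw [e2 y h]; exact hg'.basis y h

theorem IsSymplecticForm.exists_frame_strip [FiniteDimensional ℝ F]
    (hn : Module.finrank ℝ F = 2 * n) {Ω : TwoForm J W} (hΩ : IsSymplecticForm Ω)
    {u : Y × ℝ → W} (hu : Continuous u) (x : Y) {a b : ℝ} (hab : a ≤ b) :
    ∃ A ∈ 𝓝 x, ∃ f : ∀ y, Fin n ⊕ Fin n → TangentSpace J (u y),
      IsFrameOn Ω u (A ×ˢ Set.Icc a b) f := by
  refine interval_induction (Q := fun s => ∃ A ∈ 𝓝 x, ∃ f : ∀ y, Fin n ⊕ Fin n →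
    TangentSpace J (u y), IsFrameOn Ω u (A ×ˢ s) f) ?_ ?_ ?_ hab
  · rintro s t hst ⟨A, hA, f, hf⟩
    exact ⟨A, hA, f, hf.mono (Set.prod_mono_right hst)⟩
  · intro t
    obtain ⟨s, hs, f, hf⟩ := hΩ.exists_local_frame hn hu (x, t)
    obtain ⟨A, hA, U, hU, hsub⟩ := mem_nhds_prod_iff.1 hs
    exact ⟨U, hU, A, hA, f, hf.mono hsub⟩
  · rintro p q r hpq hqr ⟨A, hA, f, hf⟩ ⟨A', hA', f', hf'⟩
    exact ⟨A ∩ A', Filter.inter_mem hA hA', hΩ.glue_frame hn hpq hqr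
      (hf.mono (Set.prod_mono_left Set.inter_subset_left))
      (hf'.mono (Set.prod_mono_left Set.inter_subset_right))⟩

theorem IsSymplecticForm.exists_frame_rectangle [FiniteDimensional ℝ F]
    (hn : Module.finrank ℝ F = 2 * n) {Ω : TwoForm J W} (hΩ : IsSymplecticForm Ω)
    {u : ℝ × ℝ → W} (hu : Continuous u) {a b c d : ℝ} (hab : a ≤ b) (hcd : c ≤ d) :
    ∃ f : ∀ y, Fin n ⊕ Fin n → TangentSpace J (u y),
      IsFrameOn Ω u (Set.Icc c d ×ˢ Set.Icc a b) f := by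
  refine interval_induction (Q := fun s => ∃ f : ∀ y, Fin n ⊕ Fin n →
    TangentSpace J (u y), IsFrameOn Ω u (s ×ˢ Set.Icc a b) f) ?_ ?_ ?_ hcd
  · rintro s t hst ⟨f, hf⟩
    exact ⟨f, hf.mono (Set.prod_mono_left hst)⟩
  · intro x
    exact hΩ.exists_frame_strip hn hu x hab
  · rintro p q r hpq hqr ⟨f, hf⟩ ⟨f', hf'⟩
    obtain ⟨g, hg⟩ := hΩ.glue_frame hn (u := fun y => u y.swap) (A := Set.Icc a b) hpq hqr
      (hf.comp (g := Prod.swap) continuous_swap.continuousOn fun y hy => ⟨hy.2, hy.1⟩)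
      (hf'.comp (g := Prod.swap) continuous_swap.continuousOn fun y hy => ⟨hy.2, hy.1⟩)
    exact ⟨_, hg.comp (g := Prod.swap) continuous_swap.continuousOn fun y hy => ⟨hy.2, hy.1⟩⟩

/-- A continuous disc in `W` carries a symplectic frame. -/
theorem IsSymplecticForm.exists_frame_disc [FiniteDimensional ℝ F]
    (hn : Module.finrank ℝ F = 2 * n) {Ω : TwoForm J W} (hΩ : IsSymplecticForm Ω)
    {u : ℂ → W} (hu : ContinuousOn u (Metric.closedBall 0 1)) :
    ∃ f : ∀ z, Fin n ⊕ Fin n → TangentSpace J (u z), IsSymplecticFrameOver Ω u f := by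
  -- Radial retraction onto the disc: it extends `u` to a square containing the disc, over which
  -- frames are glued.
  let ret : ℂ → ℂ := fun z => ((max ‖z‖ 1)⁻¹ : ℝ) • z
  have hpos : ∀ z : ℂ, 0 < max ‖z‖ 1 := fun z => lt_max_of_lt_right one_pos
  have hret : Continuous ret :=
    ((continuous_norm.max continuous_const).inv₀ fun z => (hpos z).ne').smul continuous_id
  have hmem : ∀ z, ret z ∈ Metric.closedBall (0 : ℂ) 1 := fun z => by
    rw [mem_closedBall_zero_iff, norm_smul, norm_inv, Real.norm_of_nonneg (hpos z).le]
    exact (inv_mul_le_one₀ (hpos z)).2 (le_max_left _ _)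
  have hid : ∀ z ∈ Metric.closedBall (0 : ℂ) 1, ret z = z := fun z hz => by
    rw [mem_closedBall_zero_iff] at hz
    simp [ret, max_eq_right hz]
  let j : ℝ × ℝ → ℂ := fun p => ⟨p.1, p.2⟩
  have hj : Continuous j := Complex.equivRealProdCLM.symm.continuous
  obtain ⟨f, hf⟩ := hΩ.exists_frame_rectangle hn (u := fun p => u (ret (j p)))
    (hu.comp_continuous (hret.comp hj) fun p => hmem _) (a := -1) (b := 1) (c := -1) (d := 1)
    (by norm_num) (by norm_num)
  have hg := hf.comp (g := fun z : ℂ => (z.re, z.im)) (s' := Metric.closedBall 0 1)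
    (by fun_prop) fun z hz => by
      rw [mem_closedBall_zero_iff] at hz
      exact ⟨abs_le.1 ((Complex.abs_re_le_norm z).trans hz),
        abs_le.1 ((Complex.abs_im_le_norm z).trans hz)⟩
  have hjz : ∀ z : ℂ, j (z.re, z.im) = z := fun z => rfl
  classical
  have hu' : ∀ z ∈ Metric.closedBall (0 : ℂ) 1, u (ret (j (z.re, z.im))) = u z := fun z hz => by
    rw [hjz, hid z hz]
  let g : ∀ z, Fin n ⊕ Fin n → TangentSpace J (u z) := fun z a => f (z.re, z.im) a
  have htrans : ∀ x x' : W, x = x' → ∀ v : F, (⟨x, v⟩ : TangentBundle J W) = ⟨x', v⟩ := by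
    rintro x _ rfl v; rfl
  have hb : ∀ x x' : W, x = x' → ∀ f : Fin n ⊕ Fin n → F,
      IsSymplecticBasis (Ω x) (fun a => (f a : TangentSpace J x)) →
      IsSymplecticBasis (Ω x') (fun a => (f a : TangentSpace J x')) := by
    rintro x _ rfl v h; exact h
  refine ⟨g, isSymplecticFrameOver_iff.2 ⟨fun a => ?_, fun z hz => ?_⟩⟩
  · exact (hg.continuousOn a).congr fun z hz => htrans _ _ (hu' z hz).symm _
  · exact hb _ _ (hu' z hz) _ (hg.basis z hz)

end Frames

end CoisotropicIndex

namespace CoisotropicIndex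

/-! ### Exterior calculus along smooth maps from normed spaces. -/

section Plots

variable {E : Type*} [NormedAddCommGroup E] [NormedSpace ℝ E]
  {H : Type*} [TopologicalSpace H] {I : ModelWithCorners ℝ E H}
  {M : Type*} [TopologicalSpace M] [ChartedSpace H M] [IsManifold I ∞ M]
  {V : Type*} [NormedAddCommGroup V] [NormedSpace ℝ V] {g : V → M} {U : Set V} {x : V}

/-- The derivative of a map from a normed space, with values in the model space. -/
noncomputable def plotDeriv (I : ModelWithCorners ℝ E H) {M : Type*} [TopologicalSpace M]
    [ChartedSpace H M] (g : V → M) (x : V) : V →L[ℝ] TangentSpace I (g x) :=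
  mfderiv 𝓘(ℝ, V) I g x

theorem contDiffOn_extChartAt_comp (hg : ContMDiffOn 𝓘(ℝ, V) I ∞ g U) (x₀ : M) :
    ContDiffOn ℝ ∞ (fun y => extChartAt I x₀ (g y)) (U ∩ g ⁻¹' (chartAt H x₀).source) := by
  rw [← contMDiffOn_iff_contDiffOn]
  exact (contMDiffOn_extChartAt (n := ∞) (x := x₀)).comp (hg.mono Set.inter_subset_left)
    fun y hy => hy.2

omit [IsManifold I ∞ M] in
theorem isOpen_chart_preimage (hU : IsOpen U) (hg : ContMDiffOn 𝓘(ℝ, V) I ∞ g U) (x₀ : M) :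
    IsOpen (U ∩ g ⁻¹' (chartAt H x₀).source) :=
  hg.continuousOn.isOpen_inter_preimage hU (chartAt H x₀).open_source

theorem chartDeriv_plotDeriv (hU : IsOpen U) (hg : ContMDiffOn 𝓘(ℝ, V) I ∞ g U) (hx : x ∈ U)
    {x₀ : M} (h₀ : g x ∈ (chartAt H x₀).source) (v : V) :
    chartDeriv I x₀ (g x) (plotDeriv I g x v) = fderiv ℝ (fun y => extChartAt I x₀ (g y)) x v := by
  have h1 : MDifferentiableAt 𝓘(ℝ, V) I g x :=
    (hg.contMDiffAt (hU.mem_nhds hx)).mdifferentiableAt (by simp)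
  have h2 : MDifferentiableAt I 𝓘(ℝ, E) (extChartAt I x₀) (g x) := mdifferentiableAt_extChartAt h₀
  have := mfderiv_comp x h2 h1
  rw [← mfderiv_eq_fderiv]
  exact (congrArg (fun L : V →L[ℝ] E => L v) this).symm

/-- Directional derivatives of a smooth map from a normed space are continuous. -/
theorem continuousOn_plotDeriv (hU : IsOpen U) (hg : ContMDiffOn 𝓘(ℝ, V) I ∞ g U) (v : V) :
    ContinuousOn (fun y => (⟨g y, plotDeriv I g y v⟩ : TangentBundle I M)) U := by
  intro y hy
  have hy0 : g y ∈ (chartAt H (g y)).source := mem_chart_source H _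
  have hO := isOpen_chart_preimage hU hg (g y)
  rw [continuousWithinAt_tangent_iff (hg.continuousOn y hy) hy0]
  have h1 : ContinuousAt (fun z => fderiv ℝ (fun y' => extChartAt I (g y) (g y')) z v) y :=
    (((contDiffOn_extChartAt_comp hg (g y)).continuousOn_fderiv_of_isOpen hO (by simp)).clm_apply
      continuousOn_const).continuousAt (hO.mem_nhds ⟨hy, hy0⟩)
  refine ContinuousAt.continuousWithinAt (h1.congr ?_)
  filter_upwards [hO.mem_nhds ⟨hy, hy0⟩] with z hz
  exact (chartDeriv_plotDeriv hU hg hz.1 hz.2 v).symm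

theorem fderiv_fderiv_symm {f : V → E} (hf : ContDiffAt ℝ ∞ f x) (u v : V) :
    fderiv ℝ (fderiv ℝ f) x u v = fderiv ℝ (fderiv ℝ f) x v u :=
  hf.isSymmSndFDerivAt (by simpa using ENat.LEInfty.out) u v

variable [I.Boundaryless]

/-- Product rule in the chart at `g x`. The first term is the one entering `dα`; the second contains
the second derivative of the map, which is symmetric and will cancel on antisymmetrization. -/
theorem hasFDerivAt_oneForm {α : OneForm I M} (hα : α.IsSmooth) (hU : IsOpen U)
    (hg : ContMDiffOn 𝓘(ℝ, V) I ∞ g U) (hx : x ∈ U) (v : V) :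
    ∃ L : V →L[ℝ] ℝ, HasFDerivAt (fun y => α (g y) (plotDeriv I g y v)) L x ∧ ∀ u, L u =
      fderiv ℝ (α.inChart (g x)) (extChartAt I (g x) (g x))
        (chartDeriv I (g x) (g x) (plotDeriv I g x u)) (chartDeriv I (g x) (g x) (plotDeriv I g x v))
      + α.inChart (g x) (extChartAt I (g x) (g x))
        (fderiv ℝ (fderiv ℝ (fun y => extChartAt I (g x) (g y))) x u v) := by
  have hx0 : g x ∈ (chartAt H (g x)).source := mem_chart_source H _
  have hO := isOpen_chart_preimage hU hg (g x)
  have hh : ContDiffAt ℝ ∞ (fun y => extChartAt I (g x) (g y)) x :=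
    (contDiffOn_extChartAt_comp hg (g x)).contDiffAt (hO.mem_nhds ⟨hx, hx0⟩)
  set h : V → E := fun y => extChartAt I (g x) (g y) with hdef
  have hA : HasFDerivAt (α.inChart (g x)) (fderiv ℝ (α.inChart (g x)) (h x)) (h x) :=
    (((hα (g x)).contDiffAt ((isOpen_extChartAt_target (g x)).mem_nhds
      (mem_extChartAt_target (g x)))).differentiableAt (by simp)).hasFDerivAt
  have h1 : HasFDerivAt h (fderiv ℝ h x) x := (hh.differentiableAt (by simp)).hasFDerivAt
  have h2 : HasFDerivAt (fderiv ℝ h) (fderiv ℝ (fderiv ℝ h) x) x :=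
    ((hh.fderiv_right (m := 1) (by norm_num; exact ENat.LEInfty.out)).differentiableAt (by simp)).hasFDerivAt
  have h3 := (hA.comp x h1).clm_apply (h2.clm_apply (hasFDerivAt_const v x))
  refine ⟨_, h3.congr_of_eventuallyEq ?_, fun u => ?_⟩
  · filter_upwards [hO.mem_nhds ⟨hx, hx0⟩] with y hy
    rw [Function.comp_apply, ← chartDeriv_plotDeriv hU hg hy.1 hy.2 v]
    exact (α.inChart_apply hy.2 _).symm
  · rw [chartDeriv_plotDeriv hU hg hx hx0, chartDeriv_plotDeriv hU hg hx hx0]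
    simp [h, add_comm]

/-- The exterior derivative of a one-form, evaluated on the derivatives of a smooth map from a
normed space. -/
theorem OneForm.d_plotDeriv {α : OneForm I M} (hα : α.IsSmooth) (hU : IsOpen U)
    (hg : ContMDiffOn 𝓘(ℝ, V) I ∞ g U) (hx : x ∈ U) (u v : V) :
    α.d (g x) (plotDeriv I g x u) (plotDeriv I g x v)
      = fderiv ℝ (fun y => α (g y) (plotDeriv I g y v)) x u
        - fderiv ℝ (fun y => α (g y) (plotDeriv I g y u)) x v := by
  obtain ⟨L, hL, eL⟩ := hasFDerivAt_oneForm hα hU hg hx v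
  obtain ⟨L', hL', eL'⟩ := hasFDerivAt_oneForm hα hU hg hx u
  have hx0 : g x ∈ (chartAt H (g x)).source := mem_chart_source H _
  have hO := isOpen_chart_preimage hU hg (g x)
  have hh : ContDiffAt ℝ ∞ (fun y => extChartAt I (g x) (g y)) x :=
    (contDiffOn_extChartAt_comp hg (g x)).contDiffAt (hO.mem_nhds ⟨hx, hx0⟩)
  rw [hL.fderiv, hL'.fderiv, eL, eL', fderiv_fderiv_symm hh u v]
  refine Eq.trans (b := fderiv ℝ (α.inChart (g x)) (extChartAt I (g x) (g x))
        (chartDeriv I (g x) (g x) (plotDeriv I g x u)) (chartDeriv I (g x) (g x) (plotDeriv I g x v))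
      - fderiv ℝ (α.inChart (g x)) (extChartAt I (g x) (g x))
        (chartDeriv I (g x) (g x) (plotDeriv I g x v))
        (chartDeriv I (g x) (g x) (plotDeriv I g x u))) rfl ?_
  ring

theorem differentiableAt_oneForm {α : OneForm I M} (hα : α.IsSmooth) (hU : IsOpen U)
    (hg : ContMDiffOn 𝓘(ℝ, V) I ∞ g U) (hx : x ∈ U) (v : V) :
    DifferentiableAt ℝ (fun y => α (g y) (plotDeriv I g y v)) x := by
  obtain ⟨L, hL, -⟩ := hasFDerivAt_oneForm hα hU hg hx v
  exact hL.differentiableAt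

theorem hasFDerivAt_twoForm {Ω : TwoForm I M} (hΩ : Ω.IsSmooth) (hU : IsOpen U)
    (hg : ContMDiffOn 𝓘(ℝ, V) I ∞ g U) (hx : x ∈ U) (v w : V) :
    ∃ L : V →L[ℝ] ℝ,
      HasFDerivAt (fun y => Ω (g y) (plotDeriv I g y v) (plotDeriv I g y w)) L x ∧ ∀ u, L u =
      fderiv ℝ (Ω.inChart (g x)) (extChartAt I (g x) (g x))
        (chartDeriv I (g x) (g x) (plotDeriv I g x u)) (chartDeriv I (g x) (g x) (plotDeriv I g x v))
        (chartDeriv I (g x) (g x) (plotDeriv I g x w))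
      + Ω.inChart (g x) (extChartAt I (g x) (g x))
        (fderiv ℝ (fderiv ℝ (fun y => extChartAt I (g x) (g y))) x u v)
        (chartDeriv I (g x) (g x) (plotDeriv I g x w))
      + Ω.inChart (g x) (extChartAt I (g x) (g x))
        (chartDeriv I (g x) (g x) (plotDeriv I g x v))
        (fderiv ℝ (fderiv ℝ (fun y => extChartAt I (g x) (g y))) x u w) := by
  have hx0 : g x ∈ (chartAt H (g x)).source := mem_chart_source H _
  have hO := isOpen_chart_preimage hU hg (g x)
  have hh : ContDiffAt ℝ ∞ (fun y => extChartAt I (g x) (g y)) x :=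
    (contDiffOn_extChartAt_comp hg (g x)).contDiffAt (hO.mem_nhds ⟨hx, hx0⟩)
  set h : V → E := fun y => extChartAt I (g x) (g y) with hdef
  have hA : HasFDerivAt (Ω.inChart (g x)) (fderiv ℝ (Ω.inChart (g x)) (h x)) (h x) :=
    (((hΩ (g x)).contDiffAt ((isOpen_extChartAt_target (g x)).mem_nhds
      (mem_extChartAt_target (g x)))).differentiableAt (by simp)).hasFDerivAt
  have h1 : HasFDerivAt h (fderiv ℝ h x) x := (hh.differentiableAt (by simp)).hasFDerivAt
  have h2 : HasFDerivAt (fderiv ℝ h) (fderiv ℝ (fderiv ℝ h) x) x :=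
    ((hh.fderiv_right (m := 1) (by norm_num; exact ENat.LEInfty.out)).differentiableAt (by simp)).hasFDerivAt
  have hA' : HasFDerivAt (fun y => Ω.inChart (g x) (h y))
      ((fderiv ℝ (Ω.inChart (g x)) (h x)).comp (fderiv ℝ h x)) x := by
    have := HasFDerivAt.comp (g := Ω.inChart (g x)) (g' := fderiv ℝ (Ω.inChart (g x)) (h x)) x hA h1
    exact this
  have h3 := (hA'.clm_apply (h2.clm_apply (hasFDerivAt_const v x))).clm_apply
    (h2.clm_apply (hasFDerivAt_const w x))
  refine ⟨_, h3.congr_of_eventuallyEq ?_, fun u => ?_⟩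
  · filter_upwards [hO.mem_nhds ⟨hx, hx0⟩] with y hy
    rw [← chartDeriv_plotDeriv hU hg hy.1 hy.2 v,
      ← chartDeriv_plotDeriv hU hg hy.1 hy.2 w]
    exact (Ω.inChart_apply hy.2 _ _).symm
  · rw [chartDeriv_plotDeriv hU hg hx hx0, chartDeriv_plotDeriv hU hg hx hx0,
      chartDeriv_plotDeriv hU hg hx hx0]
    simp [h]
    ring

theorem differentiableAt_twoForm {Ω : TwoForm I M} (hΩ : Ω.IsSmooth) (hU : IsOpen U)
    (hg : ContMDiffOn 𝓘(ℝ, V) I ∞ g U) (hx : x ∈ U) (v w : V) :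
    DifferentiableAt ℝ (fun y => Ω (g y) (plotDeriv I g y v) (plotDeriv I g y w)) x := by
  obtain ⟨L, hL, -⟩ := hasFDerivAt_twoForm hΩ hU hg hx v w
  exact hL.differentiableAt

/-- Closedness of a symplectic form, evaluated on the derivatives of a smooth map from a normed
space. -/
theorem IsSymplecticForm.closed_plotDeriv {Ω : TwoForm I M} (hΩ : IsSymplecticForm Ω)
    (hU : IsOpen U) (hg : ContMDiffOn 𝓘(ℝ, V) I ∞ g U) (hx : x ∈ U) (u v w : V) :
    fderiv ℝ (fun y => Ω (g y) (plotDeriv I g y v) (plotDeriv I g y w)) x u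
      - fderiv ℝ (fun y => Ω (g y) (plotDeriv I g y u) (plotDeriv I g y w)) x v
      + fderiv ℝ (fun y => Ω (g y) (plotDeriv I g y u) (plotDeriv I g y v)) x w = 0 := by
  obtain ⟨L, hL, eL⟩ := hasFDerivAt_twoForm hΩ.smooth hU hg hx v w
  obtain ⟨L', hL', eL'⟩ := hasFDerivAt_twoForm hΩ.smooth hU hg hx u w
  obtain ⟨L'', hL'', eL''⟩ := hasFDerivAt_twoForm hΩ.smooth hU hg hx u v
  have hx0 : g x ∈ (chartAt H (g x)).source := mem_chart_source H _
  have hO := isOpen_chart_preimage hU hg (g x)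
  have hh : ContDiffAt ℝ ∞ (fun y => extChartAt I (g x) (g y)) x :=
    (contDiffOn_extChartAt_comp hg (g x)).contDiffAt (hO.mem_nhds ⟨hx, hx0⟩)
  have hsk : ∀ a b : E, Ω.inChart (g x) (extChartAt I (g x) (g x)) a b
      = -Ω.inChart (g x) (extChartAt I (g x) (g x)) b a := by
    have halt : ∀ a : E, Ω.inChart (g x) (extChartAt I (g x) (g x)) a a = 0 := fun a => by
      rw [← chartDeriv_chartInv (I := I) hx0 a, Ω.inChart_apply hx0]
      exact hΩ.alternating _ _
    intro a b
    have := halt (a + b)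
    rw [map_add, map_add, add_apply, add_apply, halt, halt] at this
    linarith
  have hcl := hΩ.closed (g x) (chartDeriv I (g x) (g x) (plotDeriv I g x u))
    (chartDeriv I (g x) (g x) (plotDeriv I g x v)) (chartDeriv I (g x) (g x) (plotDeriv I g x w))
  -- Three of the six second-derivative terms are turned into the other three by symmetry of second
  -- derivatives and skew-symmetry of the form; only the chart expression of closedness survives.
  rw [hL.fderiv, hL'.fderiv, hL''.fderiv, eL, eL', eL'', fderiv_fderiv_symm hh v u,
    fderiv_fderiv_symm hh w u, fderiv_fderiv_symm hh w v,
    hsk (chartDeriv I (g x) (g x) (plotDeriv I g x u)) (fderiv ℝ (fderiv ℝ (fun y => extChartAt I (g x) (g y))) x v w),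
    hsk (chartDeriv I (g x) (g x) (plotDeriv I g x v)) (fderiv ℝ (fderiv ℝ (fun y => extChartAt I (g x) (g y))) x u w)]
  linarith

omit [I.Boundaryless] in
/-- A curve with vanishing velocity is constant. -/
theorem eq_of_plotDeriv_eq_zero {c : ℝ → M} (hc : ContMDiff 𝓘(ℝ, ℝ) I ∞ c)
    (h : ∀ t, plotDeriv I c t 1 = 0) (a b : ℝ) : c a = c b := by
  have hc' : ContMDiffOn 𝓘(ℝ, ℝ) I ∞ c Set.univ := hc.contMDiffOn
  have hloc : IsLocallyConstant c := by
    rw [IsLocallyConstant.iff_eventually_eq]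
    intro t
    have ht0 : c t ∈ (chartAt H (c t)).source := mem_chart_source H _
    have hO := isOpen_chart_preimage isOpen_univ hc' (c t)
    obtain ⟨ε, hε, hball⟩ := Metric.isOpen_iff.1 hO t ⟨trivial, ht0⟩
    filter_upwards [Metric.ball_mem_nhds t hε] with s hs
    have hd : DifferentiableOn ℝ (fun y => extChartAt I (c t) (c y)) (Metric.ball t ε) :=
      ((contDiffOn_extChartAt_comp hc' (c t)).differentiableOn (by simp)).mono hball
    have hz : ∀ y ∈ Metric.ball t ε, fderivWithin ℝ (fun y => extChartAt I (c t) (c y))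
        (Metric.ball t ε) y = 0 := by
      intro y hy
      rw [fderivWithin_of_isOpen Metric.isOpen_ball hy]
      ext
      have := chartDeriv_plotDeriv isOpen_univ hc' (x := y) trivial (hball hy).2 1
      rw [h y, map_zero] at this
      simpa using this.symm
    have key := (convex_ball t ε).is_const_of_fderivWithin_eq_zero hd hz hs
      (Metric.mem_ball_self hε)
    have i1 : c s ∈ (extChartAt I (c t)).source := by
      rw [extChartAt_source]; exact (hball hs).2
    have i2 : c t ∈ (extChartAt I (c t)).source := mem_extChartAt_source _
    exact (extChartAt I (c t)).injOn i1 i2 key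
  exact hloc.apply_eq_of_preconnectedSpace a b

end Plots

end CoisotropicIndex

/-! ### The normal form and the Reeb vectors. -/

namespace CoisotropicIndex

theorem exists_form_eq {T F : Type*} [NormedAddCommGroup T] [NormedSpace ℝ T]
    [FiniteDimensional ℝ T] [NormedAddCommGroup F] [NormedSpace ℝ F] (D : T →L[ℝ] F)
    (B : F →L[ℝ] F →L[ℝ] ℝ) (hB : ∀ X, (∀ Y, B (D X) (D Y) = 0) → X = 0) (L : T →ₗ[ℝ] ℝ) :
    ∃ X, ∀ Y, B (D X) (D Y) = L Y := by
  let b : T →ₗ[ℝ] Module.Dual ℝ T :=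
    LinearMap.mk₂ ℝ (fun X Y : T => B (D X) (D Y)) (by simp) (by simp) (by simp) (by simp)
  have hinj : Function.Injective b := by
    rw [injective_iff_map_eq_zero]
    exact fun X hX => hB X fun Y => congrArg (fun L : Module.Dual ℝ T => L Y) hX
  obtain ⟨X, hX⟩ := (LinearMap.injective_iff_surjective_of_finrank_eq_finrank
    (Subspace.dual_finrank_eq (K := ℝ) (V := T)).symm).1 hinj L
  exact ⟨X, fun Y => congrArg (fun L : Module.Dual ℝ T => L Y) hX⟩

section NormalForm

variable {E : Type*} [NormedAddCommGroup E] [NormedSpace ℝ E]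
  {H : Type*} [TopologicalSpace H] {I : ModelWithCorners ℝ E H}
  {M : Type*} [TopologicalSpace M] [ChartedSpace H M]
  {F : Type*} [NormedAddCommGroup F] [NormedSpace ℝ F]
  {G : Type*} [TopologicalSpace G] {J : ModelWithCorners ℝ F G}
  {W : Type*} [TopologicalSpace W] [ChartedSpace G W]
  {k m : ℕ} {Ω : TwoForm J W} {α : Fin k → OneForm I M} {r : ℝ}
  {ψ : M × EuclideanSpace ℝ (Fin k) → W}

/-- The tangent vector of `M × ℝ^k` with the given components. -/
def pairVec (z : M × EuclideanSpace ℝ (Fin k)) (v : TangentSpace I z.1)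
    (w : EuclideanSpace ℝ (Fin k)) : TangentSpace (I.prod (𝓡 k)) z :=
  (show E × EuclideanSpace ℝ (Fin k) from (v, w))

/-- The zero section of a tube. -/
def zeroSection (ψ : M × EuclideanSpace ℝ (Fin k) → W) (q : M) : W := ψ (q, 0)

/-- A coisotropic submanifold, given as the zero section of a normal form neighbourhood. -/
structure IsStableTube (m : ℕ) (Ω : TwoForm J W) (α : Fin k → OneForm I M) (r : ℝ)
    (ψ : M × EuclideanSpace ℝ (Fin k) → W) : Prop where
  symplectic : IsSymplecticForm Ω
  coisotropic : IsCoisotropicEmbedding I Ω (zeroSection ψ)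
  stable : IsStabilizing m (Ω.pullback I (zeroSection ψ)) α
  nbhd : IsNormalFormNbhd Ω (zeroSection ψ) α r ψ

theorem isOpen_tube : IsOpen (tube M k r) := by
  exact isOpen_lt (continuous_snd.norm) continuous_const

namespace IsStableTube

variable (h : IsStableTube m Ω α r ψ)
include h

theorem zero_mem (q : M) : (q, (0 : EuclideanSpace ℝ (Fin k))) ∈ tube M k r := by
  simpa [tube] using h.nbhd.pos

theorem smooth : ContMDiffOn (I.prod (𝓡 k)) J ∞ ψ (tube M k r) :=
  h.nbhd.localDiffeo.contMDiffOn

theorem form_skew (x : W) (v w : TangentSpace J x) : Ω x v w = -Ω x w v := by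
  have := h.symplectic.alternating x (v + w)
  rw [map_add, map_add, add_apply, add_apply, h.symplectic.alternating, h.symplectic.alternating]
    at this
  linarith

theorem normalForm_skew (z : M × EuclideanSpace ℝ (Fin k))
    (X Y : TangentSpace (I.prod (𝓡 k)) z) :
    normalForm (Ω.pullback I (zeroSection ψ)) α z X Y
      = -normalForm (Ω.pullback I (zeroSection ψ)) α z Y X := by
  have h1 : (Ω.pullback I (zeroSection ψ)) z.1 (horizontal X) (horizontal Y)
    = -(Ω.pullback I (zeroSection ψ)) z.1 (horizontal Y) (horizontal X) := h.form_skew _ _ _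
  rw [normalForm, normalForm, h1, neg_add, ← Finset.sum_neg_distrib]
  congr 1
  refine Finset.sum_congr rfl fun j _ => ?_
  rw [OneForm.d, OneForm.d]
  ring

theorem bijective {z : M × EuclideanSpace ℝ (Fin k)} (hz : z ∈ tube M k r) :
    Function.Bijective (mfderiv (I.prod (𝓡 k)) J ψ z) :=
  ((h.nbhd.localDiffeo ⟨z, hz⟩).mfderivToContinuousLinearEquiv (by simp)).bijective

theorem normalForm_nondegenerate {z : M × EuclideanSpace ℝ (Fin k)} (hz : z ∈ tube M k r)
    (X : TangentSpace (I.prod (𝓡 k)) z)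
    (hX : ∀ Y, normalForm (Ω.pullback I (zeroSection ψ)) α z X Y = 0) : X = 0 := by
  obtain ⟨hi, hs⟩ := h.bijective hz
  apply hi
  rw [map_zero]
  refine h.symplectic.nondegenerate _ _ fun w => ?_
  obtain ⟨Y, rfl⟩ := hs w
  rw [h.nbhd.pullback z hz, hX]

theorem mdifferentiableAt {z : M × EuclideanSpace ℝ (Fin k)} (hz : z ∈ tube M k r) :
    MDifferentiableAt (I.prod (𝓡 k)) J ψ z :=
  (h.smooth.contMDiffAt (isOpen_tube.mem_nhds hz)).mdifferentiableAt (by simp)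

theorem mfderiv_zeroSection (q : M) (v : TangentSpace I q) :
    mfderiv I J (zeroSection ψ) q v = mfderiv (I.prod (𝓡 k)) J ψ (q, 0) (pairVec (q, 0) v 0) := by
  have h1 : MDifferentiableAt I (I.prod (𝓡 k))
      (fun q : M => (q, (0 : EuclideanSpace ℝ (Fin k)))) q :=
    mdifferentiableAt_id.prodMk mdifferentiableAt_const
  have h3 : mfderiv I (I.prod (𝓡 k)) (fun q : M => (q, (0 : EuclideanSpace ℝ (Fin k)))) q v
      = pairVec (q, 0) v 0 := by
    rw [mfderiv_prod_left]
    rfl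
  have h2 := mfderiv_comp_apply (I' := I.prod (𝓡 k)) (I'' := J) (g := ψ)
    (f := fun q : M => (q, (0 : EuclideanSpace ℝ (Fin k)))) q
    (h.mdifferentiableAt (h.zero_mem q)) h1 v
  rw [h3] at h2
  exact h2

/-- A tangent vector to `M × 0` normal to `M × 0` lies in the characteristic distribution. -/
theorem vertical_eq_zero (q : M) (v : TangentSpace I q) (w : EuclideanSpace ℝ (Fin k))
    (hvw : ∀ y : TangentSpace I q, normalForm (Ω.pullback I (zeroSection ψ)) α (q, 0)
      (pairVec (q, 0) v w) (pairVec (q, 0) y 0) = 0) : w = 0 := by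
  have hz := h.zero_mem q
  obtain ⟨y, hy⟩ := h.coisotropic.coisotropic q
    (mfderiv (I.prod (𝓡 k)) J ψ (q, 0) (pairVec (q, 0) v w)) fun y => by
      rw [h.mfderiv_zeroSection]
      exact (h.nbhd.pullback (q, 0) hz _ _).trans (hvw y)
  rw [h.mfderiv_zeroSection] at hy
  have := (h.bijective hz).1 hy
  exact (congrArg (fun X : E × EuclideanSpace ℝ (Fin k) => X.2) this).symm

/-- At a point of the zero section such a `(v, 0)` is in the kernel of the normal form, which is
nondegenerate. So the `α_i` separate the vectors of `T𝓕`, and a vector of `TM` is determined by the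
`α_i` together with its pairing under `ω_M`. This identifies vectors in all that follows. -/
theorem eq_zero_of_char {q : M} {v : TangentSpace I q}
    (hv : v ∈ charDist (Ω.pullback I (zeroSection ψ)) q) (ha : ∀ i, α i q v = 0) : v = 0 := by
  have := h.normalForm_nondegenerate (h.zero_mem q) (pairVec (q, 0) v 0) fun Y => by
    have h1 : (Ω.pullback I (zeroSection ψ)) q v (horizontal Y) = 0 := by
      have : (Ω.pullback I (zeroSection ψ)) q v = 0 := hv
      rw [this]; rfl
    refine Eq.trans (b := (Ω.pullback I (zeroSection ψ)) q v (horizontal Y) + ∑ j,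
      ((0 : EuclideanSpace ℝ (Fin k)) j * (α j).d q v (horizontal Y) +
      ((0 : EuclideanSpace ℝ (Fin k)) j * α j q (horizontal Y) - vertical Y j * α j q v))) rfl ?_
    simp [h1, ha]
  exact congrArg (fun X : E × EuclideanSpace ℝ (Fin k) => X.1) this

end IsStableTube

/-- The combination of the Reeb vectors with coefficients `p`. -/
def IsReeb (ΩM : TwoForm I M) (α : Fin k → OneForm I M) (q : M) (p : EuclideanSpace ℝ (Fin k))
    (v : TangentSpace I q) : Prop :=
  v ∈ charDist ΩM q ∧ ∀ i, α i q v = p i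

namespace IsStableTube

variable (h : IsStableTube m Ω α r ψ)
include h

theorem isReeb_unique {q : M} {p : EuclideanSpace ℝ (Fin k)} {v w : TangentSpace I q}
    (hv : IsReeb (Ω.pullback I (zeroSection ψ)) α q p v)
    (hw : IsReeb (Ω.pullback I (zeroSection ψ)) α q p w) : v = w := by
  rw [← sub_eq_zero]
  exact h.eq_zero_of_char (Submodule.sub_mem _ hv.1 hw.1) fun i => by
    rw [map_sub, hv.2, hw.2, sub_self]

/-- Represent the covector `-∑ p_i dp_i` at `(q, 0)` by the nondegenerate form. The resulting vector
is orthogonal to `TM`, hence tangent to `M` by coisotropy. Testing it against horizontal and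
vertical vectors gives the two defining conditions. -/
theorem exists_isReeb [FiniteDimensional ℝ E] (q : M) (p : EuclideanSpace ℝ (Fin k)) :
    ∃ v, IsReeb (Ω.pullback I (zeroSection ψ)) α q p v := by
  have hz := h.zero_mem q
  obtain ⟨X, hX⟩ := exists_form_eq (T := E × EuclideanSpace ℝ (Fin k))
    (F := F)
    (D := mfderiv (I.prod (𝓡 k)) J ψ (q, 0)) (B := show F →L[ℝ] F →L[ℝ] ℝ from Ω (ψ (q, 0)))
    (fun X hX => h.normalForm_nondegenerate hz _ fun Y =>
      (h.nbhd.pullback (q, 0) hz _ _).symm.trans (hX Y))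
    (-∑ i, p i • (EuclideanSpace.proj i : EuclideanSpace ℝ (Fin k) →L[ℝ] ℝ).toLinearMap ∘ₗ
      LinearMap.snd ℝ E (EuclideanSpace ℝ (Fin k)))
  have hXY : ∀ Y : E × EuclideanSpace ℝ (Fin k),
      normalForm (Ω.pullback I (zeroSection ψ)) α (q, 0)
      (pairVec (q, 0) X.1 X.2) (pairVec (q, 0) Y.1 Y.2) = -∑ i, p i * Y.2 i := fun Y =>
    (h.nbhd.pullback (q, 0) hz _ _).symm.trans ((hX Y).trans (by simp))
  have hv : X.2 = 0 := h.vertical_eq_zero q X.1 X.2 fun y => by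
    rw [hXY (y, 0)]
    simp
  refine ⟨X.1, ?_, fun i => ?_⟩
  · refine ContinuousLinearMap.ext fun y => ?_
    have h1 : (Ω.pullback I (zeroSection ψ)) q X.1 y + ∑ j,
      ((0 : EuclideanSpace ℝ (Fin k)) j * (α j).d q X.1 y +
      (X.2 j * α j q y - (0 : EuclideanSpace ℝ (Fin k)) j * α j q X.1))
        = -∑ i, p i * (0 : EuclideanSpace ℝ (Fin k)) i := hXY (y, 0)
    simpa [hv] using h1
  · have h1 : (Ω.pullback I (zeroSection ψ)) q X.1 (0 : TangentSpace I q) + ∑ j,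
      ((0 : EuclideanSpace ℝ (Fin k)) j * (α j).d q X.1 (0 : TangentSpace I q) +
      (X.2 j * α j q (0 : TangentSpace I q) - (EuclideanSpace.single i (1 : ℝ)) j * α j q X.1))
        = -∑ l, p l * (EuclideanSpace.single i (1 : ℝ)) l := hXY (0, EuclideanSpace.single i 1)
    simpa [hv] using h1

/-- Stability removes the terms `z.2 j * dα_j`, so the contraction is `-∑ p_i dp_i` at every height
of the tube, not only on the zero section. With `p = z.2` this is `-dρ`. -/
theorem normalForm_reeb {z : M × EuclideanSpace ℝ (Fin k)} {p : EuclideanSpace ℝ (Fin k)}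
    {v : TangentSpace I z.1}
    (hv : IsReeb (Ω.pullback I (zeroSection ψ)) α z.1 p v) (Y : TangentSpace (I.prod (𝓡 k)) z) :
    normalForm (Ω.pullback I (zeroSection ψ)) α z (pairVec z v 0) Y
      = -∑ i, p i * vertical Y i := by
  have h1 : (Ω.pullback I (zeroSection ψ)) z.1 v (horizontal Y) = 0 := by
    have : (Ω.pullback I (zeroSection ψ)) z.1 v = 0 := hv.1
    rw [this]; rfl
  have h2 := fun j => h.stable.ker_le j z.1 v hv.1 (horizontal Y)
  refine Eq.trans (b := (Ω.pullback I (zeroSection ψ)) z.1 v (horizontal Y) + ∑ j,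
    (z.2 j * (α j).d z.1 v (horizontal Y) +
    ((0 : EuclideanSpace ℝ (Fin k)) j * α j z.1 (horizontal Y) - vertical Y j * α j z.1 v))) rfl ?_
  simp [h1, h2, hv.2, mul_comm]

theorem eq_pairVec_reeb {z : M × EuclideanSpace ℝ (Fin k)} (hz : z ∈ tube M k r)
    {p : EuclideanSpace ℝ (Fin k)} {v : TangentSpace I z.1}
    (hv : IsReeb (Ω.pullback I (zeroSection ψ)) α z.1 p v) {X : TangentSpace (I.prod (𝓡 k)) z}
    (hX : ∀ Y : TangentSpace (I.prod (𝓡 k)) z,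
      normalForm (Ω.pullback I (zeroSection ψ)) α z X Y = -∑ i, p i * vertical Y i) :
    X = pairVec z v 0 := by
  apply (h.bijective hz).1
  rw [← sub_eq_zero]
  refine h.symplectic.nondegenerate _ _ fun w => ?_
  obtain ⟨Y, rfl⟩ := (h.bijective hz).2 w
  rw [map_sub, sub_apply, h.nbhd.pullback z hz, h.nbhd.pullback z hz, hX, h.normalForm_reeb hv,
    sub_self]

end IsStableTube
end NormalForm
end CoisotropicIndex

namespace CoisotropicIndex

/-! ### Chain rules and parametrizations by tangent vectors. -/

section PlotCalculus

variable {E : Type*} [NormedAddCommGroup E] [NormedSpace ℝ E]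
  {H : Type*} [TopologicalSpace H] {I : ModelWithCorners ℝ E H}
  {M : Type*} [TopologicalSpace M] [ChartedSpace H M]
  {V : Type*} [NormedAddCommGroup V] [NormedSpace ℝ V] {g : V → M} {U : Set V} {x : V}
  {V' : Type*} [NormedAddCommGroup V'] [NormedSpace ℝ V']

theorem plotDeriv_congr {g' : V → M} (hgg : g =ᶠ[𝓝 x] g') (v : V) :
    (⟨g x, plotDeriv I g x v⟩ : TangentBundle I M) = ⟨g' x, plotDeriv I g' x v⟩ := by
  have h1 : (plotDeriv I g x v : E) = plotDeriv I g' x v :=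
    congrArg (fun L : V →L[ℝ] E => L v) (hgg.mfderiv_eq (I := 𝓘(ℝ, V)) (I' := I))
  have h2 := hgg.eq_of_nhds
  have key : ∀ (a b : M) (v w : E), a = b → v = w →
      (⟨a, v⟩ : TangentBundle I M) = ⟨b, w⟩ := by
    rintro a _ v _ rfl rfl; rfl
  exact key _ _ _ _ h2 h1

theorem plotDeriv_comp {f : V' → V} {y : V'} (hg : MDifferentiableAt 𝓘(ℝ, V) I g (f y))
    (hf : DifferentiableAt ℝ f y) (v : V') :
    plotDeriv I (fun y => g (f y)) y v = plotDeriv I g (f y) (fderiv ℝ f y v) := by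
  have := mfderiv_comp_apply (I' := 𝓘(ℝ, V)) (I'' := I) (g := g) (f := f) y hg
    hf.mdifferentiableAt v
  rw [mfderiv_eq_fderiv] at this
  exact this

theorem plotDeriv_map {F : Type*} [NormedAddCommGroup F] [NormedSpace ℝ F]
    {G : Type*} [TopologicalSpace G] {J : ModelWithCorners ℝ F G}
    {W : Type*} [TopologicalSpace W] [ChartedSpace G W] {f : M → W}
    (hf : MDifferentiableAt I J f (g x)) (hg : MDifferentiableAt 𝓘(ℝ, V) I g x) (v : V) :
    plotDeriv J (fun y => f (g y)) x v = mfderiv I J f (g x) (plotDeriv I g x v) :=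
  mfderiv_comp_apply (I' := I) (I'' := J) (g := f) (f := g) x hf hg v

theorem mfderiv_pair {k : ℕ} {p : V → EuclideanSpace ℝ (Fin k)}
    (hg : MDifferentiableAt 𝓘(ℝ, V) I g x) (hp : DifferentiableAt ℝ p x) (v : V) :
    mfderiv 𝓘(ℝ, V) (I.prod (𝓡 k)) (fun y => (g y, p y)) x v
      = pairVec (g x, p x) (plotDeriv I g x v) (fderiv ℝ p x v) := by
  rw [mfderiv_prodMk hg hp.mdifferentiableAt, mfderiv_eq_fderiv]
  rfl

variable [IsManifold I ∞ M] [I.Boundaryless]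

/-- A parametrization of a neighbourhood of `q` by tangent vectors. -/
theorem exists_plot (q : M) : ∃ (U : Set E) (g : E → M), IsOpen U ∧ (0 : E) ∈ U ∧
    ContMDiffOn 𝓘(ℝ, E) I ∞ g U ∧ g 0 = q ∧
    ∀ v : TangentSpace I q, (⟨g 0, plotDeriv I g 0 (v : E)⟩ : TangentBundle I M) = ⟨q, v⟩ := by
  let c : E → E := fun y => extChartAt I q q + y
  have hc : ContDiff ℝ ∞ c := contDiff_const.add contDiff_id
  have h0 : c 0 = extChartAt I q q := add_zero _
  have hg0 : (extChartAt I q).symm (c 0) = q := by rw [h0]; exact extChartAt_to_inv q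
  have hm : c 0 ∈ (extChartAt I q).target := by rw [h0]; exact mem_extChartAt_target q
  refine ⟨c ⁻¹' (extChartAt I q).target, fun y => (extChartAt I q).symm (c y),
    (isOpen_extChartAt_target q).preimage hc.continuous, hm, ?_, hg0, fun v => ?_⟩
  · exact (contMDiffOn_extChartAt_symm q).comp hc.contMDiff.contMDiffOn fun y hy => hy
  · have hsm : MDifferentiableAt 𝓘(ℝ, E) I (extChartAt I q).symm (c 0) :=
      ((contMDiffOn_extChartAt_symm (n := ∞) (I := I) q).contMDiffAt
        ((isOpen_extChartAt_target q).mem_nhds hm)).mdifferentiableAt (by simp)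
    have h1 := plotDeriv_comp (g := (extChartAt I q).symm) hsm
      (hc.differentiable (by simp)).differentiableAt (v : E)
    have h2 : fderiv ℝ c 0 = ContinuousLinearMap.id ℝ E := by
      simp only [c]
      rw [fderiv_const_add, fderiv_fun_id]
    rw [h1, h2]
    have h3 : symmDeriv I q (extChartAt I q q) (v : E) = v := by
      have := symmDeriv_chartDeriv (I := I) (mem_chart_source H q) v
      rwa [chartDeriv_self] at this
    have key : ∀ (a b : M) (v w : E), a = b → v = w →
        (⟨a, v⟩ : TangentBundle I M) = ⟨b, w⟩ := by
      rintro a _ v _ rfl rfl; rfl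
    refine key _ _ _ _ hg0 (Eq.trans ?_ h3)
    rw [← h0]
    rfl

end PlotCalculus

/-! ### The Hamiltonian flow of `ρ` and its conserved momentum. -/

section Flow

variable {E : Type*} [NormedAddCommGroup E] [NormedSpace ℝ E]
  {H : Type*} [TopologicalSpace H] {I : ModelWithCorners ℝ E H}
  {M : Type*} [TopologicalSpace M] [ChartedSpace H M]
  {F : Type*} [NormedAddCommGroup F] [NormedSpace ℝ F]
  {G : Type*} [TopologicalSpace G] {J : ModelWithCorners ℝ F G}
  {W : Type*} [TopologicalSpace W] [ChartedSpace G W]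
  {k m : ℕ} {Ω : TwoForm J W} {α : Fin k → OneForm I M} {r : ℝ}
  {ψ : M × EuclideanSpace ℝ (Fin k) → W}
  {φ : ℝ → M × EuclideanSpace ℝ (Fin k) → M × EuclideanSpace ℝ (Fin k)}
  {V : Type*} [NormedAddCommGroup V] [NormedSpace ℝ V] {g : V → M} {U : Set V} {x : V}
  {p : V → EuclideanSpace ℝ (Fin k)}

theorem mfderiv_rho (z : M × EuclideanSpace ℝ (Fin k)) (Y : TangentSpace (I.prod (𝓡 k)) z) :
    mfderiv (I.prod (𝓡 k)) 𝓘(ℝ, ℝ) (rho M k) z Y = ∑ i, z.2 i * vertical Y i := by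
  let f : EuclideanSpace ℝ (Fin k) → ℝ := fun p => ‖p‖ ^ 2 / 2
  have hf : HasFDerivAt f (innerSL ℝ z.2) z.2 := by
    have := (hasStrictFDerivAt_norm_sq z.2).hasFDerivAt.const_mul (2 : ℝ)⁻¹
    rw [← Nat.cast_smul_eq_nsmul ℝ, smul_smul] at this
    norm_num at this
    refine this.congr_of_eventuallyEq (Filter.Eventually.of_forall fun p => ?_)
    simp only [f]; ring
  have h1 := mfderiv_comp_apply (I := I.prod (𝓡 k)) (I' := 𝓡 k) (I'' := 𝓘(ℝ, ℝ)) (g := f)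
    (f := Prod.snd) z hf.differentiableAt.mdifferentiableAt mdifferentiableAt_snd Y
  rw [mfderiv_snd, mfderiv_eq_fderiv, hf.fderiv] at h1
  refine Eq.trans (b := mfderiv (I.prod (𝓡 k)) 𝓘(ℝ, ℝ) (f ∘ Prod.snd) z Y) rfl (h1.trans ?_)
  change inner ℝ z.2 (vertical Y) = _
  rw [PiLp.inner_apply]
  exact Finset.sum_congr rfl fun i _ => by simp [mul_comm]

namespace IsStableTube

variable (h : IsStableTube m Ω α r ψ)
  (hφ : IsHamiltonianFlow (Ω.pullback I (zeroSection ψ)) α r (rho M k) φ)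
include h hφ

theorem flow_velocity {z : M × EuclideanSpace ℝ (Fin k)} (hz : z ∈ tube M k r) (t : ℝ)
    {v : TangentSpace I (φ t z).1}
    (hv : IsReeb (Ω.pullback I (zeroSection ψ)) α (φ t z).1 (φ t z).2 v) :
    mfderiv 𝓘(ℝ, ℝ) (I.prod (𝓡 k)) (fun s => φ s z) t (1 : ℝ) = pairVec (φ t z) v 0 :=
  h.eq_pairVec_reeb (hφ.mapsTo t hz) hv fun Y => by
    rw [hφ.hamilton z hz t Y, mfderiv_rho]
    rfl

omit h in
theorem flow_contMDiff {z : M × EuclideanSpace ℝ (Fin k)} (hz : z ∈ tube M k r) :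
    ContMDiff 𝓘(ℝ, ℝ) (I.prod (𝓡 k)) ∞ fun s => φ s z := by
  rw [← contMDiffOn_univ]
  exact hφ.smooth.comp (f := fun s : ℝ => (s, z)) (contMDiff_id.prodMk contMDiff_const).contMDiffOn
    fun s _ => ⟨trivial, hz⟩

/-- The velocity is a Reeb vector with zero vertical component. -/
theorem flow_snd [FiniteDimensional ℝ E] {z : M × EuclideanSpace ℝ (Fin k)} (hz : z ∈ tube M k r)
    (t : ℝ) : (φ t z).2 = z.2 := by
  have hc := flow_contMDiff hφ hz
  have hd : ContDiff ℝ ∞ fun s => (φ s z).2 :=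
    contMDiff_iff_contDiff.1 (contMDiff_snd.comp hc)
  have hz' : ∀ s, fderiv ℝ (fun s => (φ s z).2) s = 0 := fun s => by
    obtain ⟨v, hv⟩ := h.exists_isReeb (φ s z).1 (φ s z).2
    have h1 := h.flow_velocity hφ hz s hv
    have h2 := mfderiv_pair (g := fun s => (φ s z).1) (p := fun s => (φ s z).2) (x := s)
      ((contMDiff_fst.comp hc).contMDiffAt.mdifferentiableAt (by simp))
      (hd.differentiable (by simp)).differentiableAt (1 : ℝ)
    have h3 := congrArg (fun X : E × EuclideanSpace ℝ (Fin k) => X.2) (h2.symm.trans h1)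
    ext1
    exact h3
  rw [is_const_of_fderiv_eq_zero (hd.differentiable (by simp)) hz' t 0, hφ.zero z hz]

theorem flow_eq [FiniteDimensional ℝ E] {q : M} {p : EuclideanSpace ℝ (Fin k)} (hp : ‖p‖ < r)
    (t : ℝ) : φ t (q, p) = ((φ t (q, p)).1, p) :=
  Prod.ext rfl (h.flow_snd hφ (z := (q, p)) hp t)

omit h in
theorem contMDiffOn_flow {a : V → ℝ} (hg : ContMDiffOn 𝓘(ℝ, V) I ∞ g U)
    (hp : ContDiffOn ℝ ∞ p U) (hpr : ∀ x ∈ U, ‖p x‖ < r) (ha : ContDiffOn ℝ ∞ a U) :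
    ContMDiffOn 𝓘(ℝ, V) I ∞ (fun x => (φ (a x) (g x, p x)).1) U :=
  contMDiff_fst.comp_contMDiffOn (hφ.smooth.comp (f := fun x => (a x, (g x, p x)))
    (ha.contMDiffOn.prodMk (hg.prodMk hp.contMDiffOn)) fun x hx => ⟨trivial, hpr x hx⟩)

theorem flow_isReeb [FiniteDimensional ℝ E] {q : M} {p : EuclideanSpace ℝ (Fin k)} (hp : ‖p‖ < r)
    (t : ℝ) : IsReeb (Ω.pullback I (zeroSection ψ)) α (φ t (q, p)).1 p
      (plotDeriv I (fun s => (φ s (q, p)).1) t 1) := by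
  obtain ⟨v, hv⟩ := h.exists_isReeb (φ t (q, p)).1 p
  have hc := flow_contMDiff hφ (z := (q, p)) hp
  have hv' := hv
  have hps := h.flow_snd hφ (z := (q, p)) hp
  have h1 := h.flow_velocity hφ (z := (q, p)) hp t (v := v) (by rw [hps]; exact hv)
  have h2 := mfderiv_pair (g := fun s => (φ s (q, p)).1) (p := fun s => (φ s (q, p)).2) (x := t)
    ((contMDiff_fst.comp hc).contMDiffAt.mdifferentiableAt (by simp))
    (by simp only [hps]; fun_prop) (1 : ℝ)
  have h3 : plotDeriv I (fun s => (φ s (q, p)).1) t 1 = v :=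
    congrArg (fun X : E × EuclideanSpace ℝ (Fin k) => X.1) (h2.symm.trans h1)
  rw [h3]
  exact hv

end IsStableTube
end Flow
end CoisotropicIndex

/-! ### Evolution of the forms along the flow. -/

namespace CoisotropicIndex

theorem eq_add_mul_of_fderiv_fst {V : Type*} [NormedAddCommGroup V] [NormedSpace ℝ V]
    {B : ℝ × V → ℝ} {x : V} {c : ℝ} (hB : ∀ t, DifferentiableAt ℝ B (t, x))
    (hc : ∀ t, fderiv ℝ B (t, x) (1, 0) = c) (t : ℝ) : B (t, x) = B (0, x) + t * c := by
  have hd : ∀ t, HasDerivAt (fun t => B (t, x) - t * c) 0 t := fun t => by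
    have h1 : HasDerivAt (fun t : ℝ => (t, x)) ((1 : ℝ), (0 : V)) t :=
      (hasDerivAt_id t).prodMk (hasDerivAt_const t x)
    have h2 := (hB t).hasFDerivAt.comp_hasDerivAt t h1
    rw [hc] at h2
    have h3 := h2.sub ((hasDerivAt_id t).mul_const c)
    rw [one_mul, sub_self] at h3
    exact h3
  have := is_const_of_deriv_eq_zero (fun t => (hd t).differentiableAt) (fun t => (hd t).deriv) t 0
  linarith

section Flow

variable {E : Type*} [NormedAddCommGroup E] [NormedSpace ℝ E] [FiniteDimensional ℝ E]
  {H : Type*} [TopologicalSpace H] {I : ModelWithCorners ℝ E H} [I.Boundaryless]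
  {M : Type*} [TopologicalSpace M] [ChartedSpace H M] [IsManifold I ∞ M]
  {F : Type*} [NormedAddCommGroup F] [NormedSpace ℝ F]
  {G : Type*} [TopologicalSpace G] {J : ModelWithCorners ℝ F G} [J.Boundaryless]
  {W : Type*} [TopologicalSpace W] [ChartedSpace G W] [IsManifold J ∞ W]
  {k m : ℕ} {Ω : TwoForm J W} {α : Fin k → OneForm I M} {r : ℝ}
  {ψ : M × EuclideanSpace ℝ (Fin k) → W}
  {φ : ℝ → M × EuclideanSpace ℝ (Fin k) → M × EuclideanSpace ℝ (Fin k)}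
  {V : Type*} [NormedAddCommGroup V] [NormedSpace ℝ V] {g : V → M} {U : Set V} {x : V}
  {p : V → EuclideanSpace ℝ (Fin k)}

namespace IsStableTube

theorem zeroSection_contMDiff (h : IsStableTube m Ω α r ψ) :
    ContMDiff I J ∞ (zeroSection ψ) := by
  rw [← contMDiffOn_univ]
  exact h.smooth.comp (f := fun q : M => (q, (0 : EuclideanSpace ℝ (Fin k))))
    (contMDiff_id.prodMk contMDiff_const).contMDiffOn fun q _ => h.zero_mem q

/-- Lets `ω_M`, a mere pull-back, be differentiated through `Ω`, whose smoothness and closedness are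
given. -/
theorem pullback_plotDeriv (h : IsStableTube m Ω α r ψ) (hg : MDifferentiableAt 𝓘(ℝ, V) I g x)
    (v w : V) :
    (Ω.pullback I (zeroSection ψ)) (g x) (plotDeriv I g x v) (plotDeriv I g x w)
      = Ω (zeroSection ψ (g x)) (plotDeriv J (fun y => zeroSection ψ (g y)) x v)
        (plotDeriv J (fun y => zeroSection ψ (g y)) x w) := by
  have hd : MDifferentiableAt I J (zeroSection ψ) (g x) :=
    h.zeroSection_contMDiff.contMDiffAt.mdifferentiableAt (by simp)
  rw [plotDeriv_map hd hg, plotDeriv_map hd hg]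
  rfl

variable (h : IsStableTube m Ω α r ψ)
  (hφ : IsHamiltonianFlow (Ω.pullback I (zeroSection ψ)) α r (rho M k) φ)
include h hφ

omit h [FiniteDimensional ℝ E] [I.Boundaryless] [IsManifold I ∞ M] [J.Boundaryless]
  [IsManifold J ∞ W] in
theorem contMDiffOn_flow_family (hg : ContMDiffOn 𝓘(ℝ, V) I ∞ g U) (hp : ContDiffOn ℝ ∞ p U)
    (hpr : ∀ x ∈ U, ‖p x‖ < r) :
    ContMDiffOn 𝓘(ℝ, ℝ × V) I ∞ (fun y : ℝ × V => (φ y.1 (g y.2, p y.2)).1) (Set.univ ×ˢ U) :=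
  contMDiffOn_flow hφ (hg.comp contDiff_snd.contMDiff.contMDiffOn fun y hy => hy.2)
    (hp.comp contDiff_snd.contDiffOn fun y hy => hy.2) (fun y hy => hpr _ hy.2)
    contDiff_fst.contDiffOn

omit [J.Boundaryless] [IsManifold J ∞ W] [I.Boundaryless] [IsManifold I ∞ M] in
theorem flow_family_isReeb (hU : IsOpen U) (hg : ContMDiffOn 𝓘(ℝ, V) I ∞ g U)
    (hp : ContDiffOn ℝ ∞ p U) (hpr : ∀ x ∈ U, ‖p x‖ < r) (t : ℝ) (hx : x ∈ U) :
    IsReeb (Ω.pullback I (zeroSection ψ)) α (φ t (g x, p x)).1 (p x)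
      (plotDeriv I (fun y : ℝ × V => (φ y.1 (g y.2, p y.2)).1) (t, x) (1, 0)) := by
  have hm := ((contMDiffOn_flow_family hφ hg hp hpr).contMDiffAt
    ((isOpen_univ.prod hU).mem_nhds (x := (t, x)) ⟨trivial, hx⟩)).mdifferentiableAt (by simp)
  have h1 : HasFDerivAt (fun s : ℝ => (s, x)) ((ContinuousLinearMap.id ℝ ℝ).prod 0) t :=
    (hasFDerivAt_id t).prodMk (hasFDerivAt_const x t)
  have := plotDeriv_comp (f := fun s : ℝ => (s, x)) (y := t) hm h1.differentiableAt 1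
  rw [h1.fderiv] at this
  have h2 := h.flow_isReeb hφ (hpr x hx) t (q := g x)
  have h3 : plotDeriv I (fun s => (φ s (g x, p x)).1) t 1 = plotDeriv I
    (fun y : ℝ × V => (φ y.1 (g y.2, p y.2)).1) (t, x) (1, 0) := this
  rwa [h3] at h2

omit h [J.Boundaryless] [IsManifold J ∞ W] [I.Boundaryless] [IsManifold I ∞ M]
  [FiniteDimensional ℝ E] in
theorem plotDeriv_flow_slice (hU : IsOpen U) (hg : ContMDiffOn 𝓘(ℝ, V) I ∞ g U)
    (hp : ContDiffOn ℝ ∞ p U) (hpr : ∀ x ∈ U, ‖p x‖ < r) (t : ℝ) (hx : x ∈ U) (v : V) :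
    plotDeriv I (fun x => (φ t (g x, p x)).1) x v
      = plotDeriv I (fun y : ℝ × V => (φ y.1 (g y.2, p y.2)).1) (t, x) (0, v) := by
  have hm := ((contMDiffOn_flow_family hφ hg hp hpr).contMDiffAt
    ((isOpen_univ.prod hU).mem_nhds (x := (t, x)) ⟨trivial, hx⟩)).mdifferentiableAt (by simp)
  have h1 : HasFDerivAt (fun x : V => (t, x))
      ((0 : V →L[ℝ] ℝ).prod (ContinuousLinearMap.id ℝ V)) x :=
    (hasFDerivAt_const t x).prodMk (hasFDerivAt_id x)
  have := plotDeriv_comp (f := fun x : V => (t, x)) (y := x) hm h1.differentiableAt v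
  rw [h1.fderiv] at this
  exact this

omit h [J.Boundaryless] [IsManifold J ∞ W] [I.Boundaryless] [IsManifold I ∞ M]
  [FiniteDimensional ℝ E] in
theorem plotDeriv_flow_zero (hU : IsOpen U) (hpr : ∀ x ∈ U, ‖p x‖ < r) (hx : x ∈ U) (v : V) :
    (⟨(φ 0 (g x, p x)).1, plotDeriv I (fun x => (φ 0 (g x, p x)).1) x v⟩ : TangentBundle I M)
      = ⟨g x, plotDeriv I g x v⟩ :=
  plotDeriv_congr (g := fun x => (φ 0 (g x, p x)).1) (by
    filter_upwards [hU.mem_nhds hx] with y hy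
    exact congrArg Prod.fst (hφ.zero (g y, p y) (hpr y hy))) v

omit [J.Boundaryless] [IsManifold J ∞ W] in
/-- The evolution of the stabilizing forms along the Hamiltonian flow of `ρ`. -/
theorem flow_oneForm (hU : IsOpen U) (hg : ContMDiffOn 𝓘(ℝ, V) I ∞ g U)
    (hp : ContDiffOn ℝ ∞ p U) (hpr : ∀ x ∈ U, ‖p x‖ < r) (t : ℝ) (hx : x ∈ U) (v : V) (i : Fin k) :
    α i (φ t (g x, p x)).1 (plotDeriv I (fun x => (φ t (g x, p x)).1) x v)
      = α i (g x) (plotDeriv I g x v) + t * fderiv ℝ p x v i := by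
  set Θ : ℝ × V → M := fun y => (φ y.1 (g y.2, p y.2)).1 with hΘ
  have hO : IsOpen (Set.univ ×ˢ U : Set (ℝ × V)) := isOpen_univ.prod hU
  have hm := contMDiffOn_flow_family hφ hg hp hpr
  have hsl := fun t => plotDeriv_flow_slice hφ hU hg hp hpr t hx v
  -- Cartan's formula on the family `Θ(t, x)`: since `∂_tΘ` is characteristic, `dα_i(∂_t, ∂_v) = 0`,
  -- so `∂_t α_i(∂_vΘ) = ∂_v α_i(∂_tΘ) = ∂_v p_i`, independent of `t`. The linear growth is the
  -- origin of the shear.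
  have key := eq_add_mul_of_fderiv_fst (x := x) (c := fderiv ℝ p x v i)
    (B := fun y => α i (Θ y) (plotDeriv I Θ y (0, v)))
    (fun t => differentiableAt_oneForm (h.stable.smooth i) hO hm ⟨trivial, hx⟩ _) (fun t => by
      have h1 := OneForm.d_plotDeriv (h.stable.smooth i) hO hm (x := (t, x)) ⟨trivial, hx⟩
        (1, 0) (0, v)
      rw [h.stable.ker_le i _ _ (h.flow_family_isReeb hφ hU hg hp hpr t hx).1] at h1
      have h2 : (fun y => α i (Θ y) (plotDeriv I Θ y (1, 0))) =ᶠ[𝓝 (t, x)]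
          fun y => p y.2 i := by
        filter_upwards [hO.mem_nhds (x := (t, x)) ⟨trivial, hx⟩] with y hy
        exact (h.flow_family_isReeb hφ hU hg hp hpr y.1 hy.2).2 i
      have h3 : HasFDerivAt p (fderiv ℝ p x) x :=
        ((hp.contDiffAt (hU.mem_nhds hx)).differentiableAt (by simp)).hasFDerivAt
      have h4 : HasFDerivAt (fun y : ℝ × V => p y.2 i) ((EuclideanSpace.proj i :
          EuclideanSpace ℝ (Fin k) →L[ℝ] ℝ).comp ((fderiv ℝ p x).comp
            (ContinuousLinearMap.snd ℝ ℝ V))) (t, x) :=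
        (EuclideanSpace.proj i : EuclideanSpace ℝ (Fin k) →L[ℝ] ℝ).hasFDerivAt.comp (t, x)
          (h3.comp (t, x) hasFDerivAt_snd)
      rw [h2.fderiv_eq, h4.fderiv] at h1
      have h5 := sub_eq_zero.1 h1.symm
      rw [h5]
      rfl) t
  have h0 := congrArg (fun q : TangentBundle I M => α i q.1 q.2)
    (plotDeriv_flow_zero hφ hU (g := g) hpr hx v)
  simp only at h0 key
  rw [hsl] at h0 ⊢
  rw [← h0]
  exact key

/-- The characteristic form is preserved by the Hamiltonian flow of `ρ`. -/
theorem flow_twoForm (hU : IsOpen U) (hg : ContMDiffOn 𝓘(ℝ, V) I ∞ g U)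
    (hp : ContDiffOn ℝ ∞ p U) (hpr : ∀ x ∈ U, ‖p x‖ < r) (t : ℝ) (hx : x ∈ U) (v w : V) :
    (Ω.pullback I (zeroSection ψ)) (φ t (g x, p x)).1
      (plotDeriv I (fun x => (φ t (g x, p x)).1) x v)
      (plotDeriv I (fun x => (φ t (g x, p x)).1) x w)
      = (Ω.pullback I (zeroSection ψ)) (g x) (plotDeriv I g x v) (plotDeriv I g x w) := by
  set Θ : ℝ × V → M := fun y => (φ y.1 (g y.2, p y.2)).1 with hΘ
  have hO : IsOpen (Set.univ ×ˢ U : Set (ℝ × V)) := isOpen_univ.prod hU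
  have hm := contMDiffOn_flow_family hφ hg hp hpr
  have hmd : ∀ y ∈ (Set.univ ×ˢ U : Set (ℝ × V)), MDifferentiableAt 𝓘(ℝ, ℝ × V) I Θ y :=
    fun y hy => (hm.contMDiffAt (hO.mem_nhds hy)).mdifferentiableAt (by simp)
  have hZ : ContMDiffOn 𝓘(ℝ, ℝ × V) J ∞ (fun y => zeroSection ψ (Θ y)) (Set.univ ×ˢ U) :=
    h.zeroSection_contMDiff.comp_contMDiffOn hm
  have hsl := fun t => plotDeriv_flow_slice hφ hU hg hp hpr t hx
  have hzero : ∀ a : ℝ × V, ∀ t, (fun y => Ω (zeroSection ψ (Θ y))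
      (plotDeriv J (fun y => zeroSection ψ (Θ y)) y (1, 0))
      (plotDeriv J (fun y => zeroSection ψ (Θ y)) y a)) =ᶠ[𝓝 (t, x)] fun _ => 0 := by
    intro a t
    filter_upwards [hO.mem_nhds (x := (t, x)) ⟨trivial, hx⟩] with y hy
    rw [← h.pullback_plotDeriv (hmd y hy)]
    have : (Ω.pullback I (zeroSection ψ)) (Θ y) (plotDeriv I Θ y (1, 0)) = 0 :=
      (h.flow_family_isReeb hφ hU hg hp hpr y.1 hy.2).1
    rw [this]; rfl
  -- Closedness on `∂_t, ∂_v, ∂_w`: the two terms that pair with `∂_tΘ ∈ ker ω_M` vanish near the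
  -- point, leaving a zero time derivative.
  have key := eq_add_mul_of_fderiv_fst (x := x) (c := 0)
    (B := fun y => Ω (zeroSection ψ (Θ y))
      (plotDeriv J (fun y => zeroSection ψ (Θ y)) y (0, v))
      (plotDeriv J (fun y => zeroSection ψ (Θ y)) y (0, w)))
    (fun t => differentiableAt_twoForm h.symplectic.smooth hO hZ ⟨trivial, hx⟩ _ _) (fun t => by
      have h1 := h.symplectic.closed_plotDeriv hO hZ (x := (t, x)) ⟨trivial, hx⟩
        (1, 0) (0, v) (0, w)
      rw [(hzero _ t).fderiv_eq, (hzero _ t).fderiv_eq] at h1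
      simpa using h1) t
  have e0 : ∀ t, (Ω.pullback I (zeroSection ψ)) (φ t (g x, p x)).1
      (plotDeriv I (fun x => (φ t (g x, p x)).1) x v)
      (plotDeriv I (fun x => (φ t (g x, p x)).1) x w) = Ω (zeroSection ψ (Θ (t, x)))
      (plotDeriv J (fun y => zeroSection ψ (Θ y)) (t, x) (0, v))
      (plotDeriv J (fun y => zeroSection ψ (Θ y)) (t, x) (0, w)) := fun t => by
    rw [hsl t v, hsl t w]
    exact h.pullback_plotDeriv (hmd (t, x) ⟨trivial, hx⟩) _ _
  have h0v := plotDeriv_flow_zero hφ hU (g := g) hpr hx v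
  have h0w := plotDeriv_flow_zero hφ hU (g := g) hpr hx w
  have h00 : (Ω.pullback I (zeroSection ψ)) (φ 0 (g x, p x)).1
      (plotDeriv I (fun x => (φ 0 (g x, p x)).1) x v)
      (plotDeriv I (fun x => (φ 0 (g x, p x)).1) x w)
      = (Ω.pullback I (zeroSection ψ)) (g x) (plotDeriv I g x v) (plotDeriv I g x w) := by
    have aux : ∀ (a b : M) (v w : TangentSpace I a) (v' w' : TangentSpace I b),
        (⟨a, v⟩ : TangentBundle I M) = ⟨b, v'⟩ → (⟨a, w⟩ : TangentBundle I M) = ⟨b, w'⟩ →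
        (Ω.pullback I (zeroSection ψ)) a v w = (Ω.pullback I (zeroSection ψ)) b v' w' := by
      intro a b v w v' w' hv hw
      cases hv; cases hw; rfl
    exact aux _ _ _ _ _ _ h0v h0w
  rw [e0 t, ← h00, e0 0]
  simpa using key

end IsStableTube
end Flow
end CoisotropicIndex

namespace CoisotropicIndex

/-! ### The flow at fixed momentum and the linearized Hamiltonian flow. -/

section Flow

variable {E : Type*} [NormedAddCommGroup E] [NormedSpace ℝ E] [FiniteDimensional ℝ E]
  {H : Type*} [TopologicalSpace H] {I : ModelWithCorners ℝ E H} [I.Boundaryless]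
  {M : Type*} [TopologicalSpace M] [ChartedSpace H M] [IsManifold I ∞ M]
  {F : Type*} [NormedAddCommGroup F] [NormedSpace ℝ F]
  {G : Type*} [TopologicalSpace G] {J : ModelWithCorners ℝ F G} [J.Boundaryless]
  {W : Type*} [TopologicalSpace W] [ChartedSpace G W] [IsManifold J ∞ W]
  {k m : ℕ} {Ω : TwoForm J W} {α : Fin k → OneForm I M} {r : ℝ}
  {ψ : M × EuclideanSpace ℝ (Fin k) → W}
  {φ : ℝ → M × EuclideanSpace ℝ (Fin k) → M × EuclideanSpace ℝ (Fin k)}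
  {V : Type*} [NormedAddCommGroup V] [NormedSpace ℝ V] {g : V → M} {U : Set V} {x : V}
  {p : EuclideanSpace ℝ (Fin k)} {q : M}

/-- The flow at a fixed value of the momentum, as a map of `M`. -/
def flowAt (φ : ℝ → M × EuclideanSpace ℝ (Fin k) → M × EuclideanSpace ℝ (Fin k))
    (p : EuclideanSpace ℝ (Fin k)) (t : ℝ) (q : M) : M := (φ t (q, p)).1

/-- The derivative of the flow at a fixed value of the momentum. -/
noncomputable def flowDeriv (I : ModelWithCorners ℝ E H) {M : Type*} [TopologicalSpace M]
    [ChartedSpace H M] {k : ℕ}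
    (φ : ℝ → M × EuclideanSpace ℝ (Fin k) → M × EuclideanSpace ℝ (Fin k))
    (p : EuclideanSpace ℝ (Fin k)) (t : ℝ) (q : M) :
    TangentSpace I q →L[ℝ] TangentSpace I (flowAt φ p t q) :=
  mfderiv I I (flowAt φ p t) q

theorem exists_plot' (q : M) : ∃ (U : Set E) (g : E → M), IsOpen U ∧ (0 : E) ∈ U ∧
    ContMDiffOn 𝓘(ℝ, E) I ∞ g U ∧ ∃ e : g 0 = q, ∀ v : E, (plotDeriv I g 0 v : E) = v := by
  obtain ⟨U, g, hU, h0, hg, rfl, hv⟩ := exists_plot (I := I) q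
  exact ⟨U, g, hU, h0, hg, rfl, fun v => eq_of_heq (Bundle.TotalSpace.mk.inj (hv v)).2⟩

namespace IsStableTube

variable (h : IsStableTube m Ω α r ψ)
  (hφ : IsHamiltonianFlow (Ω.pullback I (zeroSection ψ)) α r (rho M k) φ)
include hφ

theorem flowAt_contMDiff (hp : ‖p‖ < r) (t : ℝ) : ContMDiff I I ∞ (flowAt φ p t) := by
  rw [← contMDiffOn_univ]
  exact contMDiff_fst.comp_contMDiffOn (hφ.smooth.comp (f := fun q : M => (t, (q, p)))
    (contMDiff_const.prodMk (contMDiff_id.prodMk contMDiff_const)).contMDiffOn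
      fun q _ => ⟨trivial, hp⟩)

theorem plotDeriv_flowAt (hp : ‖p‖ < r) (t : ℝ) (hg : MDifferentiableAt 𝓘(ℝ, V) I g x) (v : V) :
    plotDeriv I (fun y => flowAt φ p t (g y)) x v = flowDeriv I φ p t (g x) (plotDeriv I g x v) :=
  plotDeriv_map ((flowAt_contMDiff hφ hp t).contMDiffAt.mdifferentiableAt (by simp)) hg v

include h

theorem flowDeriv_oneForm (hp : ‖p‖ < r) (t : ℝ) (v : TangentSpace I q) (i : Fin k) :
    α i (flowAt φ p t q) (flowDeriv I φ p t q v) = α i q v := by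
  obtain ⟨U, g, hU, h0, hg, rfl, hv⟩ := exists_plot' (I := I) q
  have h1 := h.flow_oneForm hφ hU hg contDiffOn_const (fun _ _ => hp) t h0 (v : E) i
  have h2 := plotDeriv_flowAt hφ hp t ((hg.contMDiffAt (hU.mem_nhds h0)).mdifferentiableAt
    (by simp)) (v : E)
  have h3 : plotDeriv I g 0 (v : E) = v := hv v
  rw [h3] at h1 h2
  rw [← h2]
  refine h1.trans ?_
  rw [fderiv_fun_const]
  exact add_eq_left.2 (mul_zero t)

theorem flowDeriv_twoForm (hp : ‖p‖ < r) (t : ℝ) (v w : TangentSpace I q) :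
    (Ω.pullback I (zeroSection ψ)) (flowAt φ p t q) (flowDeriv I φ p t q v) (flowDeriv I φ p t q w)
      = (Ω.pullback I (zeroSection ψ)) q v w := by
  obtain ⟨U, g, hU, h0, hg, rfl, hv⟩ := exists_plot' (I := I) q
  have h1 := h.flow_twoForm hφ hU hg contDiffOn_const (fun _ _ => hp) t h0 (v : E) (w : E)
  have h2 := plotDeriv_flowAt hφ hp t ((hg.contMDiffAt (hU.mem_nhds h0)).mdifferentiableAt
    (by simp))
  have h3 : plotDeriv I g 0 (v : E) = v := hv v
  have h4 : plotDeriv I g 0 (w : E) = w := hv w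
  have h5 := h2 (v : E)
  have h6 := h2 (w : E)
  rw [h3] at h5
  rw [h4] at h6
  rw [h3, h4] at h1
  rw [← h5, ← h6]
  exact h1

/-- Along a plot, `α_i` of the moved plot and of the original one are the same function, so the two
exterior derivatives computed by `OneForm.d_plotDeriv` agree. -/
theorem flowDeriv_d (hp : ‖p‖ < r) (t : ℝ) (v w : TangentSpace I q) (i : Fin k) :
    (α i).d (flowAt φ p t q) (flowDeriv I φ p t q v) (flowDeriv I φ p t q w) = (α i).d q v w := by
  obtain ⟨U, g, hU, h0, hg, rfl, hv⟩ := exists_plot' (I := I) q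
  have h2 := plotDeriv_flowAt hφ hp t ((hg.contMDiffAt (hU.mem_nhds h0)).mdifferentiableAt
    (by simp))
  have h3 : plotDeriv I g 0 (v : E) = v := hv v
  have h4 : plotDeriv I g 0 (w : E) = w := hv w
  have h5 := h2 (v : E)
  have h6 := h2 (w : E)
  rw [h3] at h5
  rw [h4] at h6
  have hgt : ContMDiffOn 𝓘(ℝ, E) I ∞ (fun y => flowAt φ p t (g y)) U :=
    (flowAt_contMDiff hφ hp t).comp_contMDiffOn hg
  have e1 := OneForm.d_plotDeriv (h.stable.smooth i) hU hgt h0 (v : E) (w : E)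
  have e2 := OneForm.d_plotDeriv (h.stable.smooth i) hU hg h0 (v : E) (w : E)
  have e3 : ∀ u : E, (fun y => α i (flowAt φ p t (g y)) (plotDeriv I (fun y => flowAt φ p t (g y)) y u))
      =ᶠ[𝓝 0] fun y => α i (g y) (plotDeriv I g y u) := fun u => by
    filter_upwards [hU.mem_nhds h0] with y hy
    have := h.flow_oneForm hφ hU hg contDiffOn_const (fun _ _ => hp) t hy u i
    refine this.trans ?_
    rw [fderiv_fun_const]
    simp
  have e4 := congrArg₂ (fun L L' : E →L[ℝ] ℝ => L (v : E) - L' (w : E))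
    (e3 (w : E)).fderiv_eq (e3 (v : E)).fderiv_eq
  have e5 := e1.trans (e4.trans e2.symm)
  rw [h5, h6, h3, h4] at e5
  exact e5

/-- A vector in the kernel pairs to zero under `ω_M` and all `α_i`, because the derivative of the
flow preserves these forms. -/
theorem flowDeriv_injective (hp : ‖p‖ < r) (t : ℝ) (q : M) :
    Function.Injective (flowDeriv I φ p t q) := by
  rw [injective_iff_map_eq_zero]
  intro v hv
  refine h.eq_zero_of_char (ContinuousLinearMap.ext fun w => ?_) fun i => ?_
  · change (Ω.pullback I (zeroSection ψ)) q v w = 0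
    rw [← h.flowDeriv_twoForm hφ hp t v w, hv, map_zero]; rfl
  · rw [← h.flowDeriv_oneForm hφ hp t v i, hv, map_zero]

theorem flowDeriv_surjective (hp : ‖p‖ < r) (t : ℝ) (q : M) :
    Function.Surjective (flowDeriv I φ p t q) :=
  LinearMap.surjective_of_injective (K := ℝ) (V := E)
    (f := (show E →L[ℝ] E from flowDeriv I φ p t q).toLinearMap) (h.flowDeriv_injective hφ hp t q)

theorem flowDeriv_char (hp : ‖p‖ < r) (t : ℝ) {v : TangentSpace I q}
    (hv : v ∈ charDist (Ω.pullback I (zeroSection ψ)) q) :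
    flowDeriv I φ p t q v ∈ charDist (Ω.pullback I (zeroSection ψ)) (flowAt φ p t q) := by
  refine ContinuousLinearMap.ext fun w => ?_
  obtain ⟨w, rfl⟩ := h.flowDeriv_surjective hφ hp t q w
  have hv' : (Ω.pullback I (zeroSection ψ)) q v = 0 := hv
  change (Ω.pullback I (zeroSection ψ)) _ _ _ = 0
  rw [h.flowDeriv_twoForm hφ hp t v w, hv']
  rfl

theorem flowDeriv_reeb (hp : ‖p‖ < r) (t : ℝ) {v : TangentSpace I q}
    {w : EuclideanSpace ℝ (Fin k)} (hv : IsReeb (Ω.pullback I (zeroSection ψ)) α q w v) :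
    IsReeb (Ω.pullback I (zeroSection ψ)) α (flowAt φ p t q) w (flowDeriv I φ p t q v) :=
  ⟨h.flowDeriv_char hφ hp t hv.1, fun i => (h.flowDeriv_oneForm hφ hp t v i).trans (hv.2 i)⟩

/-- The derivative of a plot moved by the flow for variable times. -/
theorem plotDeriv_flowAt_time {a : V → ℝ} (hU : IsOpen U) (hg : ContMDiffOn 𝓘(ℝ, V) I ∞ g U)
    (ha : ContDiffOn ℝ ∞ a U) (hp : ‖p‖ < r) (hx : x ∈ U) (v : V) :
    ∃ R, IsReeb (Ω.pullback I (zeroSection ψ)) α (flowAt φ p (a x) (g x)) p R ∧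
      plotDeriv I (fun y => flowAt φ p (a y) (g y)) x v
        = fderiv ℝ a x v • R + flowDeriv I φ p (a x) (g x) (plotDeriv I g x v) := by
  have hm := ((contMDiffOn_flow_family hφ hg contDiffOn_const (fun _ _ => hp)).contMDiffAt
    ((isOpen_univ.prod hU).mem_nhds (x := (a x, x)) ⟨trivial, hx⟩)).mdifferentiableAt (by simp)
  have hR := h.flow_family_isReeb hφ hU hg contDiffOn_const (fun _ _ => hp) (a x) hx
  refine ⟨_, hR, ?_⟩
  have ha' : HasFDerivAt a (fderiv ℝ a x) x :=
    ((ha.contDiffAt (hU.mem_nhds hx)).differentiableAt (by simp)).hasFDerivAt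
  have h1 : HasFDerivAt (fun x : V => (a x, x))
      ((fderiv ℝ a x).prod (ContinuousLinearMap.id ℝ V)) x := ha'.prodMk (hasFDerivAt_id x)
  have h2 := plotDeriv_comp (f := fun x : V => (a x, x)) (y := x) hm h1.differentiableAt v
  rw [h1.fderiv] at h2
  have h3 := plotDeriv_flow_slice hφ hU hg contDiffOn_const (fun _ _ => hp) (a x) hx v
  have h4 := plotDeriv_flowAt hφ hp (a x) ((hg.contMDiffAt (hU.mem_nhds hx)).mdifferentiableAt
    (by simp)) v
  have h5 : ((fderiv ℝ a x).prod (ContinuousLinearMap.id ℝ V)) v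
      = fderiv ℝ a x v • ((1 : ℝ), (0 : V)) + ((0 : ℝ), v) := by simp
  rw [h5, map_add, map_smul, ← h3] at h2
  rw [← h4]
  exact h2

/-- The integral curves of the Reeb fields are the orbits of the flow. -/
theorem flowAt_neg_curve {c : ℝ → M} (hp : ‖p‖ < r) (hc : ContMDiff 𝓘(ℝ, ℝ) I ∞ c)
    (hr : ∀ t, IsReeb (Ω.pullback I (zeroSection ψ)) α (c t) p (plotDeriv I c t 1)) (t : ℝ) :
    flowAt φ p (-t) (c t) = c 0 := by
  have hsm : ContMDiff 𝓘(ℝ, ℝ) I ∞ fun t => flowAt φ p (-t) (c t) := by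
    rw [← contMDiffOn_univ]
    exact contMDiffOn_flow hφ hc.contMDiffOn contDiffOn_const (fun _ _ => hp)
      contDiff_neg.contDiffOn
  -- The velocity of the curve carried back is minus a Reeb vector plus the image of one. Both have
  -- coefficients `p` at the same point, so they cancel. This takes the place of uniqueness for
  -- differential equations.
  have := eq_of_plotDeriv_eq_zero hsm (fun t => by
    obtain ⟨R, hR, e⟩ := h.plotDeriv_flowAt_time hφ isOpen_univ hc.contMDiffOn
      (a := fun t => -t) contDiff_neg.contDiffOn hp (x := t) trivial 1
    have h1 : fderiv ℝ (fun t : ℝ => -t) t 1 = -1 := by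
      rw [fderiv_fun_neg, fderiv_fun_id]; simp
    rw [e, h1, h.isReeb_unique hR (h.flowDeriv_reeb hφ hp (-t) (hr t)), neg_one_smul,
      neg_add_cancel]) t 0
  rw [this, neg_zero]
  exact congrArg Prod.fst (hφ.zero (c 0, p) hp)

theorem flowAt_isReeb (hp : ‖p‖ < r) (q : M) (t : ℝ) :
    IsReeb (Ω.pullback I (zeroSection ψ)) α (flowAt φ p t q) p
      (plotDeriv I (fun s => flowAt φ p s q) t 1) :=
  h.flow_isReeb hφ hp t

omit h in
theorem flowAt_curve_contMDiff (hp : ‖p‖ < r) (q : M) :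
    ContMDiff 𝓘(ℝ, ℝ) I ∞ fun s => flowAt φ p s q :=
  contMDiff_fst.comp (flow_contMDiff hφ (z := (q, p)) hp)

omit h in
theorem flowAt_zero (hp : ‖p‖ < r) (q : M) : flowAt φ p 0 q = q :=
  congrArg Prod.fst (hφ.zero (q, p) hp)

theorem flowAt_neg (hp : ‖p‖ < r) (q : M) (t : ℝ) : flowAt φ p (-t) (flowAt φ p t q) = q := by
  rw [h.flowAt_neg_curve hφ hp (flowAt_curve_contMDiff hφ hp q) (h.flowAt_isReeb hφ hp q) t,
    flowAt_zero hφ hp]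

theorem eq_flowAt {c : ℝ → M} (hp : ‖p‖ < r) (hc : ContMDiff 𝓘(ℝ, ℝ) I ∞ c)
    (hr : ∀ t, IsReeb (Ω.pullback I (zeroSection ψ)) α (c t) p (plotDeriv I c t 1)) (t : ℝ) :
    c t = flowAt φ p t (c 0) := by
  have := h.flowAt_neg hφ hp (c t) (-t)
  rw [neg_neg, h.flowAt_neg_curve hφ hp hc hr t] at this
  exact this.symm

/-- A closed orbit is periodic. -/
theorem flowAt_periodic (hp : ‖p‖ < r) {T : ℝ} (hT : flowAt φ p T q = q) (t : ℝ) :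
    flowAt φ p (t + T) q = flowAt φ p t q := by
  have hadd : ContDiff ℝ ∞ fun s : ℝ => s + T := contDiff_id.add contDiff_const
  have := h.eq_flowAt hφ (c := fun s => flowAt φ p (s + T) q) hp
    ((flowAt_curve_contMDiff hφ hp q).comp hadd.contMDiff) (fun s => by
      have h1 := plotDeriv_comp (g := fun s => flowAt φ p s q) (f := fun s => s + T) (y := s)
        ((flowAt_curve_contMDiff hφ hp q).contMDiffAt.mdifferentiableAt (by simp))
        (hadd.differentiable (by simp)).differentiableAt 1
      have h2 : fderiv ℝ (fun s : ℝ => s + T) s 1 = 1 := by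
        rw [fderiv_add_const, fderiv_fun_id]; simp
      rw [h1, h2]
      exact h.flowAt_isReeb hφ hp q (s + T)) t
  rwa [zero_add, hT] at this

/-- The linearized Hamiltonian flow. -/
theorem mfderiv_flow (hp : ‖p‖ < r) (t : ℝ) (v : TangentSpace I q)
    (w : EuclideanSpace ℝ (Fin k)) {R : TangentSpace I (flowAt φ p t q)}
    (hR : IsReeb (Ω.pullback I (zeroSection ψ)) α (flowAt φ p t q) w R) :
    (⟨φ t (q, p), mfderiv (I.prod (𝓡 k)) (I.prod (𝓡 k)) (φ t) (q, p) (pairVec (q, p) v w)⟩ :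
      TangentBundle (I.prod (𝓡 k)) (M × EuclideanSpace ℝ (Fin k)))
      = ⟨(flowAt φ p t q, p), pairVec (flowAt φ p t q, p) (flowDeriv I φ p t q v + t • R) w⟩ := by
  obtain ⟨U, g, hU, h0, hg, rfl, hv⟩ := exists_plot' (I := I) q
  -- The point of `M` varies along a plot and the momentum affinely around `p`, so that the laws for
  -- families give the full differential of `φ t`.
  set V := E × EuclideanSpace ℝ (Fin k)
  let pp : V → EuclideanSpace ℝ (Fin k) := fun x => p + x.2
  let gg : V → M := fun x => g x.1
  have hppc : ContDiff ℝ ∞ pp := contDiff_const.add contDiff_snd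
  let O : Set V := {x | x.1 ∈ U ∧ ‖pp x‖ < r}
  have hO : IsOpen O := (hU.preimage continuous_fst).inter
    (isOpen_lt hppc.continuous.norm continuous_const)
  have hO0 : (0 : V) ∈ O := ⟨h0, by simpa [pp] using hp⟩
  have hgg : ContMDiffOn 𝓘(ℝ, V) I ∞ gg O := hg.comp contDiff_fst.contMDiff.contMDiffOn fun x hx => hx.1
  have hgd : MDifferentiableAt 𝓘(ℝ, V) I gg 0 :=
    (hgg.contMDiffAt (hO.mem_nhds hO0)).mdifferentiableAt (by simp)
  have hgE : MDifferentiableAt 𝓘(ℝ, E) I g (0 : V).1 :=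
    (hg.contMDiffAt (hU.mem_nhds h0)).mdifferentiableAt (by simp)
  have hpd : HasFDerivAt pp (ContinuousLinearMap.snd ℝ E (EuclideanSpace ℝ (Fin k))) 0 :=
    hasFDerivAt_snd.const_add p
  have hpp0 : pp 0 = p := by simp [pp]
  have hdg : ∀ u : V, plotDeriv I gg 0 u = (u.1 : E) := fun u => by
    have := plotDeriv_comp (g := g) (f := fun x : V => x.1) (y := 0) hgE differentiableAt_fst u
    rw [fderiv_fst] at this
    exact this.trans (hv u.1)
  have hsm := contMDiffOn_flow hφ (a := fun _ : V => t) hgg hppc.contDiffOn (fun x hx => hx.2)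
    contDiffOn_const
  have hsmd : MDifferentiableAt 𝓘(ℝ, V) I (fun x : V => (φ t (gg x, pp x)).1) 0 :=
    (hsm.contMDiffAt (hO.mem_nhds hO0)).mdifferentiableAt (by simp)
  -- the horizontal part
  let D : V → E := fun u => plotDeriv I (fun x : V => (φ t (gg x, pp x)).1) 0 u
  have hbase : (φ t (gg 0, pp 0)).1 = flowAt φ p t (g 0) := by rw [hpp0]; rfl
  have hD1 : ∀ u : V, ∀ i, α i (flowAt φ p t (g 0)) (D u) = α i (g 0) (u.1 : E) + t * u.2 i := by
    intro u i
    have h1 := h.flow_oneForm hφ hO hgg hppc.contDiffOn (fun x hx => hx.2) t hO0 u i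
    rw [hpd.fderiv, hdg] at h1
    rw [← hbase]
    exact h1
  have hD2 : ∀ u u' : V, (Ω.pullback I (zeroSection ψ)) (flowAt φ p t (g 0)) (D u) (D u')
      = (Ω.pullback I (zeroSection ψ)) (g 0) (u.1 : E) (u'.1 : E) := by
    intro u u'
    have h1 := h.flow_twoForm hφ hO hgg hppc.contDiffOn (fun x hx => hx.2) t hO0 u u'
    rw [hdg, hdg] at h1
    rw [← hbase]
    exact h1
  have hD0 : ∀ u : E, D (u, 0) = flowDeriv I φ p t (g 0) u := by
    intro u
    have h1 : HasFDerivAt (fun y : E => ((y, 0) : V)) (ContinuousLinearMap.inl ℝ E _) 0 :=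
      (ContinuousLinearMap.inl ℝ E (EuclideanSpace ℝ (Fin k))).hasFDerivAt
    have h2 := plotDeriv_comp (g := fun x : V => (φ t (gg x, pp x)).1)
      (f := fun y : E => ((y, 0) : V)) (y := 0) hsmd h1.differentiableAt u
    rw [h1.fderiv] at h2
    have h3 := plotDeriv_flowAt hφ hp t (x := (0 : E)) (g := g) hgE u
    have h4 : plotDeriv I g 0 u = u := hv u
    rw [h4] at h3
    have h5 : (fun y : E => (φ t (gg (y, 0), pp (y, 0))).1) = fun y => flowAt φ p t (g y) := by
      funext y; simp [gg, pp, flowAt]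
    have h6 := congrArg (fun f : E → M => (plotDeriv I f 0 u : E)) h5
    refine Eq.trans (b := (plotDeriv I (fun y : E => (φ t (gg (y, 0), pp (y, 0))).1) 0 u : E)) ?_
      (h6.trans h3)
    exact (congrArg (fun L : V →L[ℝ] E => L ((u, 0) : V)) rfl : _).trans h2.symm
  -- Both sides have the same pairings under `ω_M` and the same values of the `α_i`; the term `t * w
  -- i` in `hD1` is supplied by `t • R`.
  have hDvw : D (v, w) = flowDeriv I φ p t (g 0) v + t • R := by
    have key : ∀ X : TangentSpace I (flowAt φ p t (g 0)), X = D (v, w) →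
        X = flowDeriv I φ p t (g 0) v + t • R := by
      intro X hX
      have e1 : ∀ i, α i (flowAt φ p t (g 0)) X = α i (g 0) v + t * w i := fun i => by
        rw [hX]; exact hD1 (v, w) i
      have e2 : ∀ y : TangentSpace I (g 0), (Ω.pullback I (zeroSection ψ)) (flowAt φ p t (g 0)) X
          (flowDeriv I φ p t (g 0) y) = (Ω.pullback I (zeroSection ψ)) (g 0) v y := fun y => by
        rw [hX, ← hD0 y]; exact hD2 (v, w) (y, 0)
      rw [← sub_eq_zero]
      refine h.eq_zero_of_char (ContinuousLinearMap.ext fun y => ?_) fun i => ?_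
      · obtain ⟨y, rfl⟩ := h.flowDeriv_surjective hφ hp t (g 0) y
        have hR1 : (Ω.pullback I (zeroSection ψ)) (flowAt φ p t (g 0)) R = 0 := hR.1
        change (Ω.pullback I (zeroSection ψ)) (flowAt φ p t (g 0)) _ _ = 0
        rw [map_sub, sub_apply, e2, map_add, map_smul, hR1, smul_zero, add_zero,
          h.flowDeriv_twoForm hφ hp, sub_self]
      · rw [map_sub, e1, map_add, map_smul, hR.2, h.flowDeriv_oneForm hφ hp, smul_eq_mul, sub_self]
    exact key _ rfl
  have hφd : MDifferentiableAt (I.prod (𝓡 k)) (I.prod (𝓡 k)) (φ t) (gg 0, pp 0) := by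
    have : ContMDiffOn (I.prod (𝓡 k)) (I.prod (𝓡 k)) ∞ (φ t) (tube M k r) :=
      hφ.smooth.comp (f := fun z => (t, z)) (contMDiff_const.prodMk contMDiff_id).contMDiffOn
        fun z hz => ⟨trivial, hz⟩
    have hmem : (gg 0, pp 0) ∈ tube M k r := hO0.2
    exact (this.contMDiffAt (isOpen_tube.mem_nhds hmem)).mdifferentiableAt (by simp)
  have hpair : MDifferentiableAt 𝓘(ℝ, V) (I.prod (𝓡 k)) (fun x : V => (gg x, pp x)) 0 :=
    hgd.prodMk hpd.differentiableAt.mdifferentiableAt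
  have f1 := plotDeriv_map (g := fun x : V => (gg x, pp x)) (f := φ t) (x := 0) hφd hpair (v, w)
  have f2 : plotDeriv (I.prod (𝓡 k)) (fun x : V => (gg x, pp x)) 0 (v, w)
      = pairVec (gg 0, pp 0) (plotDeriv I gg 0 (v, w)) (fderiv ℝ pp 0 (v, w)) :=
    mfderiv_pair hgd hpd.differentiableAt (v, w)
  have f3 : plotDeriv (I.prod (𝓡 k)) (fun x : V => ((φ t (gg x, pp x)).1, pp x)) 0 (v, w)
      = pairVec ((φ t (gg 0, pp 0)).1, pp 0) (D (v, w)) (fderiv ℝ pp 0 (v, w)) :=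
    mfderiv_pair hsmd hpd.differentiableAt (v, w)
  have f4 := plotDeriv_congr (I := I.prod (𝓡 k)) (x := (0 : V)) (g := fun x => φ t (gg x, pp x))
    (g' := fun x : V => ((φ t (gg x, pp x)).1, pp x)) (by
      filter_upwards [hO.mem_nhds hO0] with y hy
      exact h.flow_eq hφ hy.2 t) (v, w)
  rw [f1, f2, f3, hdg, hpd.fderiv, hDvw] at f4
  have key : ∀ p', p' = p → (⟨φ t (g 0, p'), mfderiv (I.prod (𝓡 k)) (I.prod (𝓡 k)) (φ t) (g 0, p')
      (pairVec (g 0, p') v w)⟩ : TangentBundle (I.prod (𝓡 k)) (M × EuclideanSpace ℝ (Fin k)))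
      = ⟨((φ t (g 0, p')).1, p'), pairVec ((φ t (g 0, p')).1, p')
        (show E from flowDeriv I φ p t (g 0) v + t • R) w⟩ →
      (⟨φ t (g 0, p), mfderiv (I.prod (𝓡 k)) (I.prod (𝓡 k)) (φ t) (g 0, p)
      (pairVec (g 0, p) v w)⟩ : TangentBundle (I.prod (𝓡 k)) (M × EuclideanSpace ℝ (Fin k)))
      = ⟨((φ t (g 0, p)).1, p), pairVec ((φ t (g 0, p)).1, p)
        (show E from flowDeriv I φ p t (g 0) v + t • R) w⟩ := by
    rintro _ rfl h; exact h
  exact key _ hpp0 f4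

end IsStableTube
end Flow
end CoisotropicIndex

namespace CoisotropicIndex

/-! ### Holonomy of the characteristic foliation along an orbit. -/

section Holonomy

variable {E : Type*} [NormedAddCommGroup E] [NormedSpace ℝ E] [FiniteDimensional ℝ E]
  {H : Type*} [TopologicalSpace H] {I : ModelWithCorners ℝ E H} [I.Boundaryless]
  {M : Type*} [TopologicalSpace M] [ChartedSpace H M] [IsManifold I ∞ M]
  {F : Type*} [NormedAddCommGroup F] [NormedSpace ℝ F]
  {G : Type*} [TopologicalSpace G] {J : ModelWithCorners ℝ F G} [J.Boundaryless]
  {W : Type*} [TopologicalSpace W] [ChartedSpace G W] [IsManifold J ∞ W]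
  {k m : ℕ} {Ω : TwoForm J W} {α : Fin k → OneForm I M} {r : ℝ}
  {ψ : M × EuclideanSpace ℝ (Fin k) → W}
  {φ : ℝ → M × EuclideanSpace ℝ (Fin k) → M × EuclideanSpace ℝ (Fin k)}
  {p : EuclideanSpace ℝ (Fin k)} {q : M}

namespace IsStableTube

variable (h : IsStableTube m Ω α r ψ)
include h

/-- The inverse chart is itself a plot, so the coefficients of the pull-back are values of `Ω` on
derivatives of its composition with the zero section. -/
theorem differentiableAt_inChart (x₀ : M) (v w : E) :
    DifferentiableAt ℝ (fun y => (Ω.pullback I (zeroSection ψ)).inChart x₀ y v w)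
      (extChartAt I x₀ x₀) := by
  have hO := isOpen_extChartAt_target (I := I) x₀
  have hm := mem_extChartAt_target (I := I) x₀
  have hG : ContMDiffOn 𝓘(ℝ, E) I ∞ (extChartAt I x₀).symm (extChartAt I x₀).target :=
    contMDiffOn_extChartAt_symm x₀
  refine (differentiableAt_twoForm h.symplectic.smooth hO
    (h.zeroSection_contMDiff.comp_contMDiffOn hG) hm v w).congr_of_eventuallyEq ?_
  filter_upwards [hO.mem_nhds hm] with y hy
  exact h.pullback_plotDeriv ((hG.contMDiffAt (hO.mem_nhds hy)).mdifferentiableAt (by simp)) v w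

/-- The transverse component of a variation through curves in leaves which fixes the central curve
at a point is constant. -/
theorem variation_const {ε : ℝ} (hε : 0 < ε) {ζ : ℝ × ℝ → M}
    (hζ : ContMDiffOn 𝓘(ℝ, ℝ × ℝ) I ∞ ζ (Set.univ ×ˢ Set.Ioo (-ε) ε)) {x₀ : M}
    (h0 : ∀ τ, ζ (τ, 0) = x₀)
    (hch : ∀ τ, ∀ s ∈ Set.Ioo (-ε) ε,
      plotDeriv I ζ (τ, s) (1, 0) ∈ charDist (Ω.pullback I (zeroSection ψ)) (ζ (τ, s)))
    (τ τ' : ℝ) (Y : TangentSpace I x₀) :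
    (Ω.pullback I (zeroSection ψ)) x₀ (plotDeriv I ζ (τ, 0) (0, 1) : E) Y
      = (Ω.pullback I (zeroSection ψ)) x₀ (plotDeriv I ζ (τ', 0) (0, 1) : E) Y := by
  set U : Set (ℝ × ℝ) := Set.univ ×ˢ Set.Ioo (-ε) ε with hU
  have hUo : IsOpen U := isOpen_univ.prod isOpen_Ioo
  have hO := isOpen_chart_preimage hUo hζ x₀
  set O := U ∩ ζ ⁻¹' (chartAt H x₀).source
  set ΩM := Ω.pullback I (zeroSection ψ) with hΩM
  set η : ℝ × ℝ → E := fun y => extChartAt I x₀ (ζ y) with hη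
  have hηs : ContDiffOn ℝ ∞ η O := contDiffOn_extChartAt_comp hζ x₀
  have hmem : ∀ τ, (τ, (0 : ℝ)) ∈ O := fun τ =>
    ⟨⟨trivial, by simpa using hε⟩, by
      rw [Set.mem_preimage, h0]; exact mem_chart_source H x₀⟩
  have hη0 : ∀ τ, η (τ, 0) = extChartAt I x₀ x₀ := fun τ => by simp only [hη, h0]
  let B : E → E →L[ℝ] E →L[ℝ] ℝ := ΩM.inChart x₀
  have hB : ∀ x ∈ O, ∀ Y : E, B (η x) (fderiv ℝ η x (1, 0)) Y = 0 := by
    rintro ⟨τ, s⟩ hx Y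
    have h1 := ΩM.inChart_apply hx.2 (plotDeriv I ζ (τ, s) (1, 0)) (chartInv I x₀ (ζ (τ, s)) Y)
    rw [chartDeriv_plotDeriv hUo hζ hx.1 hx.2, chartDeriv_chartInv (I := I) hx.2] at h1
    refine h1.trans ?_
    have h2 : ΩM (ζ (τ, s)) (plotDeriv I ζ (τ, s) (1, 0)) = 0 := hch τ s hx.1.2
    rw [h2]; rfl
  have hct : ∀ τ, ContDiffAt ℝ ∞ η (τ, 0) := fun τ => hηs.contDiffAt (hO.mem_nhds (hmem τ))
  have hd2 : ∀ τ, HasFDerivAt (fderiv ℝ η) (fderiv ℝ (fderiv ℝ η) (τ, 0)) (τ, 0) := fun τ =>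
    (((hct τ).fderiv_right (m := 1) (by norm_num; exact ENat.LEInfty.out)).differentiableAt
      (by simp)).hasFDerivAt
  have hline : ∀ τ : ℝ, HasDerivAt (fun τ : ℝ => (τ, (0 : ℝ))) ((1 : ℝ), (0 : ℝ)) τ := fun τ =>
    (hasDerivAt_id τ).prodMk (hasDerivAt_const τ 0)
  have hz : ∀ τ, fderiv ℝ η (τ, 0) (1, 0) = 0 := fun τ => by
    have h1 := (((hct τ).differentiableAt (by simp)).hasFDerivAt).comp_hasDerivAt τ (hline τ)
    have h2 : HasDerivAt (fun τ : ℝ => η (τ, 0)) 0 τ := by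
      simp only [hη0]; exact hasDerivAt_const _ _
    exact h1.unique h2
  -- Differentiate `B(η)(∂_τη, Y) = 0` in `s` at `s = 0`. Differentiability of `B` is available for
  -- single coefficients only, so `∂_τη` is expanded in a basis. As `∂_τη = 0` at `s = 0`,
  -- derivatives of the coefficients drop out and the mixed derivative lies in the kernel of the
  -- form.
  let e := Module.finBasis ℝ E
  have hmix : ∀ τ, ∀ Y : E,
      B (extChartAt I x₀ x₀) (fderiv ℝ (fderiv ℝ η) (τ, 0) (0, 1) (1, 0)) Y = 0 := by
    intro τ Y
    have hsum : ∀ (y v : E), B y v Y = ∑ i, LinearMap.toContinuousLinearMap (e.coord i) v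
        * B y (e i) Y := fun y v => by
      conv_lhs => rw [← e.sum_repr v, map_sum, ContinuousLinearMap.sum_apply]
      refine Finset.sum_congr rfl fun i _ => ?_
      rw [map_smul, smul_apply]
      rfl
    have hf : ∀ i, HasFDerivAt
        (fun x => LinearMap.toContinuousLinearMap (e.coord i) (fderiv ℝ η x (1, 0)))
        ((LinearMap.toContinuousLinearMap (e.coord i)).comp
          ((fderiv ℝ (fderiv ℝ η) (τ, 0)).flip (1, 0))) (τ, 0) := fun i => by
      have h1 := (hd2 τ).clm_apply (hasFDerivAt_const ((1 : ℝ), (0 : ℝ)) (τ, (0 : ℝ)))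
      have h2 := (LinearMap.toContinuousLinearMap (e.coord i)).hasFDerivAt.comp (τ, (0 : ℝ)) h1
      exact h2.congr_fderiv (by ext <;> simp)
    have hg : ∀ i, DifferentiableAt ℝ (fun x => B (η x) (e i) Y) (τ, 0) := fun i => by
      have h1 := h.differentiableAt_inChart x₀ (e i) Y
      rw [← hη0 τ] at h1
      exact h1.comp (τ, (0 : ℝ)) ((hct τ).differentiableAt (by simp))
    have hF := HasFDerivAt.fun_sum (u := Finset.univ)
      fun i _ => (hf i).mul (hg i).hasFDerivAt
    have hF0 : (fun x => ∑ i, LinearMap.toContinuousLinearMap (e.coord i) (fderiv ℝ η x (1, 0))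
        * B (η x) (e i) Y) =ᶠ[𝓝 (τ, 0)] fun _ => 0 := by
      filter_upwards [hO.mem_nhds (hmem τ)] with x hx
      rw [← hsum, hB x hx]
    have h3 := (hF.congr_of_eventuallyEq hF0.symm).unique (hasFDerivAt_const (0 : ℝ) (τ, (0 : ℝ)))
    have h4 := congrArg (fun L : ℝ × ℝ →L[ℝ] ℝ => L (0, 1)) h3
    rw [hsum]
    simp only [hz, hη0, map_zero, zero_smul, zero_add] at h4
    rw [ContinuousLinearMap.sum_apply] at h4
    refine Eq.trans (Finset.sum_congr rfl fun i _ => ?_) h4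
    simp [mul_comm]
  have hconst : ∀ Y : E, B (extChartAt I x₀ x₀) (fderiv ℝ η (τ, 0) (0, 1)) Y
      = B (extChartAt I x₀ x₀) (fderiv ℝ η (τ', 0) (0, 1)) Y := by
    intro Y
    have hd : ∀ τ, HasDerivAt (fun τ : ℝ => B (extChartAt I x₀ x₀) (fderiv ℝ η (τ, 0) (0, 1)) Y)
        0 τ := fun τ => by
      have h1 := (hd2 τ).clm_apply (hasFDerivAt_const ((0 : ℝ), (1 : ℝ)) (τ, (0 : ℝ)))
      have h2 := ((B (extChartAt I x₀ x₀)).flip Y).hasFDerivAt.comp (τ, (0 : ℝ)) h1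
      have h3 := h2.comp_hasDerivAt τ (hline τ)
      have h4 := hmix τ Y
      rw [fderiv_fderiv_symm (hct τ)] at h4
      refine h3.congr_deriv (Eq.trans ?_ h4)
      simp
    exact is_const_of_deriv_eq_zero (fun t => (hd t).differentiableAt) (fun t => (hd t).deriv) _ _
  have key : ∀ x, x = x₀ → ∀ v : E, B (extChartAt I x₀ x₀) (chartDeriv I x₀ x v) (Y : E)
      = (show E →L[ℝ] E →L[ℝ] ℝ from ΩM x₀) v Y := by
    rintro x rfl v
    have h1 := ΩM.inChart_apply (mem_chart_source H x) (v : TangentSpace I x) Y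
    rw [chartDeriv_self x Y] at h1
    exact h1
  have h5 := hconst Y
  rw [← chartDeriv_plotDeriv hUo hζ (hmem τ).1 (hmem τ).2,
    ← chartDeriv_plotDeriv hUo hζ (hmem τ').1 (hmem τ').2] at h5
  exact (key _ (h0 τ) _).symm.trans (h5.trans (key _ (h0 τ') _))

variable
  (hφ : IsHamiltonianFlow (Ω.pullback I (zeroSection ψ)) α r (rho M k) φ)
include hφ

theorem flowAt_add (hp : ‖p‖ < r) (q : M) (s t : ℝ) :
    flowAt φ p (s + t) q = flowAt φ p s (flowAt φ p t q) := by
  have hadd : ContDiff ℝ ∞ fun s : ℝ => s + t := contDiff_id.add contDiff_const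
  have := h.eq_flowAt hφ (c := fun s => flowAt φ p (s + t) q) hp
    ((flowAt_curve_contMDiff hφ hp q).comp hadd.contMDiff) (fun s => by
      have h1 := plotDeriv_comp (g := fun s => flowAt φ p s q) (f := fun s => s + t) (y := s)
        ((flowAt_curve_contMDiff hφ hp q).contMDiffAt.mdifferentiableAt (by simp))
        (hadd.differentiable (by simp)).differentiableAt 1
      have h2 : fderiv ℝ (fun s : ℝ => s + t) s 1 = 1 := by
        rw [fderiv_add_const, fderiv_fun_id]; simp
      rw [h1, h2]
      exact h.flowAt_isReeb hφ hp q (s + t)) s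
  rwa [zero_add] at this

omit h hφ [FiniteDimensional ℝ E] [I.Boundaryless] [IsManifold I ∞ M] in
theorem mem_charDist_congr {ΩM : TwoForm I M} {x y : M} (hxy : x = y) (v : E) :
    (show TangentSpace I x from v) ∈ charDist ΩM x
      ↔ (show TangentSpace I y from v) ∈ charDist ΩM y := by
  subst hxy; rfl

/-- The derivative of the flow realizes the holonomy of the characteristic foliation along an
orbit. -/
theorem holonomyRelated_flowDeriv (hp : ‖p‖ < r) {γ : ℝ → M}
    (hγ : ∀ t, flowAt φ p t (γ 0) = γ t) (t : ℝ) (v w : E)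
    (hw : w = flowDeriv I φ p t (γ 0) v) :
    IsHolonomyRelated (Ω.pullback I (zeroSection ψ)) γ t v w := by
  obtain ⟨U, g, hU, h0, hg, e, hv⟩ := exists_plot' (I := I) (γ 0)
  have hl : ContDiff ℝ ∞ fun s : ℝ => s • v := contDiff_id.smul contDiff_const
  have hl0 : (0 : ℝ) • v = 0 := zero_smul _ _
  obtain ⟨ε, hε, hball⟩ := Metric.isOpen_iff.1 (hU.preimage hl.continuous) (0 : ℝ)
    (by rw [Set.mem_preimage, hl0]; exact h0)
  rw [Real.ball_eq_Ioo, zero_sub, zero_add] at hball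
  have hc : ContMDiffOn 𝓘(ℝ, ℝ) I ∞ (fun s : ℝ => g (s • v)) (Set.Ioo (-ε) ε) :=
    hg.comp hl.contMDiff.contMDiffOn hball
  have h0ε : (0 : ℝ) ∈ Set.Ioo (-ε) ε := by simpa using hε
  have hcd : MDifferentiableAt 𝓘(ℝ, ℝ) I (fun s : ℝ => g (s • v)) 0 :=
    (hc.contMDiffAt (isOpen_Ioo.mem_nhds h0ε)).mdifferentiableAt (by simp)
  have hcv : (plotDeriv I (fun s : ℝ => g (s • v)) 0 1 : E) = v := by
    have h1 : HasFDerivAt (fun s : ℝ => s • v)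
        ((ContinuousLinearMap.id ℝ ℝ).smulRight v) 0 :=
      ((ContinuousLinearMap.id ℝ ℝ).smulRight v).hasFDerivAt
    have h2 := plotDeriv_comp (I := I) (g := g) (f := fun s : ℝ => s • v) (y := 0)
      (by rw [hl0]; exact (hg.contMDiffAt (hU.mem_nhds h0)).mdifferentiableAt (by simp))
      h1.differentiableAt 1
    rw [h1.fderiv] at h2
    have h3 : (plotDeriv I g ((0 : ℝ) • v) v : E) = plotDeriv I g 0 v :=
      congrArg (fun y : E => (plotDeriv I g y v : E)) hl0
    refine Eq.trans h2 (Eq.trans ?_ (h3.trans (hv v)))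
    simp
  have hc0 : g ((0 : ℝ) • v) = γ 0 := by rw [hl0, e]
  have key : ∀ (a b : M) (v w : E), a = b → v = w →
      (⟨a, v⟩ : TangentBundle I M) = ⟨b, w⟩ := by
    rintro a _ v _ rfl rfl; rfl
  -- The witness flows a curve with initial velocity `v`; its time curves are orbits, hence lie in
  -- leaves.
  refine ⟨ε, fun y => flowAt φ p y.1 (g (y.2 • v)), v, w, hε, ?_, ?_, ?_, ?_, ?_, ?_, ?_⟩
  · exact contMDiffOn_flow hφ (a := fun y : ℝ × ℝ => y.1)
      (hc.comp contDiff_snd.contMDiff.contMDiffOn fun y hy => hy.2) contDiffOn_const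
      (fun _ _ => hp) contDiff_fst.contDiffOn
  · intro τ
    change flowAt φ p τ (g ((0 : ℝ) • v)) = γ τ
    rw [hc0, hγ]
  · intro τ s hs
    exact (h.flowAt_isReeb hφ hp _ τ).1
  · have h1 := plotDeriv_congr (I := I) (x := (0 : ℝ))
      (g := fun s : ℝ => flowAt φ p 0 (g (s • v))) (g' := fun s : ℝ => g (s • v))
      (Filter.Eventually.of_forall fun s => flowAt_zero hφ hp _) 1
    exact h1.trans (key _ _ _ _ hc0 hcv)
  · have h1 := plotDeriv_flowAt hφ hp t hcd 1
    have h2 : (flowDeriv I φ p t (g ((0 : ℝ) • v))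
        (plotDeriv I (fun s : ℝ => g (s • v)) 0 1) : E)
        = flowDeriv I φ p t (γ 0) v := by
      rw [show plotDeriv I (fun s : ℝ => g (s • v)) 0 1 = (v : E) from hcv]
      exact congrArg (fun x : M => (show E →L[ℝ] E from flowDeriv I φ p t x) v) hc0
    exact key _ _ _ _ ((congrArg (flowAt φ p t) hc0).trans (hγ t)) (Eq.trans h1 (h2.trans hw.symm))
  · exact (sub_self (show TangentSpace I (γ 0) from v)).symm ▸ Submodule.zero_mem _
  · exact (sub_self (show TangentSpace I (γ t) from w)).symm ▸ Submodule.zero_mem _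

/-- Push a variation `σ(τ, s)` forward by the flow for the remaining time `t - τ`. The new variation
is still tangent to leaves and its central curve is constant, so by `variation_const` its transverse
class does not change. At `τ = t` it is that of `w`, at `τ = 0` that of `dφ^t v`. -/
theorem holonomyRelated_unique (hp : ‖p‖ < r) {γ : ℝ → M}
    (hγ : ∀ t, flowAt φ p t (γ 0) = γ t) (t : ℝ) {v : TangentSpace I (γ 0)}
    {w w₀ : TangentSpace I (γ t)} (hvw : IsHolonomyRelated (Ω.pullback I (zeroSection ψ)) γ t v w)
    (hw₀ : (w₀ : E) = flowDeriv I φ p t (γ 0) v) :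
    w - w₀ ∈ charDist (Ω.pullback I (zeroSection ψ)) (γ t) := by
  obtain ⟨ε, σ, v', w', hε, hσ, hσ0, hleaf, hv', hw', hv, hw⟩ := hvw
  have hUo : IsOpen (Set.univ ×ˢ Set.Ioo (-ε) ε : Set (ℝ × ℝ)) := isOpen_univ.prod isOpen_Ioo
  have h0ε : (0 : ℝ) ∈ Set.Ioo (-ε) ε := by simpa using hε
  let ζ : ℝ × ℝ → M := fun y => flowAt φ p (t - y.1) (σ y)
  have ha : ContDiff ℝ ∞ fun y : ℝ × ℝ => t - y.1 := contDiff_const.sub contDiff_fst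
  have hζ : ContMDiffOn 𝓘(ℝ, ℝ × ℝ) I ∞ ζ (Set.univ ×ˢ Set.Ioo (-ε) ε) :=
    contMDiffOn_flow hφ hσ contDiffOn_const (fun _ _ => hp) ha.contDiffOn
  have hζ0 : ∀ τ, ζ (τ, 0) = flowAt φ p t (γ 0) := fun τ => by
    simp only [ζ, hσ0]
    rw [← hγ τ, ← h.flowAt_add hφ hp, sub_add_cancel]
  have hmd : ∀ {Z : ℝ × ℝ → M}, ContMDiffOn 𝓘(ℝ, ℝ × ℝ) I ∞ Z (Set.univ ×ˢ Set.Ioo (-ε) ε) →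
      ∀ τ, ∀ s ∈ Set.Ioo (-ε) ε, MDifferentiableAt 𝓘(ℝ, ℝ × ℝ) I Z (τ, s) := fun hZ τ s hs =>
    (hZ.contMDiffAt (hUo.mem_nhds ⟨trivial, hs⟩)).mdifferentiableAt (by simp)
  have hfst : ∀ τ s : ℝ, HasFDerivAt (fun τ : ℝ => (τ, s)) (ContinuousLinearMap.inl ℝ ℝ ℝ) τ :=
    fun τ s => (hasFDerivAt_id τ).prodMk (hasFDerivAt_const s τ)
  have hsnd : ∀ τ s : ℝ, HasFDerivAt (fun s : ℝ => (τ, s)) (ContinuousLinearMap.inr ℝ ℝ ℝ) s :=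
    fun τ s => (hasFDerivAt_const τ s).prodMk (hasFDerivAt_id s)
  have hslice : ∀ {Z : ℝ × ℝ → M},
      ContMDiffOn 𝓘(ℝ, ℝ × ℝ) I ∞ Z (Set.univ ×ˢ Set.Ioo (-ε) ε) → ∀ τ,
      plotDeriv I Z (τ, 0) (0, 1) = plotDeriv I (fun s => Z (τ, s)) 0 1 := fun hZ τ => by
    have h1 := plotDeriv_comp (I := I) (f := fun s : ℝ => (τ, s)) (y := 0) (hmd hZ τ 0 h0ε)
      (hsnd τ 0).differentiableAt 1
    rw [(hsnd τ 0).fderiv] at h1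
    exact h1.symm
  have hch : ∀ τ, ∀ s ∈ Set.Ioo (-ε) ε,
      plotDeriv I ζ (τ, s) (1, 0) ∈ charDist (Ω.pullback I (zeroSection ψ)) (ζ (τ, s)) := by
    intro τ s hs
    obtain ⟨R, hR, eR⟩ := h.plotDeriv_flowAt_time hφ hUo hσ ha.contDiffOn hp
      (x := (τ, s)) ⟨trivial, hs⟩ (1, 0)
    have h1 := plotDeriv_comp (I := I) (f := fun τ : ℝ => (τ, s)) (y := τ) (hmd hσ τ s hs)
      (hfst τ s).differentiableAt 1
    rw [(hfst τ s).fderiv] at h1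
    have h2 : plotDeriv I σ (τ, s) (1, 0) ∈ charDist (Ω.pullback I (zeroSection ψ)) (σ (τ, s)) := by
      have h3 := hleaf τ s hs
      have h4 : mfderiv 𝓘(ℝ, ℝ) I (fun τ' => σ (τ', s)) τ (1 : ℝ) = plotDeriv I σ (τ, s) (1, 0) :=
        h1
      rwa [h4] at h3
    rw [eR]
    exact Submodule.add_mem _ (Submodule.smul_mem _ _ hR.1) (h.flowDeriv_char hφ hp _ h2)
  have hend : (plotDeriv I ζ (t, 0) (0, 1) : E) = w' := by
    have h1 : (plotDeriv I (fun s => ζ (t, s)) 0 1 : E) = plotDeriv I (fun s => σ (t, s)) 0 1 := by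
      refine congrArg (fun Z : ℝ → M => (plotDeriv I Z 0 1 : E)) (funext fun s => ?_)
      simp only [ζ, sub_self]
      exact flowAt_zero hφ hp _
    exact (hslice hζ t).trans (h1.trans (eq_of_heq (Bundle.TotalSpace.mk.inj hw').2))
  have hstart : (plotDeriv I ζ (0, 0) (0, 1) : E) = flowDeriv I φ p t (γ 0) v' := by
    have h1 : (plotDeriv I (fun s => ζ (0, s)) 0 1 : E)
        = plotDeriv I (fun s => flowAt φ p t (σ (0, s))) 0 1 := by
      refine congrArg (fun Z : ℝ → M => (plotDeriv I Z 0 1 : E)) (funext fun s => ?_)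
      simp only [ζ, sub_zero]
    have hd : MDifferentiableAt 𝓘(ℝ, ℝ) I (fun s => σ (0, s)) 0 :=
      (hmd hσ 0 0 h0ε).comp 0 (hsnd 0 0).differentiableAt.mdifferentiableAt
    have h2 := plotDeriv_flowAt hφ hp t hd 1
    have h3 : (plotDeriv I (fun s => σ (0, s)) 0 1 : E) = v' :=
      eq_of_heq (Bundle.TotalSpace.mk.inj hv').2
    rw [show plotDeriv I (fun s => σ (0, s)) 0 1 = (v' : E) from h3] at h2
    exact (hslice hζ 0).trans (h1.trans (Eq.trans h2
      (congrArg (fun x : M => (show E →L[ℝ] E from flowDeriv I φ p t x) v') (hσ0 0))))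
  have hmain : (show TangentSpace I (flowAt φ p t (γ 0)) from w') - flowDeriv I φ p t (γ 0) v'
      ∈ charDist (Ω.pullback I (zeroSection ψ)) (flowAt φ p t (γ 0)) := by
    refine ContinuousLinearMap.ext fun Y => ?_
    have h1 := h.variation_const hε hζ hζ0 hch t 0 Y
    rw [hend, hstart] at h1
    change (Ω.pullback I (zeroSection ψ)) _ (_ - _) Y = 0
    rw [map_sub, sub_apply]
    exact sub_eq_zero.2 h1
  have h1 : (show TangentSpace I (flowAt φ p t (γ 0)) from (w' : E) - (w : E)) ∈
      charDist (Ω.pullback I (zeroSection ψ)) (flowAt φ p t (γ 0)) :=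
    (mem_charDist_congr (hγ t) _).2 hw
  have h2 := Submodule.sub_mem _ (Submodule.add_mem _ hmain (h.flowDeriv_char hφ hp t hv)) h1
  have h3 := (mem_charDist_congr (hγ t) _).1 h2
  have h4 : ∀ (L : E →L[ℝ] E) (a b c d e : E), d = L c →
      a - L b + L (b - c) - (a - e) = e - d := fun L a b c d e hd => by
    rw [hd, map_sub]; abel
  have h5 := h4 (flowDeriv I φ p t (γ 0)) w' v' v w₀ w hw₀
  exact (congrArg (fun x : E => (show TangentSpace I (γ t) from x) ∈
    charDist (Ω.pullback I (zeroSection ψ)) (γ t)) h5).mp h3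

end IsStableTube
end Holonomy
end CoisotropicIndex

/-! ### Boundary loops and collars of discs. -/

namespace CoisotropicIndex

theorem continuous_bd (T : ℝ) : Continuous (bd T) := by
  unfold bd
  fun_prop

theorem norm_bd (T t : ℝ) : ‖bd T t‖ = 1 := Complex.norm_exp_ofReal_mul_I _

theorem bd_mem (T t : ℝ) : bd T t ∈ Metric.closedBall (0 : ℂ) 1 := by simp [norm_bd]

theorem bd_rescale {T : ℝ} (hT : T ≠ 0) (t : ℝ) : bd T (T * t) = bd 1 t := by
  rw [bd, bd, mul_div_cancel_left₀ _ hT, div_one]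

theorem bd_self {T : ℝ} (hT : T ≠ 0) : bd T T = bd T 0 := by
  simp [bd, div_self hT, Complex.exp_two_pi_mul_I]

section Gluing

variable {W : Type*} [TopologicalSpace W]

theorem periodic_angle {T : ℝ} {f : ℝ → W} (hf : ∀ t, f (t + T) = f t) {a b : ℝ}
    (hab : (a : Real.Angle) = b) : f (T * (a / (2 * Real.pi))) = f (T * (b / (2 * Real.pi))) := by
  obtain ⟨n, hn⟩ := Real.Angle.angle_eq_iff_two_pi_dvd_sub.1 hab
  have h := Function.Periodic.int_mul (f := f) (c := T) hf n (T * (b / (2 * Real.pi)))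
  have hπ : (2 * Real.pi) ≠ 0 := by positivity
  have ha : a = b + 2 * Real.pi * n := by linarith
  rw [← h, ha]
  congr 1
  field_simp

/-- Off the slit plane `arg` is replaced by `arg (-z) + π`, which is continuous there and represents
the same angle; periodicity makes the two formulas agree. -/
theorem continuousOn_periodic_arg {T : ℝ} {H : ℝ → ℝ → W}
    (hH : ContinuousOn (fun y : ℝ × ℝ => H y.1 y.2) (Set.Icc 0 1 ×ˢ Set.univ))
    (hper : ∀ s t, H s (t + T) = H s t) :
    ContinuousOn (fun y : ℝ × ℂ => H y.1 (T * (y.2.arg / (2 * Real.pi)))) (Set.Icc 0 1 ×ˢ {0}ᶜ) := by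
  have hcomp : ∀ (a : ℂ → ℝ) (y : ℝ × ℂ), y ∈ (Set.Icc 0 1 ×ˢ {0}ᶜ : Set (ℝ × ℂ)) →
      ContinuousAt a y.2 → ContinuousWithinAt
        (fun y : ℝ × ℂ => H y.1 (T * (a y.2 / (2 * Real.pi)))) (Set.Icc 0 1 ×ˢ {0}ᶜ) y := by
    intro a y hy ha
    have h1 : ContinuousAt (fun y : ℝ × ℂ => a y.2) y :=
      ContinuousAt.comp (f := fun y : ℝ × ℂ => y.2) ha continuousAt_snd
    exact ContinuousWithinAt.comp (g := fun y : ℝ × ℝ => H y.1 y.2)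
      (f := fun y : ℝ × ℂ => (y.1, T * (a y.2 / (2 * Real.pi))))
      (hH _ ⟨hy.1, trivial⟩)
      (continuousAt_fst.prodMk (continuousAt_const.mul (h1.div_const _))).continuousWithinAt
      fun z hz => ⟨hz.1, trivial⟩
  intro y hy
  by_cases hs : y.2 ∈ Complex.slitPlane
  · exact hcomp Complex.arg y hy (Complex.continuousAt_arg hs)
  · have hne : ∀ z : ℂ, z ≠ 0 → ((z.arg : ℝ) : Real.Angle) = (((-z).arg + Real.pi : ℝ) : Real.Angle) :=
      fun z hz => by
        rw [Real.Angle.coe_add, Complex.arg_neg_coe_angle hz, add_assoc, Real.Angle.coe_pi_add_coe_pi,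
          add_zero]
    have hneg : -y.2 ∈ Complex.slitPlane := by
      have h0 : y.2 ≠ 0 := hy.2
      rw [Complex.mem_slitPlane_iff] at hs ⊢
      push Not at hs
      left
      rw [Complex.neg_re]
      have : y.2.re ≠ 0 := fun h => h0 (Complex.ext h hs.2)
      have := lt_of_le_of_ne hs.1 this
      linarith
    refine (hcomp (fun z => (-z).arg + Real.pi) y hy ?_).congr
      (fun z hz => periodic_angle (hper z.1) (hne z.2 hz.2)) (periodic_angle (hper y.1) (hne y.2 hy.2))
    exact (ContinuousAt.comp (f := fun z : ℂ => -z) (Complex.continuousAt_arg hneg)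
      continuousAt_neg).add continuousAt_const

/-- A collar can be added to a disc. -/
theorem exists_collar {T : ℝ} (hT : T ≠ 0) {u : ℂ → W}
    (hu : ContinuousOn u (Metric.closedBall 0 1)) {H : ℝ → ℝ → W}
    (hH : ContinuousOn (fun y : ℝ × ℝ => H y.1 y.2) (Set.Icc 0 1 ×ˢ Set.univ))
    (hper : ∀ s t, H s (t + T) = H s t) (h1 : ∀ t, H 1 t = u (bd T t)) :
    ∃ U : ℂ → W, ContinuousOn U (Metric.closedBall 0 1) ∧
      ∀ s ∈ Set.Icc (0 : ℝ) 1, ∀ t, U ((1 - s / 2 : ℝ) * bd T t) = H s t := by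
  classical
  have hang : ∀ ρ : ℝ, 0 < ρ → ∀ s t, H s (T * (((ρ : ℂ) * bd T t).arg / (2 * Real.pi))) = H s t := by
    intro ρ hρ s t
    have h2 : ((((ρ : ℂ) * bd T t).arg : ℝ) : Real.Angle) = ((2 * Real.pi * (t / T) : ℝ) : Real.Angle) := by
      rw [Complex.arg_real_mul _ hρ, bd, Complex.exp_mul_I]
      exact_mod_cast Complex.arg_cos_add_sin_mul_I_coe_angle ((2 * Real.pi * (t / T) : ℝ) : Real.Angle)
    rw [periodic_angle (hper s) h2]
    congr 1
    have hπ : (2 * Real.pi) ≠ 0 := by positivity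
    field_simp
  have hinner : ContinuousOn (fun z : ℂ => u (2 * z)) (Metric.closedBall 0 (1 / 2)) :=
    hu.comp (by fun_prop) fun z hz => by
      rw [mem_closedBall_zero_iff] at hz ⊢
      rw [norm_mul, Complex.norm_ofNat]
      linarith
  have houter : ContinuousOn (fun z : ℂ => H (2 - 2 * ‖z‖) (T * (z.arg / (2 * Real.pi))))
      {z | 1 / 2 ≤ ‖z‖ ∧ ‖z‖ ≤ 1} :=
    (continuousOn_periodic_arg hH hper).comp (f := fun z : ℂ => (2 - 2 * ‖z‖, z)) (by fun_prop)
      fun z hz => ⟨⟨by linarith [hz.2], by linarith [hz.1]⟩, fun h0 => by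
        have h3 : z = 0 := h0
        have := hz.1
        rw [h3, norm_zero] at this
        norm_num at this⟩
  -- The half-size disc carries `u`; on the annulus the parameter `s = 2 - 2‖z‖` runs from `1` on
  -- the inner circle to `0` on the outer one.
  let U : ℂ → W := fun z => if ‖z‖ ≤ 1 / 2 then u (2 * z)
    else H (2 - 2 * ‖z‖) (T * (z.arg / (2 * Real.pi)))
  have hpolar : ∀ z : ℂ, ‖z‖ = 1 / 2 → u (2 * z) = H (2 - 2 * ‖z‖) (T * (z.arg / (2 * Real.pi))) := by
    intro z hz
    have hz2 : bd T (T * (z.arg / (2 * Real.pi))) = 2 * z := by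
      have h4 := Complex.norm_mul_exp_arg_mul_I z
      rw [hz] at h4
      rw [bd, mul_div_cancel_left₀ _ hT, mul_div_cancel₀ _ (by positivity)]
      conv_rhs => rw [← h4]
      push_cast
      ring
    rw [hz, ← hz2, ← h1]
    norm_num
  have hUo : ∀ z : ℂ, 1 / 2 ≤ ‖z‖ → U z = H (2 - 2 * ‖z‖) (T * (z.arg / (2 * Real.pi))) := by
    intro z hz
    by_cases h : ‖z‖ ≤ 1 / 2
    · rw [← hpolar z (le_antisymm h hz)]; exact if_pos h
    · exact if_neg h
  have hcl : IsClosed {z : ℂ | 1 / 2 ≤ ‖z‖ ∧ ‖z‖ ≤ 1} :=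
    (isClosed_le continuous_const continuous_norm).inter (isClosed_le continuous_norm continuous_const)
  refine ⟨U, ?_, fun s hs t => ?_⟩
  · have h2 : ContinuousOn U (Metric.closedBall 0 (1 / 2)) :=
      hinner.congr fun z hz => if_pos (by simpa using hz)
    have h3 : ContinuousOn U {z | 1 / 2 ≤ ‖z‖ ∧ ‖z‖ ≤ 1} := houter.congr fun z hz => hUo z hz.1
    refine (h2.union_of_isClosed h3 Metric.isClosed_closedBall hcl).mono fun z hz => ?_
    rw [mem_closedBall_zero_iff] at hz
    by_cases h : ‖z‖ ≤ 1 / 2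
    · left; rw [mem_closedBall_zero_iff]; exact h
    · right; exact ⟨(not_le.1 h).le, hz⟩
  · have hpos : (0 : ℝ) < 1 - s / 2 := by linarith [hs.2]
    have hn : ‖((1 - s / 2 : ℝ) : ℂ) * bd T t‖ = 1 - s / 2 := by
      rw [norm_mul, norm_bd, mul_one, Complex.norm_real, Real.norm_of_nonneg hpos.le]
    rw [hUo _ (by rw [hn]; linarith [hs.2]), hn, hang _ hpos]
    congr 1
    ring

end Gluing

/-! ### Mean indices read in cappings. -/

section Capping

variable {F : Type*} [NormedAddCommGroup F] [NormedSpace ℝ F] [FiniteDimensional ℝ F]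
  {G : Type*} [TopologicalSpace G] {J : ModelWithCorners ℝ F G} [J.Boundaryless]
  {W : Type*} [TopologicalSpace W] [ChartedSpace G W] [IsManifold J ∞ W]
  {n : ℕ} {Ω : TwoForm J W} {y : ℝ → W} {T : ℝ} {u u' : ℂ → W}

omit [FiniteDimensional ℝ F] [J.Boundaryless] [IsManifold J ∞ W] in
theorem tangent_ext {x x' : W} {v : TangentSpace J x} {v' : TangentSpace J x'} (h : x = x')
    (hv : (v : F) = v') : (⟨x, v⟩ : TangentBundle J W) = ⟨x', v'⟩ := by
  subst h
  exact congrArg _ hv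

omit [FiniteDimensional ℝ F] [J.Boundaryless] [IsManifold J ∞ W] in
theorem form_congr {x x' : W} {v w : TangentSpace J x} {v' w' : TangentSpace J x'}
    (hv : (⟨x, v⟩ : TangentBundle J W) = ⟨x', v'⟩) (hw : (⟨x, w⟩ : TangentBundle J W) = ⟨x', w'⟩) :
    Ω x v w = Ω x' v' w' := by
  obtain ⟨h1, h2⟩ := Bundle.TotalSpace.mk.inj hv
  obtain ⟨-, h3⟩ := Bundle.TotalSpace.mk.inj hw
  subst h1
  rw [eq_of_heq h2, eq_of_heq h3]

omit [FiniteDimensional ℝ F] [J.Boundaryless] [IsManifold J ∞ W] in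
theorem transMatrix_congr {ι : Type*} {x x' : W} {f : Fin n ⊕ Fin n → TangentSpace J x}
    {f' : Fin n ⊕ Fin n → TangentSpace J x'} {g : ι → TangentSpace J x} {g' : ι → TangentSpace J x'}
    (hf : ∀ a, (⟨x, f a⟩ : TangentBundle J W) = ⟨x', f' a⟩)
    (hg : ∀ b, (⟨x, g b⟩ : TangentBundle J W) = ⟨x', g' b⟩) :
    transMatrix (Ω x) f g = transMatrix (Ω x') f' g' := by
  unfold transMatrix
  congr 1
  ext a b
  exact form_congr (hf a) (hg b)

theorem IsCappingFrame.basis {e : ∀ t, Fin n ⊕ Fin n → TangentSpace J (y t)}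
    (he : IsCappingFrame Ω y T u e) (t : ℝ) : IsSymplecticBasis (Ω (y t)) (e t) := by
  obtain ⟨f, hf, hfe⟩ := he
  intro a b
  rw [form_congr (hfe t a) (hfe t b)]
  exact hf.gram _ (bd_mem T t) a b

theorem IsCappingFrame.continuous {e : ∀ t, Fin n ⊕ Fin n → TangentSpace J (y t)}
    (he : IsCappingFrame Ω y T u e) (a) :
    Continuous (fun t => (⟨y t, e t a⟩ : TangentBundle J W)) := by
  obtain ⟨f, hf, hfe⟩ := he
  have := (hf.continuousOn a).comp_continuous (continuous_bd T) (bd_mem T)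
  exact this.congr fun t => (hfe t a).symm

theorem IsCappingFrame.closed {e : ∀ t, Fin n ⊕ Fin n → TangentSpace J (y t)}
    (he : IsCappingFrame Ω y T u e) (hT : T ≠ 0) (a) :
    (⟨y T, e T a⟩ : TangentBundle J W) = ⟨y 0, e 0 a⟩ := by
  obtain ⟨f, hf, hfe⟩ := he
  rw [hfe, hfe, bd_self hT]

theorem exists_cappingFrame (hn : Module.finrank ℝ F = 2 * n) (hΩ : IsSymplecticForm Ω)
    (hu : IsCapping y T u) : ∃ e : ∀ t, Fin n ⊕ Fin n → TangentSpace J (y t),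
      IsCappingFrame Ω y T u e := by
  obtain ⟨f, hf⟩ := hΩ.exists_frame_disc hn hu.1
  exact ⟨fun t a => (f (bd T t) a : F), f, hf, fun t a => tangent_ext (hu.2 t).symm rfl⟩

/-- The matrix of a transport in a frame. -/
theorem exists_transport_index (hn : Module.finrank ℝ F = 2 * n) (hΩ : IsSymplecticForm Ω)
    (hT : 0 < T) {e : ∀ t, Fin n ⊕ Fin n → TangentSpace J (y t)} (he : IsCappingFrame Ω y T u e)
    {Ψ : ∀ t, TangentSpace J (y 0) →L[ℝ] TangentSpace J (y t)}
    (hc : ∀ v, ContinuousOn (fun t => (⟨y t, Ψ t v⟩ : TangentBundle J W)) (Set.Icc 0 T))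
    (hs : ∀ t ∈ Set.Icc 0 T, ∀ v w, Ω (y t) (Ψ t v) (Ψ t w) = Ω (y 0) v w) :
    (∀ t, ∀ b, Ψ t (e 0 b) = ∑ a, transMatrix (Ω (y t)) (e t) (fun b => Ψ t (e 0 b)) a b • e t a) ∧
    ∃ d, HasMeanIndex T (fun t => transMatrix (Ω (y t)) (e t) (fun b => Ψ t (e 0 b))) d := by
  have hfr : ∀ x : W, Module.finrank ℝ (TangentSpace J x) = 2 * n := fun x => hn
  have hexp : ∀ t, ∀ b, Ψ t (e 0 b)
      = ∑ a, transMatrix (Ω (y t)) (e t) (fun b => Ψ t (e 0 b)) a b • e t a :=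
    fun t b => (he.basis t).expand_transMatrix (hfr _) (fun b => Ψ t (e 0 b)) b
  refine ⟨hexp, exists_hasMeanIndex hT.le ?_ fun t ht => ?_⟩
  · exact hΩ.continuousOn_transMatrix (fun a => (he.continuous a).continuousOn) fun b => hc (e 0 b)
  · refine (he.basis t).mem_symplecticGroup_of_eq (g := fun b => Ψ t (e 0 b)) (fun a b => ?_) (hexp t)
    rw [hs t ht]
    exact he.basis 0 a b

/-- The mean index of a transport does not depend on the capping and the frame. -/
theorem transport_index_unique (hn : Module.finrank ℝ F = 2 * n) (hΩ : IsSymplecticForm Ω)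
    (hch : ChernVanishesOnSpheres n Ω) (hT : 0 < T) (hu : IsCapping y T u) (hu' : IsCapping y T u')
    {Ψ : ∀ t, TangentSpace J (y 0) →L[ℝ] TangentSpace J (y t)} (hΨ : ∀ v, Ψ 0 v = v) {d d' : ℝ}
    (h : IsTransportMeanIndex n Ω y T u Ψ d) (h' : IsTransportMeanIndex n Ω y T u' Ψ d') :
    d = d' := by
  obtain ⟨e, A, he, hA, hAd⟩ := h
  obtain ⟨e', A', he', hA', hAd'⟩ := h'
  have hfr : ∀ x : W, Module.finrank ℝ (TangentSpace J x) = 2 * n := fun x => hn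
  set S : ℝ → Matrix (Fin n ⊕ Fin n) (Fin n ⊕ Fin n) ℝ :=
    fun t => transMatrix (Ω (y t)) (e t) (e' t) with hSdef
  have hSe : ∀ t b, e' t b = ∑ a, S t a b • e t a := fun t b =>
    (he.basis t).expand_transMatrix (hfr _) _ b
  have hSS : ∀ t, S t ∈ Matrix.symplecticGroup (Fin n) ℝ := fun t =>
    (he.basis t).mem_symplecticGroup_of_eq (he'.basis t) (hSe t)
  have hSc : ContinuousOn S (Set.Icc 0 T) :=
    hΩ.continuousOn_transMatrix (fun a => (he.continuous a).continuousOn)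
      fun b => (he'.continuous b).continuousOn
  have hSl : S T = S 0 := transMatrix_congr (he.closed hT.ne') (he'.closed hT.ne')
  have hlin : ∀ t ∈ Set.Icc 0 T, A t * S 0 = S t * A' t := by
    intro t ht
    have h1 : ∀ b, Ψ t (e' 0 b) = ∑ a, (A t * S 0) a b • e t a := fun b => by
      rw [hSe, map_sum]
      simp_rw [map_smul, hA t ht, Finset.smul_sum, smul_smul, Matrix.mul_apply, Finset.sum_smul]
      rw [Finset.sum_comm]
      exact Finset.sum_congr rfl fun i _ => Finset.sum_congr rfl fun j _ => by rw [mul_comm]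
    have h2 : ∀ b, Ψ t (e' 0 b) = ∑ a, (S t * A' t) a b • e t a := fun b => by
      rw [hA' t ht]
      simp_rw [hSe t, Finset.smul_sum, smul_smul, Matrix.mul_apply, Finset.sum_smul]
      rw [Finset.sum_comm]
      exact Finset.sum_congr rfl fun i _ => Finset.sum_congr rfl fun j _ => by rw [mul_comm]
    rw [← (he.basis t).transMatrix_of_eq h1, (he.basis t).transMatrix_of_eq h2]
  have hA0 : A' 0 = 1 := by
    rw [← (he'.basis 0).transMatrix_of_eq (hA' 0 (Set.left_mem_Icc.2 hT.le)),
      (he'.basis 0).transMatrix_of_eq (A := 1)]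
    intro b
    simp [hΨ, Matrix.one_apply]
  obtain ⟨δ, hδ⟩ := exists_rotation_path (T := 1) zero_le_one
    (A := fun t => S (T * t)) (hSc.comp (by fun_prop) fun t ht =>
      ⟨by have := ht.1; positivity, by nlinarith [ht.2]⟩) fun t _ => hSS _
  have hrot : HasRotation T (fun t => (complexPart (S t)).det) 0 := by
    obtain ⟨f, hf, hfe⟩ := he
    obtain ⟨f', hf', hfe'⟩ := he'
    -- The transition loop of the two frames, rescaled to period `1`, computes `c_1` on the sphere
    -- made of the two cappings; its vanishing makes `S` a loop of rotation zero.
    have hc0 := hch u u' hu.1 hu'.1 (fun t => by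
      rw [← bd_rescale hT.ne', hu.2, hu'.2]) (δ / (2 * Real.pi))
      ⟨f, f', fun t => S (T * t), hf, hf', fun t _ b => by
        rw [← bd_rescale hT.ne', ← hfe' (T * t) b, hSe]
        have hpt := (hu.2 (T * t)).symm
        refine tangent_ext hpt ?_
        have h3 : ∀ a, (e (T * t) a : F) = f (bd T (T * t)) a := fun a =>
          eq_of_heq (Bundle.TotalSpace.mk.inj (hfe (T * t) a)).2
        exact Finset.sum_congr rfl fun a _ =>
          congrArg (fun v : F => (S (T * t) a b • v : F)) (h3 a), by
        rwa [mul_div_cancel₀ _ (by positivity)]⟩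
    obtain ⟨θ, h1, h2, h3⟩ := hδ
    have hδ0 : δ = 0 := by
      have hπ : (2 * Real.pi) ≠ 0 := by positivity
      simpa [hπ] using hc0
    refine ⟨fun t => θ (t / T), h1.comp (by fun_prop) fun t ht =>
      ⟨div_nonneg ht.1 hT.le, (div_le_one hT).2 ht.2⟩, fun t ht => ?_, ?_⟩
    · have := h2 (t / T) ⟨div_nonneg ht.1 hT.le, (div_le_one hT).2 ht.2⟩
      simpa only [mul_div_cancel₀ _ hT.ne'] using this
    · beta_reduce
      rw [div_self hT.ne', zero_div, ← h3, hδ0]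
  have h3 := hAd'.loop_change hT.le hA0 hSc (fun t _ => hSS t) hSl hrot
  refine hAd.unique hT.le (h3.congr fun t ht => ?_)
  rw [← hlin t ht, Matrix.mul_assoc, symplectic_mul_inv_cancel (hSS 0), Matrix.mul_one]

end Capping
end CoisotropicIndex

namespace CoisotropicIndex

/-! ### Frames along the loops `(φ^t q, s p)`. -/

section OrbitFrame

variable {E : Type*} [NormedAddCommGroup E] [NormedSpace ℝ E] [FiniteDimensional ℝ E]
  {H : Type*} [TopologicalSpace H] {I : ModelWithCorners ℝ E H} [I.Boundaryless]
  {M : Type*} [TopologicalSpace M] [ChartedSpace H M] [IsManifold I ∞ M]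
  {F : Type*} [NormedAddCommGroup F] [NormedSpace ℝ F]
  {G : Type*} [TopologicalSpace G] {J : ModelWithCorners ℝ F G} [J.Boundaryless]
  {W : Type*} [TopologicalSpace W] [ChartedSpace G W] [IsManifold J ∞ W]
  {k m : ℕ} {Ω : TwoForm J W} {α : Fin k → OneForm I M} {r : ℝ}
  {ψ : M × EuclideanSpace ℝ (Fin k) → W}
  {φ : ℝ → M × EuclideanSpace ℝ (Fin k) → M × EuclideanSpace ℝ (Fin k)}
  {p : EuclideanSpace ℝ (Fin k)} {q : M} {s : ℝ}

/-- The tangent vectors of the tube along the curve `(φ^t q, s p)`, obtained from those at `q` by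
the derivative of the flow in the horizontal direction and constant in the vertical direction. -/
noncomputable def orbitFrame (I : ModelWithCorners ℝ E H) (J : ModelWithCorners ℝ F G) {M : Type*}
    [TopologicalSpace M] [ChartedSpace H M] {W : Type*} [TopologicalSpace W] [ChartedSpace G W]
    {k : ℕ} (ψ : M × EuclideanSpace ℝ (Fin k) → W)
    (φ : ℝ → M × EuclideanSpace ℝ (Fin k) → M × EuclideanSpace ℝ (Fin k))
    (p : EuclideanSpace ℝ (Fin k)) (q : M) (s t : ℝ) :
    E × EuclideanSpace ℝ (Fin k) →L[ℝ] TangentSpace J (ψ (flowAt φ p t q, s • p)) :=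
  (show E × EuclideanSpace ℝ (Fin k) →L[ℝ] F from
    mfderiv (I.prod (𝓡 k)) J ψ (flowAt φ p t q, s • p)).comp
    ((show E →L[ℝ] E from flowDeriv I φ p t q).prodMap (ContinuousLinearMap.id ℝ _))

theorem orbitFrame_apply (t : ℝ) (v : E × EuclideanSpace ℝ (Fin k)) :
    orbitFrame I J ψ φ p q s t v = mfderiv (I.prod (𝓡 k)) J ψ (flowAt φ p t q, s • p)
      (pairVec (flowAt φ p t q, s • p) (flowDeriv I φ p t q v.1) v.2) := rfl

/-- The shear of `T_q M × ℝ^k` given by Reeb vectors `R`. -/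
noncomputable def reebShear {k : ℕ} (R : Fin k → E) :
    E × EuclideanSpace ℝ (Fin k) →L[ℝ] E × EuclideanSpace ℝ (Fin k) :=
  (ContinuousLinearMap.inl ℝ E _).comp ((∑ i, (EuclideanSpace.proj i :
    EuclideanSpace ℝ (Fin k) →L[ℝ] ℝ).smulRight (R i)).comp (ContinuousLinearMap.snd ℝ E _))

omit [FiniteDimensional ℝ E] in
theorem reebShear_apply (R : Fin k → E) (v : E × EuclideanSpace ℝ (Fin k)) :
    reebShear R v = (∑ i, v.2 i • R i, 0) := by
  refine Prod.ext ?_ ?_ <;> simp [reebShear, Prod.fst_sum, Prod.snd_sum]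

omit [FiniteDimensional ℝ E] in
theorem reebShear_reebShear (R : Fin k → E) (v : E × EuclideanSpace ℝ (Fin k)) :
    reebShear R (reebShear R v) = 0 := by
  simp [reebShear_apply]

namespace IsStableTube

variable (h : IsStableTube m Ω α r ψ)
include h

theorem isReeb_sum {R : Fin k → TangentSpace I q}
    (hR : ∀ i, IsReeb (Ω.pullback I (zeroSection ψ)) α q (EuclideanSpace.single i 1) (R i))
    (w : EuclideanSpace ℝ (Fin k)) :
    IsReeb (Ω.pullback I (zeroSection ψ)) α q w (∑ i, w i • R i) := by
  refine ⟨Submodule.sum_mem _ fun i _ => Submodule.smul_mem _ _ (hR i).1, fun j => ?_⟩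
  rw [map_sum]
  simp_rw [map_smul, (hR _).2]
  simp [Pi.single_apply]

theorem normalForm_add (z : M × EuclideanSpace ℝ (Fin k)) (hz : z ∈ tube M k r)
    (X X' Y : TangentSpace (I.prod (𝓡 k)) z) :
    normalForm (Ω.pullback I (zeroSection ψ)) α z (X + X') Y
      = normalForm (Ω.pullback I (zeroSection ψ)) α z X Y
        + normalForm (Ω.pullback I (zeroSection ψ)) α z X' Y := by
  rw [← h.nbhd.pullback z hz, ← h.nbhd.pullback z hz, ← h.nbhd.pullback z hz, map_add, map_add,
    add_apply]

theorem normalForm_smul (z : M × EuclideanSpace ℝ (Fin k)) (hz : z ∈ tube M k r) (c : ℝ)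
    (X Y : TangentSpace (I.prod (𝓡 k)) z) :
    normalForm (Ω.pullback I (zeroSection ψ)) α z (c • X) Y
      = c * normalForm (Ω.pullback I (zeroSection ψ)) α z X Y := by
  rw [← h.nbhd.pullback z hz, ← h.nbhd.pullback z hz, map_smul, map_smul, smul_apply, smul_eq_mul]

/-- The normal form is invariant under the shear given by the Reeb vectors. -/
theorem normalForm_shear {z : M × EuclideanSpace ℝ (Fin k)} (hz : z ∈ tube M k r) {R : Fin k → E}
    (hR : ∀ i, IsReeb (Ω.pullback I (zeroSection ψ)) α z.1 (EuclideanSpace.single i 1) (R i))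
    (x : ℝ) (v v' : E × EuclideanSpace ℝ (Fin k)) :
    normalForm (Ω.pullback I (zeroSection ψ)) α z
        (pairVec z (v + x • reebShear R v).1 (v + x • reebShear R v).2)
        (pairVec z (v' + x • reebShear R v').1 (v' + x • reebShear R v').2)
      = normalForm (Ω.pullback I (zeroSection ψ)) α z (pairVec z v.1 v.2) (pairVec z v'.1 v'.2) := by
  let nf : E × EuclideanSpace ℝ (Fin k) → E × EuclideanSpace ℝ (Fin k) → ℝ := fun v w =>
    normalForm (Ω.pullback I (zeroSection ψ)) α z (pairVec z v.1 v.2) (pairVec z w.1 w.2)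
  -- The pairing is symmetric in `v` and `w`, so the two first-order terms of the sheared form
  -- cancel; the second-order term vanishes because `reebShear` has no vertical part.
  have hN : ∀ v w, nf (reebShear R v) w = -∑ i, v.2 i * w.2 i := fun v w => by
    have h1 := h.normalForm_reeb (h.isReeb_sum hR v.2) (pairVec z w.1 w.2)
    simp only [nf]
    rw [reebShear_apply]
    exact h1
  have hadd : ∀ u v w, nf (u + v) w = nf u w + nf v w := fun u v w =>
    h.normalForm_add z hz (pairVec z u.1 u.2) (pairVec z v.1 v.2) (pairVec z w.1 w.2)
  have hsmul : ∀ (c : ℝ) v w, nf (c • v) w = c * nf v w := fun c v w =>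
    h.normalForm_smul z hz c (pairVec z v.1 v.2) (pairVec z w.1 w.2)
  have hskew : ∀ v w, nf v w = -nf w v := fun v w =>
    h.normalForm_skew z (pairVec z v.1 v.2) (pairVec z w.1 w.2)
  have h9 : (v' + x • reebShear R v').2 = v'.2 := by
    rw [reebShear_apply]
    simp
  have h11 : ∑ i, v'.2 i * v.2 i = ∑ i, v.2 i * v'.2 i :=
    Finset.sum_congr rfl fun i _ => mul_comm _ _
  change nf _ _ = nf _ _
  rw [hadd, hsmul, hN, h9, hskew v, hadd, hsmul, hN, h11, hskew v' v]
  ring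

variable
  (hφ : IsHamiltonianFlow (Ω.pullback I (zeroSection ψ)) α r (rho M k) φ)
include hφ

omit h in
theorem flowDeriv_zero (hp : ‖p‖ < r) (v : E) : (flowDeriv I φ p 0 q v : E) = v := by
  obtain ⟨U, g, hU, h0, hg, rfl, hv⟩ := exists_plot' (I := I) q
  have h1 := plotDeriv_flowAt hφ hp 0
    ((hg.contMDiffAt (hU.mem_nhds h0)).mdifferentiableAt (by simp)) v
  rw [show plotDeriv I g 0 v = (v : E) from hv v] at h1
  have h2 := plotDeriv_congr (I := I) (x := (0 : E)) (g := fun y => flowAt φ p 0 (g y)) (g' := g)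
    (Filter.Eventually.of_forall fun y => flowAt_zero hφ hp _) v
  exact Eq.trans h1.symm ((eq_of_heq (Bundle.TotalSpace.mk.inj h2).2).trans (hv v))

/-- The base momentum is constant along the loop, and the derivative of the flow preserves every
ingredient of the normal form: `ω_M`, the `dα_j` and the `α_j`. So the Gram matrix is independent of
`t`, for each `s`. -/
theorem orbitFrame_form (hp : ‖p‖ < r) (hs : ‖s • p‖ < r) (t : ℝ)
    (v v' : E × EuclideanSpace ℝ (Fin k)) :
    Ω (ψ (flowAt φ p t q, s • p)) (orbitFrame I J ψ φ p q s t v) (orbitFrame I J ψ φ p q s t v')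
      = normalForm (Ω.pullback I (zeroSection ψ)) α (q, s • p) (pairVec (q, s • p) v.1 v.2)
        (pairVec (q, s • p) v'.1 v'.2) := by
  have hz : (flowAt φ p t q, s • p) ∈ tube M k r := hs
  rw [orbitFrame_apply, orbitFrame_apply, h.nbhd.pullback _ hz]
  change (Ω.pullback I (zeroSection ψ)) (flowAt φ p t q) (flowDeriv I φ p t q v.1)
      (flowDeriv I φ p t q v'.1) + ∑ j, ((s • p) j * (α j).d (flowAt φ p t q)
        (flowDeriv I φ p t q v.1) (flowDeriv I φ p t q v'.1) +
        (v.2 j * α j (flowAt φ p t q) (flowDeriv I φ p t q v'.1)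
          - v'.2 j * α j (flowAt φ p t q) (flowDeriv I φ p t q v.1)))
    = (Ω.pullback I (zeroSection ψ)) q v.1 v'.1 + ∑ j, ((s • p) j * (α j).d q v.1 v'.1 +
        (v.2 j * α j q v'.1 - v'.2 j * α j q v.1))
  have e1 := h.flowDeriv_twoForm hφ hp t (q := q) v.1 v'.1
  have e2 := fun j => h.flowDeriv_d hφ hp t (q := q) v.1 v'.1 j
  have e3 := fun j => h.flowDeriv_oneForm hφ hp t (q := q) v.1 j
  have e4 := fun j => h.flowDeriv_oneForm hφ hp t (q := q) v'.1 j
  rw [e1]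
  congr 1
  refine Finset.sum_congr rfl fun j _ => ?_
  rw [e2, e3, e4]

theorem orbitFrame_injective (hp : ‖p‖ < r) (hs : ‖s • p‖ < r) (t : ℝ) :
    Function.Injective (orbitFrame I J ψ φ p q s t) := by
  have hz : (flowAt φ p t q, s • p) ∈ tube M k r := hs
  intro v v' hv
  rw [orbitFrame_apply, orbitFrame_apply] at hv
  have h1 := (h.bijective hz).1 hv
  have h2 : flowDeriv I φ p t q v.1 = flowDeriv I φ p t q v'.1 :=
    congrArg (fun X : E × EuclideanSpace ℝ (Fin k) => X.1) h1
  exact Prod.ext (h.flowDeriv_injective hφ hp t q h2)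
    (congrArg (fun X : E × EuclideanSpace ℝ (Fin k) => X.2) h1 :)

theorem orbitFrame_surjective (hp : ‖p‖ < r) (hs : ‖s • p‖ < r) (t : ℝ) :
    Function.Surjective (orbitFrame I J ψ φ p q s t) := by
  have hz : (flowAt φ p t q, s • p) ∈ tube M k r := hs
  intro w
  obtain ⟨X, hX⟩ := (h.bijective hz).2 w
  obtain ⟨v, hv⟩ := h.flowDeriv_surjective hφ hp t q (horizontal X)
  refine ⟨(v, vertical X), ?_⟩
  rw [orbitFrame_apply, ← hX]
  exact congrArg (fun v' => mfderiv (I.prod (𝓡 k)) J ψ (flowAt φ p t q, s • p)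
    (pairVec (flowAt φ p t q, s • p) v' (vertical X))) hv

theorem continuousOn_orbitFrame (hp : ‖p‖ < r) (v : E × EuclideanSpace ℝ (Fin k)) :
    ContinuousOn (fun y : ℝ × ℝ => (⟨ψ (flowAt φ p y.2 q, y.1 • p),
      orbitFrame I J ψ φ p q y.1 y.2 v⟩ : TangentBundle J W)) ({s : ℝ | ‖s • p‖ < r} ×ˢ Set.univ) := by
  obtain ⟨U, g, hU, h0, hg, rfl, hv⟩ := exists_plot' (I := I) q
  -- The frame is a partial derivative, in the last factor, of a smooth map depending also on `s`
  -- and `t`; joint continuity follows.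
  let V := (ℝ × ℝ) × (E × EuclideanSpace ℝ (Fin k))
  let pp : V → EuclideanSpace ℝ (Fin k) := fun y => y.1.1 • p + y.2.2
  have hpp : ContDiff ℝ ∞ pp := by fun_prop
  let O : Set V := {y | y.2.1 ∈ U ∧ ‖pp y‖ < r}
  have hO : IsOpen O := (hU.preimage (by fun_prop)).inter
    (isOpen_lt hpp.continuous.norm continuous_const)
  have hg' : ContMDiffOn 𝓘(ℝ, V) I ∞ (fun y : V => g y.2.1) O :=
    hg.comp (f := fun y : V => y.2.1) (show ContDiff ℝ ∞ fun y : V => y.2.1 by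
      fun_prop).contMDiff.contMDiffOn fun y hy => hy.1
  have ha : ContDiff ℝ ∞ fun y : V => y.1.2 := by fun_prop
  have hhor : ContMDiffOn 𝓘(ℝ, V) I ∞ (fun y : V => flowAt φ p y.1.2 (g y.2.1)) O :=
    contMDiffOn_flow hφ hg' contDiffOn_const (fun _ _ => hp) ha.contDiffOn
  have hΘ : ContMDiffOn 𝓘(ℝ, V) J ∞ (fun y : V => ψ (flowAt φ p y.1.2 (g y.2.1), pp y)) O :=
    h.smooth.comp (f := fun y : V => (flowAt φ p y.1.2 (g y.2.1), pp y))
      (hhor.prodMk hpp.contMDiff.contMDiffOn) fun y hy => hy.2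
  have hmem : ∀ y ∈ ({s : ℝ | ‖s • p‖ < r} ×ˢ Set.univ : Set (ℝ × ℝ)), ((y, 0) : V) ∈ O :=
    fun y hy => ⟨h0, by
      change ‖y.1 • p + (0 : EuclideanSpace ℝ (Fin k))‖ < r
      rw [add_zero]; exact hy.1⟩
  have hc := (continuousOn_plotDeriv hO hΘ ((0, v) : V)).comp
    (f := fun y : ℝ × ℝ => ((y, 0) : V)) (by fun_prop) hmem
  refine hc.congr fun y hy => ?_
  have hy' := hmem y hy
  have hhd : MDifferentiableAt 𝓘(ℝ, V) I (fun y : V => flowAt φ p y.1.2 (g y.2.1)) (y, 0) :=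
    (hhor.contMDiffAt (hO.mem_nhds hy')).mdifferentiableAt (by simp)
  have hpd : HasFDerivAt pp ((ContinuousLinearMap.fst ℝ ℝ ℝ).smulRight p |>.coprod
      (ContinuousLinearMap.snd ℝ E (EuclideanSpace ℝ (Fin k)))) (y, 0) :=
    ContinuousLinearMap.hasFDerivAt ((ContinuousLinearMap.fst ℝ ℝ ℝ).smulRight p |>.coprod
      (ContinuousLinearMap.snd ℝ E (EuclideanSpace ℝ (Fin k))))
  have hzt : (flowAt φ p y.2 (g 0), pp (y, 0)) ∈ tube M k r := hy'.2
  have f1 := plotDeriv_map (J := J) (f := ψ) (g := fun y : V => (flowAt φ p y.1.2 (g y.2.1), pp y))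
    (x := (y, 0)) (h.mdifferentiableAt hzt)
    (hhd.prodMk hpd.differentiableAt.mdifferentiableAt) ((0, v) : V)
  have f2 : plotDeriv (I.prod (𝓡 k)) (fun y : V => (flowAt φ p y.1.2 (g y.2.1), pp y)) (y, 0) (0, v)
      = pairVec (flowAt φ p y.2 (g 0), pp (y, 0))
        (plotDeriv I (fun y : V => flowAt φ p y.1.2 (g y.2.1)) (y, 0) (0, v))
        (fderiv ℝ pp (y, 0) (0, v)) :=
    mfderiv_pair hhd hpd.differentiableAt ((0, v) : V)
  obtain ⟨R, -, f3⟩ := h.plotDeriv_flowAt_time hφ hO hg' ha.contDiffOn hp hy' ((0, v) : V)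
  have f4 : fderiv ℝ (fun y : V => y.1.2) (y, 0) ((0, v) : V) = 0 := by
    have : HasFDerivAt (fun y : V => y.1.2) ((ContinuousLinearMap.snd ℝ ℝ ℝ).comp
      (ContinuousLinearMap.fst ℝ (ℝ × ℝ) (E × EuclideanSpace ℝ (Fin k)))) (y, 0) :=
      ContinuousLinearMap.hasFDerivAt ((ContinuousLinearMap.snd ℝ ℝ ℝ).comp
      (ContinuousLinearMap.fst ℝ (ℝ × ℝ) (E × EuclideanSpace ℝ (Fin k))))
    rw [this.fderiv]
    rfl
  have f5 : plotDeriv I (fun y : V => g y.2.1) (y, 0) ((0, v) : V) = (v.1 : E) := by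
    have hl : HasFDerivAt (fun y : V => y.2.1) ((ContinuousLinearMap.fst ℝ E _).comp
      (ContinuousLinearMap.snd ℝ (ℝ × ℝ) (E × EuclideanSpace ℝ (Fin k)))) (y, 0) :=
      ContinuousLinearMap.hasFDerivAt ((ContinuousLinearMap.fst ℝ E _).comp
      (ContinuousLinearMap.snd ℝ (ℝ × ℝ) (E × EuclideanSpace ℝ (Fin k))))
    have h6 := plotDeriv_comp (I := I) (g := g) (f := fun y : V => y.2.1) (y := (y, 0))
      ((hg.contMDiffAt (hU.mem_nhds h0)).mdifferentiableAt (by simp)) hl.differentiableAt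
      ((0, v) : V)
    rw [hl.fderiv] at h6
    exact h6.trans (hv v.1)
  have f6 : fderiv ℝ pp (y, 0) ((0, v) : V) = v.2 := by
    rw [hpd.fderiv, ContinuousLinearMap.coprod_apply]
    change (0 : ℝ) • p + v.2 = v.2
    rw [zero_smul, zero_add]
  rw [f4, zero_smul, zero_add, f5] at f3
  rw [f2, f6, f3] at f1
  have hpp0 : pp (y, 0) = y.1 • p := add_zero _
  have key : ∀ p', p' = y.1 • p → (⟨ψ (flowAt φ p y.2 (g 0), y.1 • p),
      orbitFrame I J ψ φ p (g 0) y.1 y.2 v⟩ : TangentBundle J W)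
      = ⟨ψ (flowAt φ p y.2 (g 0), p'), mfderiv (I.prod (𝓡 k)) J ψ (flowAt φ p y.2 (g 0), p')
        (pairVec (flowAt φ p y.2 (g 0), p') (flowDeriv I φ p y.2 (g 0) v.1) v.2)⟩ := by
    rintro _ rfl
    rw [orbitFrame_apply]
  refine (key _ hpp0).trans ?_
  exact tangent_ext rfl f1.symm

omit h in
-- The flow runs with momentum `p` for every `s`, so the closing map `dφ^T × id` does not depend on
-- `s`. The conjugation estimate requires this constancy.
theorem orbitFrame_closed (hp : ‖p‖ < r) {T : ℝ} (hT : flowAt φ p T q = q)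
    (v : E × EuclideanSpace ℝ (Fin k)) :
    (⟨ψ (flowAt φ p T q, s • p), orbitFrame I J ψ φ p q s T v⟩ : TangentBundle J W)
      = ⟨ψ (flowAt φ p 0 q, s • p),
        orbitFrame I J ψ φ p q s 0 ((flowDeriv I φ p T q v.1 : E), v.2)⟩ := by
  have key : ∀ (a b : M) (v w : E) (x : EuclideanSpace ℝ (Fin k)), a = b → v = w →
      (⟨ψ (a, s • p), mfderiv (I.prod (𝓡 k)) J ψ (a, s • p) (pairVec (a, s • p) v x)⟩ :
        TangentBundle J W)
      = ⟨ψ (b, s • p), mfderiv (I.prod (𝓡 k)) J ψ (b, s • p) (pairVec (b, s • p) w x)⟩ := by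
    rintro a _ v _ x rfl rfl; rfl
  exact key _ _ _ _ _ (hT.trans (flowAt_zero hφ hp q).symm) (flowDeriv_zero hφ hp _).symm

end IsStableTube
end OrbitFrame
end CoisotropicIndex

namespace CoisotropicIndex

/-! ### Transports as matrices. -/

section Combinations

theorem combination_mul {V ι κ l : Type*} [AddCommGroup V] [Module ℝ V] [Fintype ι] [Fintype κ]
    {f : ι → V} {g : κ → V} {h : l → V} {A : Matrix ι κ ℝ} {B : Matrix κ l ℝ}
    (hg : ∀ b, g b = ∑ a, A a b • f a) (hh : ∀ c, h c = ∑ b, B b c • g b) (c : l) :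
    h c = ∑ a, (A * B) a c • f a := by
  rw [hh]
  simp_rw [hg, Finset.smul_sum, smul_smul, Matrix.mul_apply, Finset.sum_smul]
  rw [Finset.sum_comm]
  exact Finset.sum_congr rfl fun i _ => Finset.sum_congr rfl fun j _ => by rw [mul_comm]

theorem combination_map {V V' ι κ : Type*} [AddCommGroup V] [Module ℝ V] [AddCommGroup V']
    [Module ℝ V'] [Fintype ι] {f : ι → V} {g : κ → V} {A : Matrix ι κ ℝ} (L : V →ₗ[ℝ] V')
    (hg : ∀ b, g b = ∑ a, A a b • f a) (b : κ) : L (g b) = ∑ a, A a b • L (f a) := by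
  rw [hg, map_sum]
  simp_rw [map_smul]

theorem toMatrix_combination {V ι : Type*} [AddCommGroup V] [Module ℝ V] [Fintype ι]
    [DecidableEq ι] (b : Module.Basis ι ℝ V) (N : V →ₗ[ℝ] V) (j : ι) :
    N (b j) = ∑ i, LinearMap.toMatrix b b N i j • b i := by
  simp_rw [LinearMap.toMatrix_apply]
  exact (b.sum_repr (N (b j))).symm

end Combinations

section Transport

open scoped Matrix

variable {F : Type*} [NormedAddCommGroup F] [NormedSpace ℝ F] [FiniteDimensional ℝ F]
  {G : Type*} [TopologicalSpace G] {J : ModelWithCorners ℝ F G} [J.Boundaryless]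
  {W : Type*} [TopologicalSpace W] [ChartedSpace G W] [IsManifold J ∞ W]
  {V : Type*} [NormedAddCommGroup V] [NormedSpace ℝ V] [FiniteDimensional ℝ V]
  {n : ℕ} {Ω : TwoForm J W}

omit [FiniteDimensional ℝ F] [J.Boundaryless] [IsManifold J ∞ W] in
theorem exists_transport {y : ℝ → W} (L : ∀ t, V →L[ℝ] TangentSpace J (y t))
    (h0 : Function.Bijective (L 0)) :
    ∃ Ψ : ∀ t, TangentSpace J (y 0) →L[ℝ] TangentSpace J (y t), ∀ t v, Ψ t (L 0 v) = L t v := by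
  let e : V ≃ₗ[ℝ] F := LinearEquiv.ofBijective (show V →L[ℝ] F from L 0).toLinearMap h0
  haveI : FiniteDimensional ℝ F := LinearEquiv.finiteDimensional e
  let K : F →L[ℝ] V := LinearMap.toContinuousLinearMap e.symm.toLinearMap
  refine ⟨fun t => (show F →L[ℝ] F from (show V →L[ℝ] F from L t).comp K),
    fun t v => ?_⟩
  exact congrArg (fun v : V => (show V →L[ℝ] F from L t) v) (e.symm_apply_apply v)

/-- A homotopy of frames which removes a shear from a transport does not change the mean index. -/
theorem mean_index_of_shear (hn : Module.finrank ℝ F = 2 * n) (hnV : Module.finrank ℝ V = 2 * n)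
    (hΩ : IsSymplecticForm Ω) {T : ℝ} (hT : 0 < T) {y : ℝ → ℝ → W}
    {e : ∀ s t, Fin n ⊕ Fin n → TangentSpace J (y s t)} {L : ∀ s t, V →L[ℝ] TangentSpace J (y s t)}
    {N D : V →L[ℝ] V}
    (hec : ∀ a, ContinuousOn (fun x : ℝ × ℝ => (⟨y x.1 x.2, e x.1 x.2 a⟩ : TangentBundle J W))
      (Set.Icc 0 1 ×ˢ Set.Icc 0 T))
    (hLc : ∀ v, ContinuousOn (fun x : ℝ × ℝ => (⟨y x.1 x.2, L x.1 x.2 v⟩ : TangentBundle J W))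
      (Set.Icc 0 1 ×ˢ Set.Icc 0 T))
    (he : ∀ s ∈ Set.Icc (0 : ℝ) 1, ∀ t, IsSymplecticBasis (Ω (y s t)) (e s t))
    (hLs : ∀ s ∈ Set.Icc (0 : ℝ) 1, ∀ t, Function.Surjective (L s t))
    (hform : ∀ s ∈ Set.Icc (0 : ℝ) 1, ∀ t v v',
      Ω (y s t) (L s t v) (L s t v') = Ω (y s 0) (L s 0 v) (L s 0 v'))
    (hshear : ∀ s ∈ Set.Icc (0 : ℝ) 1, ∀ (x : ℝ) v v',
      Ω (y s 0) (L s 0 (v + x • N v)) (L s 0 (v' + x • N v')) = Ω (y s 0) (L s 0 v) (L s 0 v'))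
    (heT : ∀ s ∈ Set.Icc (0 : ℝ) 1, ∀ a,
      (⟨y s T, e s T a⟩ : TangentBundle J W) = ⟨y s 0, e s 0 a⟩)
    (hLT : ∀ s ∈ Set.Icc (0 : ℝ) 1, ∀ v,
      (⟨y s T, L s T v⟩ : TangentBundle J W) = ⟨y s 0, L s 0 (D v)⟩)
    (hNN : ∀ v, N (N v) = 0) (hND : ∀ v, N (D v) = D (N v))
    {Ψ₀ : ∀ t, TangentSpace J (y 0 0) →L[ℝ] TangentSpace J (y 0 t)}
    {Ψ₁ : ∀ t, TangentSpace J (y 1 0) →L[ℝ] TangentSpace J (y 1 t)}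
    (hΨ₀ : ∀ t v, Ψ₀ t (L 0 0 v) = L 0 t v) (hΨ₁ : ∀ t v, Ψ₁ t (L 1 0 v) = L 1 t (v + t • N v))
    {A₀ A₁ : ℝ → Matrix (Fin n ⊕ Fin n) (Fin n ⊕ Fin n) ℝ}
    (hA₀ : ∀ t ∈ Set.Icc 0 T, ∀ b, Ψ₀ t (e 0 0 b) = ∑ a, A₀ t a b • e 0 t a)
    (hA₁ : ∀ t ∈ Set.Icc 0 T, ∀ b, Ψ₁ t (e 1 0 b) = ∑ a, A₁ t a b • e 1 t a)
    {d : ℝ} (h : HasMeanIndex T A₁ d) : HasMeanIndex T A₀ d := by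
  have s0 : (0 : ℝ) ∈ Set.Icc (0 : ℝ) 1 := by simp
  have s1 : (1 : ℝ) ∈ Set.Icc (0 : ℝ) 1 := by simp
  have hfr : ∀ x : W, Module.finrank ℝ (TangentSpace J x) = 2 * n := fun x => hn
  let b : Module.Basis (Fin n ⊕ Fin n) ℝ V := (Module.finBasisOfFinrankEq ℝ V
    (hnV.trans (two_mul n))).reindex finSumFinEquiv.symm
  -- The matrix of `L s t`. Its inverse expresses the frame `e s t` in the fixed space `V`; there
  -- the form `Gm s` does not depend on `t` and the transport by `L` is constant, the setting of
  -- `HasMeanIndex.of_frame_homotopy`.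
  let Y : ℝ → ℝ → Matrix (Fin n ⊕ Fin n) (Fin n ⊕ Fin n) ℝ := fun s t =>
    transMatrix (Ω (y s t)) (e s t) (fun j => L s t (b j))
  let Nm := LinearMap.toMatrix b b N.toLinearMap
  let Dm := LinearMap.toMatrix b b D.toLinearMap
  have hN1 : ∀ (x : ℝ) (j), b j + x • N (b j) = ∑ i, (1 + x • Nm) i j • b i := fun x j => by
    simp_rw [Matrix.add_apply, Matrix.smul_apply, add_smul, Finset.sum_add_distrib, smul_assoc,
      ← Finset.smul_sum]
    rw [← toMatrix_combination b N.toLinearMap j]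
    simp [Matrix.one_apply]
  have hY : ∀ s ∈ Set.Icc (0 : ℝ) 1, ∀ t j, L s t (b j) = ∑ i, Y s t i j • e s t i :=
    fun s hs t j => (he s hs t).expand_transMatrix (hfr _) (fun j => L s t (b j)) j
  have hYc : ContinuousOn (fun x : ℝ × ℝ => Y x.1 x.2) (Set.Icc 0 1 ×ˢ Set.Icc 0 T) :=
    hΩ.continuousOn_transMatrix hec fun j => hLc (b j)
  have hYu : ∀ s ∈ Set.Icc (0 : ℝ) 1, ∀ t, IsUnit (Y s t).det := fun s hs t => by
    choose w hw using fun a => hLs s hs t (e s t a)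
    let Z : Matrix (Fin n ⊕ Fin n) (Fin n ⊕ Fin n) ℝ := Matrix.of fun j a => b.repr (w a) j
    have h1 : ∀ a, e s t a = ∑ j, Z j a • L s t (b j) := fun a => by
      rw [← hw a]
      conv_lhs => rw [← b.sum_repr (w a), map_sum]
      simp_rw [map_smul]
      rfl
    have h2 := (he s hs t).transMatrix_of_eq (combination_mul (hY s hs t) h1)
    have h3 := (he s hs t).transMatrix_of_eq (g := e s t) (A := 1) fun a => by
      simp [Matrix.one_apply]
    exact (Matrix.isUnit_iff_isUnit_det _).1
      (IsUnit.of_mul_eq_one _ (h2.symm.trans h3))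
  have hinv : ∀ s ∈ Set.Icc (0 : ℝ) 1, ∀ t, Y s t * (Y s t)⁻¹ = 1 := fun s hs t =>
    Matrix.mul_nonsing_inv _ (hYu s hs t)
  let Gm : ℝ → Matrix (Fin n ⊕ Fin n) (Fin n ⊕ Fin n) ℝ := fun s =>
    Matrix.of fun i j => Ω (y s 0) (L s 0 (b i)) (L s 0 (b j))
  have hgram : ∀ s ∈ Set.Icc (0 : ℝ) 1, ∀ t, Gm s = (Y s t)ᵀ * Matrix.J (Fin n) ℝ * Y s t :=
    fun s hs t => by
      have h1 := form_combination (B := Ω (y s t)) (hY s hs t)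
      have h2 : (Matrix.of fun i j => Ω (y s t) (e s t i) (e s t j)) = Matrix.J (Fin n) ℝ := by
        ext i j; exact he s hs t i j
      rw [h2] at h1
      rw [← h1]
      ext i j
      exact (hform s hs t (b i) (b j)).symm
  have hgc : ContinuousOn (fun x : ℝ × ℝ => (Y x.1 x.2)⁻¹) (Set.Icc 0 1 ×ˢ Set.Icc 0 T) :=
    continuousOn_matrix_inv hYc fun x hx => hYu _ hx.1 _
  have key := HasMeanIndex.of_frame_homotopy (n := n) (T := T) hT.le (G := Gm)
    (g := fun s t => (Y s t)⁻¹) (N := Nm) (D := Dm) (d := d) hgc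
    (fun s hs t _ => by
      rw [hgram s hs t, Matrix.mul_assoc, Matrix.mul_assoc, hinv s hs t, Matrix.mul_one,
        ← Matrix.mul_assoc, ← Matrix.transpose_mul, hinv s hs t, Matrix.transpose_one,
        Matrix.one_mul])
    (fun s hs x => by
      have h1 : ∀ j, L s 0 (b j + x • N (b j)) = ∑ i, (1 + x • Nm) i j • L s 0 (b i) :=
        combination_map (L s 0).toLinearMap (hN1 x)
      rw [← form_combination (B := Ω (y s 0)) h1]
      ext i j
      exact hshear s hs x (b i) (b j))
    (by
      rw [← LinearMap.toMatrix_mul, ← LinearMap.toMatrix_mul]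
      congr 1
      ext v
      exact hND v)
    (by
      rw [← LinearMap.toMatrix_mul]
      refine (congrArg (LinearMap.toMatrix b b) ?_).trans (map_zero _)
      ext v
      exact hNN v)
    (fun s hs => by
      have h1 : Y s T = Y s 0 * Dm := by
        have h2 : Y s T = transMatrix (Ω (y s 0)) (e s 0) (fun j => L s 0 (D (b j))) :=
          transMatrix_congr (heT s hs) fun j => hLT s hs (b j)
        rw [h2]
        exact (he s hs 0).transMatrix_of_eq (combination_mul (hY s hs 0)
          (combination_map (L s 0).toLinearMap (toMatrix_combination b D.toLinearMap)))
      refine Matrix.inv_eq_right_inv ?_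
      rw [← Matrix.mul_assoc, ← h1, hinv s hs T])
  have hdouble : ∀ s ∈ Set.Icc (0 : ℝ) 1, ∀ t, ((Y s t)⁻¹)⁻¹ = Y s t := fun s hs t =>
    Matrix.nonsing_inv_nonsing_inv _ (hYu s hs t)
  refine (key (h.congr fun t ht => ?_)).congr fun t ht => ?_
  · have h1 : A₁ t * Y 1 0 = Y 1 t * (1 + t • Nm) := by
      have h2 := (he 1 s1 t).transMatrix_of_eq (combination_mul (hA₁ t ht)
        (combination_map (Ψ₁ t).toLinearMap (hY 1 s1 0)))
      have h3 := (he 1 s1 t).transMatrix_of_eq (combination_mul (hY 1 s1 t)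
        (combination_map (L 1 t).toLinearMap (hN1 t)))
      rw [← h2, ← h3]
      congr 1
      funext j
      exact hΨ₁ t (b j)
    rw [hdouble 1 s1 t, ← h1, Matrix.mul_assoc, hinv 1 s1 0, Matrix.mul_one]
  · have h1 : A₀ t * Y 0 0 = Y 0 t := by
      have h2 := (he 0 s0 t).transMatrix_of_eq (combination_mul (hA₀ t ht)
        (combination_map (Ψ₀ t).toLinearMap (hY 0 s0 0)))
      rw [← h2]
      exact congrArg _ (funext fun j => hΨ₀ t (b j))
    rw [hdouble 0 s0 t, ← h1, Matrix.mul_assoc, hinv 0 s0 0, Matrix.mul_one]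

end Transport
end CoisotropicIndex

namespace CoisotropicIndex

/-! ### The adapted transport given by the flow along the projected loop. -/

section NormalFrame

variable {E : Type*} [NormedAddCommGroup E] [NormedSpace ℝ E] [FiniteDimensional ℝ E]
  {H : Type*} [TopologicalSpace H] {I : ModelWithCorners ℝ E H} [I.Boundaryless]
  {M : Type*} [TopologicalSpace M] [ChartedSpace H M] [IsManifold I ∞ M]
  {F : Type*} [NormedAddCommGroup F] [NormedSpace ℝ F]
  {G : Type*} [TopologicalSpace G] {J : ModelWithCorners ℝ F G} [J.Boundaryless]
  {W : Type*} [TopologicalSpace W] [ChartedSpace G W] [IsManifold J ∞ W]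
  {k m : ℕ} {Ω : TwoForm J W} {α : Fin k → OneForm I M} {r : ℝ}
  {ψ : M × EuclideanSpace ℝ (Fin k) → W}
  {φ : ℝ → M × EuclideanSpace ℝ (Fin k) → M × EuclideanSpace ℝ (Fin k)}
  {p : EuclideanSpace ℝ (Fin k)} {q : M}

/-- The tangent vectors of `W` along `φ^t q`, obtained from those at `q` by the derivative of the
flow in the horizontal direction and constant in the vertical direction. -/
noncomputable def normalFrame (I : ModelWithCorners ℝ E H) (J : ModelWithCorners ℝ F G) {M : Type*}
    [TopologicalSpace M] [ChartedSpace H M] {W : Type*} [TopologicalSpace W] [ChartedSpace G W]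
    {k : ℕ} (ψ : M × EuclideanSpace ℝ (Fin k) → W)
    (φ : ℝ → M × EuclideanSpace ℝ (Fin k) → M × EuclideanSpace ℝ (Fin k))
    (p : EuclideanSpace ℝ (Fin k)) (q : M) (t : ℝ) :
    E × EuclideanSpace ℝ (Fin k) →L[ℝ] TangentSpace J (zeroSection ψ (flowAt φ p t q)) :=
  orbitFrame I J ψ φ p q 0 t

theorem normalFrame_eq (t : ℝ) (v : E × EuclideanSpace ℝ (Fin k)) :
    (⟨zeroSection ψ (flowAt φ p t q), normalFrame I J ψ φ p q t v⟩ : TangentBundle J W)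
      = ⟨ψ (flowAt φ p t q, (0 : ℝ) • p), orbitFrame I J ψ φ p q 0 t v⟩ :=
  tangent_ext (by rw [zero_smul]; rfl) rfl

theorem normalFrame_apply (t : ℝ) (v : E × EuclideanSpace ℝ (Fin k)) :
    normalFrame I J ψ φ p q t v = mfderiv (I.prod (𝓡 k)) J ψ (flowAt φ p t q, 0)
      (pairVec (flowAt φ p t q, 0) (flowDeriv I φ p t q v.1) v.2) := by
  have key : ∀ p', p' = (0 : EuclideanSpace ℝ (Fin k)) →
      (mfderiv (I.prod (𝓡 k)) J ψ (flowAt φ p t q, p')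
        (pairVec (flowAt φ p t q, p') (flowDeriv I φ p t q v.1) v.2) : F)
      = mfderiv (I.prod (𝓡 k)) J ψ (flowAt φ p t q, 0)
      (pairVec (flowAt φ p t q, 0) (flowDeriv I φ p t q v.1) v.2) := by
    rintro _ rfl; rfl
  exact key _ (zero_smul ℝ p)

namespace IsStableTube

variable (h : IsStableTube m Ω α r ψ)
  (hφ : IsHamiltonianFlow (Ω.pullback I (zeroSection ψ)) α r (rho M k) φ)
include h

theorem normalFrame_horizontal (t : ℝ) (v : E) :
    normalFrame I J ψ φ p q t (v, 0)
      = mfderiv I J (zeroSection ψ) (flowAt φ p t q) (flowDeriv I φ p t q v) := by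
  rw [normalFrame_apply, h.mfderiv_zeroSection]

include hφ

theorem normalFrame_form (hp : ‖p‖ < r) (t : ℝ) (v v' : E × EuclideanSpace ℝ (Fin k)) :
    Ω (zeroSection ψ (flowAt φ p t q)) (normalFrame I J ψ φ p q t v)
        (normalFrame I J ψ φ p q t v')
      = (Ω.pullback I (zeroSection ψ)) q v.1 v'.1 + ∑ j, (v.2 j * α j q v'.1 - v'.2 j * α j q v.1) := by
  have hs : ‖(0 : ℝ) • p‖ < r := by rw [zero_smul, norm_zero]; exact h.nbhd.pos
  rw [form_congr (normalFrame_eq t v) (normalFrame_eq t v'), h.orbitFrame_form hφ hp hs]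
  change (Ω.pullback I (zeroSection ψ)) q v.1 v'.1 + ∑ j, (((0 : ℝ) • p) j * (α j).d q v.1 v'.1 +
        (v.2 j * α j q v'.1 - v'.2 j * α j q v.1)) = _
  simp

theorem normalFrame_bijective (hp : ‖p‖ < r) (t : ℝ) :
    Function.Bijective (normalFrame I J ψ φ p q t) := by
  have hs : ‖(0 : ℝ) • p‖ < r := by rw [zero_smul, norm_zero]; exact h.nbhd.pos
  exact ⟨h.orbitFrame_injective hφ hp hs t, h.orbitFrame_surjective hφ hp hs t⟩

theorem continuous_normalFrame (hp : ‖p‖ < r) (v : E × EuclideanSpace ℝ (Fin k)) :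
    Continuous (fun t => (⟨zeroSection ψ (flowAt φ p t q), normalFrame I J ψ φ p q t v⟩ :
      TangentBundle J W)) := by
  have hs : ‖(0 : ℝ) • p‖ < r := by rw [zero_smul, norm_zero]; exact h.nbhd.pos
  have h1 := (h.continuousOn_orbitFrame hφ (q := q) hp v).comp_continuous
    (f := fun t : ℝ => ((0 : ℝ), t)) (by fun_prop) fun t => ⟨hs, trivial⟩
  exact h1.congr fun t => (normalFrame_eq t v).symm

omit h in
theorem flowDeriv_start (hp : ‖p‖ < r) (t : ℝ) (v : E) :
    (flowDeriv I φ p t (flowAt φ p 0 q) v : E) = flowDeriv I φ p t q v :=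
  congrArg (fun x : M => (show E →L[ℝ] E from flowDeriv I φ p t x) v) (flowAt_zero hφ hp q)

theorem mfderiv_start (hp : ‖p‖ < r) (v : E) :
    mfderiv I J (zeroSection ψ) (flowAt φ p 0 q) v = normalFrame I J ψ φ p q 0 (v, 0) := by
  rw [h.normalFrame_horizontal]
  exact congrArg (fun v : E => (show E →L[ℝ] F from mfderiv I J (zeroSection ψ) (flowAt φ p 0 q)) v)
    (flowDeriv_zero hφ hp v).symm

variable {R : Fin k → E}
  (hR : ∀ i, IsReeb (Ω.pullback I (zeroSection ψ)) α q (EuclideanSpace.single i 1) (R i))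
include hR

theorem normalFrame_reeb_form (hp : ‖p‖ < r) (t : ℝ) (i : Fin k)
    (v : E × EuclideanSpace ℝ (Fin k)) :
    Ω (zeroSection ψ (flowAt φ p t q)) (normalFrame I J ψ φ p q t (R i, 0))
        (normalFrame I J ψ φ p q t v) = -v.2 i := by
  have h1 : (Ω.pullback I (zeroSection ψ)) q (R i) = 0 := (hR i).1
  rw [h.normalFrame_form hφ hp]
  have h2 : (Ω.pullback I (zeroSection ψ)) q (R i) v.1 = 0 := by rw [h1]; rfl
  have h3 : ∀ j, α j q (R i) = (EuclideanSpace.single i (1 : ℝ) : EuclideanSpace ℝ (Fin k)) j :=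
    (hR i).2
  simp [h2, h3, Pi.single_apply]

theorem charDist_eq_span (hp : ‖p‖ < r) (t : ℝ) :
    Submodule.span ℝ (Set.range fun i => (normalFrame I J ψ φ p q t (R i, 0))) =
    (charDist (Ω.pullback I (zeroSection ψ)) (flowAt φ p t q)).map
      (mfderiv I J (zeroSection ψ) (flowAt φ p t q)).toLinearMap := by
  have hRt := fun i => h.flowDeriv_reeb hφ hp t (hR i)
  refine le_antisymm (Submodule.span_le.2 ?_) ?_
  · rintro _ ⟨i, rfl⟩
    exact ⟨flowDeriv I φ p t q (R i), (hRt i).1, (h.normalFrame_horizontal t (R i)).symm⟩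
  · rintro _ ⟨v, hv, rfl⟩
    have h1 := h.isReeb_unique (w := ∑ i, α i _ v • flowDeriv I φ p t q (R i)) (v := v)
      (p := WithLp.toLp 2 fun i => α i _ v) ⟨hv, fun i => rfl⟩
      (h.isReeb_sum hRt (WithLp.toLp 2 fun i => α i _ v))
    rw [h1, map_sum]
    refine Submodule.sum_mem _ fun i _ => ?_
    rw [map_smul]
    refine Submodule.smul_mem _ _ (Submodule.subset_span ⟨i, ?_⟩)
    exact h.normalFrame_horizontal t (R i)

/-- The flow sends Reeb vectors to Reeb vectors, and these are determined by the base point, so the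
frame closes up after one period. Consequently `T𝓕` is orientable along the loop. -/
theorem isLeafFrame (hp : ‖p‖ < r) {T : ℝ} (hT : flowAt φ p T q = q) :
    IsLeafFrame I Ω (zeroSection ψ) (fun t => flowAt φ p t q) T
      (fun t i => normalFrame I J ψ φ p q t (R i, 0)) where
  continuous i := h.continuous_normalFrame hφ hp _
  periodic t i := by
    have hRt := fun t => h.flowDeriv_reeb hφ hp t (hR i)
    have hper := h.flowAt_periodic hφ hp hT t
    have key : ∀ (x y : M) (v w : E), x = y →
        IsReeb (Ω.pullback I (zeroSection ψ)) α x (EuclideanSpace.single i 1) v →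
        IsReeb (Ω.pullback I (zeroSection ψ)) α y (EuclideanSpace.single i 1) w →
        (⟨zeroSection ψ x, mfderiv I J (zeroSection ψ) x v⟩ : TangentBundle J W)
          = ⟨zeroSection ψ y, mfderiv I J (zeroSection ψ) y w⟩ := by
      rintro x _ v w rfl hv hw
      have h1 : v = w := h.isReeb_unique hv hw
      rw [h1]
    rw [h.normalFrame_horizontal, h.normalFrame_horizontal]
    exact key _ _ _ _ hper (hRt (t + T)) (hRt t)
  linearIndependent t := by
    rw [Fintype.linearIndependent_iff]
    intro c hc i
    have h1 : normalFrame I J ψ φ p q t (∑ i, c i • R i, 0) = 0 := by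
      rw [← hc]
      have h2 : ((∑ i, c i • R i, 0) : E × EuclideanSpace ℝ (Fin k))
          = ∑ i, c i • ((R i, 0) : E × EuclideanSpace ℝ (Fin k)) := by
        refine Prod.ext ?_ ?_ <;> simp [Prod.fst_sum, Prod.snd_sum]
      rw [h2, map_sum]
      simp_rw [map_smul]
    have h2 := (h.normalFrame_bijective hφ hp t).1 (h1.trans (map_zero _).symm)
    have h3 : ∑ i, c i • R i = 0 := congrArg Prod.fst h2
    have h4 := (h.isReeb_sum hR (WithLp.toLp 2 c)).2 i
    have h5 : α i q (∑ i, c i • R i : E) = 0 := by rw [h3]; exact map_zero _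
    exact h4.symm.trans h5
  span t := h.charDist_eq_span hφ hR hp t

/-- The vectors `∂/∂p_i` are dual to the Reeb vectors because of the terms `dp_i ∧ α_i`, and have no
horizontal component for the derivative of the flow to move. -/
theorem isDualFrame (hp : ‖p‖ < r) {T : ℝ} (hT : flowAt φ p T q = q) :
    IsDualFrame Ω (zeroSection ψ) (fun t => flowAt φ p t q) T
      (fun t i => normalFrame I J ψ φ p q t (R i, 0))
      (fun t i => normalFrame I J ψ φ p q t (0, EuclideanSpace.single i 1)) where
  continuous i := h.continuous_normalFrame hφ hp _
  periodic t i := by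
    have key : ∀ (x y : M) (v w : E), x = y → v = 0 → w = 0 →
        (⟨zeroSection ψ x, mfderiv (I.prod (𝓡 k)) J ψ (x, 0)
          (pairVec (x, 0) v (EuclideanSpace.single i 1))⟩ : TangentBundle J W)
          = ⟨zeroSection ψ y, mfderiv (I.prod (𝓡 k)) J ψ (y, 0)
          (pairVec (y, 0) w (EuclideanSpace.single i 1))⟩ := by
      rintro x _ _ _ rfl rfl rfl; rfl
    rw [normalFrame_apply, normalFrame_apply]
    exact key _ _ _ _ (h.flowAt_periodic hφ hp hT t) (map_zero _) (map_zero _)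
  dual t i j := by
    rw [h.form_skew, h.normalFrame_reeb_form hφ hR hp, neg_neg]
    simp [Pi.single_apply, eq_comm]
  isotropic t i j := by
    rw [h.normalFrame_form hφ hp]
    have h1 : (Ω.pullback I (zeroSection ψ)) q (0 : E) (0 : E) = 0 := map_zero _
    have h2 : ∀ l, α l q (0 : E) = 0 := fun l => map_zero _
    simp [h1, h2]

/-- The complement orthogonal to the Reeb and vertical frames is the common kernel of the `α_i` in
`TM`; the derivative of the flow preserves it and realizes the holonomy on it. -/
theorem isAdaptedTransport (hp : ‖p‖ < r) {T : ℝ} (hT : flowAt φ p T q = q)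
    {Ψ : ∀ t, TangentSpace J (zeroSection ψ (flowAt φ p 0 q)) →L[ℝ]
      TangentSpace J (zeroSection ψ (flowAt φ p t q))}
    (hΨ : ∀ t v, Ψ t (normalFrame I J ψ φ p q 0 v) = normalFrame I J ψ φ p q t v) :
    IsAdaptedTransport k I Ω (zeroSection ψ) (fun t => flowAt φ p t q) T Ψ := by
  refine ⟨_, _, h.isLeafFrame hφ hR hp hT, h.isDualFrame hφ hR hp hT, fun t _ =>
    ⟨fun i => hΨ t _, fun i => hΨ t _, fun v hv => ⟨flowDeriv I φ p t q v, fun i => ?_, ?_, ?_⟩⟩⟩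
  · have h1 := (congrArg (Ω (zeroSection ψ (flowAt φ p 0 q))
      (normalFrame I J ψ φ p q 0 (0, EuclideanSpace.single i 1))) (h.mfderiv_start hφ hp v)).symm.trans
      (hv i)
    refine (congrArg (Ω (zeroSection ψ (flowAt φ p t q))
      (normalFrame I J ψ φ p q t (0, EuclideanSpace.single i 1)))
      (h.normalFrame_horizontal (φ := φ) (p := p) (q := q) t v)).symm.trans ?_
    rw [h.normalFrame_form hφ hp]
    rwa [h.normalFrame_form hφ hp] at h1
  · exact h.holonomyRelated_flowDeriv hφ hp (γ := fun t => flowAt φ p t q)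
      (fun t => congrArg (flowAt φ p t) (flowAt_zero hφ hp q)) t v _
      (flowDeriv_start hφ hp t v).symm
  · exact (congrArg (Ψ t) (h.mfderiv_start hφ hp v)).trans
      ((hΨ t _).trans (h.normalFrame_horizontal t v))

end IsStableTube
end NormalFrame
end CoisotropicIndex

namespace CoisotropicIndex

/-! ### Comparison of adapted transports. -/

section FrameCoordinates

open scoped Matrix

variable {F : Type*} [NormedAddCommGroup F] [NormedSpace ℝ F] [FiniteDimensional ℝ F]
  {G : Type*} [TopologicalSpace G] {J : ModelWithCorners ℝ F G} [J.Boundaryless]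
  {W : Type*} [TopologicalSpace W] [ChartedSpace G W] [IsManifold J ∞ W]
  {n k : ℕ} {Ω : TwoForm J W}

theorem form_combination₂ {V ι ι' κ : Type*} [AddCommGroup V] [Module ℝ V] [TopologicalSpace V]
    [Fintype κ] {B : V →L[ℝ] V →L[ℝ] ℝ} {f : κ → V} {g : ι → V} {g' : ι' → V} {A : Matrix κ ι ℝ}
    {A' : Matrix κ ι' ℝ} (h : ∀ b, g b = ∑ a, A a b • f a) (h' : ∀ b, g' b = ∑ a, A' a b • f a) :
    (Matrix.of fun a b => B (g a) (g' b)) = Aᵀ * (Matrix.of fun a b => B (f a) (f b)) * A' := by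
  ext a b
  rw [Matrix.of_apply, h a, h' b, form_sum_left, Matrix.mul_apply]
  simp only [form_sum_right, Matrix.mul_apply, Matrix.transpose_apply, Matrix.of_apply,
    Finset.sum_mul, Finset.mul_sum]
  rw [Finset.sum_comm]
  exact Finset.sum_congr rfl fun x _ => Finset.sum_congr rfl fun y _ => by ring

theorem IsSymplecticBasis.form_eq {V ι ι' : Type*} [AddCommGroup V] [Module ℝ V]
    [TopologicalSpace V] {B : V →L[ℝ] V →L[ℝ] ℝ} {f : Fin n ⊕ Fin n → V} (hf : IsSymplecticBasis B f)
    {g : ι → V} {g' : ι' → V} {A : Matrix (Fin n ⊕ Fin n) ι ℝ} {A' : Matrix (Fin n ⊕ Fin n) ι' ℝ}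
    (h : ∀ b, g b = ∑ a, A a b • f a) (h' : ∀ b, g' b = ∑ a, A' a b • f a) :
    Aᵀ * Matrix.J (Fin n) ℝ * A' = Matrix.of fun a b => B (g a) (g' b) := by
  rw [form_combination₂ h h']
  congr 2
  ext a b
  exact (hf a b).symm

/-- A change of the splitting and of the transport of its leaf part does not change the index. -/
theorem transport_index_change (hn : Module.finrank ℝ F = 2 * n) (hΩ : IsSymplecticForm Ω)
    {T : ℝ} (hT : 0 < T) {y : ℝ → W} {u : ℂ → W}
    {ξ ν ξ' ν' : ∀ t, Fin k → TangentSpace J (y t)}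
    (hξ : ∀ i, Continuous (fun t => (⟨y t, ξ t i⟩ : TangentBundle J W)))
    (hν : ∀ i, Continuous (fun t => (⟨y t, ν t i⟩ : TangentBundle J W)))
    (hξ' : ∀ i, Continuous (fun t => (⟨y t, ξ' t i⟩ : TangentBundle J W)))
    (hν' : ∀ i, Continuous (fun t => (⟨y t, ν' t i⟩ : TangentBundle J W)))
    (pξ : ∀ i, (⟨y T, ξ T i⟩ : TangentBundle J W) = ⟨y 0, ξ 0 i⟩)
    (pν : ∀ i, (⟨y T, ν T i⟩ : TangentBundle J W) = ⟨y 0, ν 0 i⟩)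
    (pξ' : ∀ i, (⟨y T, ξ' T i⟩ : TangentBundle J W) = ⟨y 0, ξ' 0 i⟩)
    (pν' : ∀ i, (⟨y T, ν' T i⟩ : TangentBundle J W) = ⟨y 0, ν' 0 i⟩)
    (hd : ∀ t i j, Ω (y t) (ν t i) (ξ t j) = if i = j then 1 else 0)
    (hd' : ∀ t i j, Ω (y t) (ν' t i) (ξ' t j) = if i = j then 1 else 0)
    (hi : ∀ t i j, Ω (y t) (ξ t i) (ξ t j) = 0)
    (hνi : ∀ t i j, Ω (y t) (ν t i) (ν t j) = 0)
    (hνi' : ∀ t i j, Ω (y t) (ν' t i) (ν' t j) = 0)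
    (hspan : ∀ t, Submodule.span ℝ (Set.range (ξ' t)) = Submodule.span ℝ (Set.range (ξ t)))
    {Ψ Ψ' : ∀ t, TangentSpace J (y 0) →L[ℝ] TangentSpace J (y t)}
    (hΨ0 : ∀ v, Ψ 0 v = v)
    (hΨc : ∀ v, ContinuousOn (fun t => (⟨y t, Ψ t v⟩ : TangentBundle J W)) (Set.Icc 0 T))
    (hΨs : ∀ t ∈ Set.Icc 0 T, ∀ v w, Ω (y t) (Ψ t v) (Ψ t w) = Ω (y 0) v w)
    (tξ : ∀ t ∈ Set.Icc 0 T, ∀ i, Ψ t (ξ 0 i) = ξ t i)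
    (tν : ∀ t ∈ Set.Icc 0 T, ∀ i, Ψ t (ν 0 i) = ν t i)
    (tξ' : ∀ t ∈ Set.Icc 0 T, ∀ i, Ψ' t (ξ' 0 i) = ξ' t i)
    (tν' : ∀ t ∈ Set.Icc 0 T, ∀ i, Ψ' t (ν' 0 i) = ν' t i)
    (hE : ∀ t ∈ Set.Icc 0 T, ∀ x, (∀ i, Ω (y 0) (ξ 0 i) x = 0) →
      Ψ' t x - Ψ t x ∈ Submodule.span ℝ (Set.range (ξ' t)))
    {d : ℝ} (h : IsTransportMeanIndex n Ω y T u Ψ' d) : IsTransportMeanIndex n Ω y T u Ψ d := by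
  obtain ⟨e, A', he, hA', hAd'⟩ := h
  obtain ⟨hA, d₁, hAd⟩ := exists_transport_index hn hΩ hT he hΨc hΨs
  set A := fun t => transMatrix (Ω (y t)) (e t) (fun b => Ψ t (e 0 b)) with hAdef
  have hfr : ∀ x : W, Module.finrank ℝ (TangentSpace J x) = 2 * n := fun x => hn
  have m0 := Set.left_mem_Icc.2 hT.le
  let X : (∀ t, Fin k → TangentSpace J (y t)) → ℝ → Matrix (Fin n ⊕ Fin n) (Fin k) ℝ :=
    fun ξ t => transMatrix (Ω (y t)) (e t) (ξ t)
  have hX : ∀ ξ : ∀ t, Fin k → TangentSpace J (y t), ∀ t i, ξ t i = ∑ a, X ξ t a i • e t a :=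
    fun ξ t i => (he.basis t).expand_transMatrix (hfr _) (ξ t) i
  have hXc : ∀ {ξ : ∀ t, Fin k → TangentSpace J (y t)},
      (∀ i, Continuous (fun t => (⟨y t, ξ t i⟩ : TangentBundle J W))) →
      ContinuousOn (X ξ) (Set.Icc 0 T) := fun hξ =>
    hΩ.continuousOn_transMatrix (fun a => (he.continuous a).continuousOn) fun i =>
      (hξ i).continuousOn
  have hXl : ∀ {ξ : ∀ t, Fin k → TangentSpace J (y t)},
      (∀ i, (⟨y T, ξ T i⟩ : TangentBundle J W) = ⟨y 0, ξ 0 i⟩) → X ξ T = X ξ 0 := fun pξ =>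
    transMatrix_congr (he.closed hT.ne') pξ
  have hform : ∀ (ξ ν : ∀ t, Fin k → TangentSpace J (y t)) t, (X ν t)ᵀ * Matrix.J (Fin n) ℝ * X ξ t
      = Matrix.of fun i j => Ω (y t) (ν t i) (ξ t j) := fun ξ ν t =>
    (he.basis t).form_eq (hX ν t) (hX ξ t)
  -- Isotropy depends only on the span, which the two leaf frames share.
  have hi' : ∀ t i j, Ω (y t) (ξ' t i) (ξ' t j) = 0 := by
    intro t
    have hl : ∀ x ∈ Submodule.span ℝ (Set.range (ξ t)), ∀ z ∈ Submodule.span ℝ (Set.range (ξ t)),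
        Ω (y t) x z = 0 := by
      intro x hx z hz
      obtain ⟨c, rfl⟩ := (Submodule.mem_span_range_iff_exists_fun ℝ).1 hx
      obtain ⟨c', rfl⟩ := (Submodule.mem_span_range_iff_exists_fun ℝ).1 hz
      rw [form_sum_left]
      simp [form_sum_right, hi]
    intro i j
    exact hl _ (hspan t ▸ Submodule.subset_span ⟨i, rfl⟩) _
      (hspan t ▸ Submodule.subset_span ⟨j, rfl⟩)
  have hpair : ∀ {ξ ν : ∀ t, Fin k → TangentSpace J (y t)},
      (∀ t i j, Ω (y t) (ν t i) (ξ t j) = if i = j then 1 else 0) →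
      (∀ t i j, Ω (y t) (ξ t i) (ξ t j) = 0) → (∀ t i j, Ω (y t) (ν t i) (ν t j) = 0) →
      ∀ t, IsDualPair (X ξ t) (X ν t) := fun hd hi hν t =>
    ⟨by rw [hform]; ext i j; exact hi t i j, by rw [hform]; ext i j; exact hν t i j, by
      rw [hform]; ext i j; rw [Matrix.of_apply, hd, Matrix.one_apply]⟩
  have htr : ∀ {Ψ : ∀ t, TangentSpace J (y 0) →L[ℝ] TangentSpace J (y t)}
      {A : ℝ → Matrix (Fin n ⊕ Fin n) (Fin n ⊕ Fin n) ℝ}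
      {ξ : ∀ t, Fin k → TangentSpace J (y t)},
      (∀ t ∈ Set.Icc 0 T, ∀ b, Ψ t (e 0 b) = ∑ a, A t a b • e t a) →
      (∀ t ∈ Set.Icc 0 T, ∀ i, Ψ t (ξ 0 i) = ξ t i) →
      ∀ t ∈ Set.Icc 0 T, A t * X ξ 0 = X ξ t := by
    intro Ψ A ξ hA hξ t ht
    rw [← (he.basis t).transMatrix_of_eq (combination_mul (hA t ht)
      (combination_map (Ψ t).toLinearMap (hX ξ 0)))]
    exact congrArg _ (funext fun i => hξ t ht i)
  have hA0 : A 0 = 1 := by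
    rw [hAdef]
    beta_reduce
    rw [(he.basis 0).transMatrix_of_eq (A := 1)]
    intro b
    simp [hΨ0, Matrix.one_apply]
  have key := HasMeanIndex.change_splitting (n := n) (k := k) hT.le (hXc hξ) (hXc hν) (hXc hξ')
    (hXc hν') (hXl pξ) (hXl pν) (hXl pξ') (hXl pν') (fun t _ => hpair hd hi hνi t)
    (fun t _ => hpair hd' hi' hνi' t)
    (fun t _ => by
      have h1 : ∀ j, ∃ c : Fin k → ℝ, ∑ i, c i • ξ t i = ξ' t j := fun j =>
        (Submodule.mem_span_range_iff_exists_fun ℝ).1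
          (hspan t ▸ Submodule.subset_span ⟨j, rfl⟩)
      choose c hc using h1
      refine ⟨Matrix.of fun i j => c j i, ?_⟩
      exact (he.basis t).transMatrix_of_eq (combination_mul (hX ξ t) fun j => (hc j).symm))
    hAd hA0 hAd'.2.1 (htr (fun t _ => hA t) tξ) (htr (fun t _ => hA t) tν) (htr hA' tξ')
    (htr hA' tν')
    (fun t ht v hv => by
      let x : TangentSpace J (y 0) := ∑ a, v a • e 0 a
      have hx : ∀ i, Ω (y 0) (ξ 0 i) x = 0 := fun i => by
        have h1 := (he.basis 0).form_eq (g' := fun _ : Unit => x) (A' := Matrix.of fun a _ => v a)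
          (hX ξ 0) (fun _ => rfl)
        have h2 := congrFun (congrFun h1 i) ()
        rw [Matrix.of_apply] at h2
        rw [← h2]
        exact congrFun hv i
      obtain ⟨c, hc⟩ := (Submodule.mem_span_range_iff_exists_fun ℝ).1 (hE t ht x hx)
      refine ⟨c, ?_⟩
      have himg : ∀ {Ψ : ∀ t, TangentSpace J (y 0) →L[ℝ] TangentSpace J (y t)}
          {A : ℝ → Matrix (Fin n ⊕ Fin n) (Fin n ⊕ Fin n) ℝ},
          (∀ b, Ψ t (e 0 b) = ∑ a, A t a b • e t a) → sympCoord (Ω (y t)) (e t) (Ψ t x)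
            = A t *ᵥ v := by
        intro Ψ A hA
        have h1 := combination_mul (h := fun _ : Unit => Ψ t x) (B := Matrix.of fun a _ => v a) hA
          (fun _ => by
            rw [map_sum]
            simp_rw [map_smul]
            rfl) ()
        rw [h1, (he.basis t).sympCoord_sum]
        rfl
      have hsub : ∀ x z, sympCoord (Ω (y t)) (e t) (x - z)
          = sympCoord (Ω (y t)) (e t) x - sympCoord (Ω (y t)) (e t) z := fun x z => by
        rw [sympCoord, sympCoord, sympCoord, ← Matrix.mulVec_sub]
        congr 1
        ext a
        simp
      rw [← himg (hA' t ht), ← himg (hA t), ← hsub, ← hc]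
      have h1 := combination_mul (h := fun _ : Unit => ∑ i, c i • ξ' t i)
        (B := Matrix.of fun a _ => c a) (hX ξ' t) (fun _ => rfl) ()
      rw [h1, (he.basis t).sympCoord_sum]
      rfl)
  -- The comparison transfers the index `d₁` of `A` to `A'`, where uniqueness identifies it with the
  -- given `d`.
  have hdd : d₁ = d := key.unique hT.le hAd'
  exact ⟨e, A, he, fun t _ => hA t, hdd ▸ hAd⟩

end FrameCoordinates

section Comparison

variable {E : Type*} [NormedAddCommGroup E] [NormedSpace ℝ E] [FiniteDimensional ℝ E]
  {H : Type*} [TopologicalSpace H] {I : ModelWithCorners ℝ E H} [I.Boundaryless]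
  {M : Type*} [TopologicalSpace M] [ChartedSpace H M] [IsManifold I ∞ M]
  {F : Type*} [NormedAddCommGroup F] [NormedSpace ℝ F] [FiniteDimensional ℝ F]
  {G : Type*} [TopologicalSpace G] {J : ModelWithCorners ℝ F G} [J.Boundaryless]
  {W : Type*} [TopologicalSpace W] [ChartedSpace G W] [IsManifold J ∞ W]
  {n k m : ℕ} {Ω : TwoForm J W} {α : Fin k → OneForm I M} {r : ℝ}
  {ψ : M × EuclideanSpace ℝ (Fin k) → W}
  {φ : ℝ → M × EuclideanSpace ℝ (Fin k) → M × EuclideanSpace ℝ (Fin k)}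
  {p : EuclideanSpace ℝ (Fin k)} {q : M}

namespace IsStableTube

variable (h : IsStableTube m Ω α r ψ)
  (hφ : IsHamiltonianFlow (Ω.pullback I (zeroSection ψ)) α r (rho M k) φ)
include h hφ

theorem exists_reeb_frame (q : M) : ∃ R : Fin k → E,
    ∀ i, IsReeb (Ω.pullback I (zeroSection ψ)) α q (EuclideanSpace.single i 1) (R i) := by
  choose R hR using fun i : Fin k => h.exists_isReeb q (EuclideanSpace.single i 1)
  exact ⟨R, hR⟩

/-- Split `v` into a leaf component and a part in the complement chosen by `ν`. On the latter both
transports induce holonomy and agree modulo `T𝓕`; the former stays in `T𝓕` under both. Hence the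
transports agree on `TM / T𝓕` although their splittings differ. -/
theorem adapted_difference (hp : ‖p‖ < r) {T : ℝ}
    {Ψ' : ∀ t, TangentSpace J (zeroSection ψ (flowAt φ p 0 q)) →L[ℝ]
      TangentSpace J (zeroSection ψ (flowAt φ p t q))}
    {ξ ν : ∀ t, Fin k → TangentSpace J (zeroSection ψ (flowAt φ p t q))}
    (hξ : IsLeafFrame I Ω (zeroSection ψ) (fun t => flowAt φ p t q) T ξ)
    (hν : IsDualFrame Ω (zeroSection ψ) (fun t => flowAt φ p t q) T ξ ν) {t : ℝ}
    (hξt : ∀ i, Ψ' t (ξ 0 i) = ξ t i)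
    (hE : ∀ v : TangentSpace I (flowAt φ p 0 q),
      (∀ i, Ω (zeroSection ψ (flowAt φ p 0 q)) (ν 0 i)
        (mfderiv I J (zeroSection ψ) (flowAt φ p 0 q) v) = 0) →
      ∃ w : TangentSpace I (flowAt φ p t q),
        IsHolonomyRelated (Ω.pullback I (zeroSection ψ)) (fun t => flowAt φ p t q) t v w ∧
        Ψ' t (mfderiv I J (zeroSection ψ) (flowAt φ p 0 q) v)
          = mfderiv I J (zeroSection ψ) (flowAt φ p t q) w) (v : E) :
    Ψ' t (normalFrame I J ψ φ p q 0 (v, 0)) - normalFrame I J ψ φ p q t (v, 0)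
      ∈ Submodule.span ℝ (Set.range (ξ t)) := by
  let D₀ : E →L[ℝ] F := mfderiv I J (zeroSection ψ) (flowAt φ p 0 q)
  let Dt : E →L[ℝ] F := mfderiv I J (zeroSection ψ) (flowAt φ p t q)
  let B : F →L[ℝ] F →L[ℝ] ℝ := Ω (zeroSection ψ (flowAt φ p 0 q))
  let P' : F →L[ℝ] F := Ψ' t
  let L : E →L[ℝ] E := flowDeriv I φ p t q
  let ξ₀ : Fin k → F := ξ 0
  let ξt : Fin k → F := ξ t
  let ν₀ : Fin k → F := ν 0
  -- By duality these are the coefficients, in the frame `ξ`, of the leaf component of `v`.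
  let c : Fin k → ℝ := fun i => B (ν₀ i) (D₀ v)
  obtain ⟨vF, hvF, hvF'⟩ : ∃ vF : E, (show TangentSpace I (flowAt φ p 0 q) from vF) ∈
      charDist (Ω.pullback I (zeroSection ψ)) (flowAt φ p 0 q) ∧ D₀ vF = ∑ i, c i • ξ₀ i := by
    have h1 : ∑ i, c i • ξ 0 i ∈ Submodule.span ℝ (Set.range (ξ 0)) :=
      Submodule.sum_mem _ fun i _ => Submodule.smul_mem _ _ (Submodule.subset_span ⟨i, rfl⟩)
    rw [hξ.span 0] at h1
    obtain ⟨vF, h2, h3⟩ := h1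
    exact ⟨vF, h2, h3⟩
  obtain ⟨w, hw, hw'⟩ := hE (v - vF : E) fun i => by
    have h1 : B (ν₀ i) (D₀ (v - vF)) = 0 := by
      have hd : ∀ j, B (ν₀ i) (ξ₀ j) = if i = j then 1 else 0 := hν.dual 0 i
      rw [map_sub, map_sub, hvF', map_sum]
      simp_rw [map_smul, hd]
      simp [c]
    exact h1
  let w₁ : E := w
  have hchar : ∀ x : E, (show TangentSpace I (flowAt φ p t q) from x) ∈
      charDist (Ω.pullback I (zeroSection ψ)) (flowAt φ p t q) →
      Dt x ∈ Submodule.span ℝ (Set.range ξt) := fun x hx => by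
    have h1 := hξ.span t
    have h2 : Dt x ∈ (charDist (Ω.pullback I (zeroSection ψ)) (flowAt φ p t q)).map
        (mfderiv I J (zeroSection ψ) (flowAt φ p t q)).toLinearMap := ⟨x, hx, rfl⟩
    rwa [← h1] at h2
  have m1 : Dt (w₁ - L (v - vF)) ∈ Submodule.span ℝ (Set.range ξt) := by
    refine hchar _ ?_
    have h1 := h.holonomyRelated_unique hφ hp (γ := fun t => flowAt φ p t q)
      (fun t => congrArg (flowAt φ p t) (flowAt_zero hφ hp q)) t (w₀ := L (v - vF)) hw
      (flowDeriv_start hφ hp t (v - vF : E)).symm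
    exact h1
  have m2 : Dt (L vF) ∈ Submodule.span ℝ (Set.range ξt) :=
    hchar _ (h.flowDeriv_char hφ hp t ((mem_charDist_congr (flowAt_zero hφ hp q) vF).1 hvF))
  have m3 : ∑ i, c i • ξt i ∈ Submodule.span ℝ (Set.range ξt) :=
    Submodule.sum_mem _ fun i _ => Submodule.smul_mem _ _ (Submodule.subset_span ⟨i, rfl⟩)
  have e1 : P' (D₀ vF) = ∑ i, c i • ξt i := by
    rw [hvF', map_sum]
    simp_rw [map_smul]
    exact Finset.sum_congr rfl fun i _ => congrArg (fun x : F => c i • x) (hξt i)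
  have e2 : P' (D₀ (v - vF)) = Dt w₁ := hw'
  have e3 : P' (D₀ v) - Dt (L v) = ∑ i, c i • ξt i + Dt (w₁ - L (v - vF)) - Dt (L vF) := by
    rw [← e1, map_sub Dt, ← e2]
    simp only [map_sub]
    abel
  have e4 : P' (D₀ v) - Dt (L v) ∈ Submodule.span ℝ (Set.range ξt) := by
    rw [e3]
    exact Submodule.sub_mem _ (Submodule.add_mem _ m3 m1) m2
  have e5 : D₀ v = (normalFrame I J ψ φ p q 0 (v, 0) : F) := h.mfderiv_start hφ hp v
  have e6 : (normalFrame I J ψ φ p q t (v, 0) : F) = Dt (L v) := h.normalFrame_horizontal t v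
  rw [e5, ← e6] at e4
  exact e4

/-- The mean index of every adapted transport is that of the one given by the flow. -/
theorem adapted_index (hn : Module.finrank ℝ F = 2 * n) (hp : ‖p‖ < r) {T : ℝ} (hT : 0 < T)
    (hq : flowAt φ p T q = q)
    {Ψ Ψ' : ∀ t, TangentSpace J (zeroSection ψ (flowAt φ p 0 q)) →L[ℝ]
      TangentSpace J (zeroSection ψ (flowAt φ p t q))}
    (hΨ : ∀ t v, Ψ t (normalFrame I J ψ φ p q 0 v) = normalFrame I J ψ φ p q t v)
    (hΨ' : IsAdaptedTransport k I Ω (zeroSection ψ) (fun t => flowAt φ p t q) T Ψ') {u : ℂ → W}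
    {d : ℝ} (hd : IsTransportMeanIndex n Ω (fun t => zeroSection ψ (flowAt φ p t q)) T u Ψ' d) :
    IsTransportMeanIndex n Ω (fun t => zeroSection ψ (flowAt φ p t q)) T u Ψ d := by
  obtain ⟨R, hR⟩ := h.exists_reeb_frame hφ q
  obtain ⟨ξ', ν', hξ', hν', htr⟩ := hΨ'
  have hξ := h.isLeafFrame hφ hR hp hq
  have hν := h.isDualFrame hφ hR hp hq
  have hsurj := (h.normalFrame_bijective hφ (q := q) hp 0).2
  have hper : ∀ {ζ : ∀ t, Fin k → TangentSpace J (zeroSection ψ (flowAt φ p t q))},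
      (∀ t i, (⟨zeroSection ψ (flowAt φ p (t + T) q), ζ (t + T) i⟩ : TangentBundle J W)
        = ⟨zeroSection ψ (flowAt φ p t q), ζ t i⟩) → ∀ i,
      (⟨zeroSection ψ (flowAt φ p T q), ζ T i⟩ : TangentBundle J W)
        = ⟨zeroSection ψ (flowAt φ p 0 q), ζ 0 i⟩ := fun hζ i => by
    have := hζ 0 i
    rwa [zero_add] at this
  refine transport_index_change hn h.symplectic hT hξ.continuous hν.continuous hξ'.continuous
    hν'.continuous (hper (ζ := fun t i => normalFrame I J ψ φ p q t (R i, 0)) hξ.periodic)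
    (hper (ζ := fun t i => normalFrame I J ψ φ p q t (0, EuclideanSpace.single i 1)) hν.periodic)
    (hper (ζ := ξ') hξ'.periodic) (hper (ζ := ν') hν'.periodic)
    hν.dual hν'.dual (fun t i j => ?_) hν.isotropic hν'.isotropic
    (fun t => (hξ'.span t).trans (hξ.span t).symm) (fun x => ?_) (fun x => ?_)
    (fun t _ x z => ?_) (fun t _ i => hΨ t _) (fun t _ i => hΨ t _) (fun t ht => (htr t ht).1)
    (fun t ht => (htr t ht).2.1) (fun t ht x hx => ?_) hd
  · have h1 := h.normalFrame_reeb_form hφ hR hp t i (R j, 0)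
    exact h1.trans (by simp)
  · obtain ⟨v, rfl⟩ := hsurj x
    exact hΨ 0 v
  · obtain ⟨v, rfl⟩ := hsurj x
    simp_rw [hΨ]
    exact (h.continuous_normalFrame hφ hp v).continuousOn
  · obtain ⟨v, rfl⟩ := hsurj x
    obtain ⟨w, rfl⟩ := hsurj z
    rw [hΨ, hΨ]
    exact (h.normalFrame_form hφ hp t v w).trans (h.normalFrame_form hφ hp 0 v w).symm
  · obtain ⟨⟨v, w⟩, rfl⟩ := hsurj x
    have hw : w = 0 := by
      ext i
      have h1 := (h.normalFrame_reeb_form hφ hR hp 0 i (v, w)).symm.trans (hx i)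
      simpa using h1
    subst hw
    rw [hΨ]
    exact h.adapted_difference hφ hp hξ' hν' (htr t ht).1
      (fun v hv => by
        obtain ⟨w, -, h1, h2⟩ := (htr t ht).2.2 v hv
        exact ⟨w, h1, h2⟩) v

end IsStableTube
end Comparison
end CoisotropicIndex

namespace CoisotropicIndex

/-! ### A common index for both ends of the homotopy. -/

section CommonIndex

variable {F : Type*} [NormedAddCommGroup F] [NormedSpace ℝ F] [FiniteDimensional ℝ F]
  {G : Type*} [TopologicalSpace G] {J : ModelWithCorners ℝ F G} [J.Boundaryless]
  {W : Type*} [TopologicalSpace W] [ChartedSpace G W] [IsManifold J ∞ W]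
  {V : Type*} [NormedAddCommGroup V] [NormedSpace ℝ V] [FiniteDimensional ℝ V]
  {n : ℕ} {Ω : TwoForm J W} {T : ℝ}

omit [FiniteDimensional ℝ F] [J.Boundaryless] [IsManifold J ∞ W] in
theorem tangent_snd {x x' : W} {v : TangentSpace J x} {v' : TangentSpace J x'}
    (h : (⟨x, v⟩ : TangentBundle J W) = ⟨x', v'⟩) : (v : F) = v' :=
  congrArg (fun z : TangentBundle J W => (z.2 : F)) h

omit [FiniteDimensional ℝ F] [J.Boundaryless] in
theorem IsTransportMeanIndex.congr {y y' : ℝ → W} (hy : y = y') {u : ℂ → W}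
    {Ψ : ∀ t, TangentSpace J (y 0) →L[ℝ] TangentSpace J (y t)}
    {Ψ' : ∀ t, TangentSpace J (y' 0) →L[ℝ] TangentSpace J (y' t)}
    (hΨ : ∀ t ∈ Set.Icc 0 T, ∀ v : F, (Ψ t v : F) = Ψ' t v) {d : ℝ}
    (h : IsTransportMeanIndex n Ω y T u Ψ d) : IsTransportMeanIndex n Ω y' T u Ψ' d := by
  subst hy
  obtain ⟨e, A, he, hA, hd⟩ := h
  exact ⟨e, A, he, fun t ht b => (hΨ t ht _).symm.trans (hA t ht b), hd⟩

/-- Existence and uniqueness of the mean index of a symplectic transport. -/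
theorem transport_index_iff (hn : Module.finrank ℝ F = 2 * n) (hΩ : IsSymplecticForm Ω)
    (hch : ChernVanishesOnSpheres n Ω) (hT : 0 < T) {y : ℝ → W}
    {Ψ : ∀ t, TangentSpace J (y 0) →L[ℝ] TangentSpace J (y t)} (h0 : ∀ v, Ψ 0 v = v)
    (hc : ∀ v, ContinuousOn (fun t => (⟨y t, Ψ t v⟩ : TangentBundle J W)) (Set.Icc 0 T))
    (hs : ∀ t ∈ Set.Icc 0 T, ∀ v w, Ω (y t) (Ψ t v) (Ψ t w) = Ω (y 0) v w)
    {u₀ : ℂ → W} (hu₀ : IsCapping y T u₀) {Δ : ℝ} (hΔ : IsTransportMeanIndex n Ω y T u₀ Ψ Δ)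
    {u : ℂ → W} (hu : IsCapping y T u) (d : ℝ) :
    IsTransportMeanIndex n Ω y T u Ψ d ↔ d = Δ := by
  refine ⟨fun h => transport_index_unique hn hΩ hch hT hu hu₀ h0 h hΔ, ?_⟩
  rintro rfl
  obtain ⟨e, he⟩ := exists_cappingFrame hn hΩ hu
  obtain ⟨hA, d', hd'⟩ := exists_transport_index hn hΩ hT he hc hs
  have h1 : IsTransportMeanIndex n Ω y T u Ψ d' := ⟨e, _, he, fun t _ => hA t, hd'⟩
  rwa [transport_index_unique hn hΩ hch hT hu hu₀ h0 h1 hΔ] at h1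

/-- Two transports along homotopic loops, related by a shear, have the same mean index. -/
theorem exists_common_index (hn : Module.finrank ℝ F = 2 * n) (hnV : Module.finrank ℝ V = 2 * n)
    (hΩ : IsSymplecticForm Ω) (hch : ChernVanishesOnSpheres n Ω) (hT : 0 < T) {y : ℝ → ℝ → W}
    {L : ∀ s t, V →L[ℝ] TangentSpace J (y s t)} {N D : V →L[ℝ] V}
    (hyp : ∀ s t, y s (t + T) = y s t)
    (hLc : ∀ v, ContinuousOn (fun x : ℝ × ℝ => (⟨y x.1 x.2, L x.1 x.2 v⟩ : TangentBundle J W))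
      (Set.Icc 0 1 ×ˢ Set.univ))
    (hLs : ∀ s ∈ Set.Icc (0 : ℝ) 1, ∀ t, Function.Surjective (L s t))
    (hform : ∀ s ∈ Set.Icc (0 : ℝ) 1, ∀ t v v',
      Ω (y s t) (L s t v) (L s t v') = Ω (y s 0) (L s 0 v) (L s 0 v'))
    (hshear : ∀ s ∈ Set.Icc (0 : ℝ) 1, ∀ (x : ℝ) v v',
      Ω (y s 0) (L s 0 (v + x • N v)) (L s 0 (v' + x • N v')) = Ω (y s 0) (L s 0 v) (L s 0 v'))
    (hLT : ∀ s ∈ Set.Icc (0 : ℝ) 1, ∀ v,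
      (⟨y s T, L s T v⟩ : TangentBundle J W) = ⟨y s 0, L s 0 (D v)⟩)
    (hNN : ∀ v, N (N v) = 0) (hND : ∀ v, N (D v) = D (N v))
    {Ψ₀ : ∀ t, TangentSpace J (y 0 0) →L[ℝ] TangentSpace J (y 0 t)}
    {Ψ₁ : ∀ t, TangentSpace J (y 1 0) →L[ℝ] TangentSpace J (y 1 t)}
    (hΨ₀ : ∀ t v, Ψ₀ t (L 0 0 v) = L 0 t v) (hΨ₁ : ∀ t v, Ψ₁ t (L 1 0 v) = L 1 t (v + t • N v))
    {u : ℂ → W} (hu : IsCapping (y 1) T u) :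
    (∃ U, IsCapping (y 0) T U) ∧ ∃ Δ,
      (∀ u, IsCapping (y 1) T u → ∀ d, IsTransportMeanIndex n Ω (y 1) T u Ψ₁ d ↔ d = Δ) ∧
      (∀ u, IsCapping (y 0) T u → ∀ d, IsTransportMeanIndex n Ω (y 0) T u Ψ₀ d ↔ d = Δ) := by
  have m0 : (0 : ℝ) ∈ Set.Icc (0 : ℝ) 1 := ⟨le_rfl, zero_le_one⟩
  have m1 : (1 : ℝ) ∈ Set.Icc (0 : ℝ) 1 := ⟨zero_le_one, le_rfl⟩
  have hyc : ContinuousOn (fun x : ℝ × ℝ => y x.1 x.2) (Set.Icc 0 1 ×ˢ Set.univ) :=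
    (FiberBundle.continuous_proj F (TangentSpace J : W → Type _)).comp_continuousOn (hLc 0)
  -- One disc serves all loops: `y s` lies on its circle of radius `1 - s / 2`. Thus `U` caps `y 0`,
  -- its inner half caps `y 1`, and a single frame over `U` restricts to capping frames of both.
  obtain ⟨U, hUc, hU⟩ := exists_collar hT.ne' hu.1 hyc hyp fun t => (hu.2 t).symm
  obtain ⟨f, hf⟩ := hΩ.exists_frame_disc hn hUc
  let z : ℝ → ℝ → ℂ := fun s t => (1 - s / 2 : ℝ) * bd T t
  have hz : ∀ s ∈ Set.Icc (0 : ℝ) 1, ∀ t, z s t ∈ Metric.closedBall (0 : ℂ) 1 := fun s hs t => by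
    rw [mem_closedBall_zero_iff, norm_mul, norm_bd, mul_one, Complex.norm_real, Real.norm_eq_abs,
      abs_of_nonneg (by linarith [hs.2])]
    linarith [hs.1]
  have hzc : Continuous (fun x : ℝ × ℝ => z x.1 x.2) :=
    (Complex.continuous_ofReal.comp (by fun_prop)).mul ((continuous_bd T).comp continuous_snd)
  let e : ∀ s t, Fin n ⊕ Fin n → TangentSpace J (y s t) := fun s t a => (f (z s t) a : F)
  have hef : ∀ s ∈ Set.Icc (0 : ℝ) 1, ∀ t a,
      (⟨y s t, e s t a⟩ : TangentBundle J W) = ⟨U (z s t), f (z s t) a⟩ := fun s hs t a =>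
    tangent_ext (hU s hs t).symm rfl
  have hec : ∀ a, ContinuousOn (fun x : ℝ × ℝ => (⟨y x.1 x.2, e x.1 x.2 a⟩ : TangentBundle J W))
      (Set.Icc 0 1 ×ˢ Set.Icc 0 T) := fun a =>
    ((hf.continuousOn a).comp hzc.continuousOn fun x (hx : x ∈ Set.Icc 0 1 ×ˢ Set.Icc 0 T) =>
      hz _ hx.1 _).congr fun x hx => hef _ hx.1 _ a
  have he : ∀ s ∈ Set.Icc (0 : ℝ) 1, ∀ t, IsSymplecticBasis (Ω (y s t)) (e s t) :=
    fun s hs t a b => (form_congr (hef s hs t a) (hef s hs t b)).trans (hf.gram _ (hz s hs t) a b)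
  have heT : ∀ s ∈ Set.Icc (0 : ℝ) 1, ∀ a,
      (⟨y s T, e s T a⟩ : TangentBundle J W) = ⟨y s 0, e s 0 a⟩ := fun s hs a => by
    have h1 : z s T = z s 0 := congrArg (fun w : ℂ => ((1 - s / 2 : ℝ) : ℂ) * w) (bd_self hT.ne')
    rw [hef s hs, hef s hs, h1]
  have hz0 : ∀ t, z 0 t = bd T t := fun t => by simp [z]
  have hcapU : IsCapping (y 0) T U := ⟨hUc, fun t => hz0 t ▸ hU 0 m0 t⟩
  have hcf₀ : IsCappingFrame Ω (y 0) T U (e 0) :=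
    ⟨f, hf, fun t a => (hef 0 m0 t a).trans (by rw [hz0])⟩
  have hhalf : Set.MapsTo (fun w : ℂ => w / 2) (Metric.closedBall 0 1) (Metric.closedBall 0 1) :=
    fun w hw => by
      rw [mem_closedBall_zero_iff] at hw ⊢
      rw [norm_div, Complex.norm_ofNat]
      linarith
  have hhc : ContinuousOn (fun w : ℂ => w / 2) (Metric.closedBall 0 1) := by fun_prop
  have hz1 : ∀ t, bd T t / 2 = z 1 t := fun t => by simp [z]; ring
  have hcapU₁ : IsCapping (y 1) T (fun w => U (w / 2)) :=
    ⟨hUc.comp hhc hhalf, fun t => (congrArg U (hz1 t)).trans (hU 1 m1 t)⟩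
  have hcf₁ : IsCappingFrame Ω (y 1) T (fun w => U (w / 2)) (e 1) := by
    refine ⟨fun w => f (w / 2), ⟨fun a => (hf.continuousOn a).comp hhc hhalf,
      fun w hw => hf.gram _ (hhalf hw)⟩, fun t a => (hef 1 m1 t a).trans ?_⟩
    show _ = (⟨U (bd T t / 2), f (bd T t / 2) a⟩ : TangentBundle J W)
    rw [hz1]
  have hLc1 : ∀ s ∈ Set.Icc (0 : ℝ) 1, ∀ v, ContinuousOn
      (fun t => (⟨y s t, L s t v⟩ : TangentBundle J W)) (Set.Icc 0 T) := fun s hs v =>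
    (hLc v).comp (f := fun t => (s, t)) (by fun_prop) fun t _ => ⟨hs, trivial⟩
  have c₀ : ∀ v, ContinuousOn (fun t => (⟨y 0 t, Ψ₀ t v⟩ : TangentBundle J W)) (Set.Icc 0 T) :=
    fun v => by
      obtain ⟨v, rfl⟩ := hLs 0 m0 0 v
      simp_rw [hΨ₀]
      exact hLc1 0 m0 v
  have c₁ : ∀ v, ContinuousOn (fun t => (⟨y 1 t, Ψ₁ t v⟩ : TangentBundle J W)) (Set.Icc 0 T) :=
    fun v => by
      obtain ⟨v, rfl⟩ := hLs 1 m1 0 v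
      intro t ht
      -- The sheared transport is `L v + t • L (N v)`, a sum of two continuous sections with
      -- coefficients `1` and `t`.
      have h1 := continuousWithinAt_tangent_sum (ι := Bool) (u := y 1) (s := Set.Icc 0 T) (y₀ := t)
        (v := fun i t => bif i then L 1 t v else L 1 t (N v)) (a := fun i t => bif i then 1 else t)
        ((hyc.comp (f := fun t => (1, t)) (s := Set.Icc 0 T) (by fun_prop)
          fun t _ => ⟨m1, trivial⟩) t ht)
        (fun i => by cases i <;> exact hLc1 1 m1 _ t ht)
        (fun i => by cases i; exacts [continuousWithinAt_id, continuousWithinAt_const])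
      refine h1.congr (fun t _ => ?_) ?_ <;>
      · rw [hΨ₁]
        simp
  have s₀ : ∀ t ∈ Set.Icc 0 T, ∀ v w, Ω (y 0 t) (Ψ₀ t v) (Ψ₀ t w) = Ω (y 0 0) v w :=
    fun t _ v w => by
      obtain ⟨v, rfl⟩ := hLs 0 m0 0 v
      obtain ⟨w, rfl⟩ := hLs 0 m0 0 w
      rw [hΨ₀, hΨ₀, hform 0 m0]
  have s₁ : ∀ t ∈ Set.Icc 0 T, ∀ v w, Ω (y 1 t) (Ψ₁ t v) (Ψ₁ t w) = Ω (y 1 0) v w :=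
    fun t _ v w => by
      obtain ⟨v, rfl⟩ := hLs 1 m1 0 v
      obtain ⟨w, rfl⟩ := hLs 1 m1 0 w
      rw [hΨ₁, hΨ₁, hform 1 m1, hshear 1 m1]
  have i₀ : ∀ v, Ψ₀ 0 v = v := fun v => by
    obtain ⟨v, rfl⟩ := hLs 0 m0 0 v
    exact hΨ₀ 0 v
  have i₁ : ∀ v, Ψ₁ 0 v = v := fun v => by
    obtain ⟨v, rfl⟩ := hLs 1 m1 0 v
    rw [hΨ₁, zero_smul, add_zero]
  obtain ⟨hA₀, -⟩ := exists_transport_index hn hΩ hT hcf₀ c₀ s₀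
  obtain ⟨hA₁, Δ, hΔ⟩ := exists_transport_index hn hΩ hT hcf₁ c₁ s₁
  have hΔ₀ := mean_index_of_shear hn hnV hΩ hT hec
    (fun v => (hLc v).mono (Set.prod_mono_right (Set.subset_univ _))) he hLs hform hshear heT hLT
    hNN hND hΨ₀ hΨ₁ (fun t _ => hA₀ t) (fun t _ => hA₁ t) hΔ
  exact ⟨⟨U, hcapU⟩, Δ,
    fun u hu d => transport_index_iff hn hΩ hch hT i₁ c₁ s₁ hcapU₁
      ⟨e 1, _, hcf₁, fun t _ => hA₁ t, hΔ⟩ hu d,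
    fun u hu d => transport_index_iff hn hΩ hch hT i₀ c₀ s₀ hcapU
      ⟨e 0, _, hcf₀, fun t _ => hA₀ t, hΔ₀⟩ hu d⟩

end CommonIndex
end CoisotropicIndex

namespace CoisotropicIndex

/-! ### The closed orbit and its projection. -/

section Orbit

variable {E : Type*} [NormedAddCommGroup E] [NormedSpace ℝ E] [FiniteDimensional ℝ E]
  {H : Type*} [TopologicalSpace H] {I : ModelWithCorners ℝ E H} [I.Boundaryless]
  {M : Type*} [TopologicalSpace M] [ChartedSpace H M] [IsManifold I ∞ M]
  {F : Type*} [NormedAddCommGroup F] [NormedSpace ℝ F] [FiniteDimensional ℝ F]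
  {G : Type*} [TopologicalSpace G] {J : ModelWithCorners ℝ F G} [J.Boundaryless]
  {W : Type*} [TopologicalSpace W] [ChartedSpace G W] [IsManifold J ∞ W]
  {n k m : ℕ} {Ω : TwoForm J W} {α : Fin k → OneForm I M} {r : ℝ}
  {ψ : M × EuclideanSpace ℝ (Fin k) → W}
  {φ : ℝ → M × EuclideanSpace ℝ (Fin k) → M × EuclideanSpace ℝ (Fin k)}
  {p : EuclideanSpace ℝ (Fin k)} {q : M}

namespace IsStableTube

variable (h : IsStableTube m Ω α r ψ)
  (hφ : IsHamiltonianFlow (Ω.pullback I (zeroSection ψ)) α r (rho M k) φ)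

include h hφ in
theorem isCharLoop (hp : ‖p‖ < r) {T : ℝ} (hq : flowAt φ p T q = q) :
    IsCharLoop (Ω.pullback I (zeroSection ψ)) (fun t => flowAt φ p t q) T where
  smooth := flowAt_curve_contMDiff hφ hp q
  periodic t := h.flowAt_periodic hφ hp hq t
  tangent t := (h.flowAt_isReeb hφ hp q t).1

include hφ in
theorem start_frame (hp : ‖p‖ < r) (v : E × EuclideanSpace ℝ (Fin k)) :
    tangentMap (I.prod (𝓡 k)) J ψ ⟨(q, p), pairVec (q, p) v.1 v.2⟩
      = ⟨ψ (flowAt φ p 0 q, (1 : ℝ) • p), orbitFrame I J ψ φ p q 1 0 v⟩ := by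
  have h1 : (⟨(q, p), pairVec (q, p) v.1 v.2⟩ :
      TangentBundle (I.prod (𝓡 k)) (M × EuclideanSpace ℝ (Fin k)))
      = ⟨(flowAt φ p 0 q, (1 : ℝ) • p),
        pairVec (flowAt φ p 0 q, (1 : ℝ) • p) (flowDeriv I φ p 0 q v.1) v.2⟩ :=
    tangent_ext (Prod.ext (flowAt_zero hφ hp q).symm (one_smul ℝ p).symm)
      (Prod.ext (flowDeriv_zero hφ hp v.1).symm rfl)
  exact congrArg (tangentMap (I.prod (𝓡 k)) J ψ) h1

include h hφ

theorem flow_frame {R : Fin k → E} (hp : ‖p‖ < r)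
    (hR : ∀ i, IsReeb (Ω.pullback I (zeroSection ψ)) α q (EuclideanSpace.single i 1) (R i)) (t : ℝ)
    (v : E × EuclideanSpace ℝ (Fin k)) :
    tangentMap (I.prod (𝓡 k)) J ψ (tangentMap (I.prod (𝓡 k)) (I.prod (𝓡 k)) (φ t)
        ⟨(q, p), pairVec (q, p) v.1 v.2⟩)
      = ⟨ψ (flowAt φ p t q, (1 : ℝ) • p),
        orbitFrame I J ψ φ p q 1 t (v + t • reebShear R v)⟩ := by
  let Q : E →L[ℝ] E := flowDeriv I φ p t q
  have h1 := h.mfderiv_flow hφ hp t (q := q) v.1 v.2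
    (h.flowDeriv_reeb hφ hp t (h.isReeb_sum hR v.2))
  have h2 : Q v.1 + t • Q (∑ i, v.2 i • R i) = Q (v + t • reebShear R v).1 := by
    rw [reebShear_apply, Prod.fst_add, Prod.smul_fst, map_add, map_smul]
  have h3 : v.2 = (v + t • reebShear R v).2 := by
    rw [reebShear_apply, Prod.snd_add, Prod.smul_snd, smul_zero, add_zero]
  have h4 : (⟨φ t (q, p), mfderiv (I.prod (𝓡 k)) (I.prod (𝓡 k)) (φ t) (q, p)
      (pairVec (q, p) v.1 v.2)⟩ : TangentBundle (I.prod (𝓡 k)) (M × EuclideanSpace ℝ (Fin k)))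
      = ⟨(flowAt φ p t q, (1 : ℝ) • p), pairVec (flowAt φ p t q, (1 : ℝ) • p)
        (Q (v + t • reebShear R v).1) (v + t • reebShear R v).2⟩ :=
    h1.trans (tangent_ext (Prod.ext rfl (one_smul ℝ p).symm) (Prod.ext h2 h3))
  exact congrArg (tangentMap (I.prod (𝓡 k)) J ψ) h4

/-- The mean index of the orbit is that of the transport given by the sheared frame. -/
theorem isOrbitMeanIndex_iff {R : Fin k → E} (hp : ‖p‖ < r)
    (hR : ∀ i, IsReeb (Ω.pullback I (zeroSection ψ)) α q (EuclideanSpace.single i 1) (R i))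
    {T : ℝ}
    {Ψ : ∀ t, TangentSpace J (ψ (flowAt φ p 0 q, (1 : ℝ) • p)) →L[ℝ]
      TangentSpace J (ψ (flowAt φ p t q, (1 : ℝ) • p))}
    (hΨ : ∀ t v, Ψ t (orbitFrame I J ψ φ p q 1 0 v)
      = orbitFrame I J ψ φ p q 1 t (v + t • reebShear R v)) (u : ℂ → W) (d : ℝ) :
    IsOrbitMeanIndex n I Ω ψ φ (q, p) T u d ↔
      IsTransportMeanIndex n Ω (fun t => ψ (flowAt φ p t q, (1 : ℝ) • p)) T u Ψ d := by
  have hy : (fun t => ψ (φ t (q, p))) = fun t => ψ (flowAt φ p t q, (1 : ℝ) • p) := by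
    funext t
    rw [h.flow_eq hφ hp t, one_smul]
    rfl
  have hs := h.orbitFrame_surjective hφ (q := q) (s := 1) hp (by rwa [one_smul]) 0
  constructor
  · rintro ⟨Ψ', hΨ', hd⟩
    refine hd.congr hy fun t ht v => ?_
    obtain ⟨X, hX⟩ := hs v
    have h1 := hΨ' t ht (pairVec (q, p) X.1 X.2) v
      ((start_frame hφ hp X).trans (tangent_ext (congrFun hy 0).symm hX))
    have h2 := tangent_snd (h1.symm.trans (h.flow_frame hφ hp hR t X))
    exact h2.trans ((hΨ t X).symm.trans (congrArg (Ψ t) hX))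
  · intro hd
    refine ⟨fun t => (show F →L[ℝ] F from Ψ t), fun t _ X v hX => ?_,
      hd.congr hy.symm fun t _ v => rfl⟩
    have h1 := tangent_snd ((start_frame hφ hp X).symm.trans hX)
    exact (h.flow_frame hφ hp hR t X).trans (tangent_ext (congrFun hy t).symm
      ((hΨ t X).symm.trans (congrArg (Ψ t) h1)))

/-- The Maslov index of the projected loop is minus the mean index of the transport by the flow. -/
theorem isMaslovIndex_iff (hn : Module.finrank ℝ F = 2 * n) (hp : ‖p‖ < r) {T : ℝ} (hT : 0 < T)
    (hq : flowAt φ p T q = q)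
    {Ψ : ∀ t, TangentSpace J (zeroSection ψ (flowAt φ p 0 q)) →L[ℝ]
      TangentSpace J (zeroSection ψ (flowAt φ p t q))}
    (hΨ : ∀ t v, Ψ t (normalFrame I J ψ φ p q 0 v) = normalFrame I J ψ φ p q t v) (u : ℂ → W)
    (μ : ℝ) :
    IsMaslovIndex n k I Ω (zeroSection ψ) (fun t => flowAt φ p t q) T u μ ↔
      IsTransportMeanIndex n Ω (fun t => zeroSection ψ (flowAt φ p t q)) T u Ψ (-μ) := by
  obtain ⟨R, hR⟩ := h.exists_reeb_frame hφ q
  constructor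
  · rintro (⟨-, Ψ', hΨ', hd⟩ | ⟨hno, -⟩)
    · exact h.adapted_index hφ hn hp hT hq hΨ hΨ' hd
    -- The double-cover clause is empty, because the Reeb frame trivializes `T𝓕`.
    · exact absurd ⟨_, h.isLeafFrame hφ hR hp hq⟩ hno
  · exact fun hd => Or.inl ⟨⟨_, h.isLeafFrame hφ hR hp hq⟩, Ψ,
      h.isAdaptedTransport hφ hR hp hq hΨ, hd⟩

theorem exists_index (hn : Module.finrank ℝ F = 2 * n)
    (hnV : Module.finrank ℝ (E × EuclideanSpace ℝ (Fin k)) = 2 * n)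
    (hch : ChernVanishesOnSpheres n Ω) (hp : ‖p‖ < r) {T : ℝ} (hT : 0 < T)
    (hq : flowAt φ p T q = q) {u : ℂ → W} (hu : IsCapping (fun t => ψ (φ t (q, p))) T u) :
    (∃ u : ℂ → W, IsCapping (fun t => zeroSection ψ (flowAt φ p t q)) T u) ∧ ∃ Δ : ℝ,
      (∀ u : ℂ → W, IsCapping (fun t => ψ (φ t (q, p))) T u → ∀ d : ℝ,
        IsOrbitMeanIndex n I Ω ψ φ (q, p) T u d ↔ d = Δ) ∧
      (∀ u : ℂ → W, IsCapping (fun t => zeroSection ψ (flowAt φ p t q)) T u → ∀ μ : ℝ,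
        IsMaslovIndex n k I Ω (zeroSection ψ) (fun t => flowAt φ p t q) T u μ ↔ μ = -Δ) := by
  obtain ⟨R, hR⟩ := h.exists_reeb_frame hφ q
  let D : E × EuclideanSpace ℝ (Fin k) →L[ℝ] E × EuclideanSpace ℝ (Fin k) :=
    ContinuousLinearMap.prodMap (show E →L[ℝ] E from flowDeriv I φ p T q)
      (ContinuousLinearMap.id ℝ _)
  have hsr : ∀ s ∈ Set.Icc (0 : ℝ) 1, ‖s • p‖ < r := fun s hs => by
    rw [norm_smul, Real.norm_of_nonneg hs.1]
    exact (mul_le_of_le_one_left (norm_nonneg p) hs.2).trans_lt hp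
  have m0 : (0 : ℝ) ∈ Set.Icc (0 : ℝ) 1 := ⟨le_rfl, zero_le_one⟩
  have m1 : (1 : ℝ) ∈ Set.Icc (0 : ℝ) 1 := ⟨zero_le_one, le_rfl⟩
  have hy : (fun t => ψ (φ t (q, p))) = fun t => ψ (flowAt φ p t q, (1 : ℝ) • p) := by
    funext t
    rw [h.flow_eq hφ hp t, one_smul]
    rfl
  have hy0 : (fun t => zeroSection ψ (flowAt φ p t q))
      = fun t => ψ (flowAt φ p t q, (0 : ℝ) • p) := by
    funext t
    rw [zero_smul]
    rfl
  obtain ⟨Ψc, hΨc⟩ := exists_transport (fun t => normalFrame I J ψ φ p q t)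
    (h.normalFrame_bijective hφ hp 0)
  let Ψ₀ : ∀ t, TangentSpace J (ψ (flowAt φ p 0 q, (0 : ℝ) • p)) →L[ℝ]
      TangentSpace J (ψ (flowAt φ p t q, (0 : ℝ) • p)) := fun t => (show F →L[ℝ] F from Ψc t)
  have hΨ₀ : ∀ t v, Ψ₀ t (orbitFrame I J ψ φ p q 0 0 v) = orbitFrame I J ψ φ p q 0 t v := hΨc
  obtain ⟨Ψ₁, hΨ₁⟩ : ∃ Ψ : ∀ t, TangentSpace J (ψ (flowAt φ p 0 q, (1 : ℝ) • p)) →L[ℝ]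
      TangentSpace J (ψ (flowAt φ p t q, (1 : ℝ) • p)),
      ∀ t v, Ψ t (orbitFrame I J ψ φ p q 1 0 v)
        = orbitFrame I J ψ φ p q 1 t (v + t • reebShear R v) := by
    have hb : ∀ v, ((orbitFrame I J ψ φ p q 1 0).comp
        (ContinuousLinearMap.id ℝ _ + (0 : ℝ) • reebShear R)) v = orbitFrame I J ψ φ p q 1 0 v :=
      fun v => congrArg (orbitFrame I J ψ φ p q 1 0) (by simp)
    obtain ⟨Ψ, hΨ⟩ := exists_transport (J := J) (y := fun t => ψ (flowAt φ p t q, (1 : ℝ) • p))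
      (fun t => (orbitFrame I J ψ φ p q 1 t).comp
        (ContinuousLinearMap.id ℝ _ + t • reebShear R))
      (by
        rw [show ⇑((orbitFrame I J ψ φ p q 1 0).comp
          (ContinuousLinearMap.id ℝ _ + (0 : ℝ) • reebShear R)) = _ from funext hb]
        exact ⟨h.orbitFrame_injective hφ hp (hsr 1 m1) 0,
          h.orbitFrame_surjective hφ hp (hsr 1 m1) 0⟩)
    exact ⟨Ψ, fun t v => (congrArg (Ψ t) (hb v)).symm.trans (hΨ t v)⟩
  -- The end `s = 1`, with shear, is the linearized flow along `x`; the end `s = 0`, without shear,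
  -- is the adapted transport along `γ`.
  obtain ⟨hU, Δ, hΔ₁, hΔ₀⟩ := exists_common_index hn hnV h.symplectic hch hT
    (y := fun s t => ψ (flowAt φ p t q, s • p)) (L := fun s t => orbitFrame I J ψ φ p q s t)
    (N := reebShear R) (D := D) (fun s t => by rw [h.flowAt_periodic hφ hp hq])
    (fun v => (h.continuousOn_orbitFrame hφ hp v).mono (Set.prod_mono_left fun s hs => hsr s hs))
    (fun s hs t => h.orbitFrame_surjective hφ hp (hsr s hs) t)
    (fun s hs t v v' => (h.orbitFrame_form hφ hp (hsr s hs) t v v').trans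
      (h.orbitFrame_form hφ hp (hsr s hs) 0 v v').symm)
    (fun s hs x v v' => (h.orbitFrame_form hφ hp (hsr s hs) 0 _ _).trans
      ((h.normalForm_shear (z := (q, s • p)) (hsr s hs) hR x v v').trans
        (h.orbitFrame_form hφ hp (hsr s hs) 0 v v').symm))
    (fun s _ v => orbitFrame_closed hφ hp hq v) (reebShear_reebShear R)
    (fun v => by
      rw [reebShear_apply, reebShear_apply]
      have h1 := h.flowDeriv_reeb hφ hp T (h.isReeb_sum hR v.2)
      -- The shear commutes with the closing map: `dφ^T` fixes the Reeb combinations at `q`, as it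
      -- sends them to Reeb vectors with the same coefficients and `φ^T q = q`.
      have h2 : (∑ i, v.2 i • R i : E) = (flowDeriv I φ p T q (∑ i, v.2 i • R i : E) : E) := by
        have h3 : ∀ q' : M, q' = q → ∀ X : E,
            IsReeb (Ω.pullback I (zeroSection ψ)) α q' v.2 X → (∑ i, v.2 i • R i : E) = X := by
          rintro _ rfl X hX
          exact h.isReeb_unique (h.isReeb_sum hR v.2) hX
        exact h3 _ hq _ h1
      exact Prod.ext h2 rfl)
    hΨ₀ hΨ₁ (u := u) (hy ▸ hu)
  refine ⟨hy0 ▸ hU, Δ, fun u hu d => (h.isOrbitMeanIndex_iff hφ hp hR hΨ₁ u d).trans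
    (hΔ₁ u (hy ▸ hu) d), fun u hu μ => (h.isMaslovIndex_iff hφ hn hp hT hq hΨc u μ).trans ?_⟩
  have h1 : IsTransportMeanIndex n Ω (fun t => zeroSection ψ (flowAt φ p t q)) T u Ψc (-μ) ↔
      IsTransportMeanIndex n Ω (fun t => ψ (flowAt φ p t q, (0 : ℝ) • p)) T u Ψ₀ (-μ) :=
    ⟨fun hd => hd.congr hy0 fun _ _ _ => rfl, fun hd => hd.congr hy0.symm fun _ _ _ => rfl⟩
  rw [h1, hΔ₀ u (hy0 ▸ hu), neg_eq_iff_eq_neg]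

end IsStableTube
end Orbit
end CoisotropicIndex
theorem proposition3p1 (k m : ℕ)
    {W : Type*} [TopologicalSpace W] [T2Space W] [SecondCountableTopology W]
    [ChartedSpace (EuclideanSpace ℝ (Fin (2 * (k + m)))) W]
    [IsManifold (𝓡 (2 * (k + m))) ∞ W]
    (Ω : TwoForm (𝓡 (2 * (k + m))) W) (hΩ : IsSymplecticForm Ω)
    (hc : ChernVanishesOnSpheres (k + m) Ω)
    {M : Type*} [TopologicalSpace M] [CompactSpace M]
    [ChartedSpace (EuclideanSpace ℝ (Fin (k + 2 * m))) M]
    [IsManifold (𝓡 (k + 2 * m)) ∞ M]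
    (ι : M → W) (hι : IsCoisotropicEmbedding (𝓡 (k + 2 * m)) Ω ι)
    (α : Fin k → OneForm (𝓡 (k + 2 * m)) M)
    (hα : IsStabilizing m (Ω.pullback (𝓡 (k + 2 * m)) ι) α)
    (r : ℝ) (ψ : M × EuclideanSpace ℝ (Fin k) → W) (hψ : IsNormalFormNbhd Ω ι α r ψ)
    (φ : ℝ → M × EuclideanSpace ℝ (Fin k) → M × EuclideanSpace ℝ (Fin k))
    (hφ : IsHamiltonianFlow (Ω.pullback (𝓡 (k + 2 * m)) ι) α r (rho M k) φ)
    (z₀ : M × EuclideanSpace ℝ (Fin k)) (hz₀ : z₀ ∈ tube M k r)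
    (T : ℝ) (hT : 0 < T) (hclosed : φ T z₀ = z₀) (hnontrivial : ∃ t, φ t z₀ ≠ z₀)
    (hcontractible : ∃ u : ℂ → W, IsCapping (fun t => ψ (φ t z₀)) T u) :
    IsCharLoop (Ω.pullback (𝓡 (k + 2 * m)) ι) (fun t => (φ t z₀).1) T ∧
    (∃ u : ℂ → W, IsCapping (fun t => ι (φ t z₀).1) T u) ∧
    ∃ Δ : ℝ,
      (∀ u : ℂ → W, IsCapping (fun t => ψ (φ t z₀)) T u →
        ∀ d : ℝ, IsOrbitMeanIndex (k + m) (𝓡 (k + 2 * m)) Ω ψ φ z₀ T u d ↔ d = Δ) ∧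
      (∀ u : ℂ → W, IsCapping (fun t => ι (φ t z₀).1) T u →
        ∀ μ : ℝ, IsMaslovIndex (k + m) k (𝓡 (k + 2 * m)) Ω ι (fun t => (φ t z₀).1) T u μ
          ↔ μ = -Δ) := by
  obtain rfl : zeroSection ψ = ι := funext hψ.zero_section
  obtain ⟨q, p⟩ := z₀
  have h : IsStableTube m Ω α r ψ := ⟨hΩ, hι, hα, hψ⟩
  have hq : flowAt φ p T q = q := congrArg Prod.fst hclosed
  obtain ⟨u, hu⟩ := hcontractible
  exact ⟨h.isCharLoop hφ hz₀ hq, h.exists_index hφ finrank_euclideanSpace_fin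
    (by rw [Module.finrank_prod, finrank_euclideanSpace_fin, finrank_euclideanSpace_fin]; ring)
    hc hz₀ hT hq hu⟩
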